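/- **Setting.** A bounded open set $D\subset\mathbb R^2$ is a *John domain with respect to $\tilde x\in D$ with constant $L\in(0,\infty)$* if for every $y\in D$ there is an $L$-Lipschitz map $\rho:[0,|y-\tilde x|]\to D$ with $\rho(0)=y$, $\rho(|y-\tilde x|)=\tilde x$ and $\operatorname{dist}(\rho(t),\partial D)\ge t/L$ for all $t\in[0,|y-\tilde x|]$. Let $Q_R(x)$ be the open square centred at $x$ with side length $2R$. Let $\Omega\subset\mathbb R^2$ be an open set with the following properties. * $\{x_2>0\}\subset\Omega\subset\{x_2>-1\}$ (so $\partial\Omega\subset\{-1\le x_2\le 0\}$), and for some $L,K\in(0,\infty)$ the set $\Omega$ is a bumpy John half-plane: for all $x\in\{x_2=0\}$ and $R\ge1$ there is a John domain $D$ with respect to $x+Re_2$ with constant $L$ such that $Q_R(x)\cap\Omega\subset D\subset Q_{KR}(x)\cap\Omega$. * $\Omega$ is invariant under translation by $(k,0)$ for every $k\in\mathbb Z$. * $(0,0)\in\partial\Omega$, and $\partial\Omega$ is of class $C^2$ in a neighbourhood of $(0,0)$. For $\varepsilon>0$ with $\varepsilon^{-1}\in\mathbb N_+$ put $\Omega_\varepsilon=\varepsilon\Omega\cap\big((0,1)\times(-1,1)\big)$,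 $\Gamma_\varepsilon=\partial\Omega_\varepsilon\cap\{x_2\le0\}$, $\Gamma_1=(0,1)\times\{1\}$, $\Sigma_0=\{0\}\times(0,1)$, $\Sigma_1=\{1\}\times(0,1)$. For constants $p_0,p_1\in\mathbb R$ consider $$-\Delta U+U\cdot\nabla U+\nabla P=0,\quad \operatorname{div}U=0\ \text{ in }\Omega_\varepsilon,\qquad U=0\ \text{ on }\Gamma_\varepsilon\cup\Gamma_1,\quad U_2=0\ \text{ on }\Sigma_0\cup\Sigma_1,\quad P=p_0\ \text{ on }\Sigma_0,\quad P=p_1\ \text{ on }\Sigma_1. \tag{1.1}$$ A solution is a pair $(U,P)\in H^1(\Omega_\varepsilon)^2\times L^2(\Omega_\varepsilon)$ solving (1.1) weakly: $\operatorname{div}U=0$; $U_1$ lies in the $H^1(\Omega_\varepsilon)$-closure of the functions in $C_c^\infty(\mathbb R^2)$ vanishing near $\overline{\Gamma_\varepsilon\cup\Gamma_1}$, and $U_2$ in that of the functions in $C_c^\infty(\mathbb R^2)$ vanishing near $\overline{\Gamma_\varepsilon\cup\Gamma_1\cup\Sigma_0\cup\Sigma_1}$; and for all $\varphi=(\varphi_1,\varphi_2)$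 with $\varphi_1$ and $\varphi_2$ in these two classes of smooth functions respectively, $$\int_{\Omega_\varepsilon}\nabla U:\nabla\varphi+\int_{\Omega_\varepsilon}(U\cdot\nabla U)\cdot\varphi-\int_{\Omega_\varepsilon}P\operatorname{div}\varphi=p_0\int_0^1\varphi_1(0,s)\,ds-p_1\int_0^1\varphi_1(1,s)\,ds .$$ Let $U_{S,0}=\left(\tfrac12(p_1-p_0)x_2(x_2-1),0\right)$ for $x_2>0$ and $U_{S,0}=0$ for $x_2\le0$. **Theorem 2.2.** There are universal constants $C_1',\varepsilon_0,C>0$ and $r\ge C\varepsilon_0$ (independent of $\Omega,L,K,p_0,p_1,\varepsilon$) such that for every $\Omega$ as above, all $p_0,p_1$ with $|p_1-p_0|\le C_1'$ and every $\varepsilon\le\varepsilon_0$ with $\varepsilon^{-1}\in\mathbb N_+$ for which $\Omega_\varepsilon$ is itself a bounded John domain (with respect to some point and with some constant), problem (1.1) has a solution $(U_{S,\varepsilon},P_{S,\varepsilon})\in H^1(\Omega_\varepsilon)^2\times L^2(\Omega_\varepsilon)$ with $$\int_{\Omega_\varepsilon}|\nabla U_{S,\varepsilon}-\nabla U_{S,0}|^2\le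 C\varepsilon \tag{2.4}$$ $$\int_{\Omega_\varepsilon}|U_{S,\varepsilon}-U_{S,0}|^2\le C\varepsilon^2, \tag{2.5}$$ and it is the only solution $(U,P)\in H^1(\Omega_\varepsilon)^2\times L^2(\Omega_\varepsilon)$ of (1.1) with $\int_{\Omega_\varepsilon}|\nabla U-\nabla U_{S,0}|^2\le r$; in particular it is the only solution satisfying (2.4). -/

import Mathlib

open MeasureTheory Set Filter Topology
open scoped NNReal ContDiff

namespace RoughChannel

/-- The plane `ℝ²`; the coordinates `x₁, x₂` are `x 0` and `x 1`. -/
abbrev Plane : Type := EuclideanSpace ℝ (Fin 2)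

/-! ### John domains and rough channels -/

/-- `D` is a bounded John domain with respect to `x₀` and with constant `L`. -/
def IsJohnDomain (D : Set Plane) (x₀ : Plane) (L : ℝ≥0) : Prop :=
  IsOpen D ∧ Bornology.IsBounded D ∧ x₀ ∈ D ∧ 0 < L ∧
    ∀ y ∈ D, ∃ ρ : ℝ → Plane,
      LipschitzOnWith L ρ (Icc 0 (dist y x₀)) ∧ ρ 0 = y ∧ ρ (dist y x₀) = x₀ ∧
        ∀ t ∈ Icc (0 : ℝ) (dist y x₀), ρ t ∈ D ∧ t / L ≤ Metric.infDist (ρ t) (frontier D)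

/-- The open square centred at `x` with side length `2R`. -/
def square (x : Plane) (R : ℝ) : Set Plane := {y | ∀ i, |y i - x i| < R}

/-- `Ω` is a bumpy John half-plane with constants `(L, K)`. -/
def IsBumpyJohn (Ω : Set Plane) (L : ℝ≥0) (K : ℝ) : Prop :=
  IsOpen Ω ∧ {x : Plane | 0 < x 1} ⊆ Ω ∧ Ω ⊆ {x : Plane | -1 < x 1} ∧
    frontier Ω ⊆ {x : Plane | -1 ≤ x 1 ∧ x 1 ≤ 0} ∧
    ∀ x : Plane, x 1 = 0 → ∀ R : ℝ, 1 ≤ R →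
      ∃ D : Set Plane, IsJohnDomain D (x + R • EuclideanSpace.single 1 1) L ∧
        square x R ∩ Ω ⊆ D ∧ D ⊆ square x (K * R) ∩ Ω

/-- Near the origin `Ω` is the positivity set of a `C²` function with nonvanishing gradient; at a
boundary point this says that `∂Ω` is of class `C²` in a neighbourhood of that point. -/
def IsC2NearOrigin (Ω : Set Plane) : Prop :=
  ∃ F : Plane → ℝ, ContDiffAt ℝ 2 F 0 ∧ fderiv ℝ F 0 ≠ 0 ∧ ∀ᶠ x in 𝓝 (0 : Plane), (x ∈ Ω ↔ 0 < F x)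

/-- The admissible profiles: bumpy John half-planes, `1`-periodic in `x₁`, whose boundary passes
through the origin and is of class `C²` near it. -/
def IsRoughProfile (Ω : Set Plane) : Prop :=
  (∃ (L : ℝ≥0) (K : ℝ), IsBumpyJohn Ω L K) ∧
    (∀ (k : ℤ) (x : Plane), x + (k : ℝ) • EuclideanSpace.single 0 1 ∈ Ω ↔ x ∈ Ω) ∧
    (0 : Plane) ∈ frontier Ω ∧ IsC2NearOrigin Ω

/-- The rough channel `Ω_ε = εΩ ∩ ((0,1) × (-1,1))`. -/
def roughChannel (Ω : Set Plane) (ε : ℝ) : Set Plane :=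
  {x | ε⁻¹ • x ∈ Ω ∧ x 0 ∈ Ioo (0 : ℝ) 1 ∧ x 1 ∈ Ioo (-1 : ℝ) 1}

/-- The inflow side `Σ₀`. -/
def inflow : Set Plane := {x | x 0 = 0 ∧ x 1 ∈ Ioo (0 : ℝ) 1}

/-- The outflow side `Σ₁`. -/
def outflow : Set Plane := {x | x 0 = 1 ∧ x 1 ∈ Ioo (0 : ℝ) 1}

/-- The flat upper wall `Γ₁`. -/
def upperWall : Set Plane := {x | x 0 ∈ Ioo (0 : ℝ) 1 ∧ x 1 = 1}

/-- The lower (rough) wall of `D`: the part of its boundary in `{x₂ ≤ 0}`. -/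
def lowerWall (D : Set Plane) : Set Plane := frontier D ∩ {x | x 1 ≤ 0}

/-! ### Weak derivatives and `H¹` -/

/-- The classical partial derivative `∂ⱼ φ`. -/
noncomputable def partialDeriv (j : Fin 2) (φ : Plane → ℝ) (x : Plane) : ℝ :=
  fderiv ℝ φ x (EuclideanSpace.single j 1)

/-- `v` is a square-integrable weak partial derivative `∂ⱼ u` in the open set `D`. -/
def IsWeakPartial (D : Set Plane) (j : Fin 2) (u v : Plane → ℝ) : Prop :=
  MemLp v 2 (volume.restrict D) ∧
    ∀ φ : Plane → ℝ, ContDiff ℝ ∞ φ → HasCompactSupport φ → tsupport φ ⊆ D →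
      ∫ x in D, u x * partialDeriv j φ x = -∫ x in D, v x * φ x

/-- `u ∈ H¹(D)`. -/
def MemH1 (D : Set Plane) (u : Plane → ℝ) : Prop :=
  MemLp u 2 (volume.restrict D) ∧ ∀ j, ∃ v, IsWeakPartial D j u v

open Classical in
/-- The weak partial derivative `∂ⱼ u` of `u ∈ H¹(D)`, determined up to a null set (and `0` where
there is none). -/
noncomputable def weakPartial (D : Set Plane) (u : Plane → ℝ) (j : Fin 2) : Plane → ℝ :=
  if h : ∃ v, IsWeakPartial D j u v then h.choose else 0

/-- Smooth functions on the plane with compact support that vanish near `S`. -/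
def IsTestOff (S : Set Plane) (φ : Plane → ℝ) : Prop :=
  ContDiff ℝ ∞ φ ∧ HasCompactSupport φ ∧ Disjoint (tsupport φ) (closure S)

/-- `u ∈ H¹(D)` and `u = 0` on the part `S` of the boundary: `u` belongs to the closure in `H¹(D)`
of the smooth functions that vanish near `S`. -/
def MemH1Zero (D S : Set Plane) (u : Plane → ℝ) : Prop :=
  MemH1 D u ∧ ∀ δ : ℝ, 0 < δ → ∃ φ : Plane → ℝ, IsTestOff S φ ∧
    ∫ x in D, ((u x - φ x) ^ 2 + ∑ j, (weakPartial D u j x - partialDeriv j φ x) ^ 2) < δ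

/-! ### The stationary Navier-Stokes problem -/

/-- The part of the boundary where the first velocity component is prescribed. -/
def walls (D : Set Plane) : Set Plane := lowerWall D ∪ upperWall

/-- The part of the boundary where the second velocity component is prescribed. -/
def wallsAndSides (D : Set Plane) : Set Plane := walls D ∪ (inflow ∪ outflow)

/-- `(U, P) ∈ H¹(D)² × L²(D)` is a weak solution of `-ΔU + U·∇U + ∇P = 0`, `div U = 0` in `D`, with
`U = 0` on the lower and the upper wall, `U₂ = 0` on the inflow and outflow sides, `P = p₀` on the
inflow side and `P = p₁` on the outflow side. The pressure conditions enter through the boundary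
term that integration by parts against a test field `φ` produces; there `φ` vanishes near the walls
and `φ₂` vanishes near the sides too. -/
def IsWeakSolution (D : Set Plane) (p₀ p₁ : ℝ) (U : Plane → Plane) (P : Plane → ℝ) : Prop :=
  MemH1Zero D (walls D) (fun x => U x 0) ∧
  MemH1Zero D (wallsAndSides D) (fun x => U x 1) ∧
  MemLp P 2 (volume.restrict D) ∧
  (∀ᵐ x ∂volume.restrict D, ∑ j, weakPartial D (fun y => U y j) j x = 0) ∧
  ∀ φ : Plane → Plane,
    IsTestOff (walls D) (fun x => φ x 0) → IsTestOff (wallsAndSides D) (fun x => φ x 1) →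
      (∫ x in D, ∑ i, ∑ j, weakPartial D (fun y => U y i) j x * partialDeriv j (fun y => φ y i) x)
        + (∫ x in D, ∑ i, (∑ j, U x j * weakPartial D (fun y => U y i) j x) * φ x i)
        - (∫ x in D, P x * ∑ j, partialDeriv j (fun y => φ y j) x)
      = p₀ * (∫ s in (0 : ℝ)..1, φ !₂[0, s] 0) - p₁ * (∫ s in (0 : ℝ)..1, φ !₂[1, s] 0)

/-- The Poiseuille flow `(½ (p₁ - p₀) x₂ (x₂ - 1), 0)`, extended by `0` below `{x₂ = 0}`. -/
noncomputable def poiseuille (p₀ p₁ : ℝ) (x : Plane) : Plane :=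
  if 0 < x 1 then !₂[(p₁ - p₀) / 2 * (x 1 * (x 1 - 1)), 0] else 0

/-- `∫_D |∇U - ∇V|²`. -/
noncomputable def gradDistSq (D : Set Plane) (U V : Plane → Plane) : ℝ :=
  ∫ x in D, ∑ i, ∑ j,
    (weakPartial D (fun y => U y i) j x - weakPartial D (fun y => V y i) j x) ^ 2

end RoughChannel

/-!
Let `D` be the channel `Ω_ε` and `lam = (p₁ - p₀) / 2`. The Poiseuille profile `lam * x₂ (x₂ - 1)`,
extended by zero below the axis, is an admissible divergence-free field on `D` whose convection
vanishes. Tested against an admissible field it fails to solve the equations only through integrals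
over the layer of `D` below the axis (`IsPoiseuille.residual_eq`), whose height is at most `ε`. Hence
the residual has size `|lam| √ε` in the dual norm. Everything takes place in a Hilbert space: `H¹`
functions are triples of a function and its two derivatives in `L²(D)`, and the boundary conditions
are encoded by closures of test functions (`H1Zero`, `velocity`, `solenoidal`).

*Existence, `H¹` bound, local uniqueness.* On the divergence-free fields the pressure drops out. The
Dirichlet form is coercive by Poincaré's inequality, with constants that do not depend on `D`, since
all fields vanish on the top side; for the same reason the convection term is bounded in `H¹` by
Ladyzhenskaya's inequality (`setIntegral_pow_four_le`). The Lax-Milgram theorem and a contraction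
give a perturbation `v` of size `√ε` that is unique in a fixed ball (`exists_isSolenoidalSolution`).

*Pressure.* Existence and uniqueness of the pressure follow from the closed range theorem
(`exists_inner_eq_of_forall_ker`) once the gradient is bounded below on `L²(D)`, which is Nečas'
inequality (`IsJohnDomain.necas`). If `∇P = div T`, then the projection of `P` to the closure of the
Laplacians of test functions is bounded by `T`, because the `L²` norms of the Hessian and of the
Laplacian of a test function agree. The remainder is harmonic. The square of its gradient at a point
is bounded by averages of `|T|²` over balls in `D`, divided by the square of the radius, and these
bounds are integrated along John curves; the points from which a given ball is visited fill a region
of comparable size (`lintegral_john_le`), so only a constant is lost after integration over all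
starting points (`IsJohnDomain.harmonic_estimate`).

*`L²` bound.* In the upper square the components of `v` are expanded in cosines and sines of `x₁`.
For the frequency `m`, let `f` be the mode of `v₂`. The equation is tested with the field
`(β' cos (m x₁) / m, β sin (m x₁))`, where `β` has zero Cauchy data at both ends, so that the field
extends by zero below the axis. Such data require a corrector in the equation for `β`: it solves
`β'' - m² β = s - f`, where `s` is the projection of `f` to the boundary layers
(`exists_isCorrector`). The field made from `s` pairs with the divergence-free field `v` only through
the trace of `v` on the axis (`dirichlet_corrector`). The trace is of size `ε`, since `v` vanishes at
the bottom of a layer of height `ε` and its gradient has size `√ε` (`integral_axis_sq_le`). The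
remaining terms are the convection, which is quadratic in `v` or carries the small factor `lam`, and
gains a factor `1 / m` (`mode_pairing_le`). Summation over the modes with Bessel's inequality and
Parseval's identity gives `l2_estimate`. Since traces and modes are only defined for continuous
functions, these steps are carried out for smooth approximations of `v`.

The weak formulation is translated to this setting, and back, by
`IsWeakSolution.exists_isVelocityPressure` and `IsVelocityPressure.exists_isWeakSolution`.
-/

namespace RoughChannel

/-! ### Coordinates on the plane -/

/-- The measurable equivalence between pairs of reals and the plane. -/
noncomputable def planeEquiv : ℝ × ℝ ≃ᵐ Plane :=
  (MeasurableEquiv.finTwoArrow (α := ℝ)).symm.trans (MeasurableEquiv.toLp 2 (Fin 2 → ℝ))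

lemma planeEquiv_apply (p : ℝ × ℝ) : planeEquiv p = !₂[p.1, p.2] := by
  ext i; fin_cases i <;> rfl

lemma measurePreserving_planeEquiv : MeasurePreserving planeEquiv volume volume :=
  (EuclideanSpace.volume_preserving_symm_measurableEquiv_toLp (Fin 2)).symm.comp
    (volume_preserving_finTwoArrow ℝ).symm

/-- The open rectangle `(a, b) × (c, d)`. -/
def rect (a b c d : ℝ) : Set Plane := {x | x 0 ∈ Ioo a b ∧ x 1 ∈ Ioo c d}

lemma continuous_coord (i : Fin 2) : Continuous (fun x : Plane => x i) := by fun_prop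

lemma isOpen_rect (a b c d : ℝ) : IsOpen (rect a b c d) :=
  (isOpen_Ioo.preimage (continuous_coord 0)).inter (isOpen_Ioo.preimage (continuous_coord 1))

lemma measurableSet_rect (a b c d : ℝ) : MeasurableSet (rect a b c d) :=
  (isOpen_rect a b c d).measurableSet

lemma planeEquiv_preimage_rect (a b c d : ℝ) :
    planeEquiv ⁻¹' rect a b c d = Ioo a b ×ˢ Ioo c d := by
  ext p; simp [planeEquiv_apply, rect, mem_prod]

lemma measurePreserving_planeEquiv_rect (a b c d : ℝ) :
    MeasurePreserving planeEquiv
      ((volume.restrict (Ioo a b)).prod (volume.restrict (Ioo c d)))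
      (volume.restrict (rect a b c d)) := by
  rw [Measure.prod_restrict, ← planeEquiv_preimage_rect]
  exact measurePreserving_planeEquiv.restrict_preimage (measurableSet_rect a b c d)

lemma integrableOn_rect_iff {a b c d : ℝ} {g : Plane → ℝ} :
    IntegrableOn g (rect a b c d) ↔ Integrable (fun p : ℝ × ℝ => g !₂[p.1, p.2])
      ((volume.restrict (Ioo a b)).prod (volume.restrict (Ioo c d))) := by
  have h := (measurePreserving_planeEquiv_rect a b c d).integrable_comp_emb
    planeEquiv.measurableEmbedding (g := g)
  rw [IntegrableOn, ← h]
  simp only [Function.comp_def, planeEquiv_apply]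

lemma setIntegral_rect {a b c d : ℝ} (hab : a ≤ b) (hcd : c ≤ d) {g : Plane → ℝ}
    (hg : IntegrableOn g (rect a b c d)) :
    ∫ x in rect a b c d, g x = ∫ s in a..b, ∫ t in c..d, g !₂[s, t] := by
  have h := (measurePreserving_planeEquiv_rect a b c d).integral_comp
    planeEquiv.measurableEmbedding g
  rw [← h]
  simp only [planeEquiv_apply]
  rw [integral_prod _ (integrableOn_rect_iff.1 hg), intervalIntegral.integral_of_le hab,
    integral_Ioc_eq_integral_Ioo]
  simp_rw [intervalIntegral.integral_of_le hcd, integral_Ioc_eq_integral_Ioo]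

lemma setIntegral_rect_swap {a b c d : ℝ} (hab : a ≤ b) (hcd : c ≤ d) {g : Plane → ℝ}
    (hg : IntegrableOn g (rect a b c d)) :
    ∫ x in rect a b c d, g x = ∫ t in c..d, ∫ s in a..b, g !₂[s, t] := by
  have h := (measurePreserving_planeEquiv_rect a b c d).integral_comp
    planeEquiv.measurableEmbedding g
  rw [← h]
  simp only [planeEquiv_apply]
  rw [integral_prod_symm _ (integrableOn_rect_iff.1 hg), intervalIntegral.integral_of_le hcd,
    integral_Ioc_eq_integral_Ioo]
  simp_rw [intervalIntegral.integral_of_le hab, integral_Ioc_eq_integral_Ioo]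

lemma rect_subset_closedBox (a b c d : ℝ) :
    rect a b c d ⊆ (fun p : ℝ × ℝ => (!₂[p.1, p.2] : Plane)) '' (Icc a b ×ˢ Icc c d) := by
  intro x hx
  refine ⟨(x 0, x 1), ⟨⟨hx.1.1.le, hx.1.2.le⟩, ⟨hx.2.1.le, hx.2.2.le⟩⟩, ?_⟩
  ext i; fin_cases i <;> rfl

lemma continuous_pt : Continuous (fun p : ℝ × ℝ => (!₂[p.1, p.2] : Plane)) := by
  have : Continuous (fun p : ℝ × ℝ => (![p.1, p.2] : Fin 2 → ℝ)) := by
    refine continuous_pi fun i => ?_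
    fin_cases i
    · exact continuous_fst
    · exact continuous_snd
  exact (PiLp.continuous_toLp 2 _).comp this

lemma isCompact_closedBox (a b c d : ℝ) :
    IsCompact ((fun p : ℝ × ℝ => (!₂[p.1, p.2] : Plane)) '' (Icc a b ×ˢ Icc c d)) :=
  (isCompact_Icc.prod isCompact_Icc).image continuous_pt

lemma integrableOn_rect_of_continuous {a b c d : ℝ} {g : Plane → ℝ} (hg : Continuous g) :
    IntegrableOn g (rect a b c d) :=
  (hg.continuousOn.integrableOn_compact (isCompact_closedBox a b c d)).mono_set
    (rect_subset_closedBox a b c d)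

/-! ### Partial derivatives of smooth functions -/

lemma hasDerivAt_vertical {φ : Plane → ℝ} (hφ : Differentiable ℝ φ) (s t : ℝ) :
    HasDerivAt (fun t => φ !₂[s, t]) (partialDeriv 1 φ !₂[s, t]) t := by
  have h1 : HasDerivAt (fun t : ℝ => (!₂[s, t] : Plane)) (EuclideanSpace.single 1 1) t := by
    have h := ((hasDerivAt_id t).smul_const (EuclideanSpace.single 1 1 : Plane)).const_add !₂[s, 0]
    rw [one_smul] at h
    convert! h using 1
    ext r i; fin_cases i <;> simp
  exact (hφ _).hasFDerivAt.comp_hasDerivAt t h1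

lemma hasDerivAt_horizontal {φ : Plane → ℝ} (hφ : Differentiable ℝ φ) (s t : ℝ) :
    HasDerivAt (fun s => φ !₂[s, t]) (partialDeriv 0 φ !₂[s, t]) s := by
  have h1 : HasDerivAt (fun s : ℝ => (!₂[s, t] : Plane)) (EuclideanSpace.single 0 1) s := by
    have h := ((hasDerivAt_id s).smul_const (EuclideanSpace.single 0 1 : Plane)).const_add !₂[0, t]
    rw [one_smul] at h
    convert! h using 1
    ext r i; fin_cases i <;> simp
  exact (hφ _).hasFDerivAt.comp_hasDerivAt s h1

lemma contDiff_partialDeriv {φ : Plane → ℝ} (hφ : ContDiff ℝ ∞ φ) (j : Fin 2) :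
    ContDiff ℝ ∞ (partialDeriv j φ) :=
  (hφ.fderiv_right (m := ∞) (by simp)).clm_apply contDiff_const

lemma tsupport_partialDeriv_subset (φ : Plane → ℝ) (j : Fin 2) :
    tsupport (partialDeriv j φ) ⊆ tsupport φ := by
  refine closure_minimal ?_ (isClosed_tsupport φ)
  intro x hx
  by_contra h
  apply hx
  have h1 : φ =ᶠ[𝓝 x] 0 := notMem_tsupport_iff_eventuallyEq.1 h
  simp [partialDeriv, h1.fderiv_eq]

lemma hasCompactSupport_partialDeriv {φ : Plane → ℝ} (hφ : HasCompactSupport φ) (j : Fin 2) :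
    HasCompactSupport (partialDeriv j φ) :=
  hφ.of_isClosed_subset (isClosed_tsupport _) (tsupport_partialDeriv_subset φ j)

lemma partialDeriv_congr {φ ψ : Plane → ℝ} {x : Plane} (h : φ =ᶠ[𝓝 x] ψ) (j : Fin 2) :
    partialDeriv j φ x = partialDeriv j ψ x := by
  simp [partialDeriv, h.fderiv_eq]

lemma partialDeriv_eq_zero {φ : Plane → ℝ} {x : Plane} (h : φ =ᶠ[𝓝 x] 0) (j : Fin 2) :
    partialDeriv j φ x = 0 := by
  simp [partialDeriv, h.fderiv_eq]

lemma partialDeriv_add {φ ψ : Plane → ℝ} (hφ : Differentiable ℝ φ) (hψ : Differentiable ℝ ψ)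
    (j : Fin 2) : partialDeriv j (φ + ψ) = partialDeriv j φ + partialDeriv j ψ := by
  ext x; simp [partialDeriv, fderiv_add (hφ x) (hψ x)]

lemma partialDeriv_smul {φ : Plane → ℝ} (c : ℝ) (j : Fin 2) :
    partialDeriv j (c • φ) = c • partialDeriv j φ := by
  ext x; simp [partialDeriv, fderiv_const_smul_field]

lemma partialDeriv_mul {φ ψ : Plane → ℝ} (hφ : Differentiable ℝ φ) (hψ : Differentiable ℝ ψ)
    (j : Fin 2) (x : Plane) :
    partialDeriv j (fun y => φ y * ψ y) x = φ x * partialDeriv j ψ x + partialDeriv j φ x * ψ x := by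
  simp only [partialDeriv]
  rw [fderiv_fun_mul (hφ x) (hψ x)]
  simp; ring

/-! ### Rough channels and test functions adapted to them -/

/-- The geometric properties of `roughChannel Ω ε` that the analysis uses. -/
structure IsChannel (D : Set Plane) (ε : ℝ) : Prop where
  isOpen : IsOpen D
  pos : 0 < ε
  lt_one : ε < 1
  subset_rect : D ⊆ rect 0 1 (-ε) 1
  unit_subset : rect 0 1 0 1 ⊆ D

lemma isChannel_roughChannel {Ω : Set Plane} {ε : ℝ} (hΩ : IsRoughProfile Ω) (h0 : 0 < ε)
    (h1 : ε < 1) : IsChannel (roughChannel Ω ε) ε := by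
  obtain ⟨⟨L, K, hO, hpos, hlow, -, -⟩, -⟩ := hΩ
  refine ⟨?_, h0, h1, ?_, ?_⟩
  · have h : roughChannel Ω ε = (fun x : Plane => ε⁻¹ • x) ⁻¹' Ω ∩ rect 0 1 (-1) 1 := by
      ext x; simp [roughChannel, rect]
    rw [h]
    exact (hO.preimage (continuous_const_smul _)).inter (isOpen_rect _ _ _ _)
  · rintro x ⟨hx, hx0, hx1⟩
    refine ⟨hx0, ?_, hx1.2⟩
    have h := hlow hx
    simp only [mem_ofPred_eq, PiLp.smul_apply, smul_eq_mul] at h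
    have h2 := mul_lt_mul_of_pos_left h h0
    rw [← mul_assoc, mul_inv_cancel₀ h0.ne'] at h2
    linarith
  · rintro x ⟨hx0, hx1⟩
    refine ⟨hpos ?_, hx0, by linarith [hx1.1], hx1.2⟩
    simp only [mem_ofPred_eq, PiLp.smul_apply, smul_eq_mul]
    exact mul_pos (inv_pos.2 h0) hx1.1

namespace IsChannel

variable {D : Set Plane} {ε : ℝ}

lemma subset_box (hD : IsChannel D ε) : D ⊆ rect 0 1 (-1) 1 := fun x hx =>
  ⟨(hD.subset_rect hx).1, by linarith [(hD.subset_rect hx).2.1, hD.lt_one], (hD.subset_rect hx).2.2⟩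

lemma mem_closure_of_mem_Icc (hD : IsChannel D ε) {x : Plane} (h0 : x 0 ∈ Icc (0 : ℝ) 1)
    (h1 : x 1 ∈ Icc (0 : ℝ) 1) : x ∈ closure D := by
  have hx : x = !₂[x 0, x 1] := by ext i; fin_cases i <;> rfl
  have hc : (x 0, x 1) ∈ closure (Ioo (0 : ℝ) 1 ×ˢ Ioo (0 : ℝ) 1) := by
    rw [closure_prod_eq, closure_Ioo zero_ne_one]; exact ⟨h0, h1⟩
  have h2 := image_closure_subset_closure_image continuous_pt (mem_image_of_mem _ hc)
  dsimp only at h2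
  rw [← hx] at h2
  refine closure_mono (Subset.trans ?_ hD.unit_subset) h2
  rintro _ ⟨p, hp, rfl⟩
  exact hp

lemma frontier_eq (hD : IsChannel D ε) : frontier D = closure D \ D := by
  rw [frontier, hD.isOpen.interior_eq]

lemma mem_closure_upperWall {x : Plane} (h0 : x 0 ∈ Icc (0 : ℝ) 1) (h1 : x 1 = 1) :
    x ∈ closure upperWall := by
  have hx : x = !₂[x 0, 1] := by ext i; fin_cases i <;> simp [h1]
  have hc : x 0 ∈ closure (Ioo (0 : ℝ) 1) := by rw [closure_Ioo zero_ne_one]; exact h0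
  have hcont : Continuous (fun s : ℝ => (!₂[s, 1] : Plane)) :=
    continuous_pt.comp (continuous_id.prodMk continuous_const)
  have h2 := image_closure_subset_closure_image hcont (mem_image_of_mem _ hc)
  rw [hx]
  refine closure_mono ?_ h2
  rintro _ ⟨s, hs, rfl⟩
  exact ⟨by simpa using hs, by simp⟩

/-- A point of the closed box that is not in the channel, and is at or below the axis or on the top
side, is either a boundary point where the velocity is prescribed or an exterior point. -/
lemma mem_closure_walls_or (hD : IsChannel D ε) {x : Plane} (h0 : x 0 ∈ Icc (0 : ℝ) 1)
    (h : x 1 ≤ 0 ∨ x 1 = 1) (hx : x ∉ D) :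
    x ∈ closure (walls D) ∨ (x ∉ closure D ∧ x 1 < 0) := by
  rcases h with h | h
  · by_cases hc : x ∈ closure D
    · left
      apply subset_closure
      left
      exact ⟨by rw [hD.frontier_eq]; exact ⟨hc, hx⟩, h⟩
    · right
      refine ⟨hc, lt_of_le_of_ne h fun h1 => hc (hD.mem_closure_of_mem_Icc h0 ?_)⟩
      rw [h1]; simp
  · left
    exact closure_mono subset_union_right (mem_closure_upperWall h0 h)

end IsChannel

lemma IsTestOff.eventuallyEq_zero {S : Set Plane} {φ : Plane → ℝ} (hφ : IsTestOff S φ) {x : Plane}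
    (hx : x ∈ closure S) : φ =ᶠ[𝓝 x] 0 :=
  notMem_tsupport_iff_eventuallyEq.1 fun h => (disjoint_left.1 hφ.2.2) h hx

lemma IsTestOff.add {S : Set Plane} {φ ψ : Plane → ℝ} (hφ : IsTestOff S φ) (hψ : IsTestOff S ψ) :
    IsTestOff S (φ + ψ) :=
  ⟨hφ.1.add hψ.1, hφ.2.1.add hψ.2.1,
    (disjoint_union_left.2 ⟨hφ.2.2, hψ.2.2⟩).mono_left (tsupport_add φ ψ)⟩

lemma IsTestOff.smul {S : Set Plane} {φ : Plane → ℝ} (c : ℝ) (hφ : IsTestOff S φ) :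
    IsTestOff S (c • φ) :=
  ⟨hφ.1.const_smul c, hφ.2.1.smul_left (f := fun _ => c),
    hφ.2.2.mono_left (tsupport_smul_subset_right (fun _ => c) φ)⟩

/-- A test function that vanishes near `S` and, in the closed box `[0,1] × [-1,1]`, near every point
at which the channel `D` has no fluid; its integrals over `D` are integrals over the box. -/
structure IsBoxTest (D S : Set Plane) (ψ : Plane → ℝ) : Prop where
  isTestOff : IsTestOff S ψ
  eventually_zero : ∀ x : Plane, x 0 ∈ Icc (0 : ℝ) 1 → (x 1 ≤ 0 ∨ x 1 = 1) → x ∉ D →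
    ψ =ᶠ[𝓝 x] 0

/-- Every test function can be replaced by one that is adapted to the box without changing it in
`D` or on the two sides: it is set to zero below the axis outside `D`, after a cut-off in `x₁`. -/
lemma IsTestOff.exists_isBoxTest {D S : Set Plane} {ε : ℝ} (hD : IsChannel D ε) (hS : walls D ⊆ S)
    {φ : Plane → ℝ} (hφ : IsTestOff S φ) :
    ∃ ψ, IsBoxTest D S ψ ∧ (∀ x ∈ D, ψ =ᶠ[𝓝 x] φ) ∧
      ∀ x : Plane, x 0 ∈ Icc (0 : ℝ) 1 → 0 < x 1 → ψ x = φ x := by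
  classical
  have hcorner : ∀ s : ℝ, s = 0 ∨ s = 1 → ∃ η > 0, ∀ x ∈ Metric.ball (!₂[s, 0] : Plane) η,
      φ x = 0 := by
    intro s hs
    have hs' : s ∈ Icc (0 : ℝ) 1 := by rcases hs with rfl | rfl <;> simp
    have hmem : (!₂[s, 0] : Plane) ∈ closure S := by
      rcases hD.mem_closure_walls_or (x := !₂[s, 0]) hs' (by simp) (fun h => by
        have := (hD.subset_rect h).1
        rcases hs with rfl | rfl <;> simp at this) with h | h
      · exact closure_mono hS h
      · simp at h
    obtain ⟨η, hη, h⟩ := Metric.eventually_nhds_iff_ball.1 (hφ.eventuallyEq_zero hmem)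
    exact ⟨η, hη, h⟩
  -- `φ` vanishes near the two corners on the axis, so a cut-off in `x₁` whose transition takes place
  -- next to the corners does not disturb the values over `[0, 1]`
  obtain ⟨η₀, hη₀, hz₀⟩ := hcorner 0 (by simp)
  obtain ⟨η₁, hη₁, hz₁⟩ := hcorner 1 (by simp)
  set η := min η₀ η₁ with hη
  have hηpos : 0 < η := lt_min hη₀ hη₁
  let κ : ContDiffBump (1 / 2 : ℝ) := ⟨1 / 2 + η / 4, 1 / 2 + η / 2, by positivity, by linarith⟩
  have hκ1 : ∀ s ∈ Ioo (-(η / 4)) (1 + η / 4), κ s = 1 := by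
    intro s hs
    apply κ.one_of_mem_closedBall
    rw [Metric.mem_closedBall, Real.dist_eq, abs_le]
    constructor <;> simp only [κ] <;> linarith [hs.1, hs.2]
  have hκ0 : ∀ s, s ∉ Ioo (-(η / 2)) (1 + η / 2) → κ s = 0 := by
    intro s hs
    apply κ.zero_of_le_dist
    rw [Real.dist_eq]
    by_contra h
    rw [not_le, abs_lt] at h
    apply hs
    constructor <;> simp only [κ] at h <;> linarith [h.1, h.2]
  let ψ : Plane → ℝ := fun x => if 0 < x 1 ∨ x ∈ D then κ (x 0) * φ x else 0
  have hκφ : ContDiff ℝ ∞ (fun x : Plane => κ (x 0) * φ x) :=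
    (κ.contDiff.comp (by fun_prop : ContDiff ℝ ∞ (fun x : Plane => x 0))).mul hφ.1
  have hopen : IsOpen {x : Plane | 0 < x 1 ∨ x ∈ D} :=
    (isOpen_Ioi.preimage (continuous_coord 1)).union hD.isOpen
  have hin : ∀ x : Plane, (0 < x 1 ∨ x ∈ D) → ψ =ᶠ[𝓝 x] fun x => κ (x 0) * φ x := by
    intro x hx
    filter_upwards [hopen.mem_nhds hx] with y hy
    exact if_pos hy
  have hφ0 : ∀ x : Plane, φ =ᶠ[𝓝 x] 0 → ψ =ᶠ[𝓝 x] 0 := by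
    intro x hx
    filter_upwards [hx] with y hy
    simp only [ψ, hy, Pi.zero_apply, mul_zero, ite_self]
  have hext : ∀ x : Plane, x ∉ closure D → x 1 < 0 → ψ =ᶠ[𝓝 x] 0 := by
    intro x hx hx1
    filter_upwards [isClosed_closure.isOpen_compl.mem_nhds hx,
      (isOpen_Iio.preimage (continuous_coord 1)).mem_nhds hx1] with y hy hy1
    have hy1' : y 1 < 0 := hy1
    exact if_neg (by rintro (h | h); exacts [absurd h hy1'.not_gt, hy (subset_closure h)])
  have hzero : ∀ x : Plane, x 0 ∈ Icc (0 : ℝ) 1 → (x 1 ≤ 0 ∨ x 1 = 1) → x ∉ D →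
      ψ =ᶠ[𝓝 x] 0 := by
    intro x h0 h1 hx
    rcases hD.mem_closure_walls_or h0 h1 hx with h | h
    · exact hφ0 x (hφ.eventuallyEq_zero (closure_mono hS h))
    · exact hext x h.1 h.2
  have hsmooth : ContDiff ℝ ∞ ψ := by
    rw [contDiff_iff_contDiffAt]
    intro x
    by_cases hx : 0 < x 1 ∨ x ∈ D
    · exact hκφ.contDiffAt.congr_of_eventuallyEq (hin x hx)
    push Not at hx
    by_cases hc : x ∈ closure D
    · have : x ∈ closure S := subset_closure (hS (Or.inl
        ⟨by rw [hD.frontier_eq]; exact ⟨hc, hx.2⟩, hx.1⟩))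
      exact contDiffAt_const.congr_of_eventuallyEq (hφ0 x (hφ.eventuallyEq_zero this))
    rcases hx.1.lt_or_eq with hneg | hzer
    · exact contDiffAt_const.congr_of_eventuallyEq (hext x hc hneg)
    have hx0 : x 0 ∉ Icc (0 : ℝ) 1 := fun h => hc (hD.mem_closure_of_mem_Icc h (by simp [hzer]))
    have hxe : x = !₂[x 0, 0] := by ext i; fin_cases i <;> simp [hzer]
    have hdist : ∀ s : ℝ, dist x !₂[s, 0] = |x 0 - s| := by
      intro s
      rw [EuclideanSpace.dist_eq]
      simp [hzer, Real.dist_eq, Real.sqrt_sq_eq_abs]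
    have key : φ =ᶠ[𝓝 x] 0 ∨ (fun y : Plane => κ (y 0)) =ᶠ[𝓝 x] 0 := by
      by_cases hs : x 0 ∈ Ioo (-η) (1 + η)
      · left
        rw [mem_Icc, not_and_or, not_le, not_le] at hx0
        rcases hx0 with h | h
        · refine Metric.isOpen_ball.eventually_mem
            (?_ : x ∈ Metric.ball (!₂[0, 0] : Plane) η₀) |>.mono hz₀
          rw [Metric.mem_ball, hdist, abs_lt]
          constructor <;> linarith [hs.1, hs.2, min_le_left η₀ η₁]
        · refine Metric.isOpen_ball.eventually_mem
            (?_ : x ∈ Metric.ball (!₂[1, 0] : Plane) η₁) |>.mono hz₁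
          rw [Metric.mem_ball, hdist, abs_lt]
          constructor <;> linarith [hs.1, hs.2, min_le_right η₀ η₁]
      · right
        have : x 0 ∈ (Icc (-(η / 2)) (1 + η / 2))ᶜ := fun h => hs
          ⟨by linarith [h.1], by linarith [h.2]⟩
        filter_upwards [(isClosed_Icc.isOpen_compl.preimage (continuous_coord 0)).mem_nhds this]
          with y hy
        exact hκ0 _ fun h => hy ⟨h.1.le, h.2.le⟩
    rcases key with h | h
    · exact contDiffAt_const.congr_of_eventuallyEq (hφ0 x h)
    · refine (contDiffAt_const (c := (0 : ℝ))).congr_of_eventuallyEq ?_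
      filter_upwards [h] with y hy
      have hy' : κ (y 0) = 0 := hy
      simp only [ψ, hy', zero_mul, ite_self]
  have hsupp : tsupport ψ ⊆ tsupport φ := by
    refine closure_mono fun x hx h => hx ?_
    simp only [ψ, h, mul_zero, ite_self]
  refine ⟨ψ, ⟨⟨hsmooth, hφ.2.1.of_isClosed_subset (isClosed_tsupport _) hsupp,
    hφ.2.2.mono_left hsupp⟩, hzero⟩, ?_, ?_⟩
  · intro x hx
    refine (hin x (Or.inr hx)).trans ?_
    have h0 := (hD.subset_rect hx).1
    filter_upwards [(isOpen_Ioo.preimage (continuous_coord 0)).mem_nhds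
      (show x ∈ (fun x : Plane => x 0) ⁻¹' Ioo (-(η / 4)) (1 + η / 4) from
        ⟨by linarith [h0.1], by linarith [h0.2]⟩)] with y hy
    rw [hκ1 _ hy, one_mul]
  · intro x h0 h1
    simp only [ψ, h1, true_or, if_true]
    rw [hκ1 _ ⟨by linarith [h0.1], by linarith [h0.2]⟩, one_mul]

/-! ### Inequalities for smooth functions on the box -/

lemma sq_intervalIntegral_le {f : ℝ → ℝ} (hf : Continuous f) {a b : ℝ} (hab : a ≤ b) :
    (∫ t in a..b, f t) ^ 2 ≤ (b - a) * ∫ t in a..b, f t ^ 2 := by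
  rcases hab.eq_or_lt with rfl | h
  · simp
  set I := ∫ t in a..b, f t with hI
  set c := I / (b - a) with hc
  have h0 : 0 ≤ ∫ t in a..b, (f t - c) ^ 2 :=
    intervalIntegral.integral_nonneg hab fun t _ => sq_nonneg _
  have h1 : ∫ t in a..b, (f t - c) ^ 2 = (∫ t in a..b, f t ^ 2) - 2 * c * I + c ^ 2 * (b - a) := by
    have : ∀ t, (f t - c) ^ 2 = f t ^ 2 - 2 * c * f t + c ^ 2 := fun t => by ring
    simp_rw [this]
    rw [intervalIntegral.integral_add, intervalIntegral.integral_sub,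
      intervalIntegral.integral_const_mul, intervalIntegral.integral_const, smul_eq_mul]
    · ring
    all_goals exact Continuous.intervalIntegrable (by fun_prop) _ _
  have hba : 0 < b - a := by linarith
  have h2 : c * (b - a) = I := by rw [hc]; field_simp
  rw [h1] at h0
  nlinarith [mul_nonneg hba.le h0]

/-- A `C¹` function on an interval is bounded by its mean-square and that of its derivative, from
any reference point. -/
lemma sq_le_sq_add_integral {f f' : ℝ → ℝ} (hf : ∀ t, HasDerivAt f (f' t) t) (hf' : Continuous f')
    {a b s t : ℝ} (hs : s ∈ Icc a b) (ht : t ∈ Icc a b) :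
    f t ^ 2 ≤ f s ^ 2 + ∫ u in a..b, (f u ^ 2 + f' u ^ 2) := by
  have hfc : Continuous f := continuous_iff_continuousAt.2 fun u => (hf u).continuousAt
  have hd : ∀ u, HasDerivAt (fun u => f u ^ 2) (2 * f u * f' u) u := fun u => by
    convert! (hf u).pow 2 using 1; simp
  have hFTC := intervalIntegral.integral_eq_sub_of_hasDerivAt (a := s) (b := t)
    (fun u _ => hd u) (Continuous.intervalIntegrable (by fun_prop) _ _)
  have hI : Continuous fun u => f u ^ 2 + f' u ^ 2 := by fun_prop
  have hle : |∫ u in s..t, 2 * f u * f' u| ≤ ∫ u in a..b, (f u ^ 2 + f' u ^ 2) := by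
    calc |∫ u in s..t, 2 * f u * f' u| ≤ |∫ u in s..t, (f u ^ 2 + f' u ^ 2)| := by
          have := intervalIntegral.norm_integral_le_abs_of_norm_le
            (f := fun u => 2 * f u * f' u) (g := fun u => f u ^ 2 + f' u ^ 2) (a := s) (b := t)
            (μ := volume) ?_ (hI.intervalIntegrable _ _)
          · simpa using this
          · refine Eventually.of_forall fun u => ?_
            rw [Real.norm_eq_abs, abs_le]
            constructor <;> nlinarith [sq_nonneg (f u + f' u), sq_nonneg (f u - f' u)]
      _ = ∫ u in uIoc s t, (f u ^ 2 + f' u ^ 2) := by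
          rw [intervalIntegral.abs_integral_eq_abs_integral_uIoc, abs_of_nonneg]
          exact setIntegral_nonneg measurableSet_uIoc fun u _ => add_nonneg (sq_nonneg _) (sq_nonneg _)
      _ ≤ ∫ u in a..b, (f u ^ 2 + f' u ^ 2) := by
          rw [intervalIntegral.integral_of_le (hs.1.trans hs.2)]
          refine setIntegral_mono_set ((hI.intervalIntegrable a b).1)
            (Eventually.of_forall fun u => add_nonneg (sq_nonneg _) (sq_nonneg _)) (LE.le.eventuallyLE ?_)
          intro u hu
          rw [mem_uIoc] at hu
          rcases hu with hu | hu
          · exact ⟨by linarith [hs.1, hu.1], by linarith [ht.2, hu.2]⟩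
          · exact ⟨by linarith [ht.1, hu.1], by linarith [hs.2, hu.2]⟩
  have := (abs_le.1 hle).2
  linarith

lemma continuous_vertical {g : Plane → ℝ} (hg : Continuous g) (s : ℝ) :
    Continuous fun t : ℝ => g !₂[s, t] :=
  hg.comp (continuous_pt.comp (continuous_const.prodMk continuous_id))

lemma continuous_horizontal {g : Plane → ℝ} (hg : Continuous g) (t : ℝ) :
    Continuous fun s : ℝ => g !₂[s, t] :=
  hg.comp (continuous_pt.comp (continuous_id.prodMk continuous_const))

lemma continuous_integral_vertical {g : Plane → ℝ} (hg : Continuous g) (a b : ℝ) :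
    Continuous fun s : ℝ => ∫ t in a..b, g !₂[s, t] :=
  intervalIntegral.continuous_parametric_intervalIntegral_of_continuous'
    (f := fun s t => g !₂[s, t]) (hg.comp continuous_pt) a b

lemma continuous_integral_horizontal {g : Plane → ℝ} (hg : Continuous g) (a b : ℝ) :
    Continuous fun t : ℝ => ∫ s in a..b, g !₂[s, t] :=
  intervalIntegral.continuous_parametric_intervalIntegral_of_continuous'
    (f := fun t s => g !₂[s, t]) (hg.comp (continuous_pt.comp continuous_swap)) a b

namespace IsBoxTest

variable {D S : Set Plane} {ε : ℝ} {ψ : Plane → ℝ}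

lemma contDiff (hψ : IsBoxTest D S ψ) : ContDiff ℝ ∞ ψ := hψ.isTestOff.1

lemma differentiable (hψ : IsBoxTest D S ψ) : Differentiable ℝ ψ :=
  hψ.contDiff.differentiable (by simp)

lemma continuous (hψ : IsBoxTest D S ψ) : Continuous ψ := hψ.contDiff.continuous

lemma continuous_partialDeriv (hψ : IsBoxTest D S ψ) (j : Fin 2) : Continuous (partialDeriv j ψ) :=
  (contDiff_partialDeriv hψ.contDiff j).continuous

lemma zero_of_notMem (hψ : IsBoxTest D S ψ) {x : Plane} (h0 : x 0 ∈ Icc (0 : ℝ) 1)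
    (h : x 1 ≤ 0 ∨ x 1 = 1) (hx : x ∉ D) : ψ x = 0 :=
  (hψ.eventually_zero x h0 h hx).self_of_nhds

lemma eventually_zero_of_mem_rect (hD : IsChannel D ε) (hψ : IsBoxTest D S ψ) {x : Plane}
    (hx : x ∈ rect 0 1 (-1) 1) (hxD : x ∉ D) : ψ =ᶠ[𝓝 x] 0 := by
  refine hψ.eventually_zero x ⟨hx.1.1.le, hx.1.2.le⟩ (Or.inl ?_) hxD
  by_contra h
  exact hxD (hD.unit_subset ⟨hx.1, not_le.1 h, hx.2.2⟩)

lemma apply_top (hD : IsChannel D ε) (hψ : IsBoxTest D S ψ) {s : ℝ} (hs : s ∈ Icc (0 : ℝ) 1) :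
    ψ !₂[s, 1] = 0 :=
  hψ.zero_of_notMem (by simpa using hs) (by simp) fun h => by
    have := (hD.subset_rect h).2.2; simp at this

lemma apply_bottom (hD : IsChannel D ε) (hψ : IsBoxTest D S ψ) {s t : ℝ}
    (hs : s ∈ Icc (0 : ℝ) 1) (ht : t ≤ -ε) : ψ !₂[s, t] = 0 :=
  hψ.zero_of_notMem (by simpa using hs) (Or.inl (by simpa using ht.trans (by linarith [hD.pos])))
    fun h => by have := (hD.subset_rect h).2.1; simp at this; linarith

lemma apply_side (hD : IsChannel D ε) (hψ : IsBoxTest D S ψ) {s t : ℝ}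
    (hs : s = 0 ∨ s = 1) (ht : t ≤ 0) : ψ !₂[s, t] = 0 :=
  hψ.zero_of_notMem (by rcases hs with rfl | rfl <;> simp) (Or.inl (by simpa using ht))
    fun h => by have := (hD.subset_rect h).1; rcases hs with rfl | rfl <;> simp at this

/-- An integrand that vanishes where the test function vanishes locally may be integrated over the
whole box. -/
lemma setIntegral_eq (hD : IsChannel D ε) (hψ : IsBoxTest D S ψ) {F : Plane → ℝ}
    (hF : ∀ x, ψ =ᶠ[𝓝 x] 0 → F x = 0) :
    ∫ x in D, F x = ∫ x in rect 0 1 (-1) 1, F x :=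
  (setIntegral_eq_of_subset_of_forall_sdiff_eq_zero (measurableSet_rect _ _ _ _) hD.subset_box
    fun x hx => hF x (hψ.eventually_zero_of_mem_rect hD hx.1 hx.2)).symm

lemma setIntegral_sq_eq (hD : IsChannel D ε) (hψ : IsBoxTest D S ψ) :
    ∫ x in D, ψ x ^ 2 = ∫ s in (0 : ℝ)..1, ∫ t in (-1 : ℝ)..1, ψ !₂[s, t] ^ 2 := by
  rw [hψ.setIntegral_eq hD fun x hx => by simp [hx.self_of_nhds],
    setIntegral_rect (by norm_num) (by norm_num)]
  have := hψ.continuous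
  exact integrableOn_rect_of_continuous (by fun_prop)

lemma setIntegral_partialDeriv_sq_eq (hD : IsChannel D ε) (hψ : IsBoxTest D S ψ) (j : Fin 2) :
    ∫ x in D, partialDeriv j ψ x ^ 2 =
      ∫ s in (0 : ℝ)..1, ∫ t in (-1 : ℝ)..1, partialDeriv j ψ !₂[s, t] ^ 2 := by
  rw [hψ.setIntegral_eq hD fun x hx => by simp [partialDeriv_eq_zero hx],
    setIntegral_rect (by norm_num) (by norm_num)]
  have := hψ.continuous_partialDeriv j
  exact integrableOn_rect_of_continuous (by fun_prop)

/-- Poincaré's inequality between a zero at height `b` and heights in `[a, b]`. -/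
lemma integral_sq_le (hψ : IsBoxTest D S ψ) {a b c : ℝ} (hab : a ≤ b) (hc : c ∈ Icc a b) {s : ℝ}
    (h0 : ψ !₂[s, c] = 0) :
    ∫ t in a..b, ψ !₂[s, t] ^ 2 ≤
      (b - a) ^ 2 * ∫ t in a..b, partialDeriv 1 ψ !₂[s, t] ^ 2 := by
  have hc1 := continuous_vertical (hψ.continuous_partialDeriv 1) s
  set J := ∫ t in a..b, partialDeriv 1 ψ !₂[s, t] ^ 2 with hJ
  have hpt : ∀ t ∈ Icc a b, ψ !₂[s, t] ^ 2 ≤ (b - a) * J := by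
    intro t ht
    have hFTC : ∀ u v : ℝ, ∫ t in u..v, partialDeriv 1 ψ !₂[s, t] = ψ !₂[s, v] - ψ !₂[s, u] :=
      fun u v => intervalIntegral.integral_eq_sub_of_hasDerivAt
        (fun u _ => hasDerivAt_vertical hψ.differentiable s u) (hc1.intervalIntegrable _ _)
    have main : ∀ u v : ℝ, a ≤ u → u ≤ v → v ≤ b → (ψ !₂[s, v] - ψ !₂[s, u]) ^ 2 ≤ (b - a) * J := by
      intro u v hau huv hvb
      rw [← hFTC]
      refine (sq_intervalIntegral_le hc1 huv).trans ?_
      refine mul_le_mul (by linarith) ?_ (intervalIntegral.integral_nonneg huv fun _ _ => sq_nonneg _)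
        (by linarith)
      exact intervalIntegral.integral_mono_interval hau huv hvb
        (Eventually.of_forall fun _ => sq_nonneg _) ((hc1.pow 2).intervalIntegrable _ _)
    rcases le_total t c with h | h
    · have := main t c ht.1 h hc.2
      rwa [h0, zero_sub, neg_sq] at this
    · have := main c t hc.1 h ht.2
      rwa [h0, sub_zero] at this
  calc ∫ t in a..b, ψ !₂[s, t] ^ 2 ≤ ∫ t in a..b, (b - a) * J :=
        intervalIntegral.integral_mono_on hab
          (((continuous_vertical hψ.continuous s).pow 2).intervalIntegrable _ _)
          (by simp) hpt
    _ = (b - a) ^ 2 * J := by simp; ring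

lemma setIntegral_sq_le (hD : IsChannel D ε) (hψ : IsBoxTest D S ψ) :
    ∫ x in D, ψ x ^ 2 ≤ 4 * ∫ x in D, partialDeriv 1 ψ x ^ 2 := by
  rw [hψ.setIntegral_sq_eq hD, hψ.setIntegral_partialDeriv_sq_eq hD,
    ← intervalIntegral.integral_const_mul]
  refine intervalIntegral.integral_mono_on (by norm_num)
    ((continuous_integral_vertical (hψ.continuous.pow 2) _ _).intervalIntegrable _ _)
    ((continuous_const.mul (continuous_integral_vertical
      ((hψ.continuous_partialDeriv 1).pow 2) _ _)).intervalIntegrable _ _) fun s hs => ?_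
  have := hψ.integral_sq_le (a := -1) (b := 1) (c := 1) (by norm_num) (by norm_num)
    (hψ.apply_top hD hs)
  norm_num at this
  exact this

/-- Poincaré's inequality in the part of the channel below the axis, whose height is at most `ε`. -/
lemma setIntegral_low_sq_le (hD : IsChannel D ε) (hψ : IsBoxTest D S ψ) :
    ∫ x in D ∩ {x | x 1 < 0}, ψ x ^ 2 ≤ ε ^ 2 * ∫ x in D, partialDeriv 1 ψ x ^ 2 := by
  have h1 : ∫ x in D ∩ {x | x 1 < 0}, ψ x ^ 2 ≤ ∫ x in rect 0 1 (-ε) 0, ψ x ^ 2 := by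
    refine setIntegral_mono_set (integrableOn_rect_of_continuous (hψ.continuous.pow 2))
      (Eventually.of_forall fun _ => sq_nonneg _) (LE.le.eventuallyLE ?_)
    exact fun x hx => ⟨(hD.subset_rect hx.1).1, (hD.subset_rect hx.1).2.1, hx.2⟩
  have h2 : ∫ x in rect 0 1 (-ε) 0, partialDeriv 1 ψ x ^ 2 ≤ ∫ x in D, partialDeriv 1 ψ x ^ 2 := by
    rw [hψ.setIntegral_eq hD fun x hx => by simp [partialDeriv_eq_zero hx]]
    refine setIntegral_mono_set
      (integrableOn_rect_of_continuous ((hψ.continuous_partialDeriv 1).pow 2))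
      (Eventually.of_forall fun _ => sq_nonneg _) (LE.le.eventuallyLE ?_)
    exact fun x hx => ⟨hx.1, by linarith [hx.2.1, hD.lt_one], by linarith [hx.2.2]⟩
  refine h1.trans (le_trans ?_ (mul_le_mul_of_nonneg_left h2 (sq_nonneg _)))
  have hε := hD.pos.le
  have hi : ∀ g : Plane → ℝ, Continuous g → IntegrableOn (fun x => g x ^ 2) (rect 0 1 (-ε) 0) :=
    fun g hg => integrableOn_rect_of_continuous (by fun_prop)
  rw [setIntegral_rect (by norm_num) (by linarith) (hi _ hψ.continuous),
    setIntegral_rect (by norm_num) (by linarith) (hi _ (hψ.continuous_partialDeriv 1)),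
    ← intervalIntegral.integral_const_mul]
  refine intervalIntegral.integral_mono_on (by norm_num)
    ((continuous_integral_vertical (hψ.continuous.pow 2) _ _).intervalIntegrable _ _)
    ((continuous_const.mul (continuous_integral_vertical
      ((hψ.continuous_partialDeriv 1).pow 2) _ _)).intervalIntegrable _ _) fun s hs => ?_
  have := hψ.integral_sq_le (a := -ε) (b := 0) (c := -ε) (by linarith) ⟨le_rfl, by linarith⟩
    (hψ.apply_bottom hD hs le_rfl)
  simpa using this

/-- Ladyzhenskaya's inequality. The function vanishes on the top side, which controls it on vertical
lines; on horizontal lines its mean over `[0, 1]` serves as the reference value. -/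
lemma setIntegral_pow_four_le (hD : IsChannel D ε) (hψ : IsBoxTest D S ψ) :
    ∫ x in D, ψ x ^ 4 ≤ 45 * (∑ j, ∫ x in D, partialDeriv j ψ x ^ 2) ^ 2 := by
  set G := ∑ j, ∫ x in D, partialDeriv j ψ x ^ 2 with hG
  have hnn : ∀ j, 0 ≤ ∫ x in D, partialDeriv j ψ x ^ 2 := fun j =>
    integral_nonneg fun _ => sq_nonneg _
  have hG0 : ∫ x in D, partialDeriv 0 ψ x ^ 2 ≤ G := by
    rw [hG, Fin.sum_univ_two]; linarith [hnn 1]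
  have hG1 : ∫ x in D, partialDeriv 1 ψ x ^ 2 ≤ G := by
    rw [hG, Fin.sum_univ_two]; linarith [hnn 0]
  have hc := hψ.continuous
  have hc0 := hψ.continuous_partialDeriv 0
  have hc1 := hψ.continuous_partialDeriv 1
  -- `A s` bounds `ψ²` on the vertical line over `s`, and `B t` on the horizontal line at height `t`;
  -- the integral of the product `A s * B t` splits
  let gA : Plane → ℝ := fun x => ψ x ^ 2 + partialDeriv 1 ψ x ^ 2
  let gB : Plane → ℝ := fun x => 2 * ψ x ^ 2 + partialDeriv 0 ψ x ^ 2
  have hgA : Continuous gA := by fun_prop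
  have hgB : Continuous gB := by fun_prop
  let A : ℝ → ℝ := fun s => ∫ t in (-1 : ℝ)..1, gA !₂[s, t]
  let B : ℝ → ℝ := fun t => ∫ s in (0 : ℝ)..1, gB !₂[s, t]
  have hA : Continuous A := continuous_integral_vertical hgA _ _
  have hB : Continuous B := continuous_integral_horizontal hgB _ _
  have hAle : ∀ s ∈ Icc (0 : ℝ) 1, ∀ t ∈ Icc (-1 : ℝ) 1, ψ !₂[s, t] ^ 2 ≤ A s := by
    intro s hs t ht
    have := sq_le_sq_add_integral (a := -1) (b := 1) (s := 1) (t := t)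
      (fun t => hasDerivAt_vertical hψ.differentiable s t) (continuous_vertical hc1 s)
      (by norm_num) ht
    simpa only [hψ.apply_top hD hs, zero_pow two_ne_zero, zero_add] using this
  have hBle : ∀ s ∈ Icc (0 : ℝ) 1, ∀ t, ψ !₂[s, t] ^ 2 ≤ B t := by
    intro s hs t
    have hch := continuous_horizontal hc t
    have hch0 := continuous_horizontal hc0 t
    have h1 : ∀ r ∈ Icc (0 : ℝ) 1, ψ !₂[s, t] ^ 2 ≤ ψ !₂[r, t] ^ 2 +
        ∫ u in (0 : ℝ)..1, (ψ !₂[u, t] ^ 2 + partialDeriv 0 ψ !₂[u, t] ^ 2) := fun r hr =>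
      sq_le_sq_add_integral (fun s => hasDerivAt_horizontal hψ.differentiable s t) hch0 hr hs
    have h2 := intervalIntegral.integral_mono_on (μ := volume) (zero_le_one (α := ℝ))
      (by simp) (Continuous.intervalIntegrable (by fun_prop) _ _) h1
    rw [intervalIntegral.integral_const, sub_zero, one_smul, intervalIntegral.integral_add,
      intervalIntegral.integral_const, sub_zero, one_smul,
      ← intervalIntegral.integral_add] at h2
    · refine h2.trans_eq ?_
      simp only [B, gB]
      congr 1; ext u; ring
    all_goals exact Continuous.intervalIntegrable (by fun_prop) _ _
  have hAint : ∫ s in (0 : ℝ)..1, A s ≤ 5 * G := by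
    have h1 : ∫ s in (0 : ℝ)..1, A s = ∫ x in D, gA x := by
      rw [hψ.setIntegral_eq hD fun x hx => by
          simp [gA, hx.self_of_nhds, partialDeriv_eq_zero hx],
        setIntegral_rect (by norm_num) (by norm_num) (integrableOn_rect_of_continuous hgA)]
    have hi : ∀ g : Plane → ℝ, Continuous g → IntegrableOn g D := fun g hg =>
      (integrableOn_rect_of_continuous hg).mono_set hD.subset_box
    have h2 : ∫ x in D, gA x = (∫ x in D, ψ x ^ 2) + ∫ x in D, partialDeriv 1 ψ x ^ 2 :=
      integral_add (hi _ (by fun_prop)) (hi _ (by fun_prop))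
    rw [h1, h2]
    linarith [hψ.setIntegral_sq_le hD]
  have hBint : ∫ t in (-1 : ℝ)..1, B t ≤ 9 * G := by
    have h1 : ∫ t in (-1 : ℝ)..1, B t = ∫ x in D, gB x := by
      rw [hψ.setIntegral_eq hD fun x hx => by
          simp [gB, hx.self_of_nhds, partialDeriv_eq_zero hx],
        setIntegral_rect_swap (by norm_num) (by norm_num) (integrableOn_rect_of_continuous hgB)]
    have hi : ∀ g : Plane → ℝ, Continuous g → IntegrableOn g D := fun g hg =>
      (integrableOn_rect_of_continuous hg).mono_set hD.subset_box
    have h2 : ∫ x in D, gB x = (∫ x in D, 2 * ψ x ^ 2) + ∫ x in D, partialDeriv 0 ψ x ^ 2 :=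
      integral_add (hi _ (by fun_prop)) (hi _ (by fun_prop))
    rw [h1, h2, integral_const_mul]
    linarith [hψ.setIntegral_sq_le hD]
  have hA0 : 0 ≤ ∫ s in (0 : ℝ)..1, A s := intervalIntegral.integral_nonneg (by norm_num)
    fun s hs => (sq_nonneg _).trans (hAle s hs 0 (by norm_num))
  have hG0' : 0 ≤ G := (hnn 0).trans hG0
  calc ∫ x in D, ψ x ^ 4 = ∫ s in (0 : ℝ)..1, ∫ t in (-1 : ℝ)..1, ψ !₂[s, t] ^ 4 := by
        rw [hψ.setIntegral_eq hD fun x hx => by simp [hx.self_of_nhds],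
          setIntegral_rect (by norm_num) (by norm_num)]
        exact integrableOn_rect_of_continuous (by fun_prop)
    _ ≤ ∫ s in (0 : ℝ)..1, A s * ∫ t in (-1 : ℝ)..1, B t := by
        refine intervalIntegral.integral_mono_on (by norm_num)
          ((continuous_integral_vertical (hc.pow 4) _ _).intervalIntegrable _ _)
          ((hA.mul continuous_const).intervalIntegrable _ _) fun s hs => ?_
        rw [← intervalIntegral.integral_const_mul]
        refine intervalIntegral.integral_mono_on (by norm_num)
          (((continuous_vertical hc s).pow 4).intervalIntegrable _ _)
          ((continuous_const.mul hB).intervalIntegrable _ _) fun t ht => ?_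
        have e : ψ !₂[s, t] ^ 4 = ψ !₂[s, t] ^ 2 * ψ !₂[s, t] ^ 2 := by ring
        rw [e]
        exact mul_le_mul (hAle s hs t ht) (hBle s hs t) (sq_nonneg _)
          ((sq_nonneg _).trans (hAle s hs t ht))
    _ = (∫ s in (0 : ℝ)..1, A s) * ∫ t in (-1 : ℝ)..1, B t :=
        intervalIntegral.integral_mul_const _ _
    _ ≤ (5 * G) * (9 * G) := mul_le_mul hAint hBint (intervalIntegral.integral_nonneg (by norm_num)
          fun t _ => (sq_nonneg _).trans (hBle 0 (by norm_num) t)) (by positivity)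
    _ = 45 * G ^ 2 := by ring

end IsBoxTest

/-! ### The Hilbert space of functions with square-integrable gradient -/

/-- The space `L²(D)³`, in which `u ∈ H¹(D)` is represented by `(u, ∂₁u, ∂₂u)`. -/
abbrev H1Triple (D : Set Plane) : Type :=
  PiLp 2 (fun _ : Fin 3 => Lp ℝ 2 (volume.restrict D))

/-- `z` consists of the values and the classical partial derivatives of `φ`. -/
structure IsTripleOf (D : Set Plane) (φ : Plane → ℝ) (z : H1Triple D) : Prop where
  val : z 0 =ᵐ[volume.restrict D] φ
  grad : ∀ j : Fin 2, z j.succ =ᵐ[volume.restrict D] partialDeriv j φ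

/-- The triples of the test functions that vanish near `S`. -/
def testTriples (D S : Set Plane) : Submodule ℝ (H1Triple D) where
  carrier := {z | ∃ φ, IsTestOff S φ ∧ IsTripleOf D φ z}
  add_mem' := by
    rintro z w ⟨φ, hφ, hz⟩ ⟨ψ, hψ, hw⟩
    refine ⟨φ + ψ, hφ.add hψ, ?_, fun j => ?_⟩
    · exact (Lp.coeFn_add _ _).trans (hz.val.add hw.val)
    · rw [partialDeriv_add (hφ.1.differentiable (by simp)) (hψ.1.differentiable (by simp))]
      exact (Lp.coeFn_add _ _).trans ((hz.grad j).add (hw.grad j))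
  zero_mem' := by
    refine ⟨0, ⟨contDiff_const, HasCompactSupport.zero, by
      rw [(tsupport_eq_empty_iff (f := (0 : Plane → ℝ))).2 rfl]; exact disjoint_bot_left⟩, ?_, fun j => ?_⟩
    · exact Lp.coeFn_zero _ _ _
    · refine (Lp.coeFn_zero _ _ _).trans (Eventually.of_forall fun x => ?_)
      simp [partialDeriv]
  smul_mem' := by
    rintro c z ⟨φ, hφ, hz⟩
    refine ⟨c • φ, hφ.smul c, ?_, fun j => ?_⟩
    · exact (Lp.coeFn_smul _ _).trans (hz.val.const_smul c)
    · rw [partialDeriv_smul]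
      exact (Lp.coeFn_smul _ _).trans ((hz.grad j).const_smul c)

/-- The closure in `H¹(D)` of the test functions that vanish near `S`. -/
noncomputable def H1Zero (D S : Set Plane) : Submodule ℝ (H1Triple D) :=
  (testTriples D S).topologicalClosure

lemma isClosed_H1Zero (D S : Set Plane) : IsClosed (H1Zero D S : Set (H1Triple D)) :=
  Submodule.isClosed_topologicalClosure _

lemma Lp_norm_sq_eq {μ : Measure Plane} (u : Lp ℝ 2 μ) : ‖u‖ ^ 2 = ∫ x, u x ^ 2 ∂μ := by
  rw [← real_inner_self_eq_norm_sq, L2.inner_def]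
  refine integral_congr_ae (Eventually.of_forall fun x => ?_)
  simp [sq]

lemma H1Triple_norm_sq {D : Set Plane} (z : H1Triple D) :
    ‖z‖ ^ 2 = ‖z 0‖ ^ 2 + (‖z 1‖ ^ 2 + ‖z 2‖ ^ 2) := by
  rw [PiLp.norm_sq_eq_of_L2, Fin.sum_univ_three]; ring

lemma exists_isTripleOf {S : Set Plane} (D : Set Plane) {φ : Plane → ℝ} (hφ : IsTestOff S φ) :
    ∃ z : H1Triple D, IsTripleOf D φ z := by
  have h0 : MemLp φ 2 (volume.restrict D) := hφ.1.continuous.memLp_of_hasCompactSupport hφ.2.1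
  have h1 : ∀ j, MemLp (partialDeriv j φ) 2 (volume.restrict D) := fun j =>
    (contDiff_partialDeriv hφ.1 j).continuous.memLp_of_hasCompactSupport
      (hasCompactSupport_partialDeriv hφ.2.1 j)
  refine ⟨WithLp.toLp 2 (Fin.cons h0.toLp fun j => (h1 j).toLp), ?_, fun j => ?_⟩
  · exact h0.coeFn_toLp
  · exact (h1 j).coeFn_toLp

lemma IsTripleOf.mem_H1Zero {D S : Set Plane} {φ : Plane → ℝ} {z : H1Triple D}
    (hz : IsTripleOf D φ z) (hφ : IsTestOff S φ) : z ∈ H1Zero D S :=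
  subset_closure ⟨φ, hφ, hz⟩

/-- A closed property of elements of `H1Zero D S` may be checked on the adapted test functions. -/
lemma H1Zero_induction {D S : Set Plane} {ε : ℝ} (hD : IsChannel D ε) (hS : walls D ⊆ S)
    {p : Set (H1Triple D)} (hp : IsClosed p)
    (h : ∀ ψ, IsBoxTest D S ψ → ∀ z, IsTripleOf D ψ z → z ∈ p) :
    ∀ z ∈ H1Zero D S, z ∈ p := by
  refine fun z hz => closure_minimal ?_ hp hz
  rintro w ⟨φ, hφ, hw⟩
  obtain ⟨ψ, hψ, he, -⟩ := hφ.exists_isBoxTest hD hS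
  refine h ψ hψ w ⟨hw.val.trans ?_, fun j => (hw.grad j).trans ?_⟩
  · filter_upwards [ae_restrict_mem hD.isOpen.measurableSet] with x hx
    exact (he x hx).self_of_nhds.symm
  · filter_upwards [ae_restrict_mem hD.isOpen.measurableSet] with x hx
    exact (partialDeriv_congr (he x hx) j).symm

lemma H1Zero_exists_approx {D S : Set Plane} {ε : ℝ} (hD : IsChannel D ε) (hS : walls D ⊆ S)
    {z : H1Triple D} (hz : z ∈ H1Zero D S) {δ : ℝ} (hδ : 0 < δ) :
    ∃ ψ, IsBoxTest D S ψ ∧ ∃ t, IsTripleOf D ψ t ∧ ‖z - t‖ < δ := by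
  have := H1Zero_induction hD hS (p := closure {t | ∃ ψ, IsBoxTest D S ψ ∧ IsTripleOf D ψ t})
    isClosed_closure (fun ψ hψ z hz => subset_closure ⟨ψ, hψ, hz⟩) z hz
  obtain ⟨t, ⟨ψ, hψ, ht⟩, hd⟩ := Metric.mem_closure_iff.1 this δ hδ
  exact ⟨ψ, hψ, t, ht, by rwa [← dist_eq_norm]⟩

lemma continuous_integral_mul {μ : Measure Plane} {k : Plane → ℝ} (hk : MemLp k 2 μ) :
    Continuous fun u : Lp ℝ 2 μ => ∫ x, k x * u x ∂μ := by
  have : (fun u : Lp ℝ 2 μ => ∫ x, k x * u x ∂μ) = fun u => inner ℝ u hk.toLp := by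
    ext u
    rw [L2.inner_def]
    refine integral_congr_ae ?_
    filter_upwards [hk.coeFn_toLp] with x hx
    simp [hx]
  rw [this]
  fun_prop

lemma IsTripleOf.norm_sq_val {D : Set Plane} {φ : Plane → ℝ} {z : H1Triple D}
    (hz : IsTripleOf D φ z) : ‖z 0‖ ^ 2 = ∫ x in D, φ x ^ 2 := by
  rw [Lp_norm_sq_eq]
  exact integral_congr_ae (hz.val.mono fun x hx => by simp only [hx])

lemma IsTripleOf.norm_sq_grad {D : Set Plane} {φ : Plane → ℝ} {z : H1Triple D}
    (hz : IsTripleOf D φ z) (j : Fin 2) : ‖z j.succ‖ ^ 2 = ∫ x in D, partialDeriv j φ x ^ 2 := by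
  rw [Lp_norm_sq_eq]
  exact integral_congr_ae ((hz.grad j).mono fun x hx => by simp only [hx])

lemma continuous_triple_apply {D : Set Plane} (i : Fin 3) : Continuous fun z : H1Triple D => z i :=
  PiLp.continuous_apply 2 _ i

/-- Poincaré's inequality. -/
lemma H1Zero_poincare {D S : Set Plane} {ε : ℝ} (hD : IsChannel D ε) (hS : walls D ⊆ S)
    {z : H1Triple D} (hz : z ∈ H1Zero D S) : ‖z 0‖ ^ 2 ≤ 4 * ‖z 2‖ ^ 2 := by
  refine H1Zero_induction hD hS (p := {z | ‖z 0‖ ^ 2 ≤ 4 * ‖z 2‖ ^ 2}) ?_ ?_ z hz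
  · exact isClosed_le ((continuous_triple_apply 0).norm.pow 2)
      (continuous_const.mul ((continuous_triple_apply 2).norm.pow 2))
  · intro ψ hψ z hz
    have h := hψ.setIntegral_sq_le hD
    rw [← hz.norm_sq_val, ← hz.norm_sq_grad 1] at h
    exact h

lemma H1Zero_poincare_low {D S : Set Plane} {ε : ℝ} (hD : IsChannel D ε) (hS : walls D ⊆ S)
    {z : H1Triple D} (hz : z ∈ H1Zero D S) :
    ∫ x in D ∩ {x | x 1 < 0}, z 0 x ^ 2 ≤ ε ^ 2 * ‖z 2‖ ^ 2 := by
  have hm : MeasurableSet {x : Plane | x 1 < 0} := measurableSet_lt (by fun_prop) measurable_const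
  have hr : (volume.restrict D).restrict {x : Plane | x 1 < 0}
      = volume.restrict (D ∩ {x | x 1 < 0}) := by
    rw [Measure.restrict_restrict hm, inter_comm]
  let R := LpToLpRestrictCLM Plane ℝ ℝ (volume.restrict D) 2 {x : Plane | x 1 < 0}
  have hR : ∀ u : Lp ℝ 2 (volume.restrict D),
      ‖R u‖ ^ 2 = ∫ x in D ∩ {x | x 1 < 0}, u x ^ 2 := by
    intro u
    rw [Lp_norm_sq_eq, ← hr]
    exact integral_congr_ae ((LpToLpRestrictCLM_coeFn ℝ _ u).mono fun x hx => by simp only [R, hx])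
  have := H1Zero_induction hD hS (p := {z | ‖R (z 0)‖ ^ 2 ≤ ε ^ 2 * ‖z 2‖ ^ 2}) ?_ ?_ z hz
  · rwa [← hR]
  · exact isClosed_le ((R.continuous.comp (continuous_triple_apply 0)).norm.pow 2)
      (continuous_const.mul ((continuous_triple_apply 2).norm.pow 2))
  · intro ψ hψ z hz
    have h := hψ.setIntegral_low_sq_le hD
    rw [← hz.norm_sq_grad 1] at h
    change ‖R (z 0)‖ ^ 2 ≤ _
    rw [hR]
    refine le_trans (le_of_eq ?_) h
    refine integral_congr_ae ?_
    have := ae_restrict_of_ae_restrict_of_subset (inter_subset_left (t := {x : Plane | x 1 < 0}))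
      hz.val
    exact this.mono fun x hx => by simp only [hx]

lemma memLp_four_and_le {μ : Measure Plane} {f : Plane → ℝ} (hf : Continuous f)
    (hs : HasCompactSupport f) [IsFiniteMeasureOnCompacts μ] {c : ℝ} (hc : 0 ≤ c)
    (h : ∫ x, f x ^ 4 ∂μ ≤ c ^ 4) : eLpNorm f 4 μ ≤ ENNReal.ofReal c := by
  have hm : MemLp f 4 μ := hf.memLp_of_hasCompactSupport hs
  rw [hm.eLpNorm_eq_integral_rpow_norm (by norm_num) (by norm_num)]
  refine ENNReal.ofReal_le_ofReal ?_
  have h4 : (4 : ENNReal).toReal = 4 := by norm_num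
  have : ∀ x, ‖f x‖ ^ (4 : ENNReal).toReal = f x ^ 4 := fun x => by
    rw [h4, Real.norm_eq_abs]
    have : |f x| ^ (4 : ℝ) = |f x| ^ 4 := by exact_mod_cast Real.rpow_natCast |f x| 4
    rw [this, Even.pow_abs (by decide)]
  simp_rw [this]
  rw [h4]
  calc (∫ x, f x ^ 4 ∂μ) ^ ((4 : ℝ)⁻¹) ≤ (c ^ 4) ^ ((4 : ℝ)⁻¹) :=
        Real.rpow_le_rpow (integral_nonneg fun x => by positivity) h (by norm_num)
    _ = c := by
        have := Real.pow_rpow_inv_natCast hc (n := 4) (by norm_num)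
        exact_mod_cast this

/-- Ladyzhenskaya's inequality in `H1Zero`. -/
lemma H1Zero_ladyzhenskaya {D S : Set Plane} {ε : ℝ} (hD : IsChannel D ε) (hS : walls D ⊆ S)
    {z : H1Triple D} (hz : z ∈ H1Zero D S) :
    eLpNorm (z 0) 4 (volume.restrict D) ≤
      ENNReal.ofReal (3 * Real.sqrt (‖z 1‖ ^ 2 + ‖z 2‖ ^ 2)) := by
  refine H1Zero_induction hD hS (p := {z | eLpNorm (z 0) 4 (volume.restrict D) ≤
      ENNReal.ofReal (3 * Real.sqrt (‖z 1‖ ^ 2 + ‖z 2‖ ^ 2))}) ?_ ?_ z hz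
  · have hc : Continuous fun z : H1Triple D => 3 * Real.sqrt (‖z 1‖ ^ 2 + ‖z 2‖ ^ 2) :=
      continuous_const.mul (((continuous_triple_apply 1).norm.pow 2).add
        ((continuous_triple_apply 2).norm.pow 2)).sqrt
    refine isClosed_of_closure_subset fun z hz => ?_
    obtain ⟨w, hw, hlim⟩ := mem_closure_iff_seq_limit.1 hz
    have h0 : Tendsto (fun n => w n 0) atTop (𝓝 (z 0)) :=
      ((continuous_triple_apply 0).tendsto z).comp hlim
    obtain ⟨ns, hns, hae⟩ := (tendstoInMeasure_of_tendsto_Lp h0).exists_seq_tendsto_ae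
    have hb := ((ENNReal.continuous_ofReal.comp hc).tendsto z).comp
      (hlim.comp hns.tendsto_atTop)
    change eLpNorm (z 0) 4 (volume.restrict D) ≤ _
    refine le_of_forall_gt fun b hbz => ?_
    obtain ⟨b', hb1, hb2⟩ := exists_between hbz
    refine lt_of_le_of_lt ?_ hb2
    refine Lp.eLpNorm_le_of_ae_tendsto (u := atTop) ?_ (fun n => (Lp.aestronglyMeasurable _)) hae
    filter_upwards [hb.eventually_lt_const hb1] with n hn
    exact (hw _).trans hn.le
  · intro ψ hψ z hz
    have h := hψ.setIntegral_pow_four_le hD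
    rw [Fin.sum_univ_two, ← hz.norm_sq_grad 0, ← hz.norm_sq_grad 1] at h
    change eLpNorm (z 0) 4 _ ≤ _
    rw [eLpNorm_congr_ae hz.val]
    refine memLp_four_and_le hψ.continuous hψ.isTestOff.2.1 (by positivity) (h.trans ?_)
    have hs := Real.sq_sqrt (show 0 ≤ ‖z 1‖ ^ 2 + ‖z 2‖ ^ 2 by positivity)
    have e : (3 * Real.sqrt (‖z 1‖ ^ 2 + ‖z 2‖ ^ 2)) ^ 4 = 81 * (‖z 1‖ ^ 2 + ‖z 2‖ ^ 2) ^ 2 := by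
      rw [mul_pow, ← hs]
      ring_nf
      rw [hs]
    rw [e]
    change 45 * (‖z 1‖ ^ 2 + ‖z 2‖ ^ 2) ^ 2 ≤ _
    nlinarith [sq_nonneg (‖z 1‖ ^ 2 + ‖z 2‖ ^ 2)]

/-! ### Weak derivatives of elements of the closure -/

lemma integral_mul_partialDeriv {φ η : Plane → ℝ} (hφ : ContDiff ℝ ∞ φ) (hη : ContDiff ℝ ∞ η)
    (hc : HasCompactSupport η) (j : Fin 2) :
    ∫ x, φ x * partialDeriv j η x = -∫ x, partialDeriv j φ x * η x := by
  have h1 : Continuous (partialDeriv j φ) := (contDiff_partialDeriv hφ j).continuous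
  have h2 : Continuous (partialDeriv j η) := (contDiff_partialDeriv hη j).continuous
  have h3 := hφ.continuous
  have h4 := hη.continuous
  refine integral_mul_fderiv_eq_neg_fderiv_mul_of_integrable ?_ ?_ ?_
    (fun x _ => hφ.differentiable (by simp) x)
    (fun x _ => hη.differentiable (by simp) x)
  · exact (h1.mul h4).integrable_of_hasCompactSupport hc.mul_left
  · exact (h3.mul h2).integrable_of_hasCompactSupport
      (hasCompactSupport_partialDeriv hc j).mul_left
  · exact (h3.mul h4).integrable_of_hasCompactSupport hc.mul_left

lemma setIntegral_eq_integral_of_tsupport {D : Set Plane} {F η : Plane → ℝ}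
    (hη : tsupport η ⊆ D) (hF : ∀ x, η =ᶠ[𝓝 x] 0 → F x = 0) : ∫ x in D, F x = ∫ x, F x :=
  setIntegral_eq_integral_of_forall_compl_eq_zero fun x hx =>
    hF x (notMem_tsupport_iff_eventuallyEq.1 fun h => hx (hη h))

lemma isWeakPartial_of_mem_H1Zero {D S : Set Plane} {z : H1Triple D} (hz : z ∈ H1Zero D S)
    (j : Fin 2) : IsWeakPartial D j (z 0) (z j.succ) := by
  refine ⟨Lp.memLp _, fun η hη hc hs => ?_⟩
  have m1 : MemLp (partialDeriv j η) 2 (volume.restrict D) :=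
    (contDiff_partialDeriv hη j).continuous.memLp_of_hasCompactSupport
      (hasCompactSupport_partialDeriv hc j)
  have m2 : MemLp η 2 (volume.restrict D) := hη.continuous.memLp_of_hasCompactSupport hc
  have hcl : IsClosed {z : H1Triple D | ∫ x in D, partialDeriv j η x * z 0 x =
      -∫ x in D, η x * z j.succ x} :=
    isClosed_eq ((continuous_integral_mul m1).comp (continuous_triple_apply 0))
      ((continuous_integral_mul m2).comp (continuous_triple_apply j.succ)).neg
  have : z ∈ {z : H1Triple D | ∫ x in D, partialDeriv j η x * z 0 x =
      -∫ x in D, η x * z j.succ x} := by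
    refine closure_minimal ?_ hcl hz
    rintro w ⟨φ, hφ, hw⟩
    have e1 : ∫ x in D, partialDeriv j η x * w 0 x = ∫ x in D, φ x * partialDeriv j η x :=
      integral_congr_ae (hw.val.mono fun x hx => by simp only [hx, mul_comm])
    have e2 : ∫ x in D, η x * w j.succ x = ∫ x in D, partialDeriv j φ x * η x :=
      integral_congr_ae ((hw.grad j).mono fun x hx => by simp only [hx, mul_comm])
    change _ = _
    rw [e1, e2, setIntegral_eq_integral_of_tsupport hs fun x hx => by simp [partialDeriv_eq_zero hx],
      setIntegral_eq_integral_of_tsupport hs fun x hx => by simp [hx.self_of_nhds]]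
    exact integral_mul_partialDeriv hφ.1 hη hc j
  simp only [mem_ofPred_eq] at this
  simpa only [mul_comm] using this

lemma IsWeakPartial.ae_eq {D : Set Plane} (hD : IsOpen D) {j : Fin 2} {u u' v v' : Plane → ℝ}
    (h : IsWeakPartial D j u v) (h' : IsWeakPartial D j u' v')
    (hu : u =ᵐ[volume.restrict D] u') : v =ᵐ[volume.restrict D] v' := by
  have hi : ∀ {f : Plane → ℝ}, MemLp f 2 (volume.restrict D) → LocallyIntegrableOn f D volume := by
    intro f hf
    have h1 : LocallyIntegrable f (volume.restrict D) := hf.locallyIntegrable (by norm_num)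
    intro x hx
    obtain ⟨K, hK, hKx, hKD⟩ := local_compact_nhds (hD.mem_nhds hx)
    refine ⟨K, mem_nhdsWithin_of_mem_nhds hK, ?_⟩
    have := h1.integrableOn_isCompact hKD
    rwa [IntegrableOn, Measure.restrict_restrict hKD.measurableSet, inter_eq_left.2 hKx] at this
  have key := hD.ae_eq_zero_of_integral_contDiff_smul_eq_zero (μ := volume)
    (f := fun x => v x - v' x) ((hi h.1).sub (hi h'.1)) ?_
  · refine (ae_restrict_iff' hD.measurableSet).2 ?_
    filter_upwards [key] with x hx hxD
    linarith [hx hxD]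
  · intro η hη hc hs
    have m2 : MemLp η 2 (volume.restrict D) := hη.continuous.memLp_of_hasCompactSupport hc
    have e := h.2 η hη hc hs
    have e' := h'.2 η hη hc hs
    have e0 : ∫ x in D, u x * partialDeriv j η x = ∫ x in D, u' x * partialDeriv j η x :=
      integral_congr_ae (hu.mono fun x hx => by simp only [hx])
    have i1 : Integrable (fun x => v x * η x) (volume.restrict D) := h.1.integrable_mul m2
    have i2 : Integrable (fun x => v' x * η x) (volume.restrict D) := h'.1.integrable_mul m2
    rw [← setIntegral_eq_integral_of_tsupport hs fun x hx => by simp [hx.self_of_nhds]]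
    have : ∀ x, η x • (v x - v' x) = v x * η x - v' x * η x := fun x => by
      rw [smul_eq_mul]; ring
    simp_rw [this]
    rw [integral_sub i1 i2]
    linarith

lemma MemH1.isWeakPartial {D : Set Plane} {u : Plane → ℝ} (hu : MemH1 D u) (j : Fin 2) :
    IsWeakPartial D j u (weakPartial D u j) := by
  rw [weakPartial, dif_pos (hu.2 j)]
  exact (hu.2 j).choose_spec

lemma IsWeakPartial.congr {D : Set Plane} {j : Fin 2} {u u' v : Plane → ℝ}
    (h : IsWeakPartial D j u v) (hu : u' =ᵐ[volume.restrict D] u) : IsWeakPartial D j u' v :=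
  ⟨h.1, fun η hη hc hs => (integral_congr_ae (hu.mono fun x hx => by simp only [hx])).trans
    (h.2 η hη hc hs)⟩

lemma memH1_of_isWeakPartial {D : Set Plane} {u : Plane → ℝ} {v : Fin 2 → Plane → ℝ}
    (hu : MemLp u 2 (volume.restrict D)) (h : ∀ j, IsWeakPartial D j u (v j)) : MemH1 D u :=
  ⟨hu, fun j => ⟨v j, h j⟩⟩

lemma weakPartial_ae_eq {D : Set Plane} (hD : IsOpen D) {u : Plane → ℝ} {v : Plane → ℝ} {j : Fin 2}
    (h : IsWeakPartial D j u v) : weakPartial D u j =ᵐ[volume.restrict D] v := by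
  have h' : ∃ v, IsWeakPartial D j u v := ⟨v, h⟩
  have : IsWeakPartial D j u (weakPartial D u j) := by
    rw [weakPartial, dif_pos h']; exact h'.choose_spec
  exact this.ae_eq hD h EventuallyEq.rfl

lemma norm_sub_sq_eq {D : Set Plane} {u : Plane → ℝ} {v : Fin 2 → Plane → ℝ} {z t : H1Triple D}
    {φ : Plane → ℝ} (hz0 : z 0 =ᵐ[volume.restrict D] u)
    (hz : ∀ j : Fin 2, z j.succ =ᵐ[volume.restrict D] v j) (ht : IsTripleOf D φ t) :
    ‖z - t‖ ^ 2 = ∫ x in D, ((u x - φ x) ^ 2 + ∑ j, (v j x - partialDeriv j φ x) ^ 2) := by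
  have hi : ∀ i, Integrable (fun x => ((z - t) i) x ^ 2) (volume.restrict D) := fun i =>
    (Lp.memLp _).integrable_sq
  have hi12 : Integrable (fun x => ((z - t) 1) x ^ 2 + ((z - t) 2) x ^ 2) (volume.restrict D) :=
    (hi 1).add (hi 2)
  rw [H1Triple_norm_sq, Lp_norm_sq_eq, Lp_norm_sq_eq, Lp_norm_sq_eq, ← integral_add (hi 1) (hi 2),
    ← integral_add (hi 0) hi12]
  refine integral_congr_ae ?_
  filter_upwards [hz0, hz 0, hz 1, ht.val, ht.grad 0, ht.grad 1, Lp.coeFn_sub (z 0) (t 0),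
    Lp.coeFn_sub (z 1) (t 1), Lp.coeFn_sub (z 2) (t 2)] with x a0 a1 a2 b0 b1 b2 c0 c1 c2
  simp only [PiLp.sub_apply, Fin.sum_univ_two]
  rw [c0, c1, c2]
  simp only [Pi.sub_apply]
  simp only [Fin.succ_zero_eq_one, Fin.succ_one_eq_two] at a1 a2 b1 b2
  rw [a0, a1, a2, b0, b1, b2]

/-- An element of the closure in the sense of the weak formulation is represented in the Hilbert space;
its weak gradient is the limit of the gradients of the approximations. -/
lemma MemH1Zero.exists_mem_H1Zero {D S : Set Plane} {u : Plane → ℝ} (hu : MemH1Zero D S u) :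
    ∃ z ∈ H1Zero D S, z 0 =ᵐ[volume.restrict D] u ∧
      ∀ j : Fin 2, z j.succ =ᵐ[volume.restrict D] weakPartial D u j := by
  have h1 := fun j => (hu.1.isWeakPartial j).1
  let z : H1Triple D := WithLp.toLp 2 (Fin.cons hu.1.1.toLp fun j => (h1 j).toLp)
  have hz0 : z 0 =ᵐ[volume.restrict D] u := hu.1.1.coeFn_toLp
  have hz : ∀ j : Fin 2, z j.succ =ᵐ[volume.restrict D] weakPartial D u j := fun j =>
    (h1 j).coeFn_toLp
  refine ⟨z, ?_, hz0, hz⟩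
  refine Metric.mem_closure_iff.2 fun δ hδ => ?_
  obtain ⟨φ, hφ, hlt⟩ := hu.2 (δ ^ 2) (by positivity)
  obtain ⟨t, ht⟩ := exists_isTripleOf D hφ
  refine ⟨t, ⟨φ, hφ, ht⟩, ?_⟩
  rw [dist_eq_norm]
  rw [← norm_sub_sq_eq hz0 hz ht] at hlt
  exact lt_of_pow_lt_pow_left₀ 2 hδ.le hlt

/-- Conversely, elements of the Hilbert space are limits of test functions in the sense of the weak
formulation. -/
lemma memH1Zero_of_mem_H1Zero {D S : Set Plane} (hD : IsOpen D) {z : H1Triple D}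
    (hz : z ∈ H1Zero D S) {u : Plane → ℝ} (hu : u =ᵐ[volume.restrict D] z 0) :
    MemH1Zero D S u ∧ ∀ j : Fin 2, weakPartial D u j =ᵐ[volume.restrict D] z j.succ := by
  have hw : ∀ j, IsWeakPartial D j u (z j.succ) := fun j =>
    (isWeakPartial_of_mem_H1Zero hz j).congr hu
  have h2 := fun j => weakPartial_ae_eq hD (hw j)
  refine ⟨⟨memH1_of_isWeakPartial ((memLp_congr_ae hu).2 (Lp.memLp _)) hw, fun δ hδ => ?_⟩, h2⟩
  obtain ⟨t, ⟨φ, hφ, ht⟩, hd⟩ := Metric.mem_closure_iff.1 hz (Real.sqrt δ) (Real.sqrt_pos.2 hδ)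
  refine ⟨φ, hφ, ?_⟩
  rw [← norm_sub_sq_eq hu.symm (fun j => (h2 j).symm) ht, ← dist_eq_norm]
  calc dist z t ^ 2 < Real.sqrt δ ^ 2 := pow_lt_pow_left₀ hd dist_nonneg two_ne_zero
    _ = δ := Real.sq_sqrt hδ.le

/-! ### Integration by parts in the upper square -/

lemma memLp_rect_of_continuous {a b c d : ℝ} {p : ENNReal} {g : Plane → ℝ} (hg : Continuous g) :
    MemLp g p (volume.restrict (rect a b c d)) := by
  obtain ⟨M, hM⟩ := (isCompact_closedBox a b c d).exists_bound_of_continuousOn hg.continuousOn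
  have hfin : volume (rect a b c d) < ⊤ :=
    (measure_mono (rect_subset_closedBox a b c d)).trans_lt (isCompact_closedBox a b c d).measure_lt_top
  have : IsFiniteMeasure (volume.restrict (rect a b c d)) := ⟨by simpa using hfin⟩
  refine MemLp.of_bound hg.aestronglyMeasurable M ?_
  filter_upwards [ae_restrict_mem (measurableSet_rect a b c d)] with x hx
  exact hM x (rect_subset_closedBox a b c d hx)

lemma IsChannel.memLp_of_continuous {D : Set Plane} {ε : ℝ} (hD : IsChannel D ε) {p : ENNReal}
    {g : Plane → ℝ} (hg : Continuous g) : MemLp g p (volume.restrict D) :=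
  (memLp_rect_of_continuous hg).mono_measure (Measure.restrict_mono hD.subset_box le_rfl)

lemma IsChannel.isFiniteMeasure {D : Set Plane} {ε : ℝ} (hD : IsChannel D ε) :
    IsFiniteMeasure (volume.restrict D) := by
  refine ⟨?_⟩
  rw [Measure.restrict_apply_univ]
  exact (measure_mono (hD.subset_box.trans (rect_subset_closedBox _ _ _ _))).trans_lt
    (isCompact_closedBox _ _ _ _).measure_lt_top

/-- The part of `D` below the axis. -/
def lowPart (D : Set Plane) : Set Plane := D ∩ {x | x 1 < 0}

lemma measurableSet_lowPart {D : Set Plane} (hD : IsOpen D) : MeasurableSet (lowPart D) :=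
  hD.measurableSet.inter (measurableSet_lt (by fun_prop) measurable_const)

lemma continuous_setIntegral_mul {D A : Set Plane} {ε : ℝ} (hD : IsChannel D ε)
    (hA : MeasurableSet A) (hAD : A ⊆ D) {k : Plane → ℝ} (hk : Continuous k) :
    Continuous fun u : Lp ℝ 2 (volume.restrict D) => ∫ x in A, k x * u x := by
  have h1 : MemLp (A.indicator k) 2 (volume.restrict D) := (hD.memLp_of_continuous hk).indicator hA
  convert continuous_integral_mul h1 using 1
  ext u
  have : ∀ x, A.indicator k x * u x = A.indicator (fun x => k x * u x) x := fun x => by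
    by_cases hx : x ∈ A <;> simp [hx]
  simp_rw [this]
  rw [setIntegral_indicator hA, inter_eq_right.2 hAD]

lemma ae_restrict_of_subset {D A : Set Plane} {f g : Plane → ℝ} (hAD : A ⊆ D)
    (h : f =ᵐ[volume.restrict D] g) : f =ᵐ[volume.restrict A] g :=
  ae_restrict_of_ae_restrict_of_subset hAD h

lemma IsBoxTest.setIntegral_low {D S : Set Plane} {ε : ℝ} (hD : IsChannel D ε) {ψ : Plane → ℝ}
    (hψ : IsBoxTest D S ψ) {F : Plane → ℝ} (hF : ∀ x, ψ =ᶠ[𝓝 x] 0 → F x = 0) :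
    ∫ x in lowPart D, F x = ∫ x in rect 0 1 (-1) 0, F x := by
  refine (setIntegral_eq_of_subset_of_forall_sdiff_eq_zero (measurableSet_rect _ _ _ _) ?_ ?_).symm
  · exact fun x hx => ⟨(hD.subset_box hx.1).1, (hD.subset_box hx.1).2.1, hx.2⟩
  · intro x hx
    refine hF x (hψ.eventually_zero_of_mem_rect hD ⟨hx.1.1, hx.1.2.1, ?_⟩ fun h => hx.2 ⟨h, hx.1.2.2⟩)
    linarith [hx.1.2.2]

/-- Vertical integration by parts over the upper square. The boundary term on the axis is rewritten
as an integral over the part of the channel below it, at the bottom of which the function vanishes. -/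
lemma H1Zero_vertical {D S : Set Plane} {ε : ℝ} (hD : IsChannel D ε) (hS : walls D ⊆ S)
    {z : H1Triple D} (hz : z ∈ H1Zero D S) {g g' τ : ℝ → ℝ} (hg : ∀ t, HasDerivAt g (g' t) t)
    (hg' : Continuous g') (hτ : Continuous τ) :
    (∫ x in rect 0 1 0 1, g (x 1) * τ (x 0) * z 2 x) + ∫ x in rect 0 1 0 1, g' (x 1) * τ (x 0) * z 0 x
      = -(g 0) * ∫ x in lowPart D, τ (x 0) * z 2 x := by
  have hgc : Continuous g := continuous_iff_continuousAt.2 fun u => (hg u).continuousAt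
  have hml := measurableSet_lowPart hD.isOpen
  have hmu := measurableSet_rect 0 1 0 1
  have k1 : Continuous fun x : Plane => g (x 1) * τ (x 0) := by fun_prop
  have k2 : Continuous fun x : Plane => g' (x 1) * τ (x 0) := by fun_prop
  have k3 : Continuous fun x : Plane => τ (x 0) := by fun_prop
  refine H1Zero_induction hD hS (p := {z | (∫ x in rect 0 1 0 1, g (x 1) * τ (x 0) * z 2 x) +
    ∫ x in rect 0 1 0 1, g' (x 1) * τ (x 0) * z 0 x
      = -(g 0) * ∫ x in lowPart D, τ (x 0) * z 2 x}) ?_ ?_ z hz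
  · exact isClosed_eq
      (((continuous_setIntegral_mul hD hmu hD.unit_subset k1).comp (continuous_triple_apply 2)).add
        ((continuous_setIntegral_mul hD hmu hD.unit_subset k2).comp (continuous_triple_apply 0)))
      (continuous_const.mul ((continuous_setIntegral_mul hD hml inter_subset_left k3).comp
        (continuous_triple_apply 2)))
  · intro ψ hψ z hz
    have c0 := hψ.continuous
    have c1 := hψ.continuous_partialDeriv 1
    have e1 : ∫ x in rect 0 1 0 1, g (x 1) * τ (x 0) * z 2 x =
        ∫ x in rect 0 1 0 1, g (x 1) * τ (x 0) * partialDeriv 1 ψ x :=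
      integral_congr_ae ((ae_restrict_of_subset hD.unit_subset (hz.grad 1)).mono fun x hx => by
        simp only [← hx]; rfl)
    have e2 : ∫ x in rect 0 1 0 1, g' (x 1) * τ (x 0) * z 0 x =
        ∫ x in rect 0 1 0 1, g' (x 1) * τ (x 0) * ψ x :=
      integral_congr_ae ((ae_restrict_of_subset hD.unit_subset hz.val).mono fun x hx => by
        simp only [hx])
    have e3 : ∫ x in lowPart D, τ (x 0) * z 2 x = ∫ x in lowPart D, τ (x 0) * partialDeriv 1 ψ x :=
      integral_congr_ae ((ae_restrict_of_subset inter_subset_left (hz.grad 1)).mono fun x hx => by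
        simp only [← hx]; rfl)
    change _ + _ = _
    rw [e1, e2, e3, hψ.setIntegral_low hD fun x hx => by simp [partialDeriv_eq_zero hx],
      ← integral_add (integrableOn_rect_of_continuous (by fun_prop))
        (integrableOn_rect_of_continuous (by fun_prop)),
      setIntegral_rect zero_le_one zero_le_one (integrableOn_rect_of_continuous (by fun_prop)),
      setIntegral_rect zero_le_one (by norm_num) (integrableOn_rect_of_continuous (by fun_prop)),
      ← intervalIntegral.integral_const_mul]
    refine intervalIntegral.integral_congr fun s hs => ?_
    rw [uIcc_of_le zero_le_one] at hs
    have hv := fun t => hasDerivAt_vertical hψ.differentiable s t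
    have cv0 := continuous_vertical c0 s
    have cv1 := continuous_vertical c1 s
    have f1 : ∫ t in (0 : ℝ)..1, (g t * τ s * partialDeriv 1 ψ !₂[s, t] + g' t * τ s * ψ !₂[s, t])
        = g 1 * τ s * ψ !₂[s, 1] - g 0 * τ s * ψ !₂[s, 0] := by
      refine intervalIntegral.integral_eq_sub_of_hasDerivAt
        (f := fun t => g t * τ s * ψ !₂[s, t]) (fun t _ => ?_)
        (Continuous.intervalIntegrable (by fun_prop) _ _)
      have := ((hg t).mul_const (τ s)).fun_mul (hv t)
      convert! this using 1
      ring
    have f2 : ∫ t in (-1 : ℝ)..0, τ s * partialDeriv 1 ψ !₂[s, t] = τ s * ψ !₂[s, 0] := by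
      rw [intervalIntegral.integral_const_mul, intervalIntegral.integral_eq_sub_of_hasDerivAt
        (fun t _ => hv t) (cv1.intervalIntegrable _ _),
        hψ.apply_bottom hD hs (t := -1) (by linarith [hD.lt_one]), sub_zero]
    simp only [Matrix.cons_val_zero, Matrix.cons_val_one] at f1 f2 ⊢
    rw [f1, f2, hψ.apply_top hD hs]
    ring

/-- Horizontal integration by parts over the upper square, without boundary terms. -/
lemma H1Zero_horizontal {D S : Set Plane} {ε : ℝ} (hD : IsChannel D ε) (hS : walls D ⊆ S)
    {z : H1Triple D} (hz : z ∈ H1Zero D S) {g τ τ' : ℝ → ℝ} (hτ : ∀ t, HasDerivAt τ (τ' t) t)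
    (hτ' : Continuous τ') (hg : Continuous g)
    (h : inflow ∪ outflow ⊆ S ∨ (τ 0 = 0 ∧ τ 1 = 0)) :
    (∫ x in rect 0 1 0 1, g (x 1) * τ (x 0) * z 1 x) +
      ∫ x in rect 0 1 0 1, g (x 1) * τ' (x 0) * z 0 x = 0 := by
  have hτc : Continuous τ := continuous_iff_continuousAt.2 fun u => (hτ u).continuousAt
  have hmu := measurableSet_rect 0 1 0 1
  have k1 : Continuous fun x : Plane => g (x 1) * τ (x 0) := by fun_prop
  have k2 : Continuous fun x : Plane => g (x 1) * τ' (x 0) := by fun_prop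
  refine H1Zero_induction hD hS (p := {z | (∫ x in rect 0 1 0 1, g (x 1) * τ (x 0) * z 1 x) +
      ∫ x in rect 0 1 0 1, g (x 1) * τ' (x 0) * z 0 x = 0}) ?_ ?_ z hz
  · exact isClosed_eq
      (((continuous_setIntegral_mul hD hmu hD.unit_subset k1).comp (continuous_triple_apply 1)).add
        ((continuous_setIntegral_mul hD hmu hD.unit_subset k2).comp (continuous_triple_apply 0)))
      continuous_const
  · intro ψ hψ z hz
    have c0 := hψ.continuous
    have c1 := hψ.continuous_partialDeriv 0
    have e1 : ∫ x in rect 0 1 0 1, g (x 1) * τ (x 0) * z 1 x =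
        ∫ x in rect 0 1 0 1, g (x 1) * τ (x 0) * partialDeriv 0 ψ x :=
      integral_congr_ae ((ae_restrict_of_subset hD.unit_subset (hz.grad 0)).mono fun x hx => by
        simp only [← hx]; rfl)
    have e2 : ∫ x in rect 0 1 0 1, g (x 1) * τ' (x 0) * z 0 x =
        ∫ x in rect 0 1 0 1, g (x 1) * τ' (x 0) * ψ x :=
      integral_congr_ae ((ae_restrict_of_subset hD.unit_subset hz.val).mono fun x hx => by
        simp only [hx])
    change _ + _ = _
    rw [e1, e2, ← integral_add (integrableOn_rect_of_continuous (by fun_prop))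
        (integrableOn_rect_of_continuous (by fun_prop)),
      setIntegral_rect_swap zero_le_one zero_le_one
        (integrableOn_rect_of_continuous (by fun_prop))]
    rw [intervalIntegral.integral_of_le zero_le_one, integral_Ioc_eq_integral_Ioo]
    refine setIntegral_eq_zero_of_forall_eq_zero fun t ht => ?_
    have hv := fun s => hasDerivAt_horizontal hψ.differentiable s t
    have cv0 := continuous_horizontal c0 t
    have cv1 := continuous_horizontal c1 t
    have f1 : ∫ s in (0 : ℝ)..1, (g t * τ s * partialDeriv 0 ψ !₂[s, t] + g t * τ' s * ψ !₂[s, t])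
        = g t * τ 1 * ψ !₂[1, t] - g t * τ 0 * ψ !₂[0, t] := by
      refine intervalIntegral.integral_eq_sub_of_hasDerivAt
        (f := fun s => g t * τ s * ψ !₂[s, t]) (fun s _ => ?_)
        (Continuous.intervalIntegrable (by fun_prop) _ _)
      have := ((hτ s).const_mul (g t)).fun_mul (hv s)
      convert! this using 1
      ring
    simp only [Matrix.cons_val_zero, Matrix.cons_val_one] at f1 ⊢
    rw [f1]
    rcases h with h | ⟨h0, h1⟩
    · have z0 : ψ !₂[0, t] = 0 := (hψ.isTestOff.eventuallyEq_zero (x := !₂[0, t])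
        (subset_closure (h (Or.inl ⟨by simp, by simpa using ht⟩)))).self_of_nhds
      have z1 : ψ !₂[1, t] = 0 := (hψ.isTestOff.eventuallyEq_zero (x := !₂[1, t])
        (subset_closure (h (Or.inr ⟨by simp, by simpa using ht⟩)))).self_of_nhds
      rw [z0, z1]; ring
    · rw [h0, h1]; ring

/-- The boundary terms on the two sides, expressed through the pressure that interpolates linearly
between the boundary values. -/
lemma sides_eq_setIntegral {D : Set Plane} {ε : ℝ} (hD : IsChannel D ε) {φ : Plane → ℝ}
    (hφ : IsTestOff (walls D) φ) (p₀ p₁ : ℝ) :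
    p₁ * (∫ s in (0 : ℝ)..1, φ !₂[1, s]) - p₀ * (∫ s in (0 : ℝ)..1, φ !₂[0, s])
      = (∫ x in D, (p₀ + (p₁ - p₀) * x 0) * partialDeriv 0 φ x) + (p₁ - p₀) * ∫ x in D, φ x := by
  obtain ⟨ψ, hψ, he, hside⟩ := hφ.exists_isBoxTest hD Subset.rfl
  have c0 := hψ.continuous
  have c1 := hψ.continuous_partialDeriv 0
  have e1 : ∫ x in D, (p₀ + (p₁ - p₀) * x 0) * partialDeriv 0 φ x =
      ∫ x in D, (p₀ + (p₁ - p₀) * x 0) * partialDeriv 0 ψ x :=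
    setIntegral_congr_fun hD.isOpen.measurableSet fun x hx => by
      simp only [partialDeriv_congr (he x hx) 0]
  have e2 : ∫ x in D, φ x = ∫ x in D, ψ x :=
    setIntegral_congr_fun hD.isOpen.measurableSet fun x hx => (he x hx).self_of_nhds.symm
  have e3 : ∀ a : ℝ, a = 0 ∨ a = 1 →
      ∫ s in (0 : ℝ)..1, φ !₂[a, s] = ∫ s in (-1 : ℝ)..1, ψ !₂[a, s] := by
    intro a ha
    have ha' : a ∈ Icc (0 : ℝ) 1 := by rcases ha with rfl | rfl <;> simp
    have cv := continuous_vertical c0 a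
    rw [← intervalIntegral.integral_add_adjacent_intervals (cv.intervalIntegrable (-1) 0)
      (cv.intervalIntegrable 0 1)]
    have z1 : ∫ s in (-1 : ℝ)..0, ψ !₂[a, s] = 0 := by
      rw [intervalIntegral.integral_of_le (by norm_num)]
      exact setIntegral_eq_zero_of_forall_eq_zero fun t ht => hψ.apply_side hD ha ht.2
    rw [z1, zero_add, intervalIntegral.integral_of_le zero_le_one,
      intervalIntegral.integral_of_le zero_le_one]
    exact setIntegral_congr_fun measurableSet_Ioc fun t ht =>
      (hside !₂[a, t] (by simpa using ha') (by simpa using ht.1)).symm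
  rw [e1, e2, e3 1 (by simp), e3 0 (by simp), ← integral_const_mul,
    hψ.setIntegral_eq hD fun x hx => by simp [partialDeriv_eq_zero hx],
    hψ.setIntegral_eq hD fun x hx => by simp [hx.self_of_nhds],
    ← integral_add (integrableOn_rect_of_continuous (by fun_prop))
        (integrableOn_rect_of_continuous (by fun_prop)),
    setIntegral_rect_swap zero_le_one (by norm_num) (integrableOn_rect_of_continuous (by fun_prop)),
    ← intervalIntegral.integral_const_mul, ← intervalIntegral.integral_const_mul,
    ← intervalIntegral.integral_sub]
  · refine intervalIntegral.integral_congr fun t _ => ?_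
    have hv := fun s => hasDerivAt_horizontal hψ.differentiable s t
    have cv0 := continuous_horizontal c0 t
    have cv1 := continuous_horizontal c1 t
    have f1 : ∫ s in (0 : ℝ)..1, ((p₀ + (p₁ - p₀) * s) * partialDeriv 0 ψ !₂[s, t] +
        (p₁ - p₀) * ψ !₂[s, t]) = (p₀ + (p₁ - p₀) * 1) * ψ !₂[1, t] -
          (p₀ + (p₁ - p₀) * 0) * ψ !₂[0, t] := by
      refine intervalIntegral.integral_eq_sub_of_hasDerivAt
        (f := fun s => (p₀ + (p₁ - p₀) * s) * ψ !₂[s, t]) (fun s _ => ?_)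
        (Continuous.intervalIntegrable (by fun_prop) _ _)
      have h1 : HasDerivAt (fun s : ℝ => p₀ + (p₁ - p₀) * s) (p₁ - p₀) s := by
        simpa using ((hasDerivAt_id s).const_mul (p₁ - p₀)).const_add p₀
      have := h1.fun_mul (hv s)
      convert! this using 1
      ring
    simp only [Matrix.cons_val_zero] at f1 ⊢
    rw [f1]
    ring
  · exact (continuous_const.mul (continuous_vertical c0 1)).intervalIntegrable _ _
  · exact (continuous_const.mul (continuous_vertical c0 0)).intervalIntegrable _ _

/-- A vertical derivative is orthogonal to functions of `x₁`. -/
lemma setIntegral_mul_partialDeriv_one {D S : Set Plane} {ε : ℝ} (hD : IsChannel D ε)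
    (hS : walls D ⊆ S) {φ : Plane → ℝ} (hφ : IsTestOff S φ) {τ : ℝ → ℝ} (hτ : Continuous τ) :
    ∫ x in D, τ (x 0) * partialDeriv 1 φ x = 0 := by
  obtain ⟨ψ, hψ, he, -⟩ := hφ.exists_isBoxTest hD hS
  have c1 := hψ.continuous_partialDeriv 1
  have e1 : ∫ x in D, τ (x 0) * partialDeriv 1 φ x = ∫ x in D, τ (x 0) * partialDeriv 1 ψ x :=
    setIntegral_congr_fun hD.isOpen.measurableSet fun x hx => by
      simp only [partialDeriv_congr (he x hx) 1]
  rw [e1, hψ.setIntegral_eq hD fun x hx => by simp [partialDeriv_eq_zero hx],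
    setIntegral_rect zero_le_one (by norm_num) (integrableOn_rect_of_continuous (by fun_prop)),
    intervalIntegral.integral_of_le zero_le_one]
  refine setIntegral_eq_zero_of_forall_eq_zero fun s hs => ?_
  have cv1 := continuous_vertical c1 s
  simp only [Matrix.cons_val_zero]
  rw [intervalIntegral.integral_const_mul, intervalIntegral.integral_eq_sub_of_hasDerivAt
    (fun t _ => hasDerivAt_vertical hψ.differentiable s t) (cv1.intervalIntegrable _ _),
    hψ.apply_top hD ⟨hs.1.le, hs.2⟩, hψ.apply_bottom hD ⟨hs.1.le, hs.2⟩ (by linarith [hD.lt_one])]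
  simp

/-! ### Products of functions of one variable -/

lemma intervalIntegral_le_of_layers {F : ℝ → ℝ} (hF : Continuous F) {η A B : ℝ} (hη : 0 < η)
    (hη2 : η < 1 / 4) (hFA : ∀ t ∈ Icc (0 : ℝ) 1, F t ≤ A + B)
    (hFB : ∀ t ∈ Icc η (1 - η), F t ≤ B) :
    ∫ t in (0 : ℝ)..1, F t ≤ B + 2 * η * A := by
  have hi : ∀ a b, IntervalIntegrable F volume a b := fun a b => hF.intervalIntegrable a b
  have h1 : ∫ t in (0 : ℝ)..η, F t ≤ η * (A + B) := by
    have := intervalIntegral.integral_mono_on hη.le (hi 0 η)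
      (intervalIntegrable_const (c := A + B)) fun t ht => hFA t ⟨ht.1, by linarith [ht.2]⟩
    simpa [mul_add] using this
  have h2 : ∫ t in η..(1 - η), F t ≤ (1 - η - η) * B := by
    have := intervalIntegral.integral_mono_on (by linarith) (hi η (1 - η))
      (intervalIntegrable_const (c := B)) fun t ht => hFB t ht
    simpa using this
  have h3 : ∫ t in (1 - η)..1, F t ≤ η * (A + B) := by
    have := intervalIntegral.integral_mono_on (by linarith) (hi (1 - η) 1)
      (intervalIntegrable_const (c := A + B)) fun t ht => hFA t ⟨by linarith [ht.1], ht.2⟩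
    simpa [mul_add] using this
  rw [← intervalIntegral.integral_add_adjacent_intervals (hi 0 η) (hi η 1),
    ← intervalIntegral.integral_add_adjacent_intervals (hi η (1 - η)) (hi (1 - η) 1)]
  linarith

/-- Functions in `C¹[0,1]` that vanish at the end points are limits in `H¹(0,1)` of smooth functions
with compact support in the open interval: cut off and mollify the derivative, restore its mean
value with a fixed bump function, and integrate. -/
lemma exists_contDiff_compactly_supported {α α' : ℝ → ℝ} (hα : ∀ t, HasDerivAt α (α' t) t)
    (hα' : Continuous α') (h0 : α 0 = 0) (h1 : α 1 = 0) {δ : ℝ} (hδ : 0 < δ) :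
    ∃ a : ℝ → ℝ, ContDiff ℝ ∞ a ∧ HasCompactSupport a ∧ tsupport a ⊆ Ioo 0 1 ∧
      (∀ t ∈ Icc (0 : ℝ) 1, |α t - a t| ≤ δ) ∧
      ∫ t in (0 : ℝ)..1, (α' t - deriv a t) ^ 2 ≤ δ ^ 2 := by
  obtain ⟨M, hM⟩ := isCompact_Icc.exists_bound_of_continuousOn (hα'.continuousOn (s := Icc (0 : ℝ) 1))
  have hM0 : 0 ≤ M := (norm_nonneg _).trans (hM 0 (by simp))
  let e : ContDiffBump (1 / 2 : ℝ) := ⟨1 / 4, 1 / 3, by norm_num, by norm_num⟩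
  obtain ⟨E, hE⟩ := isCompact_Icc.exists_bound_of_continuousOn
    ((e.continuous_normed (μ := volume)).continuousOn (s := Icc (0 : ℝ) 1))
  have hE0 : 0 ≤ E := (norm_nonneg _).trans (hE 0 (by simp))
  -- the thickness of the layers in which the derivative is cut off
  obtain ⟨η, hη, hη4, hη1⟩ : ∃ η : ℝ, 0 < η ∧ η < 1 / 8 ∧
      2 * (η + 4 * η * (M + 1) ^ 2) + 2 * (η + 2 * η * M) ^ 2 * E ^ 2 +
        ((η + 2 * η * M) * (1 + E)) ^ 2 ≤ δ ^ 2 := by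
    have hc : ContinuousAt (fun η : ℝ => 2 * (η + 4 * η * (M + 1) ^ 2) +
        2 * (η + 2 * η * M) ^ 2 * E ^ 2 + ((η + 2 * η * M) * (1 + E)) ^ 2) 0 := by fun_prop
    have h2 := hc.eventually_lt_const (u := δ ^ 2) (by simpa using by positivity)
    obtain ⟨r, hr, h3⟩ := Metric.eventually_nhds_iff.1 h2
    refine ⟨min (r / 2) (1 / 16), by positivity, by
      linarith [min_le_right (r / 2) (1 / 16)], (h3 ?_).le⟩
    rw [Real.dist_eq, sub_zero, abs_of_pos (by positivity)]
    linarith [min_le_left (r / 2) (1 / 16)]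
  let χ : ContDiffBump (1 / 2 : ℝ) := ⟨1 / 2 - η, 1 / 2 - η / 2, by linarith, by linarith⟩
  have hχ1 : ∀ t ∈ Icc η (1 - η), χ t = 1 := fun t ht => χ.one_of_mem_closedBall (by
    rw [Metric.mem_closedBall, Real.dist_eq, abs_le]
    constructor <;> simp only [χ] <;> linarith [ht.1, ht.2])
  have hχ0 : ∀ t, t ∉ Icc (η / 2) (1 - η / 2) → χ t = 0 := fun t ht => χ.zero_of_le_dist (by
    rw [Real.dist_eq]
    by_contra h
    rw [not_le, abs_lt] at h
    apply ht
    constructor <;> simp only [χ] at h <;> linarith [h.1, h.2])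
  -- `g` is a smooth approximation of the derivative of `α`, cut off near the ends
  obtain ⟨g, hg, hgd, hgs⟩ := (hα'.mul χ.continuous).exists_contDiff_approx ⊤
    (ε := fun _ => η) continuous_const fun _ => hη
  have hgd' : ∀ t, |g t - α' t * χ t| ≤ η := fun t => (hgd t).le
  have hgc : Continuous g := hg.continuous
  have hdiff : ∀ t ∈ Icc (0 : ℝ) 1, |g t - α' t| ≤ M + η := by
    intro t ht
    have hm := hM t ht
    rw [Real.norm_eq_abs] at hm
    have h3 : |α' t * χ t - α' t| ≤ M := by
      have : α' t * χ t - α' t = -(α' t * (1 - χ t)) := by ring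
      rw [this, abs_neg, abs_mul, abs_of_nonneg (sub_nonneg.2 χ.le_one)]
      nlinarith [χ.nonneg (x := t), abs_nonneg (α' t)]
    calc |g t - α' t| = |(g t - α' t * χ t) + (α' t * χ t - α' t)| := by ring_nf
      _ ≤ _ := (abs_add_le _ _).trans (by linarith [hgd' t])
  have hdiff' : ∀ t ∈ Icc η (1 - η), |g t - α' t| ≤ η := by
    intro t ht
    have := hgd' t
    rwa [hχ1 t ht, mul_one] at this
  have hL1 : ∫ t in (0 : ℝ)..1, |g t - α' t| ≤ η + 2 * η * M :=
    intervalIntegral_le_of_layers (by fun_prop) hη (by linarith) hdiff hdiff'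
  have hL2 : ∫ t in (0 : ℝ)..1, (g t - α' t) ^ 2 ≤ η ^ 2 + 2 * η * (M + η) ^ 2 := by
    refine intervalIntegral_le_of_layers (by fun_prop) hη (by linarith)
      (fun t ht => ?_) (fun t ht => ?_)
    · have := hdiff t ht
      have h4 : (g t - α' t) ^ 2 ≤ (M + η) ^ 2 := by
        rw [← sq_abs]; exact pow_le_pow_left₀ (abs_nonneg _) this 2
      linarith [sq_nonneg η]
    · have := hdiff' t ht
      rw [← sq_abs]; exact pow_le_pow_left₀ (abs_nonneg _) this 2
  have hα'0 : ∫ t in (0 : ℝ)..1, α' t = 0 := by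
    rw [intervalIntegral.integral_eq_sub_of_hasDerivAt (fun t _ => hα t)
      (hα'.intervalIntegrable _ _), h0, h1, sub_zero]
  set I := ∫ t in (0 : ℝ)..1, g t with hI
  have hIle : |I| ≤ η + 2 * η * M := by
    have : I = ∫ t in (0 : ℝ)..1, (g t - α' t) := by
      rw [intervalIntegral.integral_sub (hgc.intervalIntegrable _ _) (hα'.intervalIntegrable _ _),
        hα'0, sub_zero]
    rw [this]
    exact (intervalIntegral.abs_integral_le_integral_abs zero_le_one).trans hL1
  -- subtracting the multiple `I` of a bump restores mean zero, so that the primitive has compact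
  -- support
  let en : ℝ → ℝ := e.normed volume
  have hen : ContDiff ℝ ∞ en := e.contDiff_normed
  have hens : ∀ t, t ∉ Icc (1 / 8 : ℝ) (7 / 8) → en t = 0 := by
    intro t ht
    have : t ∉ Function.support en := by
      rw [e.support_normed_eq, Metric.mem_ball, Real.dist_eq, abs_lt]
      intro h
      apply ht
      constructor <;> simp only [e] at h <;> linarith [h.1, h.2]
    simpa using this
  have hen1 : ∫ t in (0 : ℝ)..1, en t = 1 := by
    rw [intervalIntegral.integral_of_le zero_le_one,
      setIntegral_eq_integral_of_forall_compl_eq_zero, e.integral_normed]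
    intro t ht
    apply hens
    intro h
    exact ht ⟨by linarith [h.1], by linarith [h.2]⟩
  let h : ℝ → ℝ := fun t => g t - I * en t
  have hh : ContDiff ℝ ∞ h := hg.sub (contDiff_const.mul hen)
  have hhc : Continuous h := hh.continuous
  have hencc : Continuous en := hen.continuous
  have hh0 : ∀ t, t ∉ Icc (η / 2) (1 - η / 2) → h t = 0 := by
    intro t ht
    have h2 : g t = 0 := by
      by_contra hne
      have := hgs hne
      simp only [Pi.mul_apply, Function.mem_support, hχ0 t ht, mul_zero, ne_eq, not_true] at this
    have h3 : en t = 0 := hens t fun h => ht ⟨by linarith [h.1], by linarith [h.2]⟩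
    simp only [h, h2, h3, mul_zero, sub_zero]
  have hhI : ∫ t in (0 : ℝ)..1, h t = 0 := by
    simp only [h]
    rw [intervalIntegral.integral_sub (hgc.intervalIntegrable _ _)
      ((by fun_prop : Continuous fun t => I * en t).intervalIntegrable _ _), intervalIntegral.integral_const_mul, hen1,
      ← hI]
    ring
  let a : ℝ → ℝ := fun t => ∫ u in (0 : ℝ)..t, h u
  have had : ∀ t, HasDerivAt a (h t) t := fun t =>
    intervalIntegral.integral_hasDerivAt_right (hhc.intervalIntegrable _ _)
      hhc.aestronglyMeasurable.stronglyMeasurableAtFilter hhc.continuousAt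
  have hderiv : deriv a = h := funext fun t => (had t).deriv
  have hac : ContDiff ℝ ∞ a := contDiff_infty_iff_deriv.2
    ⟨fun t => (had t).differentiableAt, by rw [hderiv]; exact hh⟩
  have hz : ∀ u v : ℝ, (∀ t ∈ uIcc u v, h t = 0) → ∫ t in u..v, h t = 0 := by
    intro u v huv
    rw [intervalIntegral.integral_congr huv]; simp
  have ha0 : ∀ t, t ∉ Icc (η / 2) (1 - η / 2) → a t = 0 := by
    intro t ht
    rw [mem_Icc, not_and_or, not_le, not_le] at ht
    rcases ht with ht | ht
    · refine hz 0 t fun u hu => hh0 u fun h => ?_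
      have h5 : max 0 t < η / 2 := max_lt (by linarith) ht
      linarith [h.1, hu.2]
    · have e1 : a t = (∫ u in (0 : ℝ)..1, h u) + ∫ u in (1 : ℝ)..t, h u :=
        (intervalIntegral.integral_add_adjacent_intervals (hhc.intervalIntegrable _ _)
          (hhc.intervalIntegrable _ _)).symm
      rw [e1, hhI, zero_add]
      refine hz 1 t fun u hu => hh0 u fun h => ?_
      have h5 : 1 - η / 2 < min 1 t := lt_min (by linarith) ht
      linarith [h.2, hu.1]
  have hts : tsupport a ⊆ Icc (η / 2) (1 - η / 2) := by
    refine closure_minimal (fun t ht => ?_) isClosed_Icc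
    by_contra hn
    exact ht (ha0 t hn)
  refine ⟨a, hac, isCompact_Icc.of_isClosed_subset (isClosed_tsupport a) hts,
    hts.trans fun t ht => ⟨by linarith [ht.1], by linarith [ht.2]⟩, ?_, ?_⟩
  · intro t ht
    have e1 : α t - a t = ∫ u in (0 : ℝ)..t, (α' u - h u) := by
      rw [intervalIntegral.integral_sub (hα'.intervalIntegrable _ _) (hhc.intervalIntegrable _ _),
        intervalIntegral.integral_eq_sub_of_hasDerivAt (fun t _ => hα t)
          (hα'.intervalIntegrable _ _), h0, sub_zero]
    have e2 : |α t - a t| ≤ (η + 2 * η * M) * (1 + E) := by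
      rw [e1]
      calc |∫ u in (0 : ℝ)..t, (α' u - h u)| ≤ ∫ u in (0 : ℝ)..t, |α' u - h u| :=
            intervalIntegral.abs_integral_le_integral_abs ht.1
        _ ≤ ∫ u in (0 : ℝ)..1, |α' u - h u| :=
            intervalIntegral.integral_mono_interval le_rfl ht.1 ht.2
              (Eventually.of_forall fun _ => abs_nonneg _)
              (Continuous.intervalIntegrable (by fun_prop) _ _)
        _ ≤ ∫ u in (0 : ℝ)..1, (|g u - α' u| + (η + 2 * η * M) * E) := by
            refine intervalIntegral.integral_mono_on zero_le_one
              (Continuous.intervalIntegrable (by fun_prop) _ _)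
              (Continuous.intervalIntegrable (by fun_prop) _ _) fun u hu => ?_
            have h6 : α' u - h u = -(g u - α' u) + I * en u := by simp only [h]; ring
            rw [h6]
            refine (abs_add_le _ _).trans ?_
            rw [abs_neg, abs_mul]
            have := hE u hu
            rw [Real.norm_eq_abs] at this
            gcongr
        _ ≤ _ := by
            rw [intervalIntegral.integral_add (Continuous.intervalIntegrable (by fun_prop) _ _)
              (by simp)]
            simp only [intervalIntegral.integral_const, sub_zero, smul_eq_mul, one_mul]
            linarith
    refine e2.trans (le_of_sq_le_sq ?_ hδ.le)
    nlinarith [hη1, mul_nonneg hη.le (sq_nonneg (M + 1)), mul_nonneg (sq_nonneg (η + 2 * η * M))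
      (sq_nonneg E)]
  · rw [hderiv]
    calc ∫ t in (0 : ℝ)..1, (α' t - h t) ^ 2
        ≤ ∫ t in (0 : ℝ)..1, (2 * (g t - α' t) ^ 2 + 2 * (η + 2 * η * M) ^ 2 * E ^ 2) := by
          refine intervalIntegral.integral_mono_on zero_le_one
              (Continuous.intervalIntegrable (by fun_prop) _ _)
              (Continuous.intervalIntegrable (by fun_prop) _ _) fun u hu => ?_
          have h6 : α' u - h u = -(g u - α' u) + I * en u := by simp only [h]; ring
          have h7 : (I * en u) ^ 2 ≤ (η + 2 * η * M) ^ 2 * E ^ 2 := by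
            rw [← mul_pow, ← sq_abs, abs_mul]
            have := hE u hu
            rw [Real.norm_eq_abs] at this
            gcongr
          rw [h6]
          nlinarith [sq_nonneg ((g u - α' u) + I * en u)]
      _ = 2 * (∫ t in (0 : ℝ)..1, (g t - α' t) ^ 2) + 2 * (η + 2 * η * M) ^ 2 * E ^ 2 := by
          rw [intervalIntegral.integral_add (Continuous.intervalIntegrable (by fun_prop) _ _)
              (by simp), intervalIntegral.integral_const_mul]
          simp
      _ ≤ δ ^ 2 := by
          have h8 : η ^ 2 + 2 * η * (M + η) ^ 2 ≤ η + 4 * η * (M + 1) ^ 2 := by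
            have h9 : (M + η) ^ 2 ≤ (M + 1) ^ 2 := pow_le_pow_left₀ (by positivity) (by linarith) 2
            nlinarith [mul_le_mul_of_nonneg_left h9 hη.le, mul_nonneg hη.le (sq_nonneg (M + 1))]
          linarith [sq_nonneg ((η + 2 * η * M) * (1 + E))]

/-- `z` consists of the function `A(x₂) T(x₁)` and its gradient in the upper square, and of zero
below the axis, where `A'` and `T'` stand for the derivatives of `A` and `T`. -/
structure IsTensor (D : Set Plane) (A A' T T' : ℝ → ℝ) (z : H1Triple D) : Prop where
  val : z 0 =ᵐ[volume.restrict D] (rect 0 1 0 1).indicator fun x => A (x 1) * T (x 0)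
  horizontal : z 1 =ᵐ[volume.restrict D] (rect 0 1 0 1).indicator fun x => A (x 1) * T' (x 0)
  vertical : z 2 =ᵐ[volume.restrict D] (rect 0 1 0 1).indicator fun x => A' (x 1) * T (x 0)

section Tensor

variable {D : Set Plane} {ε : ℝ}

lemma exists_isTensor (hD : IsChannel D ε) {A A' T T' : ℝ → ℝ} (hA : Continuous A)
    (hA' : Continuous A') (hT : Continuous T) (hT' : Continuous T') :
    ∃ z, IsTensor D A A' T T' z := by
  have hm := measurableSet_rect 0 1 0 1
  have h : ∀ k : Plane → ℝ, Continuous k →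
      MemLp ((rect 0 1 0 1).indicator k) 2 (volume.restrict D) := fun k hk =>
    (hD.memLp_of_continuous hk).indicator hm
  have h0 := h (fun x => A (x 1) * T (x 0)) (by fun_prop)
  have h1 := h (fun x => A (x 1) * T' (x 0)) (by fun_prop)
  have h2 := h (fun x => A' (x 1) * T (x 0)) (by fun_prop)
  exact ⟨WithLp.toLp 2 ![h0.toLp, h1.toLp, h2.toLp], h0.coeFn_toLp, h1.coeFn_toLp, h2.coeFn_toLp⟩

lemma setIntegral_tensor_sq {A T : ℝ → ℝ} (hA : Continuous A) (hT : Continuous T) :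
    ∫ x in rect 0 1 0 1, (A (x 1) * T (x 0)) ^ 2 =
      (∫ t in (0 : ℝ)..1, A t ^ 2) * ∫ s in (0 : ℝ)..1, T s ^ 2 := by
  rw [setIntegral_rect zero_le_one zero_le_one (integrableOn_rect_of_continuous (by fun_prop))]
  simp only [Matrix.cons_val_zero, Matrix.cons_val_one, mul_pow]
  rw [mul_comm, ← intervalIntegral.integral_mul_const]
  refine intervalIntegral.integral_congr fun s _ => ?_
  rw [intervalIntegral.integral_mul_const, mul_comm]

lemma norm_sq_of_ae_eq_tensor (hD : IsChannel D ε) {A T : ℝ → ℝ} (hA : Continuous A)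
    (hT : Continuous T) {u : Lp ℝ 2 (volume.restrict D)}
    (hu : u =ᵐ[volume.restrict D] (rect 0 1 0 1).indicator fun x => A (x 1) * T (x 0)) :
    ‖u‖ ^ 2 = (∫ t in (0 : ℝ)..1, A t ^ 2) * ∫ s in (0 : ℝ)..1, T s ^ 2 := by
  rw [← setIntegral_tensor_sq hA hT, Lp_norm_sq_eq]
  have : ∫ x in D, u x ^ 2 = ∫ x in D, (rect 0 1 0 1).indicator
      (fun x => (A (x 1) * T (x 0)) ^ 2) x := by
    refine integral_congr_ae (hu.mono fun x hx => ?_)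
    simp only [hx]
    by_cases h : x ∈ rect 0 1 0 1 <;> simp [h]
  rw [this, setIntegral_indicator (measurableSet_rect _ _ _ _), inter_eq_right.2 hD.unit_subset]

lemma ae_eq_tensor_sub {A B T U : ℝ → ℝ} {u v w : Lp ℝ 2 (volume.restrict D)}
    (hu : u =ᵐ[volume.restrict D] (rect 0 1 0 1).indicator fun x => A (x 1) * T (x 0))
    (hv : v =ᵐ[volume.restrict D] (rect 0 1 0 1).indicator fun x => B (x 1) * U (x 0))
    (hw : w =ᵐ[volume.restrict D] u - v) :
    w =ᵐ[volume.restrict D] (rect 0 1 0 1).indicator fun x =>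
      A (x 1) * T (x 0) - B (x 1) * U (x 0) := by
  filter_upwards [hu, hv, hw] with x a b c
  rw [c, Pi.sub_apply, a, b]
  by_cases h : x ∈ rect 0 1 0 1 <;> simp [h]

lemma IsTensor.sub_vertical {A A' B B' T T' : ℝ → ℝ} {z w : H1Triple D}
    (hz : IsTensor D A A' T T' z) (hw : IsTensor D B B' T T' w) :
    IsTensor D (A - B) (A' - B') T T' (z - w) := by
  refine ⟨?_, ?_, ?_⟩
  · simpa only [Pi.sub_apply, PiLp.sub_apply, sub_mul] using
      ae_eq_tensor_sub hz.val hw.val (Lp.coeFn_sub (z 0) (w 0))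
  · simpa only [Pi.sub_apply, PiLp.sub_apply, sub_mul] using
      ae_eq_tensor_sub hz.horizontal hw.horizontal (Lp.coeFn_sub (z 1) (w 1))
  · simpa only [Pi.sub_apply, PiLp.sub_apply, sub_mul] using
      ae_eq_tensor_sub hz.vertical hw.vertical (Lp.coeFn_sub (z 2) (w 2))

lemma IsTensor.sub_horizontal {A A' U U' T T' : ℝ → ℝ} {z w : H1Triple D}
    (hz : IsTensor D A A' T T' z) (hw : IsTensor D A A' U U' w) :
    IsTensor D A A' (T - U) (T' - U') (z - w) := by
  refine ⟨?_, ?_, ?_⟩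
  · simpa only [Pi.sub_apply, PiLp.sub_apply, mul_sub] using
      ae_eq_tensor_sub hz.val hw.val (Lp.coeFn_sub (z 0) (w 0))
  · simpa only [Pi.sub_apply, PiLp.sub_apply, mul_sub] using
      ae_eq_tensor_sub hz.horizontal hw.horizontal (Lp.coeFn_sub (z 1) (w 1))
  · simpa only [Pi.sub_apply, PiLp.sub_apply, mul_sub] using
      ae_eq_tensor_sub hz.vertical hw.vertical (Lp.coeFn_sub (z 2) (w 2))

lemma IsTensor.norm_sq (hD : IsChannel D ε) {A A' T T' : ℝ → ℝ} {z : H1Triple D}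
    (hz : IsTensor D A A' T T' z) (hA : Continuous A) (hA' : Continuous A') (hT : Continuous T)
    (hT' : Continuous T') :
    ‖z‖ ^ 2 = (∫ t in (0 : ℝ)..1, A t ^ 2) * (∫ s in (0 : ℝ)..1, T s ^ 2) +
      ((∫ t in (0 : ℝ)..1, A t ^ 2) * (∫ s in (0 : ℝ)..1, T' s ^ 2) +
        (∫ t in (0 : ℝ)..1, A' t ^ 2) * ∫ s in (0 : ℝ)..1, T s ^ 2) := by
  rw [H1Triple_norm_sq, norm_sq_of_ae_eq_tensor hD hA hT hz.val,
    norm_sq_of_ae_eq_tensor hD hA hT' hz.horizontal, norm_sq_of_ae_eq_tensor hD hA' hT hz.vertical]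

lemma IsTensor.of_isTripleOf (hD : IsChannel D ε) {a σ : ℝ → ℝ} (ha : ContDiff ℝ ∞ a)
    (hσ : ContDiff ℝ ∞ σ) (ha0 : tsupport a ⊆ Ioo 0 1) {z : H1Triple D}
    (hz : IsTripleOf D (fun x => a (x 1) * σ (x 0)) z) :
    IsTensor D a (deriv a) σ (deriv σ) z := by
  have hφ : ContDiff ℝ ∞ fun x : Plane => a (x 1) * σ (x 0) :=
    (ha.comp (by fun_prop : ContDiff ℝ ∞ fun x : Plane => x 1)).mul
      (hσ.comp (by fun_prop : ContDiff ℝ ∞ fun x : Plane => x 0))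
  have hd := hφ.differentiable (by simp)
  have hae := (ha.differentiable (by simp))
  have hse := (hσ.differentiable (by simp))
  have hx : ∀ x : Plane, x = !₂[x 0, x 1] := fun x => by ext i; fin_cases i <;> rfl
  have p0 : ∀ x, partialDeriv 0 (fun x : Plane => a (x 1) * σ (x 0)) x = a (x 1) * deriv σ (x 0) := by
    intro x
    have h1 := hasDerivAt_horizontal hd (x 0) (x 1)
    rw [← hx x] at h1
    exact h1.unique (((hse (x 0)).hasDerivAt).const_mul (a (x 1)))
  have p1 : ∀ x, partialDeriv 1 (fun x : Plane => a (x 1) * σ (x 0)) x = deriv a (x 1) * σ (x 0) := by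
    intro x
    have h1 := hasDerivAt_vertical hd (x 0) (x 1)
    rw [← hx x] at h1
    exact h1.unique (((hae (x 1)).hasDerivAt).mul_const (σ (x 0)))
  have h0 : ∀ x ∈ D, x ∉ rect 0 1 0 1 → a (x 1) = 0 ∧ deriv a (x 1) = 0 := by
    intro x hxD hxr
    have : x 1 ∉ tsupport a := fun h => hxr ⟨(hD.subset_rect hxD).1, ha0 h⟩
    refine ⟨image_eq_zero_of_notMem_tsupport this, ?_⟩
    have h2 : a =ᶠ[𝓝 (x 1)] 0 := notMem_tsupport_iff_eventuallyEq.1 this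
    rw [h2.deriv_eq]; simp
  have key : ∀ {u : Plane → ℝ} {k : Plane → ℝ}, u =ᵐ[volume.restrict D] k →
      (∀ x ∈ D, x ∉ rect 0 1 0 1 → k x = 0) →
      u =ᵐ[volume.restrict D] (rect 0 1 0 1).indicator k := by
    intro u k hu hk
    filter_upwards [hu, ae_restrict_mem hD.isOpen.measurableSet] with x h1 h2
    by_cases h : x ∈ rect 0 1 0 1
    · simp [h, h1]
    · simp [h, h1, hk x h2 h]
  refine ⟨key hz.val fun x h1 h2 => by simp [h0 x h1 h2], ?_, ?_⟩
  · have := hz.grad 0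
    rw [funext p0] at this
    exact key this fun x h1 h2 => by simp [h0 x h1 h2]
  · have := hz.grad 1
    rw [funext p1] at this
    exact key this fun x h1 h2 => by simp [h0 x h1 h2]

lemma closure_walls_subset (D : Set Plane) : closure (walls D) ⊆ {x | x 1 ≤ 0 ∨ x 1 = 1} := by
  refine closure_minimal ?_ ((isClosed_le (continuous_coord 1) continuous_const).union
    (isClosed_eq (continuous_coord 1) continuous_const))
  rintro x (hx | hx)
  · exact Or.inl hx.2
  · exact Or.inr hx.2

lemma closure_wallsAndSides_subset (D : Set Plane) :
    closure (wallsAndSides D) ⊆ {x | (x 1 ≤ 0 ∨ x 1 = 1) ∨ (x 0 = 0 ∨ x 0 = 1)} := by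
  refine closure_minimal ?_ (((isClosed_le (continuous_coord 1) continuous_const).union
    (isClosed_eq (continuous_coord 1) continuous_const)).union
    ((isClosed_eq (continuous_coord 0) continuous_const).union
      (isClosed_eq (continuous_coord 0) continuous_const)))
  rintro x ((hx | hx) | (hx | hx))
  · exact Or.inl (Or.inl hx.2)
  · exact Or.inl (Or.inr hx.2)
  · exact Or.inr (Or.inl hx.1)
  · exact Or.inr (Or.inr hx.1)

lemma isTestOff_tensor {a σ : ℝ → ℝ} (ha : ContDiff ℝ ∞ a) (hσ : ContDiff ℝ ∞ σ)
    (hac : HasCompactSupport a) (hσc : HasCompactSupport σ) {S : Set Plane}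
    (h : ∀ x : Plane, x 1 ∈ tsupport a → x 0 ∈ tsupport σ → x ∉ closure S) :
    IsTestOff S (fun x => a (x 1) * σ (x 0)) := by
  have hsub : tsupport (fun x : Plane => a (x 1) * σ (x 0)) ⊆
      {x | x 1 ∈ tsupport a ∧ x 0 ∈ tsupport σ} := by
    refine closure_minimal (fun x hx => ⟨subset_tsupport a fun h => hx ?_,
      subset_tsupport σ fun h => hx ?_⟩) (((isClosed_tsupport a).preimage (continuous_coord 1)).inter
        ((isClosed_tsupport σ).preimage (continuous_coord 0)))
    · simp [h]
    · simp [h]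
  refine ⟨(ha.comp (by fun_prop : ContDiff ℝ ∞ fun x : Plane => x 1)).mul
      (hσ.comp (by fun_prop : ContDiff ℝ ∞ fun x : Plane => x 0)), ?_, ?_⟩
  · refine ((hσc.prod hac).image continuous_pt).of_isClosed_subset (isClosed_tsupport _) ?_
    intro x hx
    refine ⟨(x 0, x 1), ⟨(hsub hx).2, (hsub hx).1⟩, ?_⟩
    ext i; fin_cases i <;> rfl
  · exact disjoint_left.2 fun x hx => h x (hsub hx).1 (hsub hx).2

lemma exists_cutoff : ∃ κ : ℝ → ℝ, ContDiff ℝ ∞ κ ∧ HasCompactSupport κ ∧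
    ∀ s ∈ Ioo (-1 : ℝ) 2, κ s = 1 := by
  let κ : ContDiffBump (1 / 2 : ℝ) := ⟨3 / 2, 2, by norm_num, by norm_num⟩
  refine ⟨κ, κ.contDiff, κ.hasCompactSupport, fun s hs => κ.one_of_mem_closedBall ?_⟩
  rw [Metric.mem_closedBall, Real.dist_eq, abs_le]
  constructor <;> simp only [κ] <;> linarith [hs.1, hs.2]

lemma IsTensor.congr {A A' T T' U U' : ℝ → ℝ} {z : H1Triple D} (hz : IsTensor D A A' T T' z)
    (hT : ∀ s ∈ Ioo (0 : ℝ) 1, U s = T s) (hT' : ∀ s ∈ Ioo (0 : ℝ) 1, U' s = T' s) :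
    IsTensor D A A' U U' z := by
  have key : ∀ {B V W : ℝ → ℝ}, (∀ s ∈ Ioo (0 : ℝ) 1, V s = W s) →
      (rect 0 1 0 1).indicator (fun x : Plane => B (x 1) * W (x 0)) =
      (rect 0 1 0 1).indicator (fun x : Plane => B (x 1) * V (x 0)) := fun h =>
    indicator_congr fun x hx => by rw [h _ hx.1]
  exact ⟨key (B := A) hT ▸ hz.val, key (B := A) hT' ▸ hz.horizontal, key (B := A') hT ▸ hz.vertical⟩

lemma IsTensor.unique {A A' T T' : ℝ → ℝ} {z w : H1Triple D} (hz : IsTensor D A A' T T' z)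
    (hw : IsTensor D A A' T T' w) : z = w := by
  ext i : 2
  fin_cases i
  · exact hz.val.trans hw.val.symm
  · exact hz.horizontal.trans hw.horizontal.symm
  · exact hz.vertical.trans hw.vertical.symm

lemma tensor_small {x y c δ : ℝ} (hc : 0 < c) (hδ : 0 < δ)
    (hx' : x ≤ (δ / c) ^ 2) (hy' : y ≤ (δ / c) ^ 2) {p q : ℝ} (hp : 0 ≤ p) (hq : 0 ≤ q)
    (hpc : 2 * p + q + 1 ≤ c) : x * p + (x * q + y * p) < δ ^ 2 := by
  have hc1 : 1 ≤ c := by linarith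
  have h3 : x * p + (x * q + y * p) ≤ (δ / c) ^ 2 * (2 * p + q) := by
    nlinarith [mul_le_mul_of_nonneg_right hx' hp, mul_le_mul_of_nonneg_right hx' hq,
      mul_le_mul_of_nonneg_right hy' hp]
  have h4 : (δ / c) ^ 2 * (2 * p + q) < (δ / c) ^ 2 * c ^ 2 := by
    apply mul_lt_mul_of_pos_left _ (by positivity)
    nlinarith
  have h5 : (δ / c) ^ 2 * c ^ 2 = δ ^ 2 := by field_simp
  linarith

/-- Products are limits of products in which the vertical factor has compact support. -/
lemma tensor_mem_of_vertical (hD : IsChannel D ε) {S : Set Plane} {A A' T T' : ℝ → ℝ}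
    (hA : ∀ t, HasDerivAt A (A' t) t) (hA' : Continuous A') (h0 : A 0 = 0) (h1 : A 1 = 0)
    (hT : Continuous T) (hT' : Continuous T')
    (h : ∀ a : ℝ → ℝ, ContDiff ℝ ∞ a → HasCompactSupport a → tsupport a ⊆ Ioo 0 1 →
      ∀ w, IsTensor D a (deriv a) T T' w → w ∈ H1Zero D S)
    {z : H1Triple D} (hz : IsTensor D A A' T T' z) : z ∈ H1Zero D S := by
  refine (isClosed_H1Zero D S).closure_subset (Metric.mem_closure_iff.2 fun δ hδ => ?_)
  have hAc : Continuous A := continuous_iff_continuousAt.2 fun u => (hA u).continuousAt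
  set p := ∫ s in (0 : ℝ)..1, T s ^ 2
  set q := ∫ s in (0 : ℝ)..1, T' s ^ 2
  have hp : 0 ≤ p := intervalIntegral.integral_nonneg zero_le_one fun _ _ => sq_nonneg _
  have hq : 0 ≤ q := intervalIntegral.integral_nonneg zero_le_one fun _ _ => sq_nonneg _
  set c := 2 * p + q + 1 with hc
  have hcpos : 0 < c := by positivity
  obtain ⟨a, ha, hac, has, hle, hint⟩ :=
    exists_contDiff_compactly_supported hA hA' h0 h1 (div_pos hδ hcpos)
  have hac' := ha.continuous
  have had' : Continuous (deriv a) := ha.continuous_deriv (by simp)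
  obtain ⟨w, hw⟩ := exists_isTensor hD hac' had' hT hT'
  refine ⟨w, h a ha hac has w hw, ?_⟩
  rw [dist_eq_norm]
  refine lt_of_pow_lt_pow_left₀ 2 hδ.le ?_
  rw [(hz.sub_vertical hw).norm_sq hD (hAc.sub hac') (hA'.sub had') hT hT']
  refine tensor_small hcpos hδ ?_ hint hp hq le_rfl
  calc ∫ t in (0 : ℝ)..1, (A - a) t ^ 2 ≤ ∫ t in (0 : ℝ)..1, (δ / c) ^ 2 := by
        refine intervalIntegral.integral_mono_on zero_le_one
          (((hAc.sub hac').pow 2).intervalIntegrable _ _) (by simp) fun t ht => ?_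
        rw [Pi.sub_apply, ← sq_abs]
        exact pow_le_pow_left₀ (abs_nonneg _) (hle t ht) 2
    _ = (δ / c) ^ 2 := by simp

/-- Products are limits of products in which the horizontal factor has compact support. -/
lemma tensor_mem_of_horizontal (hD : IsChannel D ε) {S : Set Plane} {A A' T T' : ℝ → ℝ}
    (hT : ∀ t, HasDerivAt T (T' t) t) (hT' : Continuous T') (h0 : T 0 = 0) (h1 : T 1 = 0)
    (hA : Continuous A) (hA' : Continuous A')
    (h : ∀ b : ℝ → ℝ, ContDiff ℝ ∞ b → HasCompactSupport b → tsupport b ⊆ Ioo 0 1 →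
      ∀ w, IsTensor D A A' b (deriv b) w → w ∈ H1Zero D S)
    {z : H1Triple D} (hz : IsTensor D A A' T T' z) : z ∈ H1Zero D S := by
  refine (isClosed_H1Zero D S).closure_subset (Metric.mem_closure_iff.2 fun δ hδ => ?_)
  have hTc : Continuous T := continuous_iff_continuousAt.2 fun u => (hT u).continuousAt
  set p := ∫ s in (0 : ℝ)..1, A s ^ 2
  set q := ∫ s in (0 : ℝ)..1, A' s ^ 2
  have hp : 0 ≤ p := intervalIntegral.integral_nonneg zero_le_one fun _ _ => sq_nonneg _
  have hq : 0 ≤ q := intervalIntegral.integral_nonneg zero_le_one fun _ _ => sq_nonneg _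
  set c := 2 * p + q + 1 with hc
  have hcpos : 0 < c := by positivity
  obtain ⟨b, hb, hbc, hbs, hle, hint⟩ :=
    exists_contDiff_compactly_supported hT hT' h0 h1 (div_pos hδ hcpos)
  have hbc' := hb.continuous
  have hbd' : Continuous (deriv b) := hb.continuous_deriv (by simp)
  obtain ⟨w, hw⟩ := exists_isTensor hD hA hA' hbc' hbd'
  refine ⟨w, h b hb hbc hbs w hw, ?_⟩
  rw [dist_eq_norm]
  refine lt_of_pow_lt_pow_left₀ 2 hδ.le ?_
  rw [(hz.sub_horizontal hw).norm_sq hD hA hA' (hTc.sub hbc') (hT'.sub hbd')]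
  have := tensor_small hcpos hδ (?_ :
      ∫ t in (0 : ℝ)..1, (T - b) t ^ 2 ≤ (δ / c) ^ 2)
    (hint : ∫ t in (0 : ℝ)..1, (T' - deriv b) t ^ 2 ≤ _) hp hq le_rfl
  · simp only [Pi.sub_apply] at this ⊢
    linarith
  calc ∫ t in (0 : ℝ)..1, (T - b) t ^ 2 ≤ ∫ t in (0 : ℝ)..1, (δ / c) ^ 2 := by
        refine intervalIntegral.integral_mono_on zero_le_one
          (((hTc.sub hbc').pow 2).intervalIntegrable _ _) (by simp) fun t ht => ?_
        rw [Pi.sub_apply, ← sq_abs]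
        exact pow_le_pow_left₀ (abs_nonneg _) (hle t ht) 2
    _ = (δ / c) ^ 2 := by simp

/-- A product that vanishes on the bottom and the top of the upper square is admissible for the
first velocity component. -/
lemma tensor_mem_walls (hD : IsChannel D ε) {A A' T T' : ℝ → ℝ}
    (hA : ∀ t, HasDerivAt A (A' t) t) (hA' : Continuous A') (h0 : A 0 = 0) (h1 : A 1 = 0)
    (hT : ContDiff ℝ ∞ T) (hT' : ∀ t, HasDerivAt T (T' t) t)
    {z : H1Triple D} (hz : IsTensor D A A' T T' z) : z ∈ H1Zero D (walls D) := by
  have hTd : deriv T = T' := funext fun t => (hT' t).deriv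
  have hTc : Continuous T' := hTd ▸ hT.continuous_deriv (by simp)
  refine tensor_mem_of_vertical hD hA hA' h0 h1 hT.continuous hTc (fun a ha hac has w hw => ?_) hz
  obtain ⟨κ, hκ, hκc, hκ1⟩ := exists_cutoff
  have hσ : ContDiff ℝ ∞ fun s => T s * κ s := hT.mul hκ
  have hσc : HasCompactSupport fun s => T s * κ s := hκc.mul_left
  have htest : IsTestOff (walls D) fun x => a (x 1) * (fun s => T s * κ s) (x 0) :=
    isTestOff_tensor ha hσ hac hσc fun x h1 _ h3 => by
      rcases closure_walls_subset D h3 with h | h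
      · linarith [(has h1).1]
      · linarith [(has h1).2]
  obtain ⟨t, ht⟩ := exists_isTripleOf D htest
  have ht2 := (IsTensor.of_isTripleOf hD ha hσ has ht)
  have he : ∀ s ∈ Ioo (0 : ℝ) 1, (fun s => T s * κ s) =ᶠ[𝓝 s] T := by
    intro s hs
    filter_upwards [Ioo_mem_nhds (show (-1 : ℝ) < s by linarith [hs.1])
      (show s < 2 by linarith [hs.2])] with r hr
    rw [hκ1 r hr, mul_one]
  have ht3 : IsTensor D a (deriv a) T T' t :=
    ht2.congr (fun s hs => (he s hs).self_of_nhds.symm) fun s hs => by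
      rw [(he s hs).deriv_eq, hTd]
  rw [hw.unique ht3]
  exact ht.mem_H1Zero htest

/-- A product that vanishes on the boundary of the upper square is admissible for the second velocity
component. -/
lemma tensor_mem_wallsAndSides (hD : IsChannel D ε) {A A' T T' : ℝ → ℝ}
    (hA : ∀ t, HasDerivAt A (A' t) t) (hA' : Continuous A') (h0 : A 0 = 0) (h1 : A 1 = 0)
    (hT : ∀ t, HasDerivAt T (T' t) t) (hT' : Continuous T') (hT0 : T 0 = 0) (hT1 : T 1 = 0)
    {z : H1Triple D} (hz : IsTensor D A A' T T' z) : z ∈ H1Zero D (wallsAndSides D) := by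
  have hTc : Continuous T := continuous_iff_continuousAt.2 fun u => (hT u).continuousAt
  refine tensor_mem_of_vertical hD hA hA' h0 h1 hTc hT' (fun a ha hac has w hw => ?_) hz
  refine tensor_mem_of_horizontal hD hT hT' hT0 hT1 ha.continuous (ha.continuous_deriv (by simp))
    (fun b hb hbc hbs y hy => ?_) hw
  have htest : IsTestOff (wallsAndSides D) fun x => a (x 1) * b (x 0) :=
    isTestOff_tensor ha hb hac hbc fun x h1 h2 h3 => by
      rcases closure_wallsAndSides_subset D h3 with (h | h) | (h | h)
      · linarith [(has h1).1]
      · linarith [(has h1).2]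
      · linarith [(hbs h2).1]
      · linarith [(hbs h2).2]
  obtain ⟨t, ht⟩ := exists_isTripleOf D htest
  rw [hy.unique (IsTensor.of_isTripleOf hD ha hb has ht)]
  exact ht.mem_H1Zero htest

end Tensor

/-! ### The space of velocity fields and the convection term -/

/-- Pairs of elements of `H1Triple D`: the two components of a vector field, each with its
gradient. -/
abbrev VField (D : Set Plane) : Type := PiLp 2 (fun _ : Fin 2 => H1Triple D)

/-- The part of the boundary on which the `i`-th velocity component vanishes. -/
def noSlip (D : Set Plane) : Fin 2 → Set Plane := ![walls D, wallsAndSides D]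

lemma walls_subset_noSlip (D : Set Plane) (i : Fin 2) : walls D ⊆ noSlip D i := by
  fin_cases i
  · exact Subset.rfl
  · exact subset_union_left

/-- The `k`-th entry (value, horizontal or vertical derivative) of the `i`-th component. -/
noncomputable def entry (D : Set Plane) (i : Fin 2) (k : Fin 3) :
    VField D →L[ℝ] Lp ℝ 2 (volume.restrict D) :=
  (PiLp.proj 2 (fun _ : Fin 3 => Lp ℝ 2 (volume.restrict D)) k).comp
    (PiLp.proj 2 (fun _ : Fin 2 => H1Triple D) i)

@[simp] lemma entry_apply (i : Fin 2) (k : Fin 3) (x : VField D) : entry D i k x = x i k := rfl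

/-- The velocity fields that satisfy the boundary conditions. -/
noncomputable def velocity (D : Set Plane) : Submodule ℝ (VField D) :=
  ⨅ i, (H1Zero D (noSlip D i)).comap (PiLp.proj 2 (fun _ : Fin 2 => H1Triple D) i).toLinearMap

lemma mem_velocity {D : Set Plane} {x : VField D} :
    x ∈ velocity D ↔ ∀ i, x i ∈ H1Zero D (noSlip D i) := by
  simp [velocity, Submodule.mem_iInf]

lemma isClosed_velocity (D : Set Plane) : IsClosed (velocity D : Set (VField D)) := by
  have : (velocity D : Set (VField D)) = ⋂ i, {x | x i ∈ H1Zero D (noSlip D i)} := by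
    ext x; simp [mem_velocity]
  rw [this]
  exact isClosed_iInter fun i => (isClosed_H1Zero D _).preimage (PiLp.continuous_apply 2 _ i)

/-- The divergence of a vector field. -/
noncomputable def divergence (D : Set Plane) : VField D →L[ℝ] Lp ℝ 2 (volume.restrict D) :=
  entry D 0 1 + entry D 1 2

lemma divergence_apply {D : Set Plane} (x : VField D) : divergence D x = x 0 1 + x 1 2 := rfl

/-- The divergence-free fields that satisfy the boundary conditions. -/
noncomputable def solenoidal (D : Set Plane) : Submodule ℝ (VField D) :=
  velocity D ⊓ (divergence D).ker

lemma mem_solenoidal {D : Set Plane} {x : VField D} :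
    x ∈ solenoidal D ↔ x ∈ velocity D ∧ divergence D x = 0 := Iff.rfl

lemma isClosed_solenoidal (D : Set Plane) : IsClosed (solenoidal D : Set (VField D)) :=
  (isClosed_velocity D).inter (divergence D).isClosed_ker

/-- The Dirichlet form `∫ ∇U : ∇V`. -/
noncomputable def dirichlet (D : Set Plane) : VField D →L[ℝ] VField D →L[ℝ] ℝ :=
  ∑ i, ∑ j : Fin 2, (innerSL ℝ).bilinearComp (entry D i j.succ) (entry D i j.succ)

lemma dirichlet_apply {D : Set Plane} (x y : VField D) :
    dirichlet D x y = ∑ i, ∑ j : Fin 2, inner ℝ (x i j.succ) (y i j.succ) := by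
  simp [dirichlet]

lemma dirichlet_self {D : Set Plane} (x : VField D) :
    dirichlet D x x = ∑ i, ∑ j : Fin 2, ‖x i j.succ‖ ^ 2 := by
  simp [dirichlet_apply]

lemma VField_norm_sq {D : Set Plane} (x : VField D) :
    ‖x‖ ^ 2 = ∑ i, ‖x i 0‖ ^ 2 + dirichlet D x x := by
  rw [PiLp.norm_sq_eq_of_L2, dirichlet_self, ← Finset.sum_add_distrib]
  refine Finset.sum_congr rfl fun i _ => ?_
  rw [H1Triple_norm_sq, Fin.sum_univ_two]; rfl

lemma norm_entry_le {D : Set Plane} (x : VField D) (i : Fin 2) (k : Fin 3) : ‖x i k‖ ≤ ‖x‖ :=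
  (PiLp.norm_apply_le (x i) k).trans (PiLp.norm_apply_le x i)

lemma dirichlet_self_le {D : Set Plane} (x : VField D) : dirichlet D x x ≤ ‖x‖ ^ 2 := by
  rw [VField_norm_sq]
  have : 0 ≤ ∑ i, ‖x i 0‖ ^ 2 := by positivity
  linarith

lemma norm_sq_le_dirichlet {D : Set Plane} {ε : ℝ} (hD : IsChannel D ε) {x : VField D}
    (hx : x ∈ velocity D) : ‖x‖ ^ 2 ≤ 5 * dirichlet D x x := by
  have h := fun i => H1Zero_poincare hD (walls_subset_noSlip D i) (mem_velocity.1 hx i)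
  rw [VField_norm_sq, dirichlet_self]
  simp only [Fin.sum_univ_two]
  have h0 := h 0
  have h1 := h 1
  simp only [Fin.succ_zero_eq_one, Fin.succ_one_eq_two]
  nlinarith [sq_nonneg ‖x 0 1‖, sq_nonneg ‖x 1 1‖]

instance : ENNReal.HolderTriple 4 4 2 := ⟨by
  rw [← two_mul, show (4 : ENNReal) = 2 * 2 by norm_num,
    ENNReal.mul_inv (by norm_num) (by norm_num), ← mul_assoc,
    ENNReal.mul_inv_cancel (by norm_num) (by norm_num), one_mul]⟩

/-- Hölder's inequality for the convection term. -/
lemma integrable_mul_mul {μ : Measure Plane} {f g h : Plane → ℝ} (hf : MemLp f 4 μ)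
    (hg : MemLp g 2 μ) (hh : MemLp h 4 μ) : Integrable (fun x => f x * g x * h x) μ := by
  have h1 : MemLp (fun x => f x * h x) 2 μ := hh.mul hf
  exact (hg.integrable_mul h1).congr (Eventually.of_forall fun x => by
    simp only [Pi.mul_apply]; ring)

lemma abs_integral_mul_mul_le {μ : Measure Plane} {f h : Plane → ℝ} {g : Lp ℝ 2 μ} {a c : ℝ}
    (hf : AEStronglyMeasurable f μ) (hh : AEStronglyMeasurable h μ) (ha : 0 ≤ a) (hc : 0 ≤ c)
    (hfa : eLpNorm f 4 μ ≤ ENNReal.ofReal a) (hhc : eLpNorm h 4 μ ≤ ENNReal.ofReal c) :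
    |∫ x, f x * g x * h x ∂μ| ≤ a * ‖g‖ * c := by
  have mf : MemLp f 4 μ := ⟨hf, hfa.trans_lt ENNReal.ofReal_lt_top⟩
  have mh : MemLp h 4 μ := ⟨hh, hhc.trans_lt ENNReal.ofReal_lt_top⟩
  have h1 : MemLp (fun x => f x * h x) 2 μ := mh.mul mf
  have h2 : eLpNorm (fun x => f x * h x) 2 μ ≤ ENNReal.ofReal (a * c) := by
    refine (eLpNorm_smul_le_mul_eLpNorm (p := 4) (q := 4) hh hf).trans ?_
    rw [ENNReal.ofReal_mul ha]
    exact mul_le_mul' hfa hhc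
  have h3 : ‖h1.toLp‖ ≤ a * c := by
    rw [Lp.norm_toLp]
    exact ENNReal.toReal_le_of_le_ofReal (by positivity) h2
  have h4 : ∫ x, f x * g x * h x ∂μ = inner ℝ g h1.toLp := by
    rw [L2.inner_def]
    refine integral_congr_ae ?_
    filter_upwards [h1.coeFn_toLp] with x hx
    simp only [hx, RCLike.inner_apply, conj_trivial]
    ring
  rw [h4]
  calc |inner ℝ g h1.toLp| ≤ ‖g‖ * ‖h1.toLp‖ := abs_real_inner_le_norm _ _
    _ ≤ ‖g‖ * (a * c) := by gcongr
    _ = a * ‖g‖ * c := by ring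

/-- The convection term `∫ (X · ∇Y) · Z`. -/
noncomputable def convection (D : Set Plane) (x y z : VField D) : ℝ :=
  ∑ i, ∑ j : Fin 2, ∫ a in D, x j 0 a * y i j.succ a * z i 0 a

section Channel

variable {D : Set Plane} {ε : ℝ}

lemma eLpNorm_four_le_dirichlet (hD : IsChannel D ε) {x : VField D} (hx : x ∈ velocity D)
    (i : Fin 2) : eLpNorm (x i 0) 4 (volume.restrict D) ≤
      ENNReal.ofReal (3 * √(dirichlet D x x)) := by
  refine (H1Zero_ladyzhenskaya hD (walls_subset_noSlip D i) (mem_velocity.1 hx i)).trans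
    (ENNReal.ofReal_le_ofReal ?_)
  gcongr
  rw [dirichlet_self]
  calc ‖x i 1‖ ^ 2 + ‖x i 2‖ ^ 2 = ∑ j : Fin 2, ‖x i j.succ‖ ^ 2 := by
        rw [Fin.sum_univ_two]; rfl
    _ ≤ _ := Finset.single_le_sum (f := fun i => ∑ j : Fin 2, ‖x i j.succ‖ ^ 2)
        (fun i _ => by positivity) (Finset.mem_univ i)

lemma memLp_four_of_mem_velocity (hD : IsChannel D ε) {x : VField D} (hx : x ∈ velocity D)
    (i : Fin 2) : MemLp (x i 0) 4 (volume.restrict D) :=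
  ⟨(Lp.memLp _).1, (eLpNorm_four_le_dirichlet hD hx i).trans_lt ENNReal.ofReal_lt_top⟩

lemma convection_le (hD : IsChannel D ε) {x y z : VField D} (hx : x ∈ velocity D)
    (hz : z ∈ velocity D) :
    |convection D x y z| ≤ 36 * √(dirichlet D x x) * √(dirichlet D y y) * √(dirichlet D z z) := by
  have h : ∀ i j : Fin 2, |∫ a in D, x j 0 a * y i j.succ a * z i 0 a| ≤
      9 * √(dirichlet D x x) * √(dirichlet D y y) * √(dirichlet D z z) := fun i j => by
    refine (abs_integral_mul_mul_le (Lp.memLp _).1 (Lp.memLp _).1 (by positivity) (by positivity)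
      (eLpNorm_four_le_dirichlet hD hx j) (eLpNorm_four_le_dirichlet hD hz i)).trans ?_
    have : ‖y i j.succ‖ ≤ √(dirichlet D y y) := by
      refine Real.le_sqrt_of_sq_le ?_
      rw [dirichlet_self]
      exact (Finset.single_le_sum (f := fun j : Fin 2 => ‖y i j.succ‖ ^ 2)
        (fun i _ => by positivity) (Finset.mem_univ j)).trans
        (Finset.single_le_sum (f := fun i => ∑ j : Fin 2, ‖y i j.succ‖ ^ 2)
        (fun i _ => by positivity) (Finset.mem_univ i))
    calc _ ≤ 3 * √(dirichlet D x x) * √(dirichlet D y y) * (3 * √(dirichlet D z z)) := by gcongr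
      _ = _ := by ring
  calc |convection D x y z| ≤ ∑ i, |∑ j : Fin 2, ∫ a in D, x j 0 a * y i j.succ a * z i 0 a| :=
        Finset.abs_sum_le_sum_abs _ _
    _ ≤ ∑ i, ∑ j : Fin 2, |∫ a in D, x j 0 a * y i j.succ a * z i 0 a| :=
        Finset.sum_le_sum fun i _ => Finset.abs_sum_le_sum_abs _ _
    _ ≤ ∑ i : Fin 2, ∑ j : Fin 2,
        9 * √(dirichlet D x x) * √(dirichlet D y y) * √(dirichlet D z z) :=
        Finset.sum_le_sum fun i _ => Finset.sum_le_sum fun j _ => h i j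
    _ = _ := by simp; ring

lemma convection_le_norm (hD : IsChannel D ε) {x y z : VField D} (hx : x ∈ velocity D)
    (hz : z ∈ velocity D) : |convection D x y z| ≤ 36 * ‖x‖ * ‖y‖ * ‖z‖ := by
  have h : ∀ w : VField D, √(dirichlet D w w) ≤ ‖w‖ := fun w =>
    Real.sqrt_le_iff.2 ⟨norm_nonneg _, dirichlet_self_le w⟩
  refine (convection_le hD hx hz).trans ?_
  gcongr <;> exact h _

lemma convection_integrable (hD : IsChannel D ε) {x y z : VField D} (hx : x ∈ velocity D)
    (hz : z ∈ velocity D) (i j : Fin 2) :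
    Integrable (fun a => x j 0 a * y i j.succ a * z i 0 a) (volume.restrict D) :=
  integrable_mul_mul (memLp_four_of_mem_velocity hD hx j) (Lp.memLp _)
    (memLp_four_of_mem_velocity hD hz i)

lemma VField_coeFn_add (x y : VField D) (i : Fin 2) (k : Fin 3) :
    (x + y) i k =ᵐ[volume.restrict D] fun a => x i k a + y i k a := Lp.coeFn_add _ _

lemma VField_coeFn_smul (c : ℝ) (x : VField D) (i : Fin 2) (k : Fin 3) :
    (c • x) i k =ᵐ[volume.restrict D] fun a => c * x i k a := Lp.coeFn_smul _ _

lemma convection_add_left (hD : IsChannel D ε) {x x' y z : VField D} (hx : x ∈ velocity D)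
    (hx' : x' ∈ velocity D) (hz : z ∈ velocity D) :
    convection D (x + x') y z = convection D x y z + convection D x' y z := by
  simp only [convection, ← Finset.sum_add_distrib]
  refine Finset.sum_congr rfl fun i _ => Finset.sum_congr rfl fun j _ => ?_
  rw [← integral_add (convection_integrable hD hx hz i j) (convection_integrable hD hx' hz i j)]
  refine integral_congr_ae ((VField_coeFn_add x x' j 0).mono fun a h => ?_)
  simp only [h]; ring

lemma convection_add_middle (hD : IsChannel D ε) {x y y' z : VField D} (hx : x ∈ velocity D)
    (hz : z ∈ velocity D) :
    convection D x (y + y') z = convection D x y z + convection D x y' z := by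
  simp only [convection, ← Finset.sum_add_distrib]
  refine Finset.sum_congr rfl fun i _ => Finset.sum_congr rfl fun j _ => ?_
  rw [← integral_add (convection_integrable hD hx hz i j) (convection_integrable hD hx hz i j)]
  refine integral_congr_ae ((VField_coeFn_add y y' i j.succ).mono fun a h => ?_)
  simp only [h]; ring

lemma convection_add_right (hD : IsChannel D ε) {x y z z' : VField D} (hx : x ∈ velocity D)
    (hz : z ∈ velocity D) (hz' : z' ∈ velocity D) :
    convection D x y (z + z') = convection D x y z + convection D x y z' := by
  simp only [convection, ← Finset.sum_add_distrib]
  refine Finset.sum_congr rfl fun i _ => Finset.sum_congr rfl fun j _ => ?_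
  rw [← integral_add (convection_integrable hD hx hz i j) (convection_integrable hD hx hz' i j)]
  refine integral_congr_ae ((VField_coeFn_add z z' i 0).mono fun a h => ?_)
  simp only [h]; ring

lemma convection_smul_right (c : ℝ) (x y z : VField D) :
    convection D x y (c • z) = c * convection D x y z := by
  simp only [convection, Finset.mul_sum]
  refine Finset.sum_congr rfl fun i _ => Finset.sum_congr rfl fun j _ => ?_
  rw [← integral_const_mul]
  refine integral_congr_ae ((VField_coeFn_smul c z i 0).mono fun a h => ?_)
  simp only [h]; ring

lemma convection_self_sub (hD : IsChannel D ε) {x y z : VField D} (hx : x ∈ velocity D)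
    (hy : y ∈ velocity D) (hz : z ∈ velocity D) :
    convection D x x z - convection D y y z =
      convection D (x - y) x z + convection D y (x - y) z := by
  have h1 := convection_add_left (y := x) hD ((velocity D).sub_mem hx hy) hy hz
  have h2 := convection_add_middle (y := x - y) (y' := y) hD hy hz
  rw [sub_add_cancel] at h1 h2
  rw [h1, h2]; ring

end Channel

/-! ### Existence and local uniqueness -/

/-- Solvability of `B u = G u` in a small ball, for a coercive form `B` and a nonlinearity `G` with
a Lipschitz constant smaller than the coercivity constant. -/
lemma exists_unique_small_solution {E : Type*} [NormedAddCommGroup E] [InnerProductSpace ℝ E]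
    [CompleteSpace E] {B : E →L[ℝ] E →L[ℝ] ℝ} {G : E → E →L[ℝ] ℝ} {c q κ R : ℝ}
    (hqc : q < c) (hq : 0 ≤ q) (hR : 0 ≤ R) (hB : ∀ u, c * ‖u‖ ^ 2 ≤ B u u)
    (hG0 : ‖G 0‖ ≤ κ) (hG : ∀ u v, ‖u‖ ≤ R → ‖v‖ ≤ R → ‖G u - G v‖ ≤ q * ‖u - v‖)
    (hκ : κ ≤ (c - q) * R) :
    ∃ u, B u = G u ∧ (c - q) * ‖u‖ ≤ κ ∧ ‖u‖ ≤ R ∧ ∀ v, B v = G v → ‖v‖ ≤ R → v = u := by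
  have hc : 0 < c := hq.trans_lt hqc
  have hle : ∀ u, c * ‖u‖ ≤ ‖B u‖ := fun u => by
    rcases eq_or_ne u 0 with rfl | hu
    · simp
    have h1 : c * ‖u‖ ^ 2 ≤ ‖B u‖ * ‖u‖ :=
      (hB u).trans ((le_abs_self _).trans ((B u).le_opNorm u))
    have : 0 < ‖u‖ := norm_pos_iff.2 hu
    nlinarith
  have hco : IsCoercive B := ⟨c, hc, fun u => by rw [mul_assoc, ← sq]; exact hB u⟩
  -- the Lax-Milgram theorem
  have hsurj : ∀ f : E →L[ℝ] ℝ, ∃ u, B u = f := fun f => by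
    refine ⟨hco.continuousLinearEquivOfBilin.symm ((InnerProductSpace.toDual ℝ E).symm f), ?_⟩
    ext w
    rw [← hco.continuousLinearEquivOfBilin_apply]
    simp
  choose S hS using hsurj
  -- `T` maps the ball of radius `R` to itself and contracts it with the ratio `q / c`
  let T : E → E := fun u => S (G u)
  have hT : ∀ u v, ‖u‖ ≤ R → ‖v‖ ≤ R → c * ‖T u - T v‖ ≤ q * ‖u - v‖ := fun u v hu hv => by
    refine (hle _).trans ?_
    rw [map_sub, hS, hS]
    exact hG u v hu hv
  have hG0' : ∀ u, ‖u‖ ≤ R → ‖G u‖ ≤ κ + q * ‖u‖ := fun u hu => by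
    have := hG u 0 hu (by simpa using hR)
    rw [sub_zero] at this
    calc ‖G u‖ = ‖G 0 + (G u - G 0)‖ := by congr 1; abel
      _ ≤ ‖G 0‖ + ‖G u - G 0‖ := norm_add_le _ _
      _ ≤ _ := by gcongr
  have hmaps : MapsTo T (Metric.closedBall 0 R) (Metric.closedBall 0 R) := fun u hu => by
    rw [mem_closedBall_zero_iff] at hu ⊢
    have h1 := (hle (T u)).trans_eq (congrArg norm (hS (G u)))
    have h2 := hG0' u hu
    have : c * ‖T u‖ ≤ c * R := by nlinarith
    exact le_of_mul_le_mul_left this hc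
  have hcontr : ContractingWith ⟨q / c, by positivity⟩ (hmaps.restrict T _ _) := by
    refine ⟨?_, LipschitzWith.of_dist_le_mul fun u v => ?_⟩
    · exact NNReal.coe_lt_coe.1 ((div_lt_one hc).2 hqc)
    · have := hT u v (mem_closedBall_zero_iff.1 u.2) (mem_closedBall_zero_iff.1 v.2)
      change dist (T u) (T v) ≤ q / c * dist (u : E) v
      rw [dist_eq_norm, dist_eq_norm, div_mul_eq_mul_div, le_div_iff₀ hc, mul_comm]
      exact this
  obtain ⟨u, hu, hfix, -⟩ := ContractingWith.exists_fixedPoint' Metric.isClosed_closedBall.isComplete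
    hmaps hcontr (x := 0) (by simpa using hR) (edist_ne_top _ _)
  rw [mem_closedBall_zero_iff] at hu
  have hfix' : B u = G u := by
    conv_lhs => rw [← hfix.eq]
    exact hS _
  refine ⟨u, hfix', ?_, hu, fun v hv hvR => ?_⟩
  · have h1 := hle u
    have h2 := hG0' u hu
    rw [hfix'] at h1
    linarith
  · have h1 := hle (v - u)
    rw [map_sub, hv, hfix'] at h1
    have h2 := hG v u hvR hu
    have : ‖v - u‖ ≤ 0 := by
      by_contra! h
      nlinarith
    exact sub_eq_zero.1 (norm_le_zero_iff.1 this)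

/-- `exists_unique_small_solution` for a closed subspace, with the nonlinearity given as a function
of two variables that is linear in the second. -/
lemma exists_unique_small_solution_mem {H : Type*} [NormedAddCommGroup H] [InnerProductSpace ℝ H]
    [CompleteSpace H] {S : Submodule ℝ H} (hS : IsClosed (S : Set H)) {B : H →L[ℝ] H →L[ℝ] ℝ}
    {g : H → H → ℝ} {c q κ R : ℝ} (hqc : q < c) (hq : 0 ≤ q) (hR : 0 ≤ R) (hκ0 : 0 ≤ κ)
    (hκ : κ ≤ (c - q) * R) (hB : ∀ u ∈ S, c * ‖u‖ ^ 2 ≤ B u u)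
    (hadd : ∀ u ∈ S, ∀ φ ∈ S, ∀ ψ ∈ S, g u (φ + ψ) = g u φ + g u ψ)
    (hsmul : ∀ u ∈ S, ∀ a : ℝ, ∀ φ ∈ S, g u (a • φ) = a * g u φ)
    (hbdd : ∀ u ∈ S, ∃ C, ∀ φ ∈ S, |g u φ| ≤ C * ‖φ‖)
    (hg0 : ∀ φ ∈ S, |g 0 φ| ≤ κ * ‖φ‖)
    (hg : ∀ u ∈ S, ∀ v ∈ S, ∀ φ ∈ S, ‖u‖ ≤ R → ‖v‖ ≤ R →
      |g u φ - g v φ| ≤ q * ‖u - v‖ * ‖φ‖) :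
    ∃ u ∈ S, (∀ φ ∈ S, B u φ = g u φ) ∧ (c - q) * ‖u‖ ≤ κ ∧
      ∀ v ∈ S, (∀ φ ∈ S, B v φ = g v φ) → ‖v‖ ≤ R → v = u := by
  have : CompleteSpace S := hS.completeSpace_coe
  have hGex : ∀ u : S, ∃ f : S →L[ℝ] ℝ, ∀ φ : S, f φ = g u φ := fun u => by
    obtain ⟨C, hC⟩ := hbdd u u.2
    exact ⟨LinearMap.mkContinuous
      { toFun := fun φ : S => g u φ
        map_add' := fun φ ψ => hadd u u.2 φ φ.2 ψ ψ.2
        map_smul' := fun a φ => hsmul u u.2 a φ φ.2 } C fun φ => hC φ φ.2, fun φ => rfl⟩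
  choose G hG using hGex
  obtain ⟨u, hu, hun, -, huniq⟩ := exists_unique_small_solution (G := G) (R := R)
    (B := B.bilinearComp S.subtypeL S.subtypeL) hqc hq hR (fun u => hB u u.2)
    (ContinuousLinearMap.opNorm_le_bound _ hκ0 fun φ => by
      rw [hG]; exact hg0 φ φ.2)
    (fun u v hu hv => ContinuousLinearMap.opNorm_le_bound _ (by positivity) fun φ => by
      rw [sub_apply, hG, hG]; exact hg u u.2 v v.2 φ φ.2 hu hv) hκ
  refine ⟨u, u.2, fun φ hφ => ?_, hun, fun v hv hvs hvR => ?_⟩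
  · rw [← hG u ⟨φ, hφ⟩, ← hu]; rfl
  · refine congrArg Subtype.val (huniq ⟨v, hv⟩ ?_ hvR)
    ext φ
    rw [hG, ← hvs φ φ.2]; rfl

section Channel

variable {D D' : Set Plane} {ε : ℝ}

lemma volume_rect (a b c d : ℝ) :
    volume (rect a b c d) = ENNReal.ofReal (b - a) * ENNReal.ofReal (d - c) := by
  rw [← measurePreserving_planeEquiv.measure_preimage (measurableSet_rect a b c d).nullMeasurableSet,
    planeEquiv_preimage_rect, Measure.volume_eq_prod, Measure.prod_prod, Real.volume_Ioo,
    Real.volume_Ioo]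

lemma volume_axis : volume {x : Plane | x 1 = 0} = 0 := by
  have hm : MeasurableSet {x : Plane | x 1 = 0} :=
    measurableSet_eq_fun (by fun_prop) measurable_const
  rw [← measurePreserving_planeEquiv.measure_preimage hm.nullMeasurableSet]
  have : planeEquiv ⁻¹' {x : Plane | x 1 = 0} = univ ×ˢ {0} := by
    ext p; simp [planeEquiv_apply]
  rw [this, Measure.volume_eq_prod, Measure.prod_prod]
  simp

lemma setIntegral_rect_add_low (hD : IsChannel D ε) {f : Plane → ℝ}
    (hf : Integrable f (volume.restrict D)) :
    ∫ x in D, f x = (∫ x in rect 0 1 0 1, f x) + ∫ x in lowPart D, f x := by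
  have hml := measurableSet_lowPart hD.isOpen
  rw [← setIntegral_union ?_ hml (hf.mono_measure (Measure.restrict_mono hD.unit_subset le_rfl))
    (hf.mono_measure (Measure.restrict_mono inter_subset_left le_rfl))]
  · refine setIntegral_congr_set (EventuallyLE.antisymm ?_
      (LE.le.eventuallyLE (union_subset hD.unit_subset inter_subset_left)))
    filter_upwards [show ∀ᵐ x : Plane, x 1 ≠ 0 by simpa [ae_iff] using volume_axis] with x hx hxD
    have hb := hD.subset_box hxD
    rcases lt_or_gt_of_ne hx with h | h
    · exact Or.inr ⟨hxD, h⟩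
    · exact Or.inl ⟨hb.1, h, hb.2.2⟩
  · exact Set.disjoint_left.2 fun x hx hx' => lt_asymm hx.2.1 hx'.2

lemma volume_lowPart_le (hD : IsChannel D ε) : volume (lowPart D) ≤ ENNReal.ofReal ε := by
  have h : lowPart D ⊆ rect 0 1 (-ε) 0 := fun x hx =>
    ⟨(hD.subset_rect hx.1).1, (hD.subset_rect hx.1).2.1, hx.2⟩
  refine (measure_mono h).trans_eq ?_
  rw [volume_rect]; simp

lemma abs_integral_mul_le_sqrt {μ : Measure Plane} {f g : Plane → ℝ} (hf : MemLp f 2 μ)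
    (hg : MemLp g 2 μ) : |∫ x, f x * g x ∂μ| ≤ √(∫ x, f x ^ 2 ∂μ) * √(∫ x, g x ^ 2 ∂μ) := by
  have key : ∀ {h : Plane → ℝ} (hh : MemLp h 2 μ), ‖hh.toLp‖ = √(∫ x, h x ^ 2 ∂μ) := fun hh => by
    rw [← Real.sqrt_sq (norm_nonneg _), Lp_norm_sq_eq]
    congr 1
    exact integral_congr_ae (hh.coeFn_toLp.mono fun x hx => by simp only [hx])
  have : ∫ x, f x * g x ∂μ = inner ℝ hf.toLp hg.toLp := by
    rw [L2.inner_def]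
    refine integral_congr_ae ?_
    filter_upwards [hf.coeFn_toLp, hg.coeFn_toLp] with x h1 h2
    simp only [h1, h2, RCLike.inner_apply, conj_trivial]
    ring
  rw [this, ← key hf, ← key hg]
  exact abs_real_inner_le_norm _ _

lemma abs_setIntegral_lowPart_le (hD : IsChannel D ε) {k : Plane → ℝ} {M : ℝ}
    (hk : Continuous k) (hkM : ∀ x, |k x| ≤ M) (u : Lp ℝ 2 (volume.restrict D)) :
    |∫ x in lowPart D, k x * u x| ≤ M * √ε * √(∫ x in lowPart D, u x ^ 2) := by
  have hsub : lowPart D ⊆ D := inter_subset_left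
  have hM : 0 ≤ M := (abs_nonneg _).trans (hkM 0)
  have hfin : volume (lowPart D) < ⊤ := (volume_lowPart_le hD).trans_lt ENNReal.ofReal_lt_top
  have hle := Measure.restrict_mono hsub (le_refl (volume : Measure Plane))
  refine (abs_integral_mul_le_sqrt ((hD.memLp_of_continuous hk).mono_measure hle)
    ((Lp.memLp u).mono_measure hle)).trans ?_
  gcongr
  rw [← Real.sqrt_sq hM, ← Real.sqrt_mul (sq_nonneg M)]
  refine Real.sqrt_le_sqrt ?_
  have : IsFiniteMeasure (volume.restrict (lowPart D)) := ⟨by simpa using hfin⟩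
  calc ∫ x in lowPart D, k x ^ 2 ≤ ∫ x in lowPart D, M ^ 2 := by
        refine integral_mono ((hD.memLp_of_continuous hk).mono_measure hle).integrable_sq
          (integrable_const _) fun x => ?_
        exact sq_le_sq' (abs_le.1 (hkM x)).1 (abs_le.1 (hkM x)).2
    _ = M ^ 2 * volume.real (lowPart D) := by simp [mul_comm]
    _ ≤ M ^ 2 * ε := by
        gcongr
        exact ENNReal.toReal_le_of_le_ofReal hD.pos.le (volume_lowPart_le hD)

lemma sqrt_setIntegral_sq_le (hsub : D' ⊆ D) (u : Lp ℝ 2 (volume.restrict D)) :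
    √(∫ x in D', u x ^ 2) ≤ ‖u‖ := by
  refine Real.sqrt_le_iff.2 ⟨norm_nonneg _, ?_⟩
  rw [Lp_norm_sq_eq]
  exact setIntegral_mono_set (Lp.memLp u).integrable_sq (Eventually.of_forall fun x => sq_nonneg _)
    hsub.eventuallyLE

/-- The Poiseuille profile, with its gradient, as an element of `VField D`. -/
structure IsPoiseuille (D : Set Plane) (lam : ℝ) (p : VField D) : Prop where
  first : IsTensor D (fun t => lam * (t * (t - 1))) (fun t => lam * (2 * t - 1))
    (fun _ => 1) (fun _ => 0) (p 0)
  second : p 1 = 0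

lemma exists_isPoiseuille (hD : IsChannel D ε) (lam : ℝ) : ∃ p, IsPoiseuille D lam p := by
  obtain ⟨z, hz⟩ := exists_isTensor hD (A := fun t => lam * (t * (t - 1)))
    (A' := fun t => lam * (2 * t - 1)) (T := fun _ => 1) (T' := fun _ => 0) (by fun_prop)
    (by fun_prop) (by fun_prop) (by fun_prop)
  exact ⟨WithLp.toLp 2 ![z, 0], hz, rfl⟩

namespace IsPoiseuille

variable {lam : ℝ} {p : VField D}

lemma horizontal_eq_zero (hp : IsPoiseuille D lam p) : p 0 1 = 0 := by
  ext
  filter_upwards [hp.first.horizontal, Lp.coeFn_zero ℝ 2 (volume.restrict D)] with x hx h0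
  rw [hx, h0]
  simp

lemma mem_solenoidal (hD : IsChannel D ε) (hp : IsPoiseuille D lam p) : p ∈ solenoidal D := by
  refine RoughChannel.mem_solenoidal.2 ⟨mem_velocity.2 fun i => ?_, ?_⟩
  · fin_cases i
    · refine tensor_mem_walls hD (fun t => ?_) (by fun_prop) (by simp) (by simp) contDiff_const
        (fun t => hasDerivAt_const t 1) hp.first
      exact (((hasDerivAt_id' t).fun_mul ((hasDerivAt_id' t).sub_const 1)).const_mul lam).congr_deriv
        (by ring)
    · change p 1 ∈ _
      rw [hp.second]; exact zero_mem _
  · rw [divergence_apply, hp.horizontal_eq_zero, hp.second]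
    simp

lemma norm_le (hD : IsChannel D ε) (hp : IsPoiseuille D lam p) : ‖p‖ ≤ |lam| := by
  refine abs_le_of_sq_le_sq' ?_ (abs_nonneg _) |>.2
  rw [PiLp.norm_sq_eq_of_L2, Fin.sum_univ_two, hp.second,
    hp.first.norm_sq hD (by fun_prop) (by fun_prop) (by fun_prop) (by fun_prop)]
  have e1 : ∫ t in (0 : ℝ)..1, (lam * (t * (t - 1))) ^ 2 = lam ^ 2 / 30 := by
    have : ∀ t : ℝ, (lam * (t * (t - 1))) ^ 2 = lam ^ 2 * (t ^ 4 - 2 * t ^ 3 + t ^ 2) :=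
      fun t => by ring
    simp only [this]
    rw [intervalIntegral.integral_const_mul, intervalIntegral.integral_add
      (by apply Continuous.intervalIntegrable; fun_prop)
      (by apply Continuous.intervalIntegrable; fun_prop), intervalIntegral.integral_sub
      (by apply Continuous.intervalIntegrable; fun_prop)
      (by apply Continuous.intervalIntegrable; fun_prop), intervalIntegral.integral_const_mul]
    simp only [integral_pow]
    norm_num; ring
  have e2 : ∫ t in (0 : ℝ)..1, (lam * (2 * t - 1)) ^ 2 = lam ^ 2 / 3 := by
    have : ∀ t : ℝ, (lam * (2 * t - 1)) ^ 2 = lam ^ 2 * (4 * t ^ 2 - 4 * t + 1) :=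
      fun t => by ring
    simp only [this]
    rw [intervalIntegral.integral_const_mul, intervalIntegral.integral_add
      (by apply Continuous.intervalIntegrable; fun_prop)
      (by apply Continuous.intervalIntegrable; fun_prop), intervalIntegral.integral_sub
      (by apply Continuous.intervalIntegrable; fun_prop)
      (by apply Continuous.intervalIntegrable; fun_prop), intervalIntegral.integral_const_mul,
      intervalIntegral.integral_const_mul]
    simp only [integral_pow, integral_id]
    norm_num; ring
  rw [e1, e2, sq_abs]
  simp
  nlinarith [sq_nonneg lam]

lemma convection_self (hp : IsPoiseuille D lam p) (z : VField D) : convection D p p z = 0 := by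
  have h1 : p 1 = 0 := hp.second
  have h0 : (0 : Lp ℝ 2 (volume.restrict D)) =ᵐ[volume.restrict D] 0 := Lp.coeFn_zero _ _ _
  have key : ∀ f g h : Plane → ℝ, f =ᵐ[volume.restrict D] 0 ∨ g =ᵐ[volume.restrict D] 0 →
      ∫ a in D, f a * g a * h a = 0 := fun f g h hfg => by
    rw [← integral_zero Plane ℝ (μ := volume.restrict D)]
    refine integral_congr_ae ?_
    rcases hfg with hf | hf <;> exact hf.mono fun a ha => by simp [ha]
  rw [convection, Fin.sum_univ_two, Fin.sum_univ_two, Fin.sum_univ_two]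
  have e : ∀ k, p 1 k = 0 := fun k => by rw [h1]; rfl
  rw [key _ _ _ (Or.inr ?_), key _ _ _ (Or.inl ?_), key _ _ _ (Or.inr ?_), key _ _ _ (Or.inl ?_)]
  · simp
  · rw [e]; exact h0
  · rw [e]; exact h0
  · rw [e]; exact h0
  · change (p 0 1 : Plane → ℝ) =ᵐ[_] _
    rw [hp.horizontal_eq_zero]; exact h0

end IsPoiseuille

/-- The functional `Φ ↦ ∫ Φ₁`. -/
noncomputable def flux (hD : IsChannel D ε) : VField D →L[ℝ] ℝ :=
  (innerSL ℝ (hD.memLp_of_continuous (continuous_const (y := (1 : ℝ)))).toLp).comp (entry D 0 0)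

lemma flux_apply (hD : IsChannel D ε) (x : VField D) : flux hD x = ∫ a in D, x 0 0 a := by
  change inner ℝ _ (x 0 0) = _
  rw [L2.inner_def]
  refine integral_congr_ae ?_
  filter_upwards [(hD.memLp_of_continuous (p := 2) (continuous_const (y := (1 : ℝ)))).coeFn_toLp]
    with a ha
  simp [ha]

/-- The Poiseuille profile solves the Stokes problem up to terms on the rough layer below the
axis. -/
lemma IsPoiseuille.residual_eq (hD : IsChannel D ε) {lam : ℝ} {p : VField D}
    (hp : IsPoiseuille D lam p) {φ : VField D} (hφ : φ ∈ velocity D) :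
    -2 * lam * flux hD φ - dirichlet D p φ =
      -2 * lam * (∫ x in lowPart D, φ 0 0 x) - lam * ∫ x in lowPart D, φ 0 2 x := by
  have hd : dirichlet D p φ = ∫ x in rect 0 1 0 1, lam * (2 * x 1 - 1) * φ 0 2 x := by
    have e1 : p 1 = 0 := hp.second
    rw [dirichlet_apply, Fin.sum_univ_two, Fin.sum_univ_two, Fin.sum_univ_two, e1]
    simp only [Fin.succ_zero_eq_one, Fin.succ_one_eq_two, hp.horizontal_eq_zero]
    simp only [PiLp.zero_apply, inner_zero_left, zero_add, add_zero]
    rw [L2.inner_def, ← inter_eq_self_of_subset_right hD.unit_subset,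
      ← setIntegral_indicator (measurableSet_rect 0 1 0 1)]
    refine integral_congr_ae ?_
    filter_upwards [hp.first.vertical] with x hx
    rw [hx]
    by_cases h : x ∈ rect 0 1 0 1 <;> simp [h, mul_comm]
  have hv := H1Zero_vertical hD (walls_subset_noSlip D 0) (mem_velocity.1 hφ 0)
    (g := fun t => 2 * t - 1) (g' := fun _ => 2) (τ := fun _ => 1)
    (fun t => by simpa using ((hasDerivAt_id t).const_mul 2).sub_const 1) (by fun_prop) (by fun_prop)
  have := hD.isFiniteMeasure
  rw [flux_apply, setIntegral_rect_add_low hD ((Lp.memLp (φ 0 0)).integrable one_le_two), hd]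
  simp only [mul_one, one_mul, mul_zero, zero_sub, neg_neg, integral_const_mul, mul_assoc] at hv ⊢
  linear_combination -lam * hv

/-- The residual lives in the layer of height `ε` below the axis, which gives the factor `√ε`. -/
lemma IsPoiseuille.abs_residual_le (hD : IsChannel D ε) {lam : ℝ} {p : VField D}
    (hp : IsPoiseuille D lam p) {φ : VField D} (hφ : φ ∈ velocity D) :
    |-2 * lam * flux hD φ - dirichlet D p φ| ≤ 3 * |lam| * √ε * ‖φ‖ := by
  have hε := hD.pos
  rw [hp.residual_eq hD hφ]
  have h1 : |∫ x in lowPart D, φ 0 0 x| ≤ √ε * ‖φ‖ := by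
    have h := abs_setIntegral_lowPart_le hD (k := fun _ => 1) (M := 1) continuous_const (by simp)
      (φ 0 0)
    simp only [one_mul] at h
    refine h.trans ?_
    gcongr
    exact (sqrt_setIntegral_sq_le inter_subset_left _).trans (norm_entry_le φ 0 0)
  have h2 : |∫ x in lowPart D, φ 0 2 x| ≤ √ε * ‖φ‖ := by
    have h := abs_setIntegral_lowPart_le hD (k := fun _ => 1) (M := 1) continuous_const (by simp)
      (φ 0 2)
    simp only [one_mul] at h
    refine h.trans ?_
    gcongr
    exact (sqrt_setIntegral_sq_le inter_subset_left _).trans (norm_entry_le φ 0 2)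
  calc _ ≤ |-2 * lam * ∫ x in lowPart D, φ 0 0 x| + |lam * ∫ x in lowPart D, φ 0 2 x| :=
        abs_sub _ _
    _ = 2 * |lam| * |∫ x in lowPart D, φ 0 0 x| + |lam| * |∫ x in lowPart D, φ 0 2 x| := by
        rw [abs_mul, abs_mul, abs_mul]; norm_num
    _ ≤ 2 * |lam| * (√ε * ‖φ‖) + |lam| * (√ε * ‖φ‖) := by gcongr
    _ = _ := by ring

lemma abs_convection_self_sub_le (hD : IsChannel D ε) {x y z : VField D} (hx : x ∈ velocity D)
    (hy : y ∈ velocity D) (hz : z ∈ velocity D) {M : ℝ} (hxM : ‖x‖ ≤ M) (hyM : ‖y‖ ≤ M) :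
    |convection D x x z - convection D y y z| ≤ 72 * M * ‖x - y‖ * ‖z‖ := by
  rw [convection_self_sub hD hx hy hz]
  have h1 := convection_le_norm (y := x) hD ((velocity D).sub_mem hx hy) hz
  have h2 := convection_le_norm (y := x - y) hD hy hz
  have h3 : 36 * ‖x - y‖ * ‖x‖ * ‖z‖ ≤ 36 * ‖x - y‖ * M * ‖z‖ := by gcongr
  have h4 : 36 * ‖y‖ * ‖x - y‖ * ‖z‖ ≤ 36 * M * ‖x - y‖ * ‖z‖ := by gcongr
  refine (abs_add_le _ _).trans ?_
  linarith

/-- The weak form of the stationary Navier-Stokes equations on divergence-free test fields, where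
the pressure drops out and the pressure difference `2 * lam` acts as a force. -/
def IsSolenoidalSolution (hD : IsChannel D ε) (lam : ℝ) (z : VField D) : Prop :=
  ∀ φ ∈ solenoidal D, dirichlet D z φ + convection D z z φ = -2 * lam * flux hD φ

/-- For small `lam` there is a solution close to the Poiseuille flow, at a distance of order `√ε`, and it
is the only one in a fixed ball around the Poiseuille flow. -/
theorem exists_isSolenoidalSolution (hD : IsChannel D ε) {lam : ℝ} (hlam : |lam| ≤ 1 / 100000)
    {p : VField D} (hp : IsPoiseuille D lam p) :
    ∃ v ∈ solenoidal D, IsSolenoidalSolution hD lam (p + v) ∧ ‖v‖ ≤ 30 * |lam| * √ε ∧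
      ∀ w ∈ solenoidal D, IsSolenoidalSolution hD lam (p + w) → ‖w‖ ≤ 1 / 1500 → w = v := by
  have hps := hp.mem_solenoidal hD
  have hpn := hp.norm_le hD
  have hmem : ∀ u ∈ solenoidal D, p + u ∈ velocity D := fun u hu =>
    (velocity D).add_mem hps.1 hu.1
  have hε1 : √ε ≤ 1 := Real.sqrt_le_one.2 hD.lt_one.le
  have hε0 : 0 ≤ √ε := Real.sqrt_nonneg _
  have n1 : ∀ w : VField D, ‖w‖ ≤ 1 / 1500 → ‖p + w‖ ≤ 1 / 720 := fun w hw => by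
    have := norm_add_le p w
    linarith
  -- `1 / 5` is the coercivity constant from Poincaré's inequality, `1 / 10 = 72 / 720` the Lipschitz
  -- constant of the convection on the ball; they lead to the factor `30 = 3 / (1 / 5 - 1 / 10)`
  obtain ⟨u, hu, hus, hun, huniq⟩ := exists_unique_small_solution_mem (isClosed_solenoidal D)
    (B := dirichlet D) (c := 1 / 5) (q := 1 / 10) (κ := 3 * |lam| * √ε) (R := 1 / 1500)
    (g := fun u φ => -2 * lam * flux hD φ - dirichlet D p φ - convection D (p + u) (p + u) φ)
    (by norm_num) (by norm_num) (by norm_num) (by positivity) (by nlinarith [abs_nonneg lam])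
    (fun u hu => by linarith [norm_sq_le_dirichlet hD hu.1])
    (fun u hu φ hφ ψ hψ => by
      rw [convection_add_right hD (hmem u hu) hφ.1 hψ.1, map_add, map_add]; ring)
    (fun u hu a φ hφ => by
      rw [convection_smul_right, map_smul, map_smul, smul_eq_mul, smul_eq_mul]; ring)
    (fun u hu => ⟨3 * |lam| * √ε + 36 * ‖p + u‖ * ‖p + u‖, fun φ hφ => by
      rw [add_mul]
      exact (abs_sub _ _).trans (add_le_add (hp.abs_residual_le hD hφ.1)
        (convection_le_norm hD (hmem u hu) hφ.1))⟩)
    (fun φ hφ => by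
      rw [add_zero, hp.convection_self, sub_zero]
      exact hp.abs_residual_le hD hφ.1)
    (fun u hu v hv φ hφ hun hvn => by
      rw [sub_sub_sub_cancel_left, abs_sub_comm]
      refine (abs_convection_self_sub_le hD (hmem u hu) (hmem v hv) hφ.1 (n1 u hun)
        (n1 v hvn)).trans_eq ?_
      rw [add_sub_add_left_eq_sub]
      ring)
  have hiff : ∀ w, (∀ φ ∈ solenoidal D, dirichlet D w φ =
      -2 * lam * flux hD φ - dirichlet D p φ - convection D (p + w) (p + w) φ) ↔
      IsSolenoidalSolution hD lam (p + w) := fun w => by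
    refine forall₂_congr fun φ _ => ?_
    rw [map_add, add_apply]
    constructor <;> intro h <;> linarith
  refine ⟨u, hu, (hiff u).1 hus, by linarith, fun w hw hws hwn => huniq w hw ((hiff w).2 hws) hwn⟩

end Channel

/-! ### Weakly harmonic functions -/

/-- `φ ∈ C_c^∞(D)`. -/
structure IsTestIn (D : Set Plane) (φ : Plane → ℝ) : Prop where
  contDiff : ContDiff ℝ ∞ φ
  hasCompactSupport : HasCompactSupport φ
  tsupport_subset : tsupport φ ⊆ D

/-- The classical Laplacian. -/
noncomputable def laplacian (ψ : Plane → ℝ) (x : Plane) : ℝ :=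
  partialDeriv 0 (partialDeriv 0 ψ) x + partialDeriv 1 (partialDeriv 1 ψ) x

lemma partialDeriv_radial {χ χ' : ℝ → ℝ} (hχ : ∀ s, HasDerivAt χ (χ' s) s) (x : Plane) (j : Fin 2) :
    partialDeriv j (fun z => χ (‖z - x‖ ^ 2)) = fun z => χ' (‖z - x‖ ^ 2) * (2 * (z j - x j)) := by
  ext z
  have h1 : HasFDerivAt (fun z : Plane => ‖z - x‖ ^ 2)
      (2 • (innerSL ℝ (z - x)).comp (ContinuousLinearMap.id ℝ Plane)) z :=
    ((hasFDerivAt_id z).sub_const x).norm_sq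
  have h2 := (hχ (‖z - x‖ ^ 2)).comp_hasFDerivAt z h1
  rw [partialDeriv, show (fun z => χ (‖z - x‖ ^ 2)) = χ ∘ fun z : Plane => ‖z - x‖ ^ 2 from rfl,
    h2.fderiv]
  simp [EuclideanSpace.inner_single_right]

lemma norm_sub_sq_plane (z x : Plane) : ‖z - x‖ ^ 2 = (z 0 - x 0) ^ 2 + (z 1 - x 1) ^ 2 := by
  simp [EuclideanSpace.real_norm_sq_eq, Fin.sum_univ_two]

lemma differentiable_radial {χ : ℝ → ℝ} (hχ : Differentiable ℝ χ) (x : Plane) :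
    Differentiable ℝ fun z : Plane => χ (‖z - x‖ ^ 2) :=
  hχ.comp ((differentiable_id.sub_const x).norm_sq ℝ)

lemma laplacian_radial {χ χ' χ'' : ℝ → ℝ} (hχ : ∀ s, HasDerivAt χ (χ' s) s)
    (hχ' : ∀ s, HasDerivAt χ' (χ'' s) s) (x z : Plane) :
    laplacian (fun z => χ (‖z - x‖ ^ 2)) z = 4 * ‖z - x‖ ^ 2 * χ'' (‖z - x‖ ^ 2)
      + 4 * χ' (‖z - x‖ ^ 2) := by
  have key : ∀ j : Fin 2, partialDeriv j (partialDeriv j fun z => χ (‖z - x‖ ^ 2)) z =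
      4 * (z j - x j) ^ 2 * χ'' (‖z - x‖ ^ 2) + 2 * χ' (‖z - x‖ ^ 2) := fun j => by
    have hd : Differentiable ℝ χ' := fun s => (hχ' s).differentiableAt
    have h2 : partialDeriv j (fun z : Plane => 2 * (z j - x j)) z = 2 := by
      have : HasFDerivAt (fun z : Plane => 2 * (z j - x j))
          ((2 : ℝ) • (EuclideanSpace.proj j : Plane →L[ℝ] ℝ)) z :=
        (((EuclideanSpace.proj j : Plane →L[ℝ] ℝ).hasFDerivAt).sub_const (x j)).const_mul 2
      rw [partialDeriv, this.fderiv]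
      simp
    rw [partialDeriv_radial hχ, partialDeriv_mul (differentiable_radial hd x) (by fun_prop), h2,
      partialDeriv_radial hχ']
    ring
  rw [laplacian, key, key, norm_sub_sq_plane]
  ring

lemma contDiff_radial {χ : ℝ → ℝ} (hχ : ContDiff ℝ ∞ χ) (x : Plane) :
    ContDiff ℝ ∞ fun z : Plane => χ (‖z - x‖ ^ 2) :=
  hχ.comp ((contDiff_id.sub contDiff_const).norm_sq ℝ)

lemma tsupport_radial_subset {χ : ℝ → ℝ} {r : ℝ} (hr : 0 ≤ r) (hχ : ∀ s, r ^ 2 ≤ s → χ s = 0)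
    (x : Plane) : tsupport (fun z : Plane => χ (‖z - x‖ ^ 2)) ⊆ Metric.closedBall x r := by
  refine closure_minimal (fun z hz => ?_) Metric.isClosed_closedBall
  rw [mem_closedBall_iff_norm]
  by_contra! h
  exact hz (hχ _ (by gcongr))

lemma isTestIn_radial {D : Set Plane} {χ : ℝ → ℝ} (hχ : ContDiff ℝ ∞ χ) {r : ℝ} (hr : 0 ≤ r)
    (h0 : ∀ s, r ^ 2 ≤ s → χ s = 0) {x : Plane} (hx : Metric.closedBall x r ⊆ D) :
    IsTestIn D fun z => χ (‖z - x‖ ^ 2) :=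
  ⟨contDiff_radial hχ x, (isCompact_closedBall x r).of_isClosed_subset (isClosed_tsupport _)
    (tsupport_radial_subset hr h0 x), (tsupport_radial_subset hr h0 x).trans hx⟩

/-- A smooth profile supported in an annulus whose radial extension has integral one. -/
lemma exists_profile : ∃ g : ℝ → ℝ, ContDiff ℝ ∞ g ∧ (∀ s, s ≤ 1 / 4 → g s = 0) ∧
    (∀ s, 1 ≤ s → g s = 0) ∧ ∫ z : Plane, g (‖z‖ ^ 2) = 1 := by
  let b : ContDiffBump (1 / 2 : ℝ) := ⟨1 / 8, 1 / 4, by norm_num, by norm_num⟩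
  have hb0 : ∀ s, 1 / 4 ≤ |s - 1 / 2| → b s = 0 := fun s hs =>
    b.zero_of_le_dist (by rwa [Real.dist_eq])
  have hcd : ContDiff ℝ ∞ fun z : Plane => b (‖z‖ ^ 2) := by
    simpa using contDiff_radial b.contDiff (0 : Plane)
  have hz : ∀ s, (1 : ℝ) ≤ s → b s = 0 := fun s hs => hb0 s (by rw [abs_of_nonneg] <;> linarith)
  have hcs : HasCompactSupport fun z : Plane => b (‖z‖ ^ 2) := by
    have := tsupport_radial_subset (χ := b) (r := 1) zero_le_one (by simpa using hz) (0 : Plane)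
    simp only [sub_zero] at this
    exact (isCompact_closedBall (0 : Plane) 1).of_isClosed_subset (isClosed_tsupport _) this
  have hpos : 0 < ∫ z : Plane, b (‖z‖ ^ 2) := by
    refine (hcd.continuous.integral_pos_of_hasCompactSupport_nonneg_nonzero hcs
      (fun z => b.nonneg) (x := EuclideanSpace.single 0 (√(1 / 2))) ?_)
    rw [PiLp.norm_single, Real.norm_of_nonneg (Real.sqrt_nonneg _), Real.sq_sqrt (by norm_num)]
    exact (b.pos_of_mem_ball (Metric.mem_ball_self b.rOut_pos)).ne'
  refine ⟨fun s => (∫ z : Plane, b (‖z‖ ^ 2))⁻¹ * b s, contDiff_const.mul b.contDiff,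
    fun s hs => ?_, fun s hs => ?_, ?_⟩
  · simp only [hb0 s (by rw [abs_sub_comm, abs_of_nonneg] <;> linarith), mul_zero]
  · simp only [hz s hs, mul_zero]
  · rw [integral_const_mul, inv_mul_cancel₀ hpos.ne']

/-- The radial profile of the mollifier, as a function of the squared distance. It vanishes near the
origin, so that its rescalings differ by Laplacians of smooth radial functions for a reason that
needs no analysis at the origin. -/
noncomputable def profile : ℝ → ℝ := exists_profile.choose

lemma contDiff_profile : ContDiff ℝ ∞ profile := exists_profile.choose_spec.1
lemma profile_of_le {s : ℝ} (hs : s ≤ 1 / 4) : profile s = 0 := exists_profile.choose_spec.2.1 s hs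
lemma profile_of_ge {s : ℝ} (hs : 1 ≤ s) : profile s = 0 := exists_profile.choose_spec.2.2.1 s hs
lemma integral_profile : ∫ z : Plane, profile (‖z‖ ^ 2) = 1 := exists_profile.choose_spec.2.2.2

lemma contDiff_primitive {q : ℝ → ℝ} (hq : ContDiff ℝ ∞ q) (a : ℝ) :
    ContDiff ℝ ∞ fun s => ∫ t in a..s, q t := by
  have h : ∀ s, HasDerivAt (fun s => ∫ t in a..s, q t) (q s) s := fun s =>
    (hq.continuous.integral_hasStrictDerivAt a s).hasDerivAt
  rw [contDiff_infty_iff_deriv]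
  refine ⟨fun s => (h s).differentiableAt, ?_⟩
  rwa [show deriv (fun s => ∫ t in a..s, q t) = q from funext fun s => (h s).deriv]

/-- The radial mollifier at scale `r`. -/
noncomputable def mollifier (r : ℝ) (z : Plane) : ℝ := profile (‖z‖ ^ 2 / r ^ 2) / r ^ 2

/-- Two rescalings of the radial mollifier differ by the Laplacian of a test function. -/
lemma exists_laplacian_eq_mollifier_sub {r₁ r₂ : ℝ} (h1 : 0 < r₁) (h12 : r₁ < r₂) :
    ∃ χ : ℝ → ℝ, ContDiff ℝ ∞ χ ∧ (∀ s, r₂ ^ 2 ≤ s → χ s = 0) ∧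
      ∀ x z, laplacian (fun z => χ (‖z - x‖ ^ 2)) z = mollifier r₁ (z - x) - mollifier r₂ (z - x) := by
  have h2 : 0 < r₂ := h1.trans h12
  have hg := contDiff_profile
  set G : ℝ → ℝ := fun s => ∫ t in (0 : ℝ)..s, profile t with hGdef
  have hG : ContDiff ℝ ∞ G := contDiff_primitive hg 0
  have hGd : ∀ s, HasDerivAt G (profile s) s := fun s =>
    (hg.continuous.integral_hasStrictDerivAt 0 s).hasDerivAt
  have hGle : ∀ s, s ≤ 1 / 4 → G s = 0 := fun s hs => by
    refine intervalIntegral.integral_zero_ae (Eventually.of_forall fun t ht => profile_of_le ?_)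
    rcases le_total 0 s with h | h
    · rw [uIoc_of_le h] at ht; exact ht.2.trans hs
    · rw [uIoc_of_ge h] at ht; linarith [ht.2]
  have hGge : ∀ s, 1 ≤ s → G s = G 1 := fun s hs => by
    have : G 1 + ∫ t in (1 : ℝ)..s, profile t = G s :=
      intervalIntegral.integral_add_adjacent_intervals (hg.continuous.intervalIntegrable _ _)
        (hg.continuous.intervalIntegrable _ _)
    rw [← this, intervalIntegral.integral_zero_ae (Eventually.of_forall fun t ht => profile_of_ge ?_),
      add_zero]
    rw [uIoc_of_le hs] at ht; exact ht.1.le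
  set N : ℝ → ℝ := fun s => G (s / r₁ ^ 2) - G (s / r₂ ^ 2) with hN
  have hNc : ContDiff ℝ ∞ N :=
    (hG.comp (contDiff_id.div_const _)).sub (hG.comp (contDiff_id.div_const _))
  have hNd : ∀ s, HasDerivAt N (profile (s / r₁ ^ 2) / r₁ ^ 2 - profile (s / r₂ ^ 2) / r₂ ^ 2) s :=
    fun s => by
    have e : ∀ r : ℝ, HasDerivAt (fun s => G (s / r ^ 2)) (profile (s / r ^ 2) / r ^ 2) s := fun r =>
      ((hGd (s / r ^ 2)).comp_of_eq s ((hasDerivAt_id' s).div_const (r ^ 2)) rfl).congr_deriv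
        (mul_one_div _ _)
    exact (e r₁).sub (e r₂)
  have hsq : r₁ ^ 2 < r₂ ^ 2 := by gcongr
  have hN0 : ∀ s, s ≤ r₁ ^ 2 / 4 → N s = 0 := fun s hs => by
    have a : s / r₁ ^ 2 ≤ 1 / 4 := by rw [div_le_iff₀ (by positivity)]; linarith
    have b : s / r₂ ^ 2 ≤ 1 / 4 := by rw [div_le_iff₀ (by positivity)]; linarith
    simp only [hN]
    rw [hGle _ a, hGle _ b, sub_zero]
  have hN1 : ∀ s, r₂ ^ 2 ≤ s → N s = 0 := fun s hs => by
    have a : 1 ≤ s / r₁ ^ 2 := by rw [le_div_iff₀ (by positivity)]; linarith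
    have b : 1 ≤ s / r₂ ^ 2 := by rw [le_div_iff₀ (by positivity)]; linarith
    simp only [hN]
    rw [hGge _ a, hGge _ b, sub_self]
  -- With `s = ‖z‖²` the Laplacian of `χ(s)` is `(4 s χ')'`. Hence `χ' = N / (4 s)`, which is smooth
  -- since `N` vanishes near the origin.
  set q : ℝ → ℝ := fun s => N s / (4 * s) with hq
  have hqs : ∀ s, 4 * s * q s = N s := fun s => by
    rcases eq_or_ne s 0 with rfl | h
    · rw [hN0 0 (by positivity)]; simp
    · simp only [hq]; field_simp
  have hqc : ContDiff ℝ ∞ q := by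
    rw [contDiff_iff_contDiffAt]
    intro s
    rcases lt_or_ge s (r₁ ^ 2 / 4) with h | h
    · refine (contDiffAt_const (c := (0 : ℝ))).congr_of_eventuallyEq ?_
      filter_upwards [gt_mem_nhds h] with t ht
      simp only [hq]
      rw [hN0 t (le_of_lt ht), zero_div]
    · have : 4 * s ≠ 0 := by have : 0 < r₁ ^ 2 / 4 := by positivity
                             linarith
      exact hNc.contDiffAt.div (contDiffAt_const.mul contDiffAt_id) this
  have hqd : ∀ s, HasDerivAt q (deriv q s) s := fun s =>
    (hqc.differentiable (by simp) s).hasDerivAt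
  set χ : ℝ → ℝ := fun s => ∫ t in (r₂ ^ 2)..s, q t with hχ
  have hχd : ∀ s, HasDerivAt χ (q s) s := fun s =>
    (hqc.continuous.integral_hasStrictDerivAt (r₂ ^ 2) s).hasDerivAt
  refine ⟨χ, contDiff_primitive hqc _, fun s hs => ?_, fun x z => ?_⟩
  · refine intervalIntegral.integral_zero_ae (Eventually.of_forall fun t ht => ?_)
    rw [uIoc_of_le hs] at ht
    simp only [hq]
    rw [hN1 t ht.1.le, zero_div]
  · rw [laplacian_radial hχd hqd]
    have h3 : HasDerivAt (fun s => 4 * s * q s)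
        (4 * q (‖z - x‖ ^ 2) + 4 * ‖z - x‖ ^ 2 * deriv q (‖z - x‖ ^ 2)) (‖z - x‖ ^ 2) := by
      refine ((((hasDerivAt_id' (‖z - x‖ ^ 2)).const_mul 4).fun_mul (hqd _))).congr_deriv ?_
      ring
    rw [show (fun s => 4 * s * q s) = N from funext hqs] at h3
    have h4 := h3.unique (hNd _)
    simp only [mollifier]
    linarith

section Mollifier

lemma contDiff_mollifier (r : ℝ) : ContDiff ℝ ∞ (mollifier r) :=
  ((contDiff_profile.comp (contDiff_id.div_const (r ^ 2))).comp (contDiff_norm_sq ℝ)).div_const _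

lemma mollifier_neg (r : ℝ) (z : Plane) : mollifier r (-z) = mollifier r z := by
  simp [mollifier]

lemma mollifier_eq_zero {r : ℝ} (hr : 0 < r) {z : Plane} (hz : r ≤ ‖z‖) : mollifier r z = 0 := by
  rw [mollifier, profile_of_ge, zero_div]
  rw [le_div_iff₀ (by positivity), one_mul]
  gcongr

lemma tsupport_mollifier_subset {r : ℝ} (hr : 0 < r) :
    tsupport (mollifier r) ⊆ Metric.closedBall 0 r := by
  refine closure_minimal (fun z hz => ?_) Metric.isClosed_closedBall
  rw [mem_closedBall_zero_iff]
  by_contra! h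
  exact hz (mollifier_eq_zero hr h.le)

lemma hasCompactSupport_mollifier {r : ℝ} (hr : 0 < r) : HasCompactSupport (mollifier r) :=
  (isCompact_closedBall (0 : Plane) r).of_isClosed_subset (isClosed_tsupport _)
    (tsupport_mollifier_subset hr)

lemma integral_mollifier {r : ℝ} (hr : 0 < r) : ∫ z, mollifier r z = 1 := by
  have h := Measure.integral_comp_inv_smul_of_nonneg (volume : Measure Plane)
    (fun z : Plane => profile (‖z‖ ^ 2)) hr.le
  rw [integral_profile, finrank_euclideanSpace_fin] at h
  have : ∀ z : Plane, mollifier r z = (r ^ 2)⁻¹ * profile (‖r⁻¹ • z‖ ^ 2) := fun z => by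
    rw [mollifier, norm_smul, mul_pow, norm_inv, Real.norm_of_nonneg hr.le, inv_pow]
    ring_nf
  simp only [this]
  rw [integral_const_mul, h]
  simp [hr.ne']

lemma exists_mollifier_bound : ∃ A : ℝ, 0 ≤ A ∧ ∀ r : ℝ, 0 < r → ∀ z,
    |mollifier r z| ≤ A / r ^ 2 ∧ ∀ j, |partialDeriv j (mollifier r) z| ≤ A / r ^ 3 := by
  have hb : ∀ f : ℝ → ℝ, Continuous f → ∃ A, ∀ s ∈ Icc (0 : ℝ) 1, ‖f s‖ ≤ A := fun f hf =>
    isCompact_Icc.exists_bound_of_continuousOn hf.continuousOn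
  obtain ⟨A, hA⟩ := hb _ contDiff_profile.continuous
  obtain ⟨A', hA'⟩ := hb _ (contDiff_profile.continuous_deriv (by simp))
  have hA0 : 0 ≤ A := (norm_nonneg _).trans (hA 0 (by simp))
  have hA0' : 0 ≤ A' := (norm_nonneg _).trans (hA' 0 (by simp))
  refine ⟨A + 2 * A', by positivity, fun r hr z => ?_⟩
  rcases lt_or_ge r ‖z‖ with h | h
  · constructor
    · rw [mollifier_eq_zero hr h.le, abs_zero]; positivity
    · intro j
      have : mollifier r =ᶠ[𝓝 z] 0 := by
        filter_upwards [continuous_norm.continuousAt.eventually (lt_mem_nhds h)] with w hw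
        exact mollifier_eq_zero hr hw.le
      rw [partialDeriv_eq_zero this, abs_zero]; positivity
  · have hs : ‖z‖ ^ 2 / r ^ 2 ∈ Icc (0 : ℝ) 1 :=
      ⟨by positivity, by rw [div_le_one (by positivity)]; gcongr⟩
    constructor
    · rw [mollifier, abs_div, abs_of_pos (by positivity : 0 < r ^ 2)]
      gcongr
      have := hA _ hs
      rw [Real.norm_eq_abs] at this
      linarith
    · intro j
      have hd : ∀ s, HasDerivAt (fun s => profile (s / r ^ 2) / r ^ 2)
          (deriv profile (s / r ^ 2) * (1 / r ^ 2) / r ^ 2) s := fun s =>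
        ((contDiff_profile.differentiable (by simp) (s / r ^ 2)).hasDerivAt.comp_of_eq s
          ((hasDerivAt_id' s).div_const (r ^ 2)) rfl).div_const _
      have h1 := congrFun (partialDeriv_radial hd 0 j) z
      simp only [sub_zero, PiLp.zero_apply] at h1
      have h2 : mollifier r = fun z => profile (‖z‖ ^ 2 / r ^ 2) / r ^ 2 := rfl
      have h3 := hA' _ hs
      have h4 : |z j| ≤ r := (PiLp.norm_apply_le z j).trans h
      rw [Real.norm_eq_abs] at h3
      rw [h2, h1, abs_mul, abs_div, abs_mul, abs_of_pos (by positivity : 0 < 1 / r ^ 2),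
        abs_of_pos (by positivity : 0 < r ^ 2), abs_mul, abs_two]
      calc |deriv profile (‖z‖ ^ 2 / r ^ 2)| * (1 / r ^ 2) / r ^ 2 * (2 * |z j|)
          ≤ A' * (1 / r ^ 2) / r ^ 2 * (2 * r) := by gcongr
        _ = 2 * A' / r ^ 3 := by field_simp
        _ ≤ _ := by gcongr; linarith

end Mollifier

section Harmonic

variable {D : Set Plane} {h : Plane → ℝ}

/-- `h` is harmonic in `D` in the sense of distributions. -/
def IsWeaklyHarmonic (D : Set Plane) (h : Plane → ℝ) : Prop :=
  ∀ ψ, IsTestIn D ψ → ∫ x in D, h x * laplacian ψ x = 0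

lemma IsWeaklyHarmonic.setIntegral_mollifier_eq (hh : IsWeaklyHarmonic D h) (hi : IntegrableOn h D)
    {x : Plane} {r s : ℝ} (hr : 0 < r) (hs : 0 < s) (hxr : Metric.closedBall x r ⊆ D)
    (hxs : Metric.closedBall x s ⊆ D) :
    ∫ z in D, h z * mollifier r (z - x) = ∫ z in D, h z * mollifier s (z - x) := by
  have key : ∀ {r s : ℝ}, 0 < r → r < s → Metric.closedBall x s ⊆ D →
      ∫ z in D, h z * mollifier r (z - x) = ∫ z in D, h z * mollifier s (z - x) := by
    intro r s hr hrs hxs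
    have hs := hr.trans hrs
    obtain ⟨χ, hχ, hχ0, hl⟩ := exists_laplacian_eq_mollifier_sub hr hrs
    have h1 := hh _ (isTestIn_radial hχ hs.le hχ0 hxs)
    simp only [hl, mul_sub] at h1
    obtain ⟨A, -, hA⟩ := exists_mollifier_bound
    have hint : ∀ t, 0 < t → Integrable (fun z => h z * mollifier t (z - x)) (volume.restrict D) :=
      fun t ht => Integrable.mul_bdd hi
        ((contDiff_mollifier t).continuous.comp (continuous_id.sub continuous_const)).aestronglyMeasurable
        (Eventually.of_forall fun z => (hA t ht (z - x)).1)
    rw [integral_sub (hint r hr) (hint s hs)] at h1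
    linarith
  rcases lt_trichotomy r s with h | h | h
  · exact key hr h hxs
  · rw [h]
  · exact (key hs h hxr).symm

/-- The distance to the complement of `D`. -/
noncomputable def depth (D : Set Plane) (x : Plane) : ℝ := Metric.infDist x Dᶜ

lemma depth_pos (hD : IsOpen D) (hne : Dᶜ.Nonempty) {x : Plane} (hx : x ∈ D) : 0 < depth D x :=
  (hD.isClosed_compl.notMem_iff_infDist_pos hne).1 (by simpa using hx)

lemma continuous_depth (D : Set Plane) : Continuous (depth D) := Metric.continuous_infDist_pt _

lemma closedBall_subset_of_lt_depth {x : Plane} {r : ℝ} (hr : r < depth D x) :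
    Metric.closedBall x r ⊆ D :=
  (Metric.closedBall_subset_ball hr).trans Metric.ball_infDist_compl_subset

lemma depth_le_add (x y : Plane) : depth D x ≤ depth D y + dist x y :=
  Metric.infDist_le_infDist_add_dist

/-- The smooth representative of a weakly harmonic function: its average against the radial
mollifier, at any scale that fits into `D`. -/
noncomputable def harmonicRep (D : Set Plane) (h : Plane → ℝ) (x : Plane) : ℝ :=
  ∫ z in D, h z * mollifier (depth D x / 4) (z - x)

lemma IsWeaklyHarmonic.harmonicRep_eq (hh : IsWeaklyHarmonic D h) (hi : IntegrableOn h D)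
    (hD : IsOpen D) (hne : Dᶜ.Nonempty) {x : Plane} (hx : x ∈ D) {r : ℝ} (hr : 0 < r)
    (hxr : Metric.closedBall x r ⊆ D) :
    harmonicRep D h x = ∫ z in D, h z * mollifier r (z - x) := by
  have hp := depth_pos hD hne hx
  exact hh.setIntegral_mollifier_eq hi (by positivity) hr
    (closedBall_subset_of_lt_depth (by linarith)) hxr

lemma setIntegral_mollifier {x : Plane} {r : ℝ} (hr : 0 < r) (hxr : Metric.closedBall x r ⊆ D) :
    ∫ z in D, mollifier r (z - x) = 1 := by
  rw [setIntegral_eq_integral_of_forall_compl_eq_zero, integral_sub_right_eq_self, integral_mollifier hr]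
  intro z hz
  refine mollifier_eq_zero hr ?_
  by_contra! hlt
  exact hz (hxr (mem_closedBall_iff_norm.2 hlt.le))

lemma setIntegral_eq_closedBall (hD : IsOpen D) {f k : Plane → ℝ} {x : Plane} {r : ℝ}
    (hxr : Metric.closedBall x r ⊆ D) (hk : ∀ z, r < ‖z - x‖ → k z = 0) :
    ∫ z in D, f z * k z = ∫ z in Metric.closedBall x r, f z * k z := by
  refine setIntegral_eq_of_subset_of_forall_sdiff_eq_zero hD.measurableSet hxr fun z hz => ?_
  rw [hk z (not_le.1 fun h => hz.2 (mem_closedBall_iff_norm.2 h)), mul_zero]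

lemma volume_real_closedBall {x : Plane} {r : ℝ} (hr : 0 ≤ r) :
    volume.real (Metric.closedBall x r) = r ^ 2 * Real.pi := by
  rw [Measure.real, EuclideanSpace.volume_closedBall_fin_two, ENNReal.toReal_mul,
    ENNReal.toReal_pow, ENNReal.toReal_ofReal hr, ENNReal.toReal_ofReal Real.pi_pos.le]

/-- An integral against a kernel that is bounded by `a` and supported in a ball. -/
lemma abs_setIntegral_kernel_le (hD : IsOpen D) {f k : Plane → ℝ}
    (hf : MemLp f 2 (volume.restrict D)) {x : Plane} {r a : ℝ} (hr : 0 ≤ r)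
    (hxr : Metric.closedBall x r ⊆ D) (hkc : Continuous k) (hk : ∀ z, r < ‖z - x‖ → k z = 0)
    (hka : ∀ z, |k z| ≤ a) :
    (∫ z in D, f z * k z) ^ 2 ≤ 4 * a ^ 2 * r ^ 2 * ∫ z in Metric.closedBall x r, f z ^ 2 := by
  have ha : 0 ≤ a := (abs_nonneg _).trans (hka x)
  have hfin : IsFiniteMeasure (volume.restrict (Metric.closedBall x r)) :=
    ⟨by simpa using (isCompact_closedBall x r).measure_lt_top (μ := volume)⟩
  have hkm : MemLp k 2 (volume.restrict (Metric.closedBall x r)) :=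
    MemLp.of_bound hkc.aestronglyMeasurable a (Eventually.of_forall hka)
  rw [setIntegral_eq_closedBall hD hxr hk, ← sq_abs]
  have h1 := abs_integral_mul_le_sqrt (hf.mono_measure (Measure.restrict_mono hxr le_rfl)) hkm
  have h2 : ∫ z in Metric.closedBall x r, k z ^ 2 ≤ 4 * a ^ 2 * r ^ 2 := by
    calc ∫ z in Metric.closedBall x r, k z ^ 2 ≤ ∫ z in Metric.closedBall x r, a ^ 2 := by
          refine integral_mono hkm.integrable_sq (integrable_const _) fun z => ?_
          exact sq_le_sq' (abs_le.1 (hka z)).1 (abs_le.1 (hka z)).2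
      _ = a ^ 2 * (r ^ 2 * Real.pi) := by simp [volume_real_closedBall hr, mul_comm]
      _ ≤ a ^ 2 * (r ^ 2 * 4) := by gcongr; exact Real.pi_le_four
      _ = _ := by ring
  calc _ ≤ (√(∫ z in Metric.closedBall x r, f z ^ 2) *
        √(∫ z in Metric.closedBall x r, k z ^ 2)) ^ 2 := by gcongr
    _ = (∫ z in Metric.closedBall x r, f z ^ 2) * ∫ z in Metric.closedBall x r, k z ^ 2 := by
        rw [mul_pow, Real.sq_sqrt (integral_nonneg fun _ => sq_nonneg _),
          Real.sq_sqrt (integral_nonneg fun _ => sq_nonneg _)]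
    _ ≤ (∫ z in Metric.closedBall x r, f z ^ 2) * (4 * a ^ 2 * r ^ 2) := by
        gcongr
    _ = _ := by ring

/-- Weyl's lemma: the smooth representative is a representative. -/
lemma IsWeaklyHarmonic.harmonicRep_ae_eq (hh : IsWeaklyHarmonic D h) (hi : IntegrableOn h D)
    (hD : IsOpen D) (hne : Dᶜ.Nonempty) : harmonicRep D h =ᵐ[volume.restrict D] h := by
  have hi' : LocallyIntegrable (D.indicator h) volume :=
    (hi.integrable_indicator hD.measurableSet).locallyIntegrable
  rw [EventuallyEq, ae_restrict_iff' hD.measurableSet]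
  obtain ⟨A, hA0, hA⟩ := exists_mollifier_bound
  filter_upwards [IsUnifLocDoublingMeasure.ae_tendsto_average_norm_sub volume hi' 1] with x hx hxD
  have hp := depth_pos hD hne hxD
  have h1 := hx (ι := ℝ) (l := 𝓝[>] 0) (fun _ => x) id tendsto_id
    (by filter_upwards [self_mem_nhdsWithin] with r hr
        simpa using le_of_lt (mem_Ioi.1 hr))
  have h2 : Tendsto (fun r => A * Real.pi * ⨍ y in Metric.closedBall x r,
      ‖D.indicator h y - D.indicator h x‖) (𝓝[>] 0) (𝓝 0) := by
    simpa using h1.const_mul (A * Real.pi)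
  have h3 : ∀ᶠ r in 𝓝[>] (0 : ℝ), |harmonicRep D h x - h x| ≤
      A * Real.pi * ⨍ y in Metric.closedBall x r, ‖D.indicator h y - D.indicator h x‖ := by
    filter_upwards [Ioo_mem_nhdsGT hp] with r hr
    have hr0 : 0 < r := hr.1
    have hball := closedBall_subset_of_lt_depth hr.2
    have hmb : MeasurableSet (Metric.closedBall x r) := Metric.isClosed_closedBall.measurableSet
    have hih : IntegrableOn h (Metric.closedBall x r) := hi.mono_set hball
    have hic : ∀ c : ℝ, IntegrableOn (fun _ => c) (Metric.closedBall x r) := fun c =>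
      integrableOn_const (isCompact_closedBall x r).measure_ne_top
    have hk0 : ∀ z, r < ‖z - x‖ → mollifier r (z - x) = 0 := fun z hz => mollifier_eq_zero hr0 hz.le
    have hbd : ∀ {f : Plane → ℝ}, IntegrableOn f (Metric.closedBall x r) →
        IntegrableOn (fun z => f z * mollifier r (z - x)) (Metric.closedBall x r) := fun hf =>
      Integrable.mul_bdd hf ((contDiff_mollifier r).continuous.comp
        (continuous_id.sub continuous_const)).aestronglyMeasurable
        (Eventually.of_forall fun z => (hA r hr0 (z - x)).1)
    have e1 : h x = ∫ z in Metric.closedBall x r, h x * mollifier r (z - x) := by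
      rw [← setIntegral_eq_closedBall hD hball hk0, integral_const_mul,
        setIntegral_mollifier hr0 hball, mul_one]
    have e2 : harmonicRep D h x - h x =
        ∫ z in Metric.closedBall x r, (h z - h x) * mollifier r (z - x) := by
      conv_lhs => rw [e1]
      rw [hh.harmonicRep_eq hi hD hne hxD hr0 hball,
        setIntegral_eq_closedBall hD hball hk0, ← integral_sub (hbd hih) (hbd (hic (h x)))]
      simp only [sub_mul]
    rw [e2]
    calc |∫ z in Metric.closedBall x r, (h z - h x) * mollifier r (z - x)|
        ≤ ∫ z in Metric.closedBall x r, |(h z - h x) * mollifier r (z - x)| :=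
          abs_integral_le_integral_abs
      _ ≤ ∫ z in Metric.closedBall x r, |h z - h x| * (A / r ^ 2) := by
          refine integral_mono (hbd (hih.sub (hic (h x)))).abs
            ((hih.sub (hic (h x))).abs.mul_const _) fun z => ?_
          simp only [abs_mul]
          gcongr
          exact (hA r hr0 _).1
      _ = A * Real.pi * ⨍ y in Metric.closedBall x r, |h y - h x| := by
          rw [setAverage_eq, volume_real_closedBall hr0.le, integral_mul_const, smul_eq_mul]
          have := Real.pi_ne_zero
          field_simp
      _ = _ := by
          congr 1
          refine setAverage_congr_fun hmb (Eventually.of_forall fun z hz => ?_)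
          simp only [indicator_of_mem (hball hz), indicator_of_mem hxD, Real.norm_eq_abs]
  have h4 : |harmonicRep D h x - h x| ≤ 0 := ge_of_tendsto h2 h3
  exact sub_eq_zero.1 (abs_nonpos_iff.1 h4)

/-- Mean value estimate. -/
lemma IsWeaklyHarmonic.sq_harmonicRep_sub_le (hh : IsWeaklyHarmonic D h)
    (h2 : MemLp h 2 (volume.restrict D)) (hi : IntegrableOn h D) (hfin : volume D < ⊤)
    (hD : IsOpen D) (hne : Dᶜ.Nonempty) {A : ℝ}
    (hA : ∀ r : ℝ, 0 < r → ∀ z, |mollifier r z| ≤ A / r ^ 2) (c : ℝ) {x : Plane} (hx : x ∈ D)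
    {r : ℝ} (hr : 0 < r) (hxr : Metric.closedBall x r ⊆ D) :
    (harmonicRep D h x - c) ^ 2 ≤
      4 * A ^ 2 / r ^ 2 * ∫ z in Metric.closedBall x r, (h z - c) ^ 2 := by
  have : IsFiniteMeasure (volume.restrict D) := ⟨by simpa using hfin⟩
  have hkc : Continuous fun z => mollifier r (z - x) :=
    (contDiff_mollifier r).continuous.comp (continuous_id.sub continuous_const)
  have e : harmonicRep D h x - c = ∫ z in D, (h z - c) * mollifier r (z - x) := by
    simp only [sub_mul]
    have hbd : ∀ {f : Plane → ℝ}, Integrable f (volume.restrict D) →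
        Integrable (fun z => f z * mollifier r (z - x)) (volume.restrict D) := fun hf =>
      Integrable.mul_bdd hf hkc.aestronglyMeasurable (Eventually.of_forall fun z => hA r hr (z - x))
    rw [integral_sub (hbd hi) (hbd (integrable_const c)), integral_const_mul,
      setIntegral_mollifier hr hxr, mul_one, hh.harmonicRep_eq hi hD hne hx hr hxr]
  rw [e]
  refine (abs_setIntegral_kernel_le hD (h2.sub (memLp_const c)) hr.le hxr hkc
    (fun z hz => mollifier_eq_zero hr hz.le) (fun z => hA r hr (z - x))).trans_eq ?_
  simp only [Pi.sub_apply]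
  field_simp

end Harmonic

section Harmonic

variable {D : Set Plane} {h : Plane → ℝ}

open scoped Convolution in
lemma IsWeaklyHarmonic.harmonicRep_eventuallyEq (hh : IsWeaklyHarmonic D h) (hi : IntegrableOn h D)
    (hD : IsOpen D) (hne : Dᶜ.Nonempty) {x : Plane} {r : ℝ} (hr : 0 < r)
    (hxr : Metric.closedBall x (2 * r) ⊆ D) :
    harmonicRep D h =ᶠ[𝓝 x]
      (D.indicator h ⋆[ContinuousLinearMap.mul ℝ ℝ, volume] mollifier r : Plane → ℝ) := by
  filter_upwards [Metric.ball_mem_nhds x hr] with y hy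
  have hyr : Metric.closedBall y r ⊆ D := (Metric.closedBall_subset_closedBall' (by
    rw [Metric.mem_ball] at hy; linarith)).trans hxr
  rw [hh.harmonicRep_eq hi hD hne (hyr (Metric.mem_closedBall_self hr.le)) hr hyr, convolution_mul,
    ← integral_indicator hD.measurableSet]
  refine integral_congr_ae (Eventually.of_forall fun z => ?_)
  simp only [indicator_mul_left]
  rw [← mollifier_neg, neg_sub]

lemma IsWeaklyHarmonic.contDiffAt_harmonicRep (hh : IsWeaklyHarmonic D h) (hi : IntegrableOn h D)
    (hD : IsOpen D) (hne : Dᶜ.Nonempty) {x : Plane} (hx : x ∈ D) :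
    ContDiffAt ℝ ∞ (harmonicRep D h) x := by
  have hp := depth_pos hD hne hx
  refine ContDiffAt.congr_of_eventuallyEq ?_ (hh.harmonicRep_eventuallyEq hi hD hne
    (r := depth D x / 4) (by positivity) (closedBall_subset_of_lt_depth (by linarith)))
  exact ((hasCompactSupport_mollifier (by positivity)).contDiff_convolution_right _
    (hi.integrable_indicator hD.measurableSet).locallyIntegrable (contDiff_mollifier _)).contDiffAt

lemma IsWeaklyHarmonic.partialDeriv_harmonicRep (hh : IsWeaklyHarmonic D h)
    (hi : IntegrableOn h D) (hD : IsOpen D) (hne : Dᶜ.Nonempty) {x : Plane} {r : ℝ} (hr : 0 < r)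
    (hxr : Metric.closedBall x (2 * r) ⊆ D) (j : Fin 2) :
    partialDeriv j (harmonicRep D h) x = ∫ z in D, h z * partialDeriv j (mollifier r) (x - z) := by
  have hl : LocallyIntegrable (D.indicator h) volume :=
    (hi.integrable_indicator hD.measurableSet).locallyIntegrable
  have hc : ContDiff ℝ 1 (mollifier r) := (contDiff_mollifier r).of_le (by simp)
  have hcs := hasCompactSupport_mollifier hr
  rw [partialDeriv_congr (hh.harmonicRep_eventuallyEq hi hD hne hr hxr), partialDeriv,
    (hcs.hasFDerivAt_convolution_right (ContinuousLinearMap.mul ℝ ℝ) hl hc x).fderiv,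
    convolution_precompR_apply _ hl (hcs.fderiv ℝ) (hc.continuous_fderiv (by simp)),
    convolution_mul, ← integral_indicator hD.measurableSet]
  refine integral_congr_ae (Eventually.of_forall fun z => ?_)
  simp only [indicator_mul_left]
  rfl

/-- `∇P = div T` in the sense of distributions: `∫ P div φ = ∫ T : ∇φ` for test fields `φ`. -/
def HasStress (D : Set Plane) (P : Plane → ℝ) (T : Fin 2 → Fin 2 → Plane → ℝ) : Prop :=
  ∀ φ : Fin 2 → Plane → ℝ, (∀ i, IsTestIn D (φ i)) →
    ∫ x in D, P x * ∑ i, partialDeriv i (φ i) x =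
      ∑ i, ∑ j, ∫ x in D, T i j x * partialDeriv j (φ i) x

lemma partialDeriv_comp_sub_left {f : Plane → ℝ} (hf : Differentiable ℝ f) (x z : Plane)
    (j : Fin 2) : partialDeriv j (fun z => f (x - z)) z = -partialDeriv j f (x - z) := by
  have h1 : HasFDerivAt (fun z : Plane => x - z) (-ContinuousLinearMap.id ℝ Plane) z := by
    simpa using (hasFDerivAt_id z).const_sub x
  have h2 := (hf (x - z)).hasFDerivAt.comp z h1
  rw [partialDeriv, show (fun z => f (x - z)) = f ∘ fun z => x - z from rfl, h2.fderiv]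
  simp [partialDeriv]

/-- Interior gradient estimate, in terms of the stress instead of the function itself. -/
lemma IsWeaklyHarmonic.sq_partialDeriv_le (hh : IsWeaklyHarmonic D h) (hi : IntegrableOn h D)
    (hD : IsOpen D) (hne : Dᶜ.Nonempty) {T : Fin 2 → Fin 2 → Plane → ℝ} (hT : HasStress D h T)
    (hT2 : ∀ i j, MemLp (T i j) 2 (volume.restrict D)) {A : ℝ}
    (hA : ∀ r : ℝ, 0 < r → ∀ z j, |partialDeriv j (mollifier r) z| ≤ A / r ^ 3)
    {x : Plane} {r : ℝ} (hr : 0 < r) (hxr : Metric.closedBall x (2 * r) ⊆ D) (i : Fin 2) :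
    partialDeriv i (harmonicRep D h) x ^ 2 ≤
      8 * A ^ 2 / r ^ 4 * ∑ j, ∫ z in Metric.closedBall x r, T i j z ^ 2 := by
  have hxr' : Metric.closedBall x r ⊆ D :=
    (Metric.closedBall_subset_closedBall (by linarith)).trans hxr
  have hdm : Differentiable ℝ (mollifier r) := (contDiff_mollifier r).differentiable (by simp)
  let φ : Fin 2 → Plane → ℝ := fun k z => if k = i then mollifier r (x - z) else 0
  have hφ : ∀ k, IsTestIn D (φ k) := fun k => by
    by_cases hk : k = i
    · simp only [φ, if_pos hk]
      have h1 : ContDiff ℝ ∞ fun s => profile (s / r ^ 2) / r ^ 2 :=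
        (contDiff_profile.comp (contDiff_id.div_const _)).div_const _
      have h2 := isTestIn_radial (D := D) h1 hr.le (fun s hs => by
        rw [profile_of_ge, zero_div]
        rwa [le_div_iff₀ (by positivity), one_mul]) hxr'
      convert h2 using 2 with z
      rw [mollifier, ← norm_sub_rev]
    · simp only [φ, if_neg hk]
      have ht : tsupport (fun _ : Plane => (0 : ℝ)) = ∅ := tsupport_eq_empty_iff.2 rfl
      exact ⟨contDiff_const, HasCompactSupport.zero, by rw [ht]; exact empty_subset _⟩
  have hd : ∀ j z, partialDeriv j (φ i) z = -partialDeriv j (mollifier r) (x - z) := fun j z => by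
    simp only [φ, if_true]
    exact partialDeriv_comp_sub_left hdm x z j
  have hd0 : ∀ k, k ≠ i → ∀ j z, partialDeriv j (φ k) z = 0 := fun k hk j z =>
    partialDeriv_eq_zero (Eventually.of_forall fun w => by simp only [φ, if_neg hk, Pi.zero_apply]) j
  have e := hT φ hφ
  have e1 : ∀ z, ∑ k, partialDeriv k (φ k) z = -partialDeriv i (mollifier r) (x - z) := fun z => by
    rw [Finset.sum_eq_single i (fun k _ hk => hd0 k hk k z) (by simp), hd]
  have e2 : ∑ k, ∑ j, ∫ z in D, T k j z * partialDeriv j (φ k) z =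
      ∑ j, ∫ z in D, T i j z * -partialDeriv j (mollifier r) (x - z) := by
    rw [Finset.sum_eq_single i (fun k _ hk => Finset.sum_eq_zero fun j _ => by simp [hd0 k hk]) (by simp)]
    simp only [hd]
  rw [e2] at e
  simp only [e1, mul_neg, integral_neg, Finset.sum_neg_distrib, neg_inj] at e
  rw [hh.partialDeriv_harmonicRep hi hD hne hr hxr, e, Finset.mul_sum]
  have hk : ∀ j, (∫ z in D, T i j z * partialDeriv j (mollifier r) (x - z)) ^ 2 ≤
      4 * (A / r ^ 3) ^ 2 * r ^ 2 * ∫ z in Metric.closedBall x r, T i j z ^ 2 := fun j =>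
    abs_setIntegral_kernel_le hD (hT2 i j) hr.le hxr'
      ((contDiff_partialDeriv (contDiff_mollifier r) j).continuous.comp
        (continuous_const.sub continuous_id))
      (fun z hz => by
        refine partialDeriv_eq_zero ?_ j
        have : r < ‖x - z‖ := by rwa [norm_sub_rev]
        filter_upwards [continuous_norm.continuousAt.eventually (lt_mem_nhds this)] with w hw
        exact mollifier_eq_zero hr hw.le)
      (fun z => hA r hr _ _)
  rw [Fin.sum_univ_two, Fin.sum_univ_two]
  have h0 := hk 0
  have h1 := hk 1
  have e3 : 8 * A ^ 2 / r ^ 4 = 2 * (4 * (A / r ^ 3) ^ 2 * r ^ 2) := by field_simp; ring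
  rw [e3]
  nlinarith [sq_nonneg ((∫ z in D, T i 0 z * partialDeriv 0 (mollifier r) (x - z)) -
    ∫ z in D, T i 1 z * partialDeriv 1 (mollifier r) (x - z))]

end Harmonic

/-! ### John curves -/

/-- `ρ` joins `y` to `x₀` in `D`, and its distance to the complement of `D` grows at least linearly
along the way. -/
structure IsJohnCurve (D : Set Plane) (L : ℝ≥0) (y x₀ : Plane) (l : ℝ) (ρ : ℝ → Plane) : Prop where
  nonneg : 0 ≤ l
  lipschitz : LipschitzOnWith L ρ (Icc 0 l)
  start : ρ 0 = y
  finish : ρ l = x₀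
  mem : ∀ t ∈ Icc 0 l, ρ t ∈ D
  le_depth : ∀ t ∈ Icc 0 l, t ≤ L * depth D (ρ t)

lemma infDist_frontier_le_depth {D : Set Plane} (hD : IsOpen D) (hne : Dᶜ.Nonempty) {x : Plane}
    (hx : x ∈ D) : Metric.infDist x (frontier D) ≤ depth D x := by
  refine (Metric.le_infDist hne).2 fun y hy => ?_
  obtain ⟨w, hw, hwf⟩ : ∃ w ∈ segment ℝ x y, w ∈ frontier D := by
    by_contra! hno
    have hcov : segment ℝ x y ⊆ D ∪ (closure D)ᶜ := fun w hw => by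
      by_cases hc : w ∈ closure D
      · rw [closure_eq_self_union_frontier] at hc
        exact Or.inl (hc.resolve_right (hno w hw))
      · exact Or.inr hc
    have hyc : y ∈ (closure D)ᶜ := (hcov (right_mem_segment ℝ x y)).resolve_left hy
    obtain ⟨w, -, hw1, hw2⟩ := (convex_segment x y).isPreconnected D (closure D)ᶜ hD
      isClosed_closure.isOpen_compl hcov ⟨x, left_mem_segment ℝ x y, hx⟩
      ⟨y, right_mem_segment ℝ x y, hyc⟩
    exact hw2 (subset_closure hw1)
  refine (Metric.infDist_le_dist_of_mem hwf).trans ?_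
  have := dist_add_dist_of_mem_segment hw
  linarith [dist_nonneg (x := w) (y := y)]

lemma IsJohnDomain.exists_isJohnCurve {D : Set Plane} {x₀ : Plane} {L : ℝ≥0}
    (hD : IsJohnDomain D x₀ L) (hne : Dᶜ.Nonempty) {y : Plane} (hy : y ∈ D) :
    ∃ l ρ, IsJohnCurve D L y x₀ l ρ := by
  obtain ⟨ho, -, -, hL, hc⟩ := hD
  obtain ⟨ρ, hρ, h0, h1, hm⟩ := hc y hy
  refine ⟨dist y x₀, ρ, dist_nonneg, hρ, h0, h1, fun t ht => (hm t ht).1, fun t ht => ?_⟩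
  have h2 := (hm t ht).2.trans (infDist_frontier_le_depth ho hne (hm t ht).1)
  rwa [div_le_iff₀' (by exact_mod_cast hL)] at h2

/-- The fundamental theorem of calculus for `H²` along a Lipschitz curve, as an inequality. -/
lemma sq_sub_le_integral_along_curve {D : Set Plane} {H : Plane → ℝ}
    (hH : ∀ x ∈ D, ContDiffAt ℝ 1 H x) {ρ : ℝ → Plane} {l : ℝ} (hl : 0 ≤ l) {L : ℝ≥0}
    (hρ : LipschitzOnWith L ρ (Icc 0 l)) (hm : ∀ t ∈ Icc 0 l, ρ t ∈ D) (c : ℝ)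
    {b : ℝ → ℝ} (hb : Continuous b)
    (hbd : ∀ t ∈ Icc 0 l, 2 * |H (ρ t) - c| * (L * ‖fderiv ℝ H (ρ t)‖) ≤ b t) :
    (H (ρ 0) - c) ^ 2 ≤ (H (ρ l) - c) ^ 2 + ∫ t in (0 : ℝ)..l, b t := by
  have hcont : ContinuousOn (fun t => H (ρ t)) (Icc 0 l) := fun t ht =>
    (hH _ (hm t ht)).continuousAt.comp_continuousWithinAt (hρ.continuousOn t ht)
  have hBd : ∀ t, HasDerivAt (fun t => -(H (ρ 0) - c) ^ 2 + ∫ s in (0 : ℝ)..t, b s) (b t) t := fun t =>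
    (hb.integral_hasStrictDerivAt 0 t).hasDerivAt.const_add _
  -- `ρ` is Lipschitz but need not be differentiable, so right slopes take the place of derivatives
  have key := image_le_of_liminf_slope_right_le_deriv_boundary (f := fun t => -(H (ρ t) - c) ^ 2)
    (a := 0) (b := l) ((hcont.sub continuousOn_const).pow 2).neg
    (B := fun t => -(H (ρ 0) - c) ^ 2 + ∫ s in (0 : ℝ)..t, b s) (B' := b) (by simp)
    (fun t _ => (hBd t).continuousAt.continuousWithinAt) (fun t _ => (hBd t).hasDerivWithinAt)
    (fun t ht r hr => ?_) (right_mem_Icc.2 hl)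
  · linarith
  · refine Eventually.frequently ?_
    have htI : t ∈ Icc 0 l := ⟨ht.1, ht.2.le⟩
    have hI : ∀ᶠ s in 𝓝[>] t, s ∈ Icc 0 l ∧ t < s := by
      filter_upwards [Ioo_mem_nhdsGT ht.2] with s hs
      exact ⟨⟨ht.1.trans hs.1.le, hs.2.le⟩, hs.1⟩
    have hle : 𝓝[>] t ≤ 𝓝[Icc 0 l] t :=
      le_inf nhdsWithin_le_nhds (le_principal_iff.2 (hI.mono fun s hs => hs.1))
    have hct : Tendsto (fun s => H (ρ s)) (𝓝[>] t) (𝓝 (H (ρ t))) := (hcont t htI).mono_left hle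
    have hρt : Tendsto ρ (𝓝[>] t) (𝓝 (ρ t)) := (hρ.continuousOn t htI).mono_left hle
    have hlim : Tendsto (fun η => 2 * |H (ρ t) - c| * ((‖fderiv ℝ H (ρ t)‖ + η) * L))
        (𝓝[>] 0) (𝓝 (2 * |H (ρ t) - c| * ((‖fderiv ℝ H (ρ t)‖ + 0) * L))) := by
      refine (Continuous.tendsto ?_ 0).mono_left nhdsWithin_le_nhds
      fun_prop
    have hlt : 2 * |H (ρ t) - c| * ((‖fderiv ℝ H (ρ t)‖ + 0) * L) < r := by
      refine lt_of_le_of_lt (le_of_eq ?_) ((hbd t htI).trans_lt hr)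
      ring
    obtain ⟨η, hηr, hη⟩ := ((hlim.eventually (gt_mem_nhds hlt)).and self_mem_nhdsWithin).exists
    change 0 < η at hη
    have hdiff := ((hH _ (hm t htI)).differentiableAt (by simp)).hasFDerivAt.isLittleO.def hη
    have hlim2 : Tendsto (fun s => |(H (ρ s) - c) + (H (ρ t) - c)| *
        ((‖fderiv ℝ H (ρ t)‖ + η) * L)) (𝓝[>] t)
        (𝓝 (|(H (ρ t) - c) + (H (ρ t) - c)| * ((‖fderiv ℝ H (ρ t)‖ + η) * L))) :=
      (((hct.sub_const c).add_const _).abs).mul_const _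
    rw [← two_mul, abs_mul, abs_two] at hlim2
    filter_upwards [hI, hlim2.eventually (gt_mem_nhds hηr), hρt.eventually hdiff] with s hs hsr hsd
    refine lt_of_le_of_lt ?_ hsr
    have hst : 0 < s - t := sub_pos.2 hs.2
    have h1 : |H (ρ s) - H (ρ t)| ≤ (‖fderiv ℝ H (ρ t)‖ + η) * (L * (s - t)) := by
      have h2 : ‖ρ s - ρ t‖ ≤ L * (s - t) := by
        have := hρ.dist_le_mul s hs.1 t htI
        rwa [dist_eq_norm, Real.dist_eq, abs_of_pos hst] at this
      have h3 := (fderiv ℝ H (ρ t)).le_opNorm (ρ s - ρ t)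
      have h4 : ‖H (ρ s) - H (ρ t)‖ ≤ (‖fderiv ℝ H (ρ t)‖ + η) * ‖ρ s - ρ t‖ := by
        have := norm_sub_norm_le (H (ρ s) - H (ρ t)) (fderiv ℝ H (ρ t) (ρ s - ρ t))
        linarith
      exact h4.trans (by gcongr)
    rw [slope_def_field, div_le_iff₀ hst]
    calc -(H (ρ s) - c) ^ 2 - -(H (ρ t) - c) ^ 2
        = -(((H (ρ s) - c) + (H (ρ t) - c)) * (H (ρ s) - H (ρ t))) := by ring
      _ ≤ |((H (ρ s) - c) + (H (ρ t) - c))| * |H (ρ s) - H (ρ t)| := by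
          rw [← abs_mul]; exact neg_le_abs _
      _ ≤ |((H (ρ s) - c) + (H (ρ t) - c))| *
          ((‖fderiv ℝ H (ρ t)‖ + η) * (L * (s - t))) := by gcongr
      _ = _ := by ring

/-! ### Averages along John curves -/

section John

variable {D : Set Plane} {L : ℝ≥0}

/-- The region from which John curves can come close to `z`. -/
def johnShadow (D : Set Plane) (L : ℝ≥0) : Set (Plane × Plane) :=
  {p | dist p.1 p.2 ≤ (2 * L ^ 2 + 1) * depth D p.2}

lemma measurableSet_johnShadow : MeasurableSet (johnShadow D L) := by
  have := continuous_depth D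
  exact (isClosed_le (by fun_prop) (by fun_prop)).measurableSet

/-- The average of `q` over the balls along a John curve, with the weight that makes it scale like
`∫ q |y - z|⁻²`, except that only the points `z` whose depth is comparable to their distance from
`y` contribute. -/
lemma lintegral_johnCurve_le (hDo : IsOpen D) (hne : Dᶜ.Nonempty) {y x₀ : Plane} {l : ℝ}
    {ρ : ℝ → Plane} (hρ : IsJohnCurve D L y x₀ l ρ) {q : Plane → ENNReal} (hq : Measurable q) :
    ∫⁻ t in Icc 0 l, ENNReal.ofReal ((depth D (ρ t) ^ 3)⁻¹) *
        ∫⁻ z in Metric.closedBall (ρ t) (depth D (ρ t) / 4), q z ≤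
      ∫⁻ z in D, q z * (ENNReal.ofReal (4 * L * (depth D z ^ 2)⁻¹) *
        (johnShadow D L).indicator 1 (y, z)) := by
  let σ : ℝ → Plane := IccExtend hρ.nonneg ((Icc 0 l).domRestrict ρ)
  have hσc : Continuous σ := hρ.lipschitz.continuousOn.domRestrict.Icc_extend'
  have hσ : ∀ t ∈ Icc 0 l, σ t = ρ t := fun t ht => IccExtend_of_mem _ _ ht
  have hdc := continuous_depth D
  let S : Set (ℝ × Plane) := {p | dist p.2 (σ p.1) ≤ depth D (σ p.1) / 4}
  have hS : MeasurableSet S := (isClosed_le (by fun_prop) (by fun_prop)).measurableSet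
  let F : ℝ → Plane → ENNReal := fun t z =>
    ENNReal.ofReal ((depth D (σ t) ^ 3)⁻¹) * (q z * S.indicator 1 (t, z))
  have hF : Measurable (Function.uncurry F) := by
    refine Measurable.mul (Measurable.ennreal_ofReal ?_) ((hq.comp measurable_snd).mul
      (measurable_one.indicator hS))
    exact (Continuous.measurable (by fun_prop)).inv
  have e1 : ∀ t ∈ Icc 0 l, ENNReal.ofReal ((depth D (ρ t) ^ 3)⁻¹) *
      ∫⁻ z in Metric.closedBall (ρ t) (depth D (ρ t) / 4), q z = ∫⁻ z in D, F t z := fun t ht => by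
    have hp := depth_pos hDo hne (hρ.mem t ht)
    have hsub : Metric.closedBall (ρ t) (depth D (ρ t) / 4) ⊆ D :=
      closedBall_subset_of_lt_depth (by linarith)
    have hFm : Measurable fun z => q z * S.indicator 1 (t, z) :=
      hq.mul ((measurable_one.indicator hS).comp measurable_prodMk_left)
    simp only [F]
    rw [lintegral_const_mul _ hFm, hσ t ht, ← inter_eq_self_of_subset_left hsub,
      ← setLIntegral_indicator Metric.isClosed_closedBall.measurableSet]
    congr 1
    refine lintegral_congr fun z => ?_
    by_cases hz : z ∈ Metric.closedBall (ρ t) (depth D (ρ t) / 4)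
    · have : (t, z) ∈ S := by
        simpa only [S, mem_ofPred_eq, hσ t ht] using Metric.mem_closedBall.1 hz
      simp [hz, this]
    · have : (t, z) ∉ S := by
        simpa only [S, mem_ofPred_eq, hσ t ht] using fun h => hz (Metric.mem_closedBall.2 h)
      simp [hz, this]
  rw [setLIntegral_congr_fun measurableSet_Icc e1, lintegral_lintegral_swap hF.aemeasurable]
  refine setLIntegral_mono' hDo.measurableSet fun z hz => ?_
  have hpz := depth_pos hDo hne hz
  have hFe : ∀ t, F t z = q z * (ENNReal.ofReal ((depth D (σ t) ^ 3)⁻¹) * S.indicator 1 (t, z)) :=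
    fun t => by simp only [F]; ring
  simp only [hFe]
  have hGm : Measurable fun t => ENNReal.ofReal ((depth D (σ t) ^ 3)⁻¹) *
      (S.indicator 1 (t, z) : ENNReal) := by
    refine Measurable.mul (Measurable.ennreal_ofReal ?_)
      ((measurable_one.indicator hS).comp measurable_prodMk_right)
    exact (Continuous.measurable (by fun_prop)).inv
  rw [lintegral_const_mul _ hGm]
  gcongr
  set J : ENNReal := (johnShadow D L).indicator 1 (y, z) with hJ
  -- the ball at `ρ t` contains `z` only if `t ≤ 2 L depth z`, and then the depths are comparable
  have hpt : ∀ t ∈ Icc 0 l, ENNReal.ofReal ((depth D (σ t) ^ 3)⁻¹) * (S.indicator 1 (t, z) : ENNReal) ≤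
      (Icc 0 (2 * L * depth D z)).indicator
        (fun _ => ENNReal.ofReal (2 * (depth D z ^ 3)⁻¹) * J) t := by
    intro t ht
    by_cases hS' : (t, z) ∈ S
    · have hzt : dist z (ρ t) ≤ depth D (ρ t) / 4 := by
        simpa only [S, mem_ofPred_eq, hσ t ht] using hS'
      have hp := depth_pos hDo hne (hρ.mem t ht)
      have h1 := depth_le_add (D := D) (ρ t) z
      have h2 := depth_le_add (D := D) z (ρ t)
      rw [dist_comm] at h1
      have h3 := hρ.le_depth t ht
      have hL : (0 : ℝ) ≤ L := L.2
      have h4 : depth D (ρ t) ≤ 4 / 3 * depth D z := by linarith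
      have h5 : t ≤ 2 * L * depth D z := by nlinarith
      have h6 : (y, z) ∈ johnShadow D L := by
        have h7 := hρ.lipschitz.dist_le_mul 0 (left_mem_Icc.2 hρ.nonneg) t ht
        rw [hρ.start, dist_comm (0 : ℝ), Real.dist_0_eq_abs, abs_of_nonneg ht.1] at h7
        have h8 := dist_triangle_right y z (ρ t)
        have h9 : (L : ℝ) * t ≤ L * (L * (4 / 3 * depth D z)) := by gcongr; nlinarith
        change dist y z ≤ (2 * (L : ℝ) ^ 2 + 1) * depth D z
        nlinarith [mul_nonneg (mul_nonneg hL hL) hpz.le]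
      rw [indicator_of_mem (show t ∈ Icc 0 (2 * (L : ℝ) * depth D z) from ⟨ht.1, h5⟩), hJ,
        indicator_of_mem hS', indicator_of_mem h6]
      simp only [Pi.one_apply, mul_one]
      refine ENNReal.ofReal_le_ofReal ?_
      rw [hσ t ht, ← div_eq_mul_inv, inv_eq_one_div, div_le_div_iff₀ (by positivity) (by positivity)]
      have h10 : depth D z ≤ 5 / 4 * depth D (ρ t) := by linarith
      calc 1 * depth D z ^ 3 ≤ 1 * (5 / 4 * depth D (ρ t)) ^ 3 := by gcongr
        _ ≤ 2 * depth D (ρ t) ^ 3 := by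
          have : 0 < depth D (ρ t) ^ 3 := by positivity
          nlinarith
    · rw [indicator_of_notMem hS', mul_zero]; exact zero_le
  refine (setLIntegral_mono' measurableSet_Icc hpt).trans ?_
  refine (lintegral_mono_set' (t := univ) (subset_univ _).eventuallyLE).trans ?_
  rw [Measure.restrict_univ, lintegral_indicator measurableSet_Icc, setLIntegral_const,
    Real.volume_Icc, sub_zero, mul_right_comm, ← ENNReal.ofReal_mul (by positivity)]
  refine le_of_eq (congrArg (fun a => ENNReal.ofReal a * J) ?_)
  field_simp
  ring

/-- Integrating the averages along John curves over all starting points costs only a constant. -/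
lemma lintegral_john_le (hDo : IsOpen D) (hne : Dᶜ.Nonempty) {x₀ : Plane}
    {q : Plane → ENNReal} (hq : Measurable q) {u : Plane → ENNReal}
    (hu : ∀ y ∈ D, ∃ l ρ, IsJohnCurve D L y x₀ l ρ ∧
      u y ≤ ∫⁻ t in Icc 0 l, ENNReal.ofReal ((depth D (ρ t) ^ 3)⁻¹) *
        ∫⁻ z in Metric.closedBall (ρ t) (depth D (ρ t) / 4), q z) :
    ∫⁻ y in D, u y ≤ ENNReal.ofReal (16 * L * (2 * L ^ 2 + 1) ^ 2) * ∫⁻ z in D, q z := by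
  have hdc := continuous_depth D
  let F : Plane → Plane → ENNReal := fun y z => q z * (ENNReal.ofReal (4 * L * (depth D z ^ 2)⁻¹) *
        (johnShadow D L).indicator 1 (y, z))
  have hF : Measurable (Function.uncurry F) := by
    refine (hq.comp measurable_snd).mul (Measurable.mul (Measurable.ennreal_ofReal ?_)
      (measurable_one.indicator measurableSet_johnShadow))
    exact ((Continuous.measurable (by fun_prop)).inv).const_mul _
  calc ∫⁻ y in D, u y ≤ ∫⁻ y in D, ∫⁻ z in D, F y z := by
        refine setLIntegral_mono' hDo.measurableSet fun y hy => ?_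
        obtain ⟨l, ρ, hρ, hle⟩ := hu y hy
        exact hle.trans (lintegral_johnCurve_le hDo hne hρ hq)
    _ = ∫⁻ z in D, ∫⁻ y in D, F y z := lintegral_lintegral_swap hF.aemeasurable
    _ ≤ ∫⁻ z in D, q z * ENNReal.ofReal (16 * L * (2 * L ^ 2 + 1) ^ 2) := by
        refine setLIntegral_mono' hDo.measurableSet fun z hz => ?_
        have hpz := depth_pos hDo hne hz
        have hm : Measurable fun y => ((johnShadow D L).indicator 1 (y, z) : ENNReal) :=
          (measurable_one.indicator measurableSet_johnShadow).comp measurable_prodMk_right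
        simp only [F]
        rw [lintegral_const_mul _ (hm.const_mul _), lintegral_const_mul _ hm]
        gcongr
        have h1 : ∫⁻ y in D, (johnShadow D L).indicator 1 (y, z) ≤
            volume (Metric.closedBall z ((2 * L ^ 2 + 1) * depth D z)) := by
          refine (setLIntegral_le_lintegral _ _).trans ?_
          rw [← lintegral_indicator_one Metric.isClosed_closedBall.measurableSet]
          refine lintegral_mono fun y => ?_
          by_cases h : (y, z) ∈ johnShadow D L
          · rw [indicator_of_mem h, indicator_of_mem (by exact h)]; simp
          · rw [indicator_of_notMem h]; exact zero_le
        refine (mul_le_mul_right h1 _).trans ?_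
        rw [EuclideanSpace.volume_closedBall_fin_two, ← ENNReal.ofReal_pow (by positivity),
          ← ENNReal.ofReal_mul (by positivity), ← ENNReal.ofReal_mul (by positivity)]
        refine ENNReal.ofReal_le_ofReal ?_
        have : 4 * (L : ℝ) * (depth D z ^ 2)⁻¹ * (((2 * L ^ 2 + 1) * depth D z) ^ 2 * Real.pi) =
            4 * L * (2 * L ^ 2 + 1) ^ 2 * Real.pi := by field_simp
        rw [this]
        calc 4 * (L : ℝ) * (2 * L ^ 2 + 1) ^ 2 * Real.pi ≤ 4 * L * (2 * L ^ 2 + 1) ^ 2 * 4 := by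
              gcongr; exact Real.pi_le_four
          _ = _ := by ring
    _ = _ := by rw [lintegral_mul_const _ hq, mul_comm]

end John

/-! ### Harmonic functions on John domains -/

section John

variable {D : Set Plane} {L : ℝ≥0}

lemma norm_fderiv_sq_le (H : Plane → ℝ) (x : Plane) :
    ‖fderiv ℝ H x‖ ^ 2 ≤ 2 * ∑ i, partialDeriv i H x ^ 2 := by
  have h1 : ‖fderiv ℝ H x‖ ≤ |partialDeriv 0 H x| + |partialDeriv 1 H x| := by
    refine ContinuousLinearMap.opNorm_le_bound _ (by positivity) fun v => ?_
    have hv : v = v 0 • EuclideanSpace.single 0 (1 : ℝ) + v 1 • EuclideanSpace.single 1 (1 : ℝ) := by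
      ext i; fin_cases i <;> simp
    have e : fderiv ℝ H x v = v 0 * partialDeriv 0 H x + v 1 * partialDeriv 1 H x := by
      conv_lhs => rw [hv]
      rw [map_add, map_smul, map_smul]; rfl
    rw [e, Real.norm_eq_abs]
    refine (abs_add_le _ _).trans ?_
    rw [abs_mul, abs_mul, add_mul, mul_comm |v 0|, mul_comm |v 1|]
    gcongr
    · exact PiLp.norm_apply_le v 0
    · exact PiLp.norm_apply_le v 1
  rw [Fin.sum_univ_two, ← sq_abs (partialDeriv 0 H x), ← sq_abs (partialDeriv 1 H x)]
  nlinarith [sq_nonneg (|partialDeriv 0 H x| - |partialDeriv 1 H x|), norm_nonneg (fderiv ℝ H x),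
    abs_nonneg (partialDeriv 0 H x), abs_nonneg (partialDeriv 1 H x)]

/-- The pointwise estimate for a harmonic function on a John domain: `H²` is controlled by averages
along a John curve. The weight `δ` splits the product of `H` and `∇H`. -/
lemma IsWeaklyHarmonic.sq_sub_le_lintegral (hDo : IsOpen D) (hne : Dᶜ.Nonempty)
    (hfin : volume D < ⊤) {h : Lp ℝ 2 (volume.restrict D)} (hh : IsWeaklyHarmonic D h)
    {T : Fin 2 → Fin 2 → Lp ℝ 2 (volume.restrict D)} (hT : HasStress D h fun i j => T i j)
    {A : ℝ} (hA : ∀ r : ℝ, 0 < r → ∀ z,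
      |mollifier r z| ≤ A / r ^ 2 ∧ ∀ j, |partialDeriv j (mollifier r) z| ≤ A / r ^ 3)
    {x₀ y : Plane} {l : ℝ} {ρ : ℝ → Plane} (hρ : IsJohnCurve D L y x₀ l ρ) {δ : ℝ} (hδ : 0 < δ) :
    ENNReal.ofReal ((harmonicRep D h y - harmonicRep D h x₀) ^ 2) ≤
      ∫⁻ t in Icc 0 l, ENNReal.ofReal ((depth D (ρ t) ^ 3)⁻¹) *
        ∫⁻ z in Metric.closedBall (ρ t) (depth D (ρ t) / 4),
          ENNReal.ofReal (L * (4096 * A ^ 2) * (δ * (h z - harmonicRep D h x₀) ^ 2 +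
            δ⁻¹ * ∑ i, ∑ j, T i j z ^ 2)) := by
  have : IsFiniteMeasure (volume.restrict D) := ⟨by simpa using hfin⟩
  have hi : IntegrableOn h D := (Lp.memLp h).integrable one_le_two
  set H := harmonicRep D h
  set c := H x₀
  set Q : Plane → ℝ := fun z => δ * (h z - c) ^ 2 + δ⁻¹ * ∑ i, ∑ j, T i j z ^ 2 with hQ
  have hH : ∀ x ∈ D, ContDiffAt ℝ ∞ H x := fun x hx => hh.contDiffAt_harmonicRep hi hDo hne hx
  have hfc : ContinuousOn (fderiv ℝ H) D := fun x hx =>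
    ((hH x hx).fderiv_right (m := ∞) (by simp)).continuousAt.continuousWithinAt
  have hHc : ContinuousOn H D := fun x hx => (hH x hx).continuousAt.continuousWithinAt
  let b₀ : ℝ → ℝ := fun t => L * (δ * (H (ρ t) - c) ^ 2 / depth D (ρ t) +
    depth D (ρ t) * ‖fderiv ℝ H (ρ t)‖ ^ 2 / δ)
  have hdp : ∀ t ∈ Icc 0 l, 0 < depth D (ρ t) := fun t ht => depth_pos hDo hne (hρ.mem t ht)
  have hb₀ : ContinuousOn b₀ (Icc 0 l) := by
    have c1 := hρ.lipschitz.continuousOn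
    have c2 : ContinuousOn (fun t => H (ρ t)) (Icc 0 l) := hHc.comp c1 hρ.mem
    have c3 : ContinuousOn (fun t => fderiv ℝ H (ρ t)) (Icc 0 l) := hfc.comp c1 hρ.mem
    have c4 : ContinuousOn (fun t => depth D (ρ t)) (Icc 0 l) := (continuous_depth D).comp_continuousOn c1
    refine continuousOn_const.mul (ContinuousOn.add ?_ ?_)
    · exact (continuousOn_const.mul ((c2.sub continuousOn_const).pow 2)).div c4
        fun t ht => (hdp t ht).ne'
    · exact (c4.mul (c3.norm.pow 2)).div_const _
  let b : ℝ → ℝ := IccExtend hρ.nonneg ((Icc 0 l).domRestrict b₀)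
  have hb : Continuous b := hb₀.domRestrict.Icc_extend'
  have hbe : ∀ t ∈ Icc 0 l, b t = b₀ t := fun t ht => IccExtend_of_mem _ _ ht
  have hL : (0 : ℝ) ≤ L := L.2
  have h1 := sq_sub_le_integral_along_curve (fun x hx => (hH x hx).of_le (by simp)) hρ.nonneg
    hρ.lipschitz hρ.mem c hb fun t ht => by
      rw [hbe t ht]
      have hd := hdp t ht
      set d := depth D (ρ t)
      set u := H (ρ t) - c
      set G := ‖fderiv ℝ H (ρ t)‖
      -- Young's inequality with the weight `δ / d`
      have h2 : 2 * |u| * G ≤ δ * u ^ 2 / d + d * G ^ 2 / δ := by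
        have e : δ * u ^ 2 / d + d * G ^ 2 / δ - 2 * |u| * G = (δ * |u| - d * G) ^ 2 / (d * δ) := by
          rw [← sq_abs u]; field_simp; ring
        have : 0 ≤ (δ * |u| - d * G) ^ 2 / (d * δ) := by positivity
        linarith
      calc 2 * |u| * (L * G) = L * (2 * |u| * G) := by ring
        _ ≤ L * (δ * u ^ 2 / d + d * G ^ 2 / δ) := by gcongr
  rw [hρ.start, hρ.finish, sub_self, zero_pow two_ne_zero, zero_add] at h1
  refine (ENNReal.ofReal_le_ofReal h1).trans ?_
  rw [intervalIntegral.integral_of_le hρ.nonneg, ← integral_Icc_eq_integral_Ioc,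
    ofReal_integral_eq_lintegral_ofReal hb.continuousOn.integrableOn_Icc
      ((ae_restrict_iff' measurableSet_Icc).2 (Eventually.of_forall fun t ht => by
        rw [hbe t ht]
        have hd := hdp t ht
        simp only [b₀, Pi.zero_apply]; positivity))]
  refine setLIntegral_mono' measurableSet_Icc fun t ht => ?_
  have hd := hdp t ht
  have hx := hρ.mem t ht
  rw [hbe t ht]
  have hsub : Metric.closedBall (ρ t) (depth D (ρ t) / 4) ⊆ D :=
    closedBall_subset_of_lt_depth (by linarith)
  have hle := Measure.restrict_mono hsub (le_refl (volume : Measure Plane))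
  have hc2 : MemLp (fun z => h z - c) 2 (volume.restrict D) := (Lp.memLp h).sub (memLp_const c)
  have i1 : IntegrableOn (fun z => (h z - c) ^ 2)
      (Metric.closedBall (ρ t) (depth D (ρ t) / 4)) := hc2.integrable_sq.mono_measure hle
  have i2 : ∀ i j, IntegrableOn (fun z => T i j z ^ 2)
      (Metric.closedBall (ρ t) (depth D (ρ t) / 4)) := fun i j =>
    (Lp.memLp (T i j)).integrable_sq.mono_measure hle
  have i3 : IntegrableOn (fun z => ∑ i, ∑ j, T i j z ^ 2)
      (Metric.closedBall (ρ t) (depth D (ρ t) / 4)) :=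
    integrable_finsetSum _ fun i _ => integrable_finsetSum _ fun j _ => i2 i j
  have iQ : IntegrableOn Q (Metric.closedBall (ρ t) (depth D (ρ t) / 4)) :=
    (i1.const_mul δ).add (i3.const_mul δ⁻¹)
  rw [← ofReal_integral_eq_lintegral_ofReal (iQ.const_mul _)
    (Eventually.of_forall fun z => by simp only [hQ, Pi.zero_apply]; positivity),
    ← ENNReal.ofReal_mul (by positivity)]
  refine ENNReal.ofReal_le_ofReal ?_
  rw [integral_const_mul]
  have eQ : ∫ z in Metric.closedBall (ρ t) (depth D (ρ t) / 4), Q z =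
      δ * (∫ z in Metric.closedBall (ρ t) (depth D (ρ t) / 4), (h z - c) ^ 2) +
        δ⁻¹ * ∑ i, ∑ j, ∫ z in Metric.closedBall (ρ t) (depth D (ρ t) / 4), T i j z ^ 2 := by
    simp only [hQ]
    rw [integral_add (i1.const_mul δ) (i3.const_mul δ⁻¹), integral_const_mul, integral_const_mul,
      integral_finsetSum _ fun i _ => integrable_finsetSum _ fun j _ => i2 i j]
    congr 2
    exact Finset.sum_congr rfl fun i _ => integral_finsetSum _ fun j _ => i2 i j
  rw [eQ]
  have hr : 0 < depth D (ρ t) / 4 := by positivity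
  have b1 := hh.sq_harmonicRep_sub_le (Lp.memLp h) hi hfin hDo hne (fun r hr z => (hA r hr z).1) c hx
    hr hsub
  have b2 := fun i => hh.sq_partialDeriv_le hi hDo hne hT (fun i j => Lp.memLp _)
    (fun r hr z => (hA r hr z).2) hr (x := ρ t)
    (closedBall_subset_of_lt_depth (by linarith)) i
  have b3 := norm_fderiv_sq_le H (ρ t)
  set I := ∫ z in Metric.closedBall (ρ t) (depth D (ρ t) / 4), (h z - c) ^ 2
  set S : Fin 2 → ℝ := fun i =>
    ∑ j, ∫ z in Metric.closedBall (ρ t) (depth D (ρ t) / 4), T i j z ^ 2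
  have hI : 0 ≤ I := integral_nonneg fun _ => sq_nonneg _
  have hS : ∀ i, 0 ≤ S i := fun i => Finset.sum_nonneg fun j _ => integral_nonneg fun _ => sq_nonneg _
  change L * (δ * (H (ρ t) - c) ^ 2 / depth D (ρ t) + depth D (ρ t) * ‖fderiv ℝ H (ρ t)‖ ^ 2 / δ) ≤
    (depth D (ρ t) ^ 3)⁻¹ * (L * (4096 * A ^ 2) * (δ * I + δ⁻¹ * ∑ i, S i))
  have b4 : ‖fderiv ℝ H (ρ t)‖ ^ 2 ≤ 4096 * A ^ 2 / depth D (ρ t) ^ 4 * ∑ i, S i := by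
    refine b3.trans ?_
    have : ∑ i, partialDeriv i H (ρ t) ^ 2 ≤
        ∑ i, 8 * A ^ 2 / (depth D (ρ t) / 4) ^ 4 * S i := Finset.sum_le_sum fun i _ => b2 i
    rw [← Finset.mul_sum] at this
    refine (mul_le_mul_of_nonneg_left this zero_le_two).trans_eq ?_
    field_simp
    ring
  have b5 : (H (ρ t) - c) ^ 2 ≤ 4096 * A ^ 2 / depth D (ρ t) ^ 2 * I := by
    refine b1.trans (mul_le_mul_of_nonneg_right ?_ hI)
    rw [show 4 * A ^ 2 / (depth D (ρ t) / 4) ^ 2 = 64 * A ^ 2 / depth D (ρ t) ^ 2 by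
      field_simp; ring]
    gcongr
    norm_num
  calc L * (δ * (H (ρ t) - c) ^ 2 / depth D (ρ t) + depth D (ρ t) * ‖fderiv ℝ H (ρ t)‖ ^ 2 / δ)
      ≤ L * (δ * (4096 * A ^ 2 / depth D (ρ t) ^ 2 * I) / depth D (ρ t) +
        depth D (ρ t) * (4096 * A ^ 2 / depth D (ρ t) ^ 4 * ∑ i, S i) / δ) := by gcongr
    _ = _ := by field_simp

/-- Nečas' inequality for harmonic functions on John domains. -/
lemma IsJohnDomain.harmonic_estimate {x₀ : Plane} (hD : IsJohnDomain D x₀ L) :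
    ∃ C : ℝ, 0 ≤ C ∧ ∀ (h : Lp ℝ 2 (volume.restrict D))
      (T : Fin 2 → Fin 2 → Lp ℝ 2 (volume.restrict D)), IsWeaklyHarmonic D h →
      HasStress D h (fun i j => T i j) →
      ∃ c : ℝ, ∫ x in D, (h x - c) ^ 2 ≤ C * ∑ i, ∑ j, ‖T i j‖ ^ 2 := by
  have hDo := hD.1
  have hfin : volume D < ⊤ := hD.2.1.measure_lt_top
  have hne : Dᶜ.Nonempty := by
    rw [nonempty_compl]
    rintro rfl
    exact (NormedSpace.unbounded_univ ℝ Plane) hD.2.1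
  have : IsFiniteMeasure (volume.restrict D) := ⟨by simpa using hfin⟩
  obtain ⟨A, -, hA⟩ := exists_mollifier_bound
  set M : ℝ := 16 * L * (2 * L ^ 2 + 1) ^ 2 * (L * (4096 * A ^ 2)) with hM
  have hM0 : 0 ≤ M := by positivity
  refine ⟨4 * M * (M + 1), by positivity, fun h T hh hT => ⟨harmonicRep D h x₀, ?_⟩⟩
  set c := harmonicRep D h x₀
  set δ : ℝ := (2 * (M + 1))⁻¹ with hδ
  have hδ0 : 0 < δ := by positivity
  have hc2 : MemLp (fun z => h z - c) 2 (volume.restrict D) := (Lp.memLp h).sub (memLp_const c)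
  have i2 : ∀ i j, Integrable (fun z => T i j z ^ 2) (volume.restrict D) := fun i j =>
    (Lp.memLp (T i j)).integrable_sq
  have i3 : Integrable (fun z => ∑ i, ∑ j, T i j z ^ 2) (volume.restrict D) :=
    integrable_finsetSum _ fun i _ => integrable_finsetSum _ fun j _ => i2 i j
  set Q : Plane → ℝ := fun z => δ * (h z - c) ^ 2 + δ⁻¹ * ∑ i, ∑ j, T i j z ^ 2 with hQ
  have iQ : Integrable Q (volume.restrict D) := (hc2.integrable_sq.const_mul δ).add (i3.const_mul δ⁻¹)
  have hQm : Measurable Q := by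
    have m1 : Measurable (h : Plane → ℝ) := (Lp.stronglyMeasurable h).measurable
    have m2 : ∀ i j, Measurable (T i j : Plane → ℝ) := fun i j =>
      (Lp.stronglyMeasurable (T i j)).measurable
    exact (((m1.sub_const c).pow_const 2).const_mul δ).add
      ((Finset.measurable_fun_sum _ fun i _ => Finset.measurable_fun_sum _ fun j _ =>
        (m2 i j).pow_const 2).const_mul _)
  set I := ∫ x in D, (h x - c) ^ 2
  have hI0 : 0 ≤ I := integral_nonneg fun _ => sq_nonneg _
  set S := ∑ i, ∑ j, ‖T i j‖ ^ 2
  have hS0 : 0 ≤ S := by positivity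
  have eQ : ∫ z in D, Q z = δ * I + δ⁻¹ * S := by
    simp only [hQ]
    rw [integral_add (hc2.integrable_sq.const_mul δ) (i3.const_mul δ⁻¹), integral_const_mul,
      integral_const_mul, integral_finsetSum _ fun i _ => integrable_finsetSum _ fun j _ => i2 i j]
    congr 2
    refine Finset.sum_congr rfl fun i _ => ?_
    rw [integral_finsetSum _ fun j _ => i2 i j]
    exact Finset.sum_congr rfl fun j _ => (Lp_norm_sq_eq _).symm
  have key := lintegral_john_le hDo hne (x₀ := x₀)
    (q := fun z => ENNReal.ofReal (L * (4096 * A ^ 2) * Q z))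
    (u := fun y => ENNReal.ofReal ((harmonicRep D h y - c) ^ 2))
    (hQm.const_mul _).ennreal_ofReal fun y hy => by
      obtain ⟨l, ρ, hρ⟩ := hD.exists_isJohnCurve hne hy
      exact ⟨l, ρ, hρ, hh.sq_sub_le_lintegral hDo hne hfin hT hA hρ hδ0⟩
  have e1 : ∫⁻ y in D, ENNReal.ofReal ((harmonicRep D h y - c) ^ 2) = ENNReal.ofReal I := by
    rw [ofReal_integral_eq_lintegral_ofReal hc2.integrable_sq
      (Eventually.of_forall fun _ => sq_nonneg _)]
    refine lintegral_congr_ae ?_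
    filter_upwards [hh.harmonicRep_ae_eq ((Lp.memLp h).integrable one_le_two) hDo hne] with x hx
    simp only [hx]
  rw [e1, ← ofReal_integral_eq_lintegral_ofReal (iQ.const_mul _)
    (Eventually.of_forall fun z => by simp only [hQ, Pi.zero_apply]; positivity),
    ← ENNReal.ofReal_mul (by positivity), integral_const_mul, eQ,
    ENNReal.ofReal_le_ofReal_iff (by positivity), ← mul_assoc, ← hM] at key
  -- the choice of `δ` allows this term to be absorbed into the left-hand side
  have h1 : M * (δ * I) ≤ I / 2 := by
    have : M * δ ≤ 1 / 2 := by
      rw [hδ, ← div_eq_mul_inv, div_le_div_iff₀ (by positivity) (by positivity)]; linarith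
    nlinarith
  have h2 : δ⁻¹ = 2 * (M + 1) := by rw [hδ, inv_inv]
  rw [h2, mul_add] at key
  linarith

end John

/-! ### Nečas' inequality on John domains -/

lemma partialDeriv_comm {f : Plane → ℝ} (hf : ContDiff ℝ ∞ f) (i j : Fin 2) :
    partialDeriv i (partialDeriv j f) = partialDeriv j (partialDeriv i f) := by
  have h : ∀ (i j : Fin 2) x, partialDeriv i (partialDeriv j f) x =
      fderiv ℝ (fderiv ℝ f) x (EuclideanSpace.single i 1) (EuclideanSpace.single j 1) := by
    intro i j x
    have h1 : DifferentiableAt ℝ (fderiv ℝ f) x :=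
      ((hf.fderiv_right (m := ∞) (by simp)).differentiable (by simp)) x
    have h2 := (h1.hasFDerivAt.clm_apply
      (hasFDerivAt_const (EuclideanSpace.single j (1 : ℝ) : Plane) x)).fderiv
    rw [partialDeriv, show partialDeriv j f = fun y => fderiv ℝ f y (EuclideanSpace.single j 1)
      from rfl, h2]
    simp
  ext x
  rw [h, h]
  exact ((contDiff_infty.1 hf 2).contDiffAt.isSymmSndFDerivAt (by simp)) _ _

lemma IsTestIn.pderiv {D : Set Plane} {ψ : Plane → ℝ} (hψ : IsTestIn D ψ) (j : Fin 2) :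
    IsTestIn D (partialDeriv j ψ) :=
  ⟨contDiff_partialDeriv hψ.contDiff j, hasCompactSupport_partialDeriv hψ.hasCompactSupport j,
    (tsupport_partialDeriv_subset ψ j).trans hψ.tsupport_subset⟩

lemma IsTestIn.memLp {D : Set Plane} {ψ : Plane → ℝ} (hψ : IsTestIn D ψ) :
    MemLp ψ 2 (volume.restrict D) :=
  hψ.contDiff.continuous.memLp_of_hasCompactSupport hψ.hasCompactSupport

lemma IsTestIn.memLp_laplacian {D : Set Plane} {ψ : Plane → ℝ} (hψ : IsTestIn D ψ) :
    MemLp (laplacian ψ) 2 (volume.restrict D) :=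
  ((hψ.pderiv 0).pderiv 0).memLp.add ((hψ.pderiv 1).pderiv 1).memLp

/-- The `L²` norm of the Hessian of a test function is that of its Laplacian. -/
lemma IsTestIn.sum_setIntegral_hessian_sq {D : Set Plane} {ψ : Plane → ℝ} (hψ : IsTestIn D ψ) :
    ∑ i, ∑ j, ∫ x in D, partialDeriv j (partialDeriv i ψ) x ^ 2 =
      ∫ x in D, laplacian ψ x ^ 2 := by
  have hi : ∀ i j k l, Integrable (fun x => partialDeriv i (partialDeriv j ψ) x *
      partialDeriv k (partialDeriv l ψ) x) volume := fun i j k l =>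
    ((hψ.pderiv j).pderiv i).contDiff.continuous.mul
      ((hψ.pderiv l).pderiv k).contDiff.continuous |>.integrable_of_hasCompactSupport
      ((hψ.pderiv j).pderiv i).hasCompactSupport.mul_right
  have i2 : ∀ i j k l i' j' k' l', Integrable (fun x =>
      partialDeriv i (partialDeriv j ψ) x * partialDeriv k (partialDeriv l ψ) x +
      partialDeriv i' (partialDeriv j' ψ) x * partialDeriv k' (partialDeriv l' ψ) x) volume :=
    fun i j k l i' j' k' l' => (hi i j k l).add (hi i' j' k' l')
  have key : ∀ i j, ∫ x in D, partialDeriv j (partialDeriv i ψ) x ^ 2 =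
      ∫ x, partialDeriv i (partialDeriv i ψ) x *
        partialDeriv j (partialDeriv j ψ) x := fun i j => by
    rw [setIntegral_eq_integral_of_tsupport
      ((hψ.pderiv i).pderiv j).tsupport_subset fun x hx => by simp [hx.self_of_nhds]]
    simp only [sq]
    rw [integral_mul_partialDeriv ((hψ.pderiv i).pderiv j).contDiff
      (hψ.pderiv i).contDiff (hψ.pderiv i).hasCompactSupport,
      show partialDeriv j (partialDeriv j (partialDeriv i ψ)) =
        partialDeriv i (partialDeriv j (partialDeriv j ψ)) by
          rw [partialDeriv_comm hψ.contDiff j i,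
            partialDeriv_comm (hψ.pderiv j).contDiff j i],
      ← integral_mul_partialDeriv ((hψ.pderiv j).pderiv j).contDiff
      (hψ.pderiv i).contDiff (hψ.pderiv i).hasCompactSupport]
    exact integral_congr_ae (Eventually.of_forall fun x => mul_comm _ _)
  simp only [key, Fin.sum_univ_two]
  rw [setIntegral_eq_integral_of_tsupport (η := ψ) hψ.tsupport_subset fun x hx => by
    have h2 : ∀ j, partialDeriv j (partialDeriv j ψ) x = 0 := fun j =>
      image_eq_zero_of_notMem_tsupport fun h => (notMem_tsupport_iff_eventuallyEq.2 hx)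
        (tsupport_partialDeriv_subset _ _ (tsupport_partialDeriv_subset _ _ h))
    simp [laplacian, h2]]
  rw [← integral_add (hi _ _ _ _) (hi _ _ _ _), ← integral_add (hi _ _ _ _) (hi _ _ _ _),
    ← integral_add (i2 _ _ _ _ _ _ _ _) (i2 _ _ _ _ _ _ _ _)]
  refine integral_congr_ae (Eventually.of_forall fun x => ?_)
  simp only [laplacian]
  ring

lemma IsTestIn.add {D : Set Plane} {φ ψ : Plane → ℝ} (hφ : IsTestIn D φ) (hψ : IsTestIn D ψ) :
    IsTestIn D (φ + ψ) :=
  ⟨hφ.contDiff.add hψ.contDiff, hφ.hasCompactSupport.add hψ.hasCompactSupport,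
    (tsupport_add _ _).trans (union_subset hφ.tsupport_subset hψ.tsupport_subset)⟩

lemma IsTestIn.smul {D : Set Plane} {φ : Plane → ℝ} (hφ : IsTestIn D φ) (c : ℝ) :
    IsTestIn D (c • φ) :=
  ⟨contDiff_const.smul hφ.contDiff, hφ.hasCompactSupport.smul_left (f := fun _ => c),
    (tsupport_smul_subset_right (fun _ => c) φ).trans hφ.tsupport_subset⟩

/-- The Laplacians of test functions, as elements of `L²(D)`. -/
def testLaplacians (D : Set Plane) : Submodule ℝ (Lp ℝ 2 (volume.restrict D)) where
  carrier := {u | ∃ ψ, IsTestIn D ψ ∧ u =ᵐ[volume.restrict D] laplacian ψ}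
  add_mem' := by
    rintro u v ⟨φ, hφ, hu⟩ ⟨ψ, hψ, hv⟩
    refine ⟨φ + ψ, hφ.add hψ, ?_⟩
    filter_upwards [Lp.coeFn_add u v, hu, hv] with x h h1 h2
    rw [h, Pi.add_apply, h1, h2]
    have h3 : ∀ j, partialDeriv j (partialDeriv j (φ + ψ)) =
        partialDeriv j (partialDeriv j φ) + partialDeriv j (partialDeriv j ψ) := fun j => by
      rw [partialDeriv_add (hφ.contDiff.differentiable (by simp))
        (hψ.contDiff.differentiable (by simp)),
        partialDeriv_add ((hφ.pderiv j).contDiff.differentiable (by simp))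
        ((hψ.pderiv j).contDiff.differentiable (by simp))]
    simp only [laplacian, h3, Pi.add_apply]
    ring
  zero_mem' := by
    refine ⟨0, ⟨contDiff_const, HasCompactSupport.zero, ?_⟩, ?_⟩
    · rw [(tsupport_eq_empty_iff (f := (0 : Plane → ℝ))).2 rfl]; exact empty_subset _
    · refine (Lp.coeFn_zero _ _ _).trans (Eventually.of_forall fun x => ?_)
      have h : ∀ j, partialDeriv j (0 : Plane → ℝ) = 0 := fun j => by ext; simp [partialDeriv]
      simp [laplacian, h]
  smul_mem' := by
    rintro c u ⟨φ, hφ, hu⟩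
    refine ⟨c • φ, hφ.smul c, ?_⟩
    filter_upwards [Lp.coeFn_smul c u, hu] with x h h1
    rw [h, Pi.smul_apply, h1]
    simp only [laplacian, partialDeriv_smul, Pi.smul_apply, smul_eq_mul]
    ring

lemma L2_inner_eq_of_ae_eq {D : Set Plane} {P u : Lp ℝ 2 (volume.restrict D)} {f : Plane → ℝ}
    (hu : u =ᵐ[volume.restrict D] f) : inner ℝ P u = ∫ x in D, P x * f x := by
  rw [L2.inner_def]
  refine integral_congr_ae ?_
  filter_upwards [hu] with x hx
  simp [hx, mul_comm]

lemma sum_sum_mul_le_sqrt (a b : Fin 2 → Fin 2 → ℝ) :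
    ∑ i, ∑ j, a i j * b i j ≤ √(∑ i, ∑ j, a i j ^ 2) * √(∑ i, ∑ j, b i j ^ 2) := by
  have := Real.sum_mul_le_sqrt_mul_sqrt Finset.univ (fun p : Fin 2 × Fin 2 => a p.1 p.2)
    (fun p => b p.1 p.2)
  simpa only [← Finset.univ_product_univ, Finset.sum_product] using this

/-- Testing `∇P = div T` with gradients bounds the part of `P` in the closure of the Laplacians. -/
lemma HasStress.inner_le {D : Set Plane} {P : Lp ℝ 2 (volume.restrict D)}
    {T : Fin 2 → Fin 2 → Lp ℝ 2 (volume.restrict D)} (h : HasStress D P fun i j => T i j)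
    {u : Lp ℝ 2 (volume.restrict D)} (hu : u ∈ (testLaplacians D).topologicalClosure) :
    inner ℝ P u ≤ √(∑ i, ∑ j, ‖T i j‖ ^ 2) * ‖u‖ := by
  have hcl : IsClosed {u : Lp ℝ 2 (volume.restrict D) |
      inner ℝ P u ≤ √(∑ i, ∑ j, ‖T i j‖ ^ 2) * ‖u‖} :=
    isClosed_le (by fun_prop) (by fun_prop)
  refine closure_minimal ?_ hcl hu
  rintro u ⟨ψ, hψ, hu⟩
  have hH := fun i j => ((hψ.pderiv i).pderiv j).memLp
  have e1 := h (fun i => partialDeriv i ψ) fun i => hψ.pderiv i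
  simp only [Fin.sum_univ_two (fun i => partialDeriv i (partialDeriv i ψ) _)] at e1
  have e2 : ∀ i j, ∫ x in D, T i j x * partialDeriv j (partialDeriv i ψ) x =
      inner ℝ (T i j) (hH i j).toLp := fun i j => (L2_inner_eq_of_ae_eq (hH i j).coeFn_toLp).symm
  have e3 : ∑ i, ∑ j, ‖(hH i j).toLp‖ ^ 2 = ‖u‖ ^ 2 := by
    rw [Lp_norm_sq_eq, integral_congr_ae (hu.mono fun x hx => by
      change u x ^ 2 = laplacian ψ x ^ 2; rw [hx]), ← hψ.sum_setIntegral_hessian_sq]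
    refine Finset.sum_congr rfl fun i _ => Finset.sum_congr rfl fun j _ => ?_
    rw [Lp_norm_sq_eq]
    exact integral_congr_ae ((hH i j).coeFn_toLp.mono fun x hx => by simp only [hx])
  change inner ℝ P u ≤ _
  rw [L2_inner_eq_of_ae_eq hu]
  calc ∫ x in D, P x * laplacian ψ x = ∑ i, ∑ j, inner ℝ (T i j) (hH i j).toLp := by
        simp only [← e2]; exact e1
    _ ≤ ∑ i, ∑ j, ‖T i j‖ * ‖(hH i j).toLp‖ :=
        Finset.sum_le_sum fun i _ => Finset.sum_le_sum fun j _ => real_inner_le_norm _ _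
    _ ≤ √(∑ i, ∑ j, ‖T i j‖ ^ 2) * √(∑ i, ∑ j, ‖(hH i j).toLp‖ ^ 2) := sum_sum_mul_le_sqrt _ _
    _ = _ := by rw [e3, Real.sqrt_sq (norm_nonneg u)]

/-- Nečas' inequality on a John domain: `P` is controlled in `L²`, up to a constant, by any `T` with
`∇P = div T`. Subtracting from `P` its projection to the closure of the Laplacians of test functions
leaves a harmonic function. -/
lemma IsJohnDomain.necas {D : Set Plane} {x₀ : Plane} {L : ℝ≥0} (hD : IsJohnDomain D x₀ L) :
    ∃ C : ℝ, 0 ≤ C ∧ ∀ (P : Lp ℝ 2 (volume.restrict D))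
      (T : Fin 2 → Fin 2 → Lp ℝ 2 (volume.restrict D)), HasStress D P (fun i j => T i j) →
      ∃ c : ℝ, ∫ x in D, (P x - c) ^ 2 ≤ C * ∑ i, ∑ j, ‖T i j‖ ^ 2 := by
  obtain ⟨C, hC, hest⟩ := hD.harmonic_estimate
  have : IsFiniteMeasure (volume.restrict D) := ⟨by simpa using hD.2.1.measure_lt_top⟩
  refine ⟨12 * C + 2, by positivity, fun P T hPT => ?_⟩
  set S := ∑ i, ∑ j, ‖T i j‖ ^ 2 with hS
  have hS0 : 0 ≤ S := by positivity
  obtain ⟨P₁, hP₁, h, hh, hP⟩ :=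
    (testLaplacians D).topologicalClosure.exists_add_mem_mem_orthogonal P
  have hP₁n : ‖P₁‖ ^ 2 ≤ S := by
    have h1 := hPT.inner_le hP₁
    rw [hP, inner_add_left, real_inner_comm P₁ h, hh P₁ hP₁, add_zero,
      real_inner_self_eq_norm_sq] at h1
    have h2 : ‖P₁‖ ≤ √S := by
      by_contra! hlt
      nlinarith [Real.sqrt_nonneg S]
    calc ‖P₁‖ ^ 2 ≤ √S ^ 2 := by gcongr
      _ = S := Real.sq_sqrt hS0
  -- `h` is orthogonal to the Laplacians of test functions, that is, harmonic
  have hharm : IsWeaklyHarmonic D h := fun ψ hψ => by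
    rw [← L2_inner_eq_of_ae_eq (P := h) hψ.memLp_laplacian.coeFn_toLp, real_inner_comm]
    exact hh _ (subset_closure ⟨ψ, hψ, hψ.memLp_laplacian.coeFn_toLp⟩)
  -- `∇h = ∇P - ∇P₁ = div (T - P₁ Id)`
  let T' : Fin 2 → Fin 2 → Lp ℝ 2 (volume.restrict D) := fun i j => T i j - if i = j then P₁ else 0
  have hstress : HasStress D h fun i j => T' i j := fun φ hφ => by
    have hd := fun i j => ((hφ i).pderiv j).memLp
    have e0 := hPT φ hφ
    have e1 : ∀ Q : Lp ℝ 2 (volume.restrict D), ∫ x in D, Q x * ∑ i, partialDeriv i (φ i) x =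
        ∑ i, inner ℝ Q (hd i i).toLp := fun Q => by
      rw [Fin.sum_univ_two, ← inner_add_right, L2_inner_eq_of_ae_eq
        (f := fun x => ∑ i, partialDeriv i (φ i) x)]
      filter_upwards [Lp.coeFn_add (hd 0 0).toLp (hd 1 1).toLp, (hd 0 0).coeFn_toLp,
        (hd 1 1).coeFn_toLp] with x h1 h2 h3
      rw [h1, Pi.add_apply, h2, h3, Fin.sum_univ_two]
    have e2 : ∀ Q : Lp ℝ 2 (volume.restrict D), ∀ i j, ∫ x in D, Q x * partialDeriv j (φ i) x =
        inner ℝ Q (hd i j).toLp := fun Q i j => (L2_inner_eq_of_ae_eq (hd i j).coeFn_toLp).symm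
    rw [e1] at e0 ⊢
    simp only [e2] at e0 ⊢
    rw [eq_sub_of_add_eq' hP.symm]
    simp only [T', inner_sub_left, Finset.sum_sub_distrib, e0]
    congr 1
    simp [Fin.sum_univ_two]
  obtain ⟨c, hc⟩ := hest h T' hharm hstress
  have hT' : ∑ i, ∑ j, ‖T' i j‖ ^ 2 ≤ 6 * S := by
    have h1 : ∀ i j, ‖T' i j‖ ^ 2 ≤ 2 * ‖T i j‖ ^ 2 + 2 * ‖(if i = j then P₁ else 0)‖ ^ 2 :=
      fun i j => by
        have := norm_sub_le (T i j) (if i = j then P₁ else 0)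
        nlinarith [norm_nonneg (T' i j), sq_nonneg (‖T i j‖ - ‖(if i = j then P₁ else 0)‖)]
    calc ∑ i, ∑ j, ‖T' i j‖ ^ 2
        ≤ ∑ i, ∑ j, (2 * ‖T i j‖ ^ 2 + 2 * ‖(if i = j then P₁ else 0)‖ ^ 2) :=
          Finset.sum_le_sum fun i _ => Finset.sum_le_sum fun j _ => h1 i j
      _ = 2 * S + 4 * ‖P₁‖ ^ 2 := by
          simp [hS, Fin.sum_univ_two]; ring
      _ ≤ 6 * S := by linarith
  refine ⟨c, ?_⟩
  have ih : Integrable (fun x => (h x - c) ^ 2) (volume.restrict D) :=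
    ((Lp.memLp h).sub (memLp_const c)).integrable_sq
  have i1 : Integrable (fun x => P₁ x ^ 2) (volume.restrict D) := (Lp.memLp P₁).integrable_sq
  calc ∫ x in D, (P x - c) ^ 2 ≤ ∫ x in D, (2 * (h x - c) ^ 2 + 2 * P₁ x ^ 2) := by
        refine integral_mono_ae ((Lp.memLp P).sub (memLp_const c)).integrable_sq
          ((ih.const_mul 2).add (i1.const_mul 2)) ?_
        filter_upwards [Lp.coeFn_add P₁ h] with x hx
        rw [hP, hx, Pi.add_apply]
        nlinarith [sq_nonneg (h x - c - P₁ x)]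
    _ = 2 * (∫ x in D, (h x - c) ^ 2) + 2 * ‖P₁‖ ^ 2 := by
        rw [integral_add (ih.const_mul 2) (i1.const_mul 2), integral_const_mul, integral_const_mul,
          Lp_norm_sq_eq]
    _ ≤ 2 * (C * (6 * S)) + 2 * S := by
        have := hc.trans (mul_le_mul_of_nonneg_left hT' hC)
        linarith
    _ = (12 * C + 2) * S := by ring

/-! ### The pressure -/

/-- A closed range theorem: if the adjoint of `T`, restricted to `S`, is bounded below, then every
bounded functional on `S` that vanishes on the kernel of `T` is of the form `⟪π, T ·⟫`. -/
lemma exists_inner_eq_of_forall_ker {H F : Type*} [NormedAddCommGroup H] [InnerProductSpace ℝ H]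
    [CompleteSpace H] [NormedAddCommGroup F] [InnerProductSpace ℝ F] [CompleteSpace F]
    {S : Submodule ℝ H} (hS : IsClosed (S : Set H)) (T : H →L[ℝ] F) {C : ℝ}
    (hC : ∀ (q : F) (κ : ℝ), 0 ≤ κ → (∀ φ ∈ S, |inner ℝ q (T φ)| ≤ κ * ‖φ‖) → ‖q‖ ≤ C * κ)
    {f : H → ℝ} (hadd : ∀ φ ∈ S, ∀ ψ ∈ S, f (φ + ψ) = f φ + f ψ)
    (hsmul : ∀ a : ℝ, ∀ φ ∈ S, f (a • φ) = a * f φ) (hbdd : ∃ M, ∀ φ ∈ S, |f φ| ≤ M * ‖φ‖)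
    (hker : ∀ φ ∈ S, T φ = 0 → f φ = 0) : ∃ q : F, ∀ φ ∈ S, f φ = inner ℝ q (T φ) := by
  have : CompleteSpace S := hS.completeSpace_coe
  obtain ⟨M, hM⟩ := hbdd
  let g : S →L[ℝ] ℝ := LinearMap.mkContinuous
    { toFun := fun φ : S => f φ
      map_add' := fun φ ψ => hadd φ φ.2 ψ ψ.2
      map_smul' := fun a φ => hsmul a φ φ.2 } M fun φ => hM φ φ.2
  let R : S →L[ℝ] F := T.comp S.subtypeL
  have hlow : ∀ q : F, ‖q‖ ≤ max C 0 * ‖R.adjoint q‖ := fun q => by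
    refine (hC q ‖R.adjoint q‖ (norm_nonneg _) fun φ hφ => ?_).trans
      (mul_le_mul_of_nonneg_right (le_max_left _ _) (norm_nonneg _))
    have h1 : inner ℝ q (T φ) = inner ℝ (R.adjoint q) (⟨φ, hφ⟩ : S) := by
      rw [ContinuousLinearMap.adjoint_inner_left]; rfl
    rw [h1]
    exact abs_real_inner_le_norm _ _
  have hanti : AntilipschitzWith ⟨max C 0, le_max_right _ _⟩ R.adjoint :=
    AddMonoidHomClass.antilipschitz_of_bound _ hlow
  have hcl : IsClosed (R.adjoint.range : Set S) :=
    hanti.isClosed_range R.adjoint.uniformContinuous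
  have hy : (InnerProductSpace.toDual ℝ S).symm g ∈ R.kerᗮ := fun φ hφ => by
    rw [real_inner_comm, InnerProductSpace.toDual_symm_apply]
    exact hker φ φ.2 hφ
  rw [ContinuousLinearMap.orthogonal_ker, hcl.submodule_topologicalClosure_eq] at hy
  obtain ⟨q, hq⟩ := hy
  refine ⟨q, fun φ hφ => ?_⟩
  have h2 : g ⟨φ, hφ⟩ = inner ℝ (R.adjoint q) (⟨φ, hφ⟩ : S) := by
    rw [← InnerProductSpace.toDual_symm_apply, ← hq]; rfl
  rw [ContinuousLinearMap.adjoint_inner_left] at h2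
  exact h2

section Channel

variable {D : Set Plane} {ε : ℝ}

lemma disjoint_closure_noSlip (hD : IsChannel D ε) (i : Fin 2) :
    Disjoint D (closure (noSlip D i)) := by
  have hsub : noSlip D i ⊆ Dᶜ := by
    have h1 : noSlip D i ⊆ wallsAndSides D := by
      fin_cases i
      · exact subset_union_left
      · exact Subset.rfl
    intro x hx hxD
    have hb := hD.subset_box hxD
    rcases h1 hx with (h | h) | h | h
    · exact disjoint_left.1 (disjoint_frontier_iff_isOpen.2 hD.isOpen) h.1 hxD
    · exact absurd h.2 hb.2.2.ne
    · exact absurd h.1 hb.1.1.ne'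
    · exact absurd h.1 hb.1.2.ne
  exact disjoint_left.2 fun x hx hxc =>
    closure_minimal hsub hD.isOpen.isClosed_compl hxc hx

/-- The gradient is bounded below on `L²` of a John channel, as a map into the dual of the space of
velocity fields. Additive constants are controlled since the velocity fields may carry a flux
through the sides. -/
lemma IsChannel.exists_norm_le_of_abs_inner_divergence_le (hD : IsChannel D ε) {x₀ : Plane} {L : ℝ≥0}
    (hJ : IsJohnDomain D x₀ L) : ∃ C : ℝ, ∀ (q : Lp ℝ 2 (volume.restrict D)) (κ : ℝ), 0 ≤ κ →
      (∀ φ ∈ velocity D, |inner ℝ q (divergence D φ)| ≤ κ * ‖φ‖) → ‖q‖ ≤ C * κ := by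
  obtain ⟨C, hC, hest⟩ := hJ.necas
  have := hD.isFiniteMeasure
  -- the field `(x₁ x₂ (1 - x₂), 0)`, whose divergence has integral `1 / 6`, detects constants
  obtain ⟨z, hz⟩ := exists_isTensor hD (A := fun t => t * (1 - t)) (A' := fun t => 1 - 2 * t)
    (T := fun s => s) (T' := fun _ => 1) (by fun_prop) (by fun_prop) (by fun_prop) (by fun_prop)
  let χ : VField D := WithLp.toLp 2 ![z, 0]
  have hχ : χ ∈ velocity D := mem_velocity.2 fun i => by
    fin_cases i
    · exact tensor_mem_walls hD (fun t => by
        have := (hasDerivAt_id t).fun_mul ((hasDerivAt_id t).const_sub 1)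
        exact this.congr_deriv (by simp; ring)) (by fun_prop) (by simp) (by simp) contDiff_id
        (fun t => hasDerivAt_id t) hz
    · exact Submodule.zero_mem _
  have hdiv : divergence D χ = z 1 := by
    rw [divergence_apply]
    change z 1 + 0 = z 1
    rw [add_zero]
  let e : Lp ℝ 2 (volume.restrict D) := (memLp_const (1 : ℝ)).toLp
  have he : e =ᵐ[volume.restrict D] fun _ => (1 : ℝ) := MemLp.coeFn_toLp _
  have hez : inner ℝ e (z 1) = 1 / 6 := by
    rw [L2_inner_eq_of_ae_eq hz.horizontal, integral_congr_ae (he.mono fun x hx => by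
      change _ = (rect 0 1 0 1).indicator (fun x : Plane => x 1 * (1 - x 1) * 1) x
      simp only [hx, one_mul]), setIntegral_indicator (measurableSet_rect 0 1 0 1),
      inter_eq_self_of_subset_right hD.unit_subset,
      setIntegral_rect zero_le_one zero_le_one (integrableOn_rect_of_continuous (by fun_prop))]
    simp only [Matrix.cons_val_one, Matrix.cons_val_zero, intervalIntegral.integral_const, sub_zero,
      one_smul, mul_one, mul_sub, mul_one]
    rw [intervalIntegral.integral_sub (Continuous.intervalIntegrable (by fun_prop) _ _)
      (Continuous.intervalIntegrable (by fun_prop) _ _)]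
    simp only [integral_id, ← sq, integral_pow]
    norm_num
  refine ⟨5 * √C + 6 * (‖χ‖ + 5 * √C * ‖z 1‖) * ‖e‖, fun q κ hκ hq => ?_⟩
  -- `w` represents the gradient of `q`, so that `∇q` is the divergence of `∇w`
  obtain ⟨w, hw, hwe, hwn, -⟩ := exists_unique_small_solution_mem (isClosed_velocity D)
    (B := dirichlet D) (g := fun _ φ => inner ℝ q (divergence D φ)) (c := 1 / 5) (q := 0)
    (κ := κ) (R := 5 * κ) (by norm_num) le_rfl (by positivity) hκ (by linarith)
    (fun u hu => by linarith [norm_sq_le_dirichlet hD hu])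
    (fun u _ φ _ ψ _ => by rw [map_add, inner_add_right])
    (fun u _ a φ _ => by rw [map_smul, inner_smul_right])
    (fun u _ => ⟨κ, hq⟩) hq (fun u _ v _ φ _ _ _ => by simp)
  have hstress : HasStress D q fun i j => w i j.succ := fun φ hφ => by
    have htest : ∀ i, IsTestOff (noSlip D i) (φ i) := fun i =>
      ⟨(hφ i).contDiff, (hφ i).hasCompactSupport,
        (disjoint_closure_noSlip hD i).mono_left (hφ i).tsupport_subset⟩
    choose y hy using fun i => exists_isTripleOf D (htest i)
    have hmem : (WithLp.toLp 2 y : VField D) ∈ velocity D :=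
      mem_velocity.2 fun i => (hy i).mem_H1Zero (htest i)
    have h1 := hwe _ hmem
    rw [dirichlet_apply] at h1
    have h2 : ∀ i j, inner ℝ (w i j.succ) (y i j.succ) =
        ∫ x in D, w i j.succ x * partialDeriv j (φ i) x := fun i j =>
      L2_inner_eq_of_ae_eq ((hy i).grad j)
    have h3 : inner ℝ q (divergence D (WithLp.toLp 2 y : VField D)) =
        ∫ x in D, q x * ∑ i, partialDeriv i (φ i) x := by
      refine L2_inner_eq_of_ae_eq (f := fun x => ∑ i, partialDeriv i (φ i) x) ?_
      rw [divergence_apply]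
      filter_upwards [Lp.coeFn_add (y 0 1) (y 1 2), (hy 0).grad 0, (hy 1).grad 1] with x e1 e2 e3
      rw [Fin.sum_univ_two, ← e2, ← e3]
      exact e1
    rw [← h3, ← h1]
    exact Finset.sum_congr rfl fun i _ => Finset.sum_congr rfl fun j _ => h2 i j
  obtain ⟨c, hc⟩ := hest q _ hstress
  have hqc : ‖q - c • e‖ ≤ 5 * √C * κ := by
    refine abs_le_of_sq_le_sq' ?_ (by positivity) |>.2
    have h1 : ‖q - c • e‖ ^ 2 = ∫ x in D, (q x - c) ^ 2 := by
      rw [Lp_norm_sq_eq]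
      refine integral_congr_ae ?_
      filter_upwards [Lp.coeFn_sub q (c • e), Lp.coeFn_smul c e, he] with x e1 e2 e3
      simp only [e1, Pi.sub_apply, e2, Pi.smul_apply, e3, smul_eq_mul, mul_one]
    have h2 : ∑ i, ∑ j : Fin 2, ‖w i j.succ‖ ^ 2 ≤ (5 * κ) ^ 2 := by
      rw [← dirichlet_self]
      refine (dirichlet_self_le w).trans ?_
      have : ‖w‖ ≤ 5 * κ := by linarith
      gcongr
    calc ‖q - c • e‖ ^ 2 ≤ C * ∑ i, ∑ j : Fin 2, ‖w i j.succ‖ ^ 2 := h1.trans_le hc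
      _ ≤ C * (5 * κ) ^ 2 := by gcongr
      _ = (5 * √C * κ) ^ 2 := by rw [mul_pow (5 * √C), mul_pow 5 √C, Real.sq_sqrt hC]; ring
  have hcb : |c| ≤ 6 * (‖χ‖ + 5 * √C * ‖z 1‖) * κ := by
    have h1 := hq χ hχ
    rw [hdiv] at h1
    have h2 : c / 6 = inner ℝ q (z 1) - inner ℝ (q - c • e) (z 1) := by
      rw [inner_sub_left, real_inner_smul_left, hez]; ring
    have h3 := abs_real_inner_le_norm (q - c • e) (z 1)
    have h4 : |c| / 6 ≤ κ * ‖χ‖ + 5 * √C * κ * ‖z 1‖ := by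
      rw [show |c| / 6 = |c / 6| by rw [abs_div]; norm_num, h2]
      refine (abs_sub _ _).trans (add_le_add h1 (h3.trans ?_))
      gcongr
    linarith
  calc ‖q‖ = ‖(q - c • e) + c • e‖ := by rw [sub_add_cancel]
    _ ≤ ‖q - c • e‖ + ‖c • e‖ := norm_add_le _ _
    _ ≤ 5 * √C * κ + 6 * (‖χ‖ + 5 * √C * ‖z 1‖) * κ * ‖e‖ := by
        rw [norm_smul, Real.norm_eq_abs]
        gcongr
    _ = _ := by ring

end Channel

/-! ### Weak solutions in terms of the Hilbert space of velocity fields -/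

section Channel

variable {D : Set Plane} {ε : ℝ}

/-- The weak form of the stationary Navier-Stokes equations for the velocity `z` and the deviation
`q` of the pressure from its linear interpolation between the two sides. -/
def IsVelocityPressure (hD : IsChannel D ε) (lam : ℝ) (z : VField D)
    (q : Lp ℝ 2 (volume.restrict D)) : Prop :=
  ∀ φ ∈ velocity D, dirichlet D z φ + convection D z z φ - inner ℝ q (divergence D φ) =
    -2 * lam * flux hD φ

lemma IsVelocityPressure.isSolenoidalSolution {hD : IsChannel D ε} {lam : ℝ} {z : VField D}
    {q : Lp ℝ 2 (volume.restrict D)} (h : IsVelocityPressure hD lam z q) :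
    IsSolenoidalSolution hD lam z := fun φ hφ => by
  have := h φ hφ.1
  rwa [(mem_solenoidal.1 hφ).2, inner_zero_right, sub_zero] at this

/-- The equation tested with divergence-free fields determines a pressure on a John channel. -/
lemma IsSolenoidalSolution.exists_isVelocityPressure {hD : IsChannel D ε} {x₀ : Plane} {L : ℝ≥0}
    (hJ : IsJohnDomain D x₀ L) {lam : ℝ} {z : VField D} (hz : z ∈ velocity D)
    (h : IsSolenoidalSolution hD lam z) : ∃ q, IsVelocityPressure hD lam z q := by
  obtain ⟨C, hC⟩ := hD.exists_norm_le_of_abs_inner_divergence_le hJ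
  obtain ⟨q, hq⟩ := exists_inner_eq_of_forall_ker (isClosed_velocity D) (divergence D) hC
    (f := fun φ => dirichlet D z φ + convection D z z φ + 2 * lam * flux hD φ)
    (fun φ hφ ψ hψ => by rw [convection_add_right hD hz hφ hψ, map_add, map_add]; ring)
    (fun a φ _ => by rw [convection_smul_right, map_smul, map_smul, smul_eq_mul, smul_eq_mul]; ring)
    ⟨‖dirichlet D z‖ + 36 * ‖z‖ * ‖z‖ + ‖(2 * lam) • flux hD‖, fun φ hφ => by
      rw [add_mul, add_mul]
      refine (abs_add_le _ _).trans (add_le_add ((abs_add_le _ _).trans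
        (add_le_add ((dirichlet D z).le_opNorm φ) (convection_le_norm hD hz hφ))) ?_)
      exact ((2 * lam) • flux hD).le_opNorm φ⟩
    (fun φ hφ h0 => by
      have := h φ (mem_solenoidal.2 ⟨hφ, h0⟩)
      linarith)
  exact ⟨q, fun φ hφ => by rw [← hq φ hφ]; ring⟩

/-- The pressure is unique, including its additive constant: test fields may carry a flux through the
sides. -/
lemma IsVelocityPressure.pressure_unique {hD : IsChannel D ε} {x₀ : Plane} {L : ℝ≥0}
    (hJ : IsJohnDomain D x₀ L) {lam : ℝ} {z : VField D} {q q' : Lp ℝ 2 (volume.restrict D)}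
    (h : IsVelocityPressure hD lam z q) (h' : IsVelocityPressure hD lam z q') : q = q' := by
  obtain ⟨C, hC⟩ := hD.exists_norm_le_of_abs_inner_divergence_le hJ
  have := hC (q - q') 0 le_rfl fun φ hφ => by
    have h1 := h φ hφ
    have h2 := h' φ hφ
    rw [inner_sub_left, show inner ℝ q (divergence D φ) = inner ℝ q' (divergence D φ) by linarith]
    simp
  rw [mul_zero, norm_le_zero_iff] at this
  exact sub_eq_zero.1 this

/-- It is enough to test the equations with smooth fields. -/
lemma isVelocityPressure_of_test (hD : IsChannel D ε) {lam : ℝ} {z : VField D} (hz : z ∈ velocity D)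
    {q : Lp ℝ 2 (volume.restrict D)}
    (h : ∀ (φ : Plane → Plane) (x : VField D), (∀ i, IsTestOff (noSlip D i) fun a => φ a i) →
      (∀ i, IsTripleOf D (fun a => φ a i) (x i)) →
      dirichlet D z x + convection D z z x - inner ℝ q (divergence D x) = -2 * lam * flux hD x) :
    IsVelocityPressure hD lam z q := fun x hx => by
  let M := ‖dirichlet D z‖ + 36 * ‖z‖ * ‖z‖ + ‖(innerSL ℝ q).comp (divergence D)‖ +
    ‖(2 * lam) • flux hD‖
  have hM : ∀ y ∈ velocity D, |dirichlet D z y + convection D z z y - inner ℝ q (divergence D y) +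
      2 * lam * flux hD y| ≤ M * ‖y‖ := fun y hy => by
    simp only [M, add_mul]
    refine (abs_add_le _ _).trans (add_le_add ((abs_sub _ _).trans (add_le_add
      ((abs_add_le _ _).trans (add_le_add ((dirichlet D z).le_opNorm y)
      (convection_le_norm hD hz hy))) ?_)) ?_)
    · exact ((innerSL ℝ q).comp (divergence D)).le_opNorm y
    · exact ((2 * lam) • flux hD).le_opNorm y
  have hM0 : 0 ≤ M := by positivity
  have hsmall : ∀ δ > 0, |dirichlet D z x + convection D z z x - inner ℝ q (divergence D x) +
      2 * lam * flux hD x| ≤ M * (2 * δ) := fun δ hδ => by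
    choose ψ hψ t ht hxt using fun i =>
      H1Zero_exists_approx hD (walls_subset_noSlip D i) (mem_velocity.1 hx i) hδ
    have htm : (WithLp.toLp 2 t : VField D) ∈ velocity D :=
      mem_velocity.2 fun i => (ht i).mem_H1Zero (hψ i).isTestOff
    have e := h (fun a => WithLp.toLp 2 fun i => ψ i a) (WithLp.toLp 2 t)
      (fun i => (hψ i).isTestOff) ht
    have hsub := (velocity D).sub_mem hx htm
    have h1 := hM _ hsub
    have h2 := convection_add_right (y := z) hD hz hsub htm
    rw [sub_add_cancel] at h2
    rw [map_sub, map_sub, map_sub, inner_sub_right] at h1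
    have h3 : ‖x - WithLp.toLp 2 t‖ ≤ 2 * δ := by
      refine abs_le_of_sq_le_sq' ?_ (by positivity) |>.2
      rw [PiLp.norm_sq_eq_of_L2, Fin.sum_univ_two]
      have h4 : ∀ i, ‖(x - WithLp.toLp 2 t) i‖ ^ 2 ≤ δ ^ 2 := fun i =>
        pow_le_pow_left₀ (norm_nonneg _) (hxt i).le 2
      nlinarith [h4 0, h4 1, sq_nonneg δ]
    calc _ = |dirichlet D z x - dirichlet D z (WithLp.toLp 2 t) +
          convection D z z (x - WithLp.toLp 2 t) - (inner ℝ q (divergence D x) -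
          inner ℝ q (divergence D (WithLp.toLp 2 t))) + 2 * lam *
          (flux hD x - flux hD (WithLp.toLp 2 t))| := by
          congr 1; rw [h2]; linear_combination e
      _ ≤ M * ‖x - WithLp.toLp 2 t‖ := h1
      _ ≤ M * (2 * δ) := by gcongr
  have h0 : |dirichlet D z x + convection D z z x - inner ℝ q (divergence D x) +
      2 * lam * flux hD x| ≤ 0 := by
    refine le_of_forall_pos_le_add fun δ hδ => ?_
    refine (hsmall (δ / (2 * M + 1)) (by positivity)).trans ?_
    rw [zero_add, ← mul_div_assoc, ← mul_div_assoc, div_le_iff₀ (by positivity)]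
    nlinarith
  have := abs_nonpos_iff.1 h0
  linarith

/-- For smooth test fields the two weak formulations agree. -/
lemma weakForm_eq (hD : IsChannel D ε) {p₀ p₁ : ℝ} {U : Plane → Plane} {P : Plane → ℝ}
    {z : VField D} {q : Lp ℝ 2 (volume.restrict D)} (hz : z ∈ velocity D)
    (hU : ∀ i, z i 0 =ᵐ[volume.restrict D] fun a => U a i)
    (hdU : ∀ i j, z i (Fin.succ j) =ᵐ[volume.restrict D] weakPartial D (fun a => U a i) j)
    (hP : q =ᵐ[volume.restrict D] fun a => P a - (p₀ + (p₁ - p₀) * a 0))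
    {φ : Plane → Plane} (hφ : ∀ i, IsTestOff (noSlip D i) fun a => φ a i) {x : VField D}
    (hx : ∀ i, IsTripleOf D (fun a => φ a i) (x i)) :
    (∫ a in D, ∑ i, ∑ j, weakPartial D (fun y => U y i) j a * partialDeriv j (fun y => φ y i) a)
        + (∫ a in D, ∑ i, (∑ j, U a j * weakPartial D (fun y => U y i) j a) * φ a i)
        - (∫ a in D, P a * ∑ j, partialDeriv j (fun y => φ y j) a)
        - (p₀ * (∫ s in (0 : ℝ)..1, φ !₂[0, s] 0) - p₁ * (∫ s in (0 : ℝ)..1, φ !₂[1, s] 0)) =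
      dirichlet D z x + convection D z z x - inner ℝ q (divergence D x)
        + 2 * ((p₁ - p₀) / 2) * flux hD x := by
  have hxm : x ∈ velocity D := mem_velocity.2 fun i => (hx i).mem_H1Zero (hφ i)
  have e1 : ∫ a in D, ∑ i, ∑ j,
      weakPartial D (fun y => U y i) j a * partialDeriv j (fun y => φ y i) a = dirichlet D z x := by
    rw [dirichlet_apply]
    have h1 : ∀ i j, Integrable (fun a => z i (Fin.succ j) a * x i (Fin.succ j) a)
        (volume.restrict D) := fun i j => (Lp.memLp _).integrable_mul (Lp.memLp _)
    have h2 : ∀ i j, inner ℝ (z i (Fin.succ j)) (x i (Fin.succ j)) =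
        ∫ a in D, z i (Fin.succ j) a * x i (Fin.succ j) a := fun i j =>
      L2_inner_eq_of_ae_eq (EventuallyEq.refl _ _)
    simp only [h2]
    rw [← integral_congr_ae (show (fun a => ∑ i, ∑ j, z i (Fin.succ j) a * x i (Fin.succ j) a)
      =ᵐ[volume.restrict D] _ from ?_), integral_finsetSum _ fun i _ => integrable_finsetSum _
      fun j _ => h1 i j]
    · exact Finset.sum_congr rfl fun i _ => integral_finsetSum _ fun j _ => h1 i j
    · have h3 := ae_all_iff.2 fun i => ae_all_iff.2 fun j => hdU i j
      have h4 := ae_all_iff.2 fun i => ae_all_iff.2 fun j => (hx i).grad j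
      filter_upwards [h3, h4] with a ha hb
      simp only [ha, hb]
  have e2 : ∫ a in D, ∑ i, (∑ j, U a j * weakPartial D (fun y => U y i) j a) * φ a i =
      convection D z z x := by
    have h1 := convection_integrable (y := z) hD hz hxm
    rw [convection, ← integral_congr_ae (show (fun a => ∑ i, ∑ j,
      z j 0 a * z i (Fin.succ j) a * x i 0 a) =ᵐ[volume.restrict D] _ from ?_),
      integral_finsetSum _ fun i _ => integrable_finsetSum _ fun j _ => h1 i j]
    · exact Finset.sum_congr rfl fun i _ => integral_finsetSum _ fun j _ => h1 i j
    · have h3 := ae_all_iff.2 fun i => ae_all_iff.2 fun j => hdU i j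
      have h4 := ae_all_iff.2 fun i => hU i
      have h5 := ae_all_iff.2 fun i => (hx i).val
      filter_upwards [h3, h4, h5] with a ha hb hc
      simp only [ha, hb, hc, Finset.sum_mul]
  have hdx : divergence D x =ᵐ[volume.restrict D]
      fun a => ∑ j, partialDeriv j (fun y => φ y j) a := by
    rw [divergence_apply]
    filter_upwards [Lp.coeFn_add (x 0 1) (x 1 2), (hx 0).grad 0, (hx 1).grad 1] with a e1 e2 e3
    rw [Fin.sum_univ_two, ← e2, ← e3]
    exact e1
  have hl : MemLp (fun a : Plane => p₀ + (p₁ - p₀) * a 0) 2 (volume.restrict D) :=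
    hD.memLp_of_continuous (by fun_prop)
  have hd : ∀ j : Fin 2, MemLp (partialDeriv j fun y => φ y j) 2 (volume.restrict D) := fun j =>
    (contDiff_partialDeriv (hφ j).1 j).continuous.memLp_of_hasCompactSupport
      (hasCompactSupport_partialDeriv (hφ j).2.1 j)
  have hds : MemLp (fun a => ∑ j, partialDeriv j (fun y => φ y j) a) 2 (volume.restrict D) :=
    memLp_finsetSum _ fun j _ => hd j
  have hid : ∀ j : Fin 2, Integrable (fun a => (p₀ + (p₁ - p₀) * a 0) *
      partialDeriv j (fun y => φ y j) a) (volume.restrict D) := fun j => hl.integrable_mul (hd j)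
  have e3 : inner ℝ q (divergence D x) =
      (∫ a in D, P a * ∑ j, partialDeriv j (fun y => φ y j) a) -
        ∫ a in D, (p₀ + (p₁ - p₀) * a 0) * partialDeriv 0 (fun y => φ y 0) a := by
    have hPm : MemLp P 2 (volume.restrict D) := (memLp_congr_ae (hP.mono fun a ha => by
      change P a = (q a + (p₀ + (p₁ - p₀) * a 0)); rw [ha]; ring)).2 ((Lp.memLp q).add hl)
    rw [L2_inner_eq_of_ae_eq hdx]
    have h1 : ∫ a in D, (p₀ + (p₁ - p₀) * a 0) * ∑ j, partialDeriv j (fun y => φ y j) a =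
        ∫ a in D, (p₀ + (p₁ - p₀) * a 0) * partialDeriv 0 (fun y => φ y 0) a := by
      have h2 := setIntegral_mul_partialDeriv_one hD (walls_subset_noSlip D 1) (hφ 1)
        (τ := fun t => p₀ + (p₁ - p₀) * t) (by fun_prop)
      simp only [Fin.sum_univ_two, mul_add]
      rw [integral_add (hid 0) (hid 1), h2, add_zero]
    have i1 : Integrable (fun a => P a * ∑ j, partialDeriv j (fun y => φ y j) a)
      (volume.restrict D) := hPm.integrable_mul hds
    have i2 : Integrable (fun a => (p₀ + (p₁ - p₀) * a 0) *
      ∑ j, partialDeriv j (fun y => φ y j) a) (volume.restrict D) := hl.integrable_mul hds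
    rw [← h1, ← integral_sub i1 i2]
    refine integral_congr_ae (hP.mono fun a ha => ?_)
    simp only [ha]; ring
  have e4 := sides_eq_setIntegral hD (hφ 0) p₀ p₁
  have e5 : flux hD x = ∫ a in D, φ a 0 := by
    rw [flux_apply]; exact integral_congr_ae (hx 0).val
  rw [e1, e2, e3, e5]
  linear_combination e4

/-- A weak solution gives an element of the Hilbert space. -/
lemma IsWeakSolution.exists_isVelocityPressure (hD : IsChannel D ε) {p₀ p₁ : ℝ} {U : Plane → Plane}
    {P : Plane → ℝ} (h : IsWeakSolution D p₀ p₁ U P) :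
    ∃ z ∈ solenoidal D, ∃ q, IsVelocityPressure hD ((p₁ - p₀) / 2) z q ∧
      (∀ i, z i 0 =ᵐ[volume.restrict D] fun a => U a i) ∧
      (∀ i j, z i (Fin.succ j) =ᵐ[volume.restrict D] weakPartial D (fun a => U a i) j) ∧
      q =ᵐ[volume.restrict D] fun a => P a - (p₀ + (p₁ - p₀) * a 0) := by
  obtain ⟨h0, h1, hP, hdiv, hw⟩ := h
  have hU : ∀ i, MemH1Zero D (noSlip D i) fun a => U a i := fun i => by
    fin_cases i
    · exact h0
    · exact h1
  choose z hz hz0 hzj using fun i => (hU i).exists_mem_H1Zero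
  have hzm : (WithLp.toLp 2 z : VField D) ∈ velocity D := mem_velocity.2 hz
  have hl : MemLp (fun a => P a - (p₀ + (p₁ - p₀) * a 0)) 2 (volume.restrict D) :=
    hP.sub (hD.memLp_of_continuous (by fun_prop))
  refine ⟨WithLp.toLp 2 z, mem_solenoidal.2 ⟨hzm, ?_⟩, hl.toLp, isVelocityPressure_of_test hD hzm
    fun φ x hφ hx => ?_, hz0, hzj, hl.coeFn_toLp⟩
  · rw [divergence_apply, Lp.ext_iff]
    filter_upwards [Lp.coeFn_add (z 0 1) (z 1 2), Lp.coeFn_zero ℝ 2 (volume.restrict D), hzj 0 0,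
      hzj 1 1, hdiv] with a e1 e2 e3 e4 e5
    rw [Fin.sum_univ_two, ← e3, ← e4] at e5
    rw [e2]
    exact e1.trans e5
  · have := weakForm_eq (z := WithLp.toLp 2 z) hD hzm hz0 hzj hl.coeFn_toLp hφ hx
    rw [hw φ (hφ 0) (hφ 1), sub_self] at this
    linarith

/-- An element of the Hilbert space that solves the equations gives a weak solution. -/
lemma IsVelocityPressure.exists_isWeakSolution {hD : IsChannel D ε} {p₀ p₁ : ℝ} {z : VField D}
    {q : Lp ℝ 2 (volume.restrict D)} (h : IsVelocityPressure hD ((p₁ - p₀) / 2) z q)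
    (hz : z ∈ solenoidal D) :
    ∃ U P, IsWeakSolution D p₀ p₁ U P ∧
      (∀ i, z i 0 =ᵐ[volume.restrict D] fun a => U a i) ∧
      (∀ i j, z i (Fin.succ j) =ᵐ[volume.restrict D] weakPartial D (fun a => U a i) j) ∧
      q =ᵐ[volume.restrict D] fun a => P a - (p₀ + (p₁ - p₀) * a 0) := by
  let U : Plane → Plane := fun a => WithLp.toLp 2 fun i => z i 0 a
  let P : Plane → ℝ := fun a => q a + (p₀ + (p₁ - p₀) * a 0)
  have hU : ∀ i, (fun a => U a i) =ᵐ[volume.restrict D] z i 0 := fun i => EventuallyEq.refl _ _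
  have h1 := fun i => memH1Zero_of_mem_H1Zero hD.isOpen (mem_velocity.1 hz.1 i) (hU i)
  have hdU : ∀ i j, z i (Fin.succ j) =ᵐ[volume.restrict D] weakPartial D (fun a => U a i) j :=
    fun i j => ((h1 i).2 j).symm
  have hP : q =ᵐ[volume.restrict D] fun a => P a - (p₀ + (p₁ - p₀) * a 0) :=
    Eventually.of_forall fun a => by simp [P]
  refine ⟨U, P, ⟨(h1 0).1, (h1 1).1, (Lp.memLp q).add (hD.memLp_of_continuous (by fun_prop)), ?_,
    fun φ hφ0 hφ1 => ?_⟩, fun i => (hU i).symm, hdU, hP⟩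
  · have h2 := (mem_solenoidal.1 hz).2
    rw [divergence_apply, Lp.ext_iff] at h2
    filter_upwards [h2, Lp.coeFn_add (z 0 1) (z 1 2), Lp.coeFn_zero ℝ 2 (volume.restrict D),
      hdU 0 0, hdU 1 1] with a e1 e2 e3 e4 e5
    rw [Fin.sum_univ_two, ← e4, ← e5]
    rw [e2, e3] at e1
    exact e1
  · have hφ : ∀ i, IsTestOff (noSlip D i) fun a => φ a i := fun i => by
      fin_cases i
      · exact hφ0
      · exact hφ1
    choose x hx using fun i => exists_isTripleOf D (hφ i)
    have hxm : (WithLp.toLp 2 x : VField D) ∈ velocity D :=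
      mem_velocity.2 fun i => (hx i).mem_H1Zero (hφ i)
    have e := weakForm_eq (x := WithLp.toLp 2 x) hD hz.1 (fun i => (hU i).symm) hdU hP hφ hx
    have e' := h _ hxm
    linear_combination e + e'

/-- The Poiseuille flow and its weak derivatives, as an element of the Hilbert space. -/
lemma IsPoiseuille.ae_eq (hD : IsChannel D ε) {p₀ p₁ : ℝ} {p : VField D}
    (hp : IsPoiseuille D ((p₁ - p₀) / 2) p) (i : Fin 2) :
    (fun a => poiseuille p₀ p₁ a i) =ᵐ[volume.restrict D] p i 0 := by
  fin_cases i
  · filter_upwards [hp.first.val, ae_restrict_mem hD.isOpen.measurableSet] with a ha haD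
    have hb := hD.subset_rect haD
    simp only [Fin.zero_eta]
    rw [ha]
    by_cases h : 0 < a 1
    · rw [indicator_of_mem (show a ∈ rect 0 1 0 1 from ⟨hb.1, h, hb.2.2⟩), poiseuille, if_pos h]
      simp
    · rw [indicator_of_notMem (fun hm : a ∈ rect 0 1 0 1 => h hm.2.1), poiseuille, if_neg h]
      simp
  · have e1 : p 1 0 = 0 := by rw [hp.second]; rfl
    simp only [Fin.mk_one]
    rw [e1]
    filter_upwards [Lp.coeFn_zero ℝ 2 (volume.restrict D)] with a ha
    rw [ha, poiseuille]
    split_ifs <;> simp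

lemma gradDistSq_eq_dirichlet (hD : IsChannel D ε) {p₀ p₁ : ℝ} {p z : VField D}
    (hp : IsPoiseuille D ((p₁ - p₀) / 2) p) {U : Plane → Plane}
    (hdU : ∀ i j, z i (Fin.succ j) =ᵐ[volume.restrict D] weakPartial D (fun a => U a i) j) :
    gradDistSq D U (poiseuille p₀ p₁) = dirichlet D (z - p) (z - p) := by
  have h1 := fun i => (memH1Zero_of_mem_H1Zero hD.isOpen
    (mem_velocity.1 (hp.mem_solenoidal hD).1 i) (hp.ae_eq hD i)).2
  have h2 : ∀ i (j : Fin 2), Integrable (fun a => (z - p) i j.succ a ^ 2) (volume.restrict D) :=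
    fun i j => (Lp.memLp _).integrable_sq
  rw [dirichlet_self, gradDistSq, ← integral_congr_ae (show (fun a => ∑ i, ∑ j : Fin 2,
    (z - p) i j.succ a ^ 2) =ᵐ[volume.restrict D] _ from ?_),
    integral_finsetSum _ fun i _ => integrable_finsetSum _ fun j _ => h2 i j]
  · refine Finset.sum_congr rfl fun i _ => ?_
    rw [integral_finsetSum _ fun j _ => h2 i j]
    exact Finset.sum_congr rfl fun j _ => (Lp_norm_sq_eq _).symm
  · have h3 := ae_all_iff.2 fun i => ae_all_iff.2 fun j => hdU i j
    have h4 := ae_all_iff.2 fun i => ae_all_iff.2 fun j => h1 i j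
    have h5 := ae_all_iff.2 fun i => ae_all_iff.2 fun j : Fin 2 =>
      Lp.coeFn_sub (z i j.succ) (p i j.succ)
    filter_upwards [h3, h4, h5] with a e1 e2 e3
    refine Finset.sum_congr rfl fun i _ => Finset.sum_congr rfl fun j _ => ?_
    rw [← e1 i j, e2 i j]
    exact congrArg (· ^ 2) (e3 i j)

lemma setIntegral_norm_sub_sq_eq (hD : IsChannel D ε) {p₀ p₁ : ℝ} {p z : VField D}
    (hp : IsPoiseuille D ((p₁ - p₀) / 2) p) {U : Plane → Plane}
    (hU : ∀ i, z i 0 =ᵐ[volume.restrict D] fun a => U a i) :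
    ∫ a in D, ‖U a - poiseuille p₀ p₁ a‖ ^ 2 = ∑ i, ‖(z - p) i 0‖ ^ 2 := by
  have h2 : ∀ i, Integrable (fun a => (z - p) i 0 a ^ 2) (volume.restrict D) :=
    fun i => (Lp.memLp _).integrable_sq
  rw [← integral_congr_ae (show (fun a => ∑ i, (z - p) i 0 a ^ 2) =ᵐ[volume.restrict D] _ from ?_),
    integral_finsetSum _ fun i _ => h2 i]
  · exact Finset.sum_congr rfl fun i _ => (Lp_norm_sq_eq _).symm
  · have h3 := ae_all_iff.2 hU
    have h4 := ae_all_iff.2 (hp.ae_eq hD)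
    have h5 := ae_all_iff.2 fun i => Lp.coeFn_sub (z i 0) (p i 0)
    filter_upwards [h3, h4, h5] with a e1 e2 e3
    rw [EuclideanSpace.real_norm_sq_eq]
    refine Finset.sum_congr rfl fun i _ => ?_
    have e4 : (U a - poiseuille p₀ p₁ a) i = z i 0 a - p i 0 a := by
      rw [e1 i, ← e2 i]; rfl
    rw [e4]
    exact congrArg (· ^ 2) (e3 i)

end Channel

/-! ### Cosine and sine series on the unit interval -/

/-- `cos (k π s)`. -/
noncomputable def cosMode (k : ℕ) (s : ℝ) : ℝ := Real.cos (k * Real.pi * s)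

/-- `sin (k π s)`. -/
noncomputable def sinMode (k : ℕ) (s : ℝ) : ℝ := Real.sin (k * Real.pi * s)

@[fun_prop] lemma continuous_cosMode (k : ℕ) : Continuous (cosMode k) := by
  unfold cosMode; fun_prop

@[fun_prop] lemma continuous_sinMode (k : ℕ) : Continuous (sinMode k) := by
  unfold sinMode; fun_prop

lemma hasDerivAt_cosMode (k : ℕ) (s : ℝ) :
    HasDerivAt (cosMode k) (-(k * Real.pi) * sinMode k s) s :=
  ((Real.hasDerivAt_cos _).comp s ((hasDerivAt_id s).const_mul (k * Real.pi))).congr_deriv (by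
    simp [sinMode]; ring)

lemma hasDerivAt_sinMode (k : ℕ) (s : ℝ) :
    HasDerivAt (sinMode k) (k * Real.pi * cosMode k s) s :=
  ((Real.hasDerivAt_sin _).comp s ((hasDerivAt_id s).const_mul (k * Real.pi))).congr_deriv (by
    simp [cosMode]; ring)

lemma abs_cosMode_le (k : ℕ) (s : ℝ) : |cosMode k s| ≤ 1 := Real.abs_cos_le_one _

lemma abs_sinMode_le (k : ℕ) (s : ℝ) : |sinMode k s| ≤ 1 := Real.abs_sin_le_one _

@[simp] lemma sinMode_zero (k : ℕ) : sinMode k 0 = 0 := by simp [sinMode]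

@[simp] lemma sinMode_one (k : ℕ) : sinMode k 1 = 0 := by simp [sinMode]

lemma contDiff_cosMode (k : ℕ) : ContDiff ℝ ∞ (cosMode k) :=
  Real.contDiff_cos.comp (contDiff_const.mul contDiff_id)

section Parseval

variable {g : ℝ → ℝ}

/-- The reflection of a function on `[0, 1]` to `[-1, 1]`: even for `σ = 1`, odd for `σ = -1`. -/
noncomputable def reflection (g : ℝ → ℝ) (σ : ℝ) (x : ℝ) : ℂ :=
  if 0 < x then (g x : ℂ) else (σ * g (-x) : ℂ)

lemma integral_reflection {E : Type*} [NormedAddCommGroup E] [NormedSpace ℝ E] (hg : Continuous g)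
    (σ : ℝ) {F : ℝ → ℂ → E} (hF : Continuous fun p : ℝ × ℂ => F p.1 p.2) :
    ∫ x in (-1 : ℝ)..1, F x (reflection g σ x) =
      ∫ x in (0 : ℝ)..1, (F x (g x) + F (-x) (σ * g x)) := by
  have c1 : Continuous fun x : ℝ => F x (g x) := hF.comp (by fun_prop :
    Continuous fun x : ℝ => (x, (g x : ℂ)))
  have c2 : Continuous fun x : ℝ => F x (σ * g (-x)) := hF.comp (by fun_prop :
    Continuous fun x : ℝ => (x, (σ * g (-x) : ℂ)))
  have c3 : Continuous fun x : ℝ => F (-x) (σ * g x) := hF.comp (by fun_prop :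
    Continuous fun x : ℝ => (-x, (σ * g x : ℂ)))
  have e1 : EqOn (fun x => F x (g x)) (fun x => F x (reflection g σ x)) (uIoc (0 : ℝ) 1) :=
    fun x hx => by
      rw [uIoc_of_le zero_le_one] at hx
      simp only [reflection, if_pos hx.1]
  have e2 : EqOn (fun x => F x (σ * g (-x))) (fun x => F x (reflection g σ x)) (uIoc (-1 : ℝ) 0) :=
    fun x hx => by
      rw [uIoc_of_le (by norm_num)] at hx
      simp only [reflection, if_neg hx.2.not_gt]
  have i1 : IntervalIntegrable (fun x => F x (reflection g σ x)) volume 0 1 :=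
    (c1.intervalIntegrable 0 1).congr e1
  have i2 : IntervalIntegrable (fun x => F x (reflection g σ x)) volume (-1) 0 :=
    (c2.intervalIntegrable (-1) 0).congr e2
  rw [← intervalIntegral.integral_add_adjacent_intervals i2 i1,
    intervalIntegral.integral_add (c1.intervalIntegrable _ _) (c3.intervalIntegrable _ _), add_comm]
  congr 1
  · exact intervalIntegral.integral_congr_ae (Eventually.of_forall fun x hx => (e1 hx).symm)
  · rw [intervalIntegral.integral_congr_ae (Eventually.of_forall fun x hx => (e2 hx).symm)]
    have := intervalIntegral.integral_comp_neg (a := 0) (b := 1) fun x : ℝ => F x (σ * g (-x))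
    simp only [neg_neg, neg_zero] at this
    exact this.symm

lemma fourierCoeffOn_reflection (hg : Continuous g) (σ : ℝ) (n : ℤ) :
    fourierCoeffOn (show (-1 : ℝ) < 1 by norm_num) (reflection g σ) n =
      1 / 2 * ∫ x in (0 : ℝ)..1, (Complex.exp (-(n * Real.pi * x * Complex.I)) +
        σ * Complex.exp (n * Real.pi * x * Complex.I)) * g x := by
  rw [fourierCoeffOn_eq_integral]
  have h : ∀ x : ℝ, fourier (-n) (x : AddCircle ((1 : ℝ) - -1)) =
      Complex.exp (-(n * Real.pi * x * Complex.I)) := fun x => by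
    rw [fourier_coe_apply]
    congr 1
    push_cast
    ring
  rw [intervalIntegral.integral_congr fun x _ => by
      rw [h x],
    integral_reflection (F := fun x w => Complex.exp (-(n * Real.pi * x * Complex.I)) • w) hg σ
    (by fun_prop)]
  norm_num
  refine intervalIntegral.integral_congr fun x _ => ?_
  ring

lemma memLp_reflection (hg : Continuous g) (σ : ℝ) :
    MemLp (reflection g σ) 2 (volume.restrict (Ioc (-1 : ℝ) 1)) := by
  have hm : Measurable (reflection g σ) := by
    have h1 : Measurable fun x => (g x : ℂ) := by fun_prop
    have h2 : Measurable fun x => (σ * g (-x) : ℂ) := by fun_prop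
    exact Measurable.ite measurableSet_Ioi h1 h2
  obtain ⟨M, hM⟩ := isCompact_Icc.exists_bound_of_continuousOn (s := Icc (0 : ℝ) 1) hg.continuousOn
  refine MemLp.of_bound hm.aestronglyMeasurable (M + |σ| * M)
    ((ae_restrict_iff' measurableSet_Ioc).2 (Eventually.of_forall fun x hx => ?_))
  have hM0 : 0 ≤ M := (norm_nonneg _).trans (hM 0 (by simp))
  rw [reflection]
  split_ifs with h
  · rw [Complex.norm_real]
    have := hM x ⟨h.le, hx.2⟩
    have : 0 ≤ |σ| * M := by positivity
    linarith
  · rw [norm_mul, Complex.norm_real, Complex.norm_real, Real.norm_eq_abs]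
    have := mul_le_mul_of_nonneg_left (hM (-x) ⟨by linarith, by linarith [hx.1]⟩) (abs_nonneg σ)
    linarith

/-- Parseval's identity on `[-1, 1]` for the even (`σ = 1`) or odd (`σ = -1`) reflection of `g`. -/
lemma hasSum_int_sq_fourierCoeffOn_reflection (hg : Continuous g) {σ : ℝ} (hσ : |σ| = 1) :
    HasSum (fun n : ℤ => ‖fourierCoeffOn (show (-1 : ℝ) < 1 by norm_num) (reflection g σ) n‖ ^ 2)
      (∫ x in (0 : ℝ)..1, g x ^ 2) := by
  convert hasSum_sq_fourierCoeffOn (show (-1 : ℝ) < 1 by norm_num) (memLp_reflection hg σ) using 1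
  rw [integral_reflection (F := fun _ w => ‖w‖ ^ 2) hg σ (by fun_prop)]
  simp only [norm_mul, Complex.norm_real, Real.norm_eq_abs, hσ, sq_abs, one_mul, ← two_mul]
  rw [intervalIntegral.integral_const_mul, smul_eq_mul]
  ring

/-- Parseval's identity for the cosine series on `[0, 1]`. -/
lemma hasSum_sq_integral_mul_cosMode (hg : Continuous g) :
    HasSum (fun k : ℕ => (∫ s in (0 : ℝ)..1, g s * cosMode k s) ^ 2)
      (((∫ s in (0 : ℝ)..1, g s ^ 2) + (∫ s in (0 : ℝ)..1, g s) ^ 2) / 2) := by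
  have h := (hasSum_int_sq_fourierCoeffOn_reflection hg (σ := 1) (by simp)).nat_add_neg
  have key : ∀ n : ℤ, ‖fourierCoeffOn (show (-1 : ℝ) < 1 by norm_num) (reflection g 1) n‖ ^ 2 =
      (∫ s in (0 : ℝ)..1, g s * Real.cos (n * Real.pi * s)) ^ 2 := fun n => by
    rw [fourierCoeffOn_reflection hg, ← intervalIntegral.integral_const_mul]
    have : ∀ x : ℝ, (1 / 2 : ℂ) * ((Complex.exp (-(n * Real.pi * x * Complex.I)) +
        (1 : ℝ) * Complex.exp (n * Real.pi * x * Complex.I)) * g x) =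
        ((g x * Real.cos (n * Real.pi * x) : ℝ) : ℂ) := fun x => by
      push_cast
      rw [Complex.cos, ← neg_mul]
      ring
    simp only [this, intervalIntegral.integral_ofReal, Complex.norm_real, Real.norm_eq_abs, sq_abs]
  simp only [key, Int.cast_neg, Int.cast_natCast, neg_mul, Real.cos_neg, ← two_mul, Int.cast_zero,
    zero_mul, Real.cos_zero, mul_one] at h
  have h2 := h.mul_left (1 / 2)
  simp only [← mul_assoc, one_div, inv_mul_cancel₀ (two_ne_zero' ℝ), one_mul, inv_mul_eq_div] at h2
  exact h2

/-- Parseval's identity for the sine series on `[0, 1]`. -/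
lemma hasSum_sq_integral_mul_sinMode (hg : Continuous g) :
    HasSum (fun k : ℕ => (∫ s in (0 : ℝ)..1, g s * sinMode k s) ^ 2)
      ((∫ s in (0 : ℝ)..1, g s ^ 2) / 2) := by
  have h := (hasSum_int_sq_fourierCoeffOn_reflection hg (σ := -1) (by simp)).nat_add_neg
  have key : ∀ n : ℤ, ‖fourierCoeffOn (show (-1 : ℝ) < 1 by norm_num) (reflection g (-1)) n‖ ^ 2 =
      (∫ s in (0 : ℝ)..1, g s * Real.sin (n * Real.pi * s)) ^ 2 := fun n => by
    rw [fourierCoeffOn_reflection hg, ← intervalIntegral.integral_const_mul]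
    have : ∀ x : ℝ, (1 / 2 : ℂ) * ((Complex.exp (-(n * Real.pi * x * Complex.I)) +
        (-1 : ℝ) * Complex.exp (n * Real.pi * x * Complex.I)) * g x) =
        -Complex.I * ((g x * Real.sin (n * Real.pi * x) : ℝ) : ℂ) := fun x => by
      push_cast
      rw [Complex.sin, ← neg_mul]
      linear_combination (1 / 2 : ℂ) * g x * (Complex.exp (-(n * Real.pi * x) * Complex.I) -
        Complex.exp (n * Real.pi * x * Complex.I)) * Complex.I_mul_I
    simp only [this, intervalIntegral.integral_const_mul, intervalIntegral.integral_ofReal, norm_mul,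
      norm_neg, Complex.norm_I, one_mul, Complex.norm_real, Real.norm_eq_abs, sq_abs]
  simp only [key, Int.cast_neg, Int.cast_natCast, neg_mul, Real.sin_neg, mul_neg,
    intervalIntegral.integral_neg, neg_sq, ← two_mul, Int.cast_zero,
    zero_mul, Real.sin_zero, mul_zero, intervalIntegral.integral_zero] at h
  have h2 := h.mul_left (1 / 2)
  simp only [← mul_assoc, one_div, inv_mul_cancel₀ (two_ne_zero' ℝ), one_mul, inv_mul_eq_div,
    zero_pow two_ne_zero, add_zero] at h2
  exact h2

end Parseval

section Slices

variable {u : Plane → ℝ}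

/-- The `k`-th mode of `u` on horizontal lines, with respect to a family `e` of functions. -/
noncomputable def mode (e : ℕ → ℝ → ℝ) (u : Plane → ℝ) (k : ℕ) (t : ℝ) : ℝ :=
  ∫ s in (0 : ℝ)..1, u !₂[s, t] * e k s

lemma continuous_mode {e : ℕ → ℝ → ℝ} (he : ∀ k, Continuous (e k)) (hu : Continuous u) (k : ℕ) :
    Continuous (mode e u k) := by
  have : Continuous fun x : Plane => u x * e k (x 0) := by fun_prop
  exact continuous_integral_horizontal this 0 1

/-- If the sums of squares of the coefficients along every horizontal line lie between half the
integral of the square and that integral, then so do the integrated sums. -/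
lemma setIntegral_sq_le_of_sum_mode_le {e : ℕ → ℝ → ℝ} (he : ∀ k, Continuous (e k))
    (hu : Continuous u) {S : ℝ → ℝ} (hS : Continuous S)
    (hsum : ∀ t, HasSum (fun k => mode e u k t ^ 2) (S t))
    (hlow : ∀ t, (∫ s in (0 : ℝ)..1, u !₂[s, t] ^ 2) ≤ 2 * S t) {B : ℝ}
    (hB : ∀ K, ∑ k ∈ Finset.range K, ∫ t in (0 : ℝ)..1, mode e u k t ^ 2 ≤ B) :
    ∫ x in rect 0 1 0 1, u x ^ 2 ≤ 2 * B := by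
  have hint : ∀ k, Integrable (fun t => mode e u k t ^ 2) (volume.restrict (Ioc (0 : ℝ) 1)) :=
    fun k => (((continuous_mode he hu k).pow 2).intervalIntegrable 0 1).1
  have hnn : ∀ k, 0 ≤ ∫ t in (0 : ℝ)..1, mode e u k t ^ 2 := fun k =>
    intervalIntegral.integral_nonneg zero_le_one fun t _ => sq_nonneg _
  have hsm : Summable fun k => ∫ t in (0 : ℝ)..1, mode e u k t ^ 2 :=
    summable_of_sum_range_le hnn hB
  have h1 := hasSum_integral_of_summable_integral_norm hint (by
    simpa only [norm_pow, Real.norm_eq_abs, sq_abs,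
      ← intervalIntegral.integral_of_le (zero_le_one' ℝ)] using hsm)
  simp only [(hsum _).tsum_eq, ← intervalIntegral.integral_of_le (zero_le_one' ℝ)] at h1
  have h2 : ∫ t in (0 : ℝ)..1, S t ≤ B :=
    le_of_tendsto h1.tendsto_sum_nat (Eventually.of_forall hB)
  rw [setIntegral_rect_swap zero_le_one zero_le_one (integrableOn_rect_of_continuous (by fun_prop))]
  calc ∫ t in (0 : ℝ)..1, ∫ s in (0 : ℝ)..1, u !₂[s, t] ^ 2
      ≤ ∫ t in (0 : ℝ)..1, 2 * S t := by
        refine intervalIntegral.integral_mono_on zero_le_one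
          ((continuous_integral_horizontal (hu.pow 2) _ _).intervalIntegrable _ _)
          ((hS.const_mul 2).intervalIntegrable _ _) fun t _ => hlow t
    _ ≤ 2 * B := by rw [intervalIntegral.integral_const_mul]; linarith

lemma setIntegral_sq_le_of_sum_cos_le (hu : Continuous u) {B : ℝ}
    (hB : ∀ K, ∑ k ∈ Finset.range K, ∫ t in (0 : ℝ)..1, mode cosMode u k t ^ 2 ≤ B) :
    ∫ x in rect 0 1 0 1, u x ^ 2 ≤ 2 * B := by
  have c1 := continuous_integral_horizontal (hu.pow 2) 0 1
  have c2 := continuous_integral_horizontal hu 0 1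
  refine setIntegral_sq_le_of_sum_mode_le continuous_cosMode hu (S := fun t =>
    ((∫ s in (0 : ℝ)..1, u !₂[s, t] ^ 2) + (∫ s in (0 : ℝ)..1, u !₂[s, t]) ^ 2) / 2)
    (by fun_prop) (fun t => hasSum_sq_integral_mul_cosMode (continuous_horizontal hu t))
    (fun t => ?_) hB
  nlinarith [sq_nonneg (∫ s in (0 : ℝ)..1, u !₂[s, t])]

lemma setIntegral_sq_le_of_sum_sin_le (hu : Continuous u) {B : ℝ}
    (hB : ∀ K, ∑ k ∈ Finset.range K, ∫ t in (0 : ℝ)..1, mode sinMode u k t ^ 2 ≤ B) :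
    ∫ x in rect 0 1 0 1, u x ^ 2 ≤ 2 * B := by
  have c1 := continuous_integral_horizontal (hu.pow 2) 0 1
  refine setIntegral_sq_le_of_sum_mode_le continuous_sinMode hu (S := fun t =>
    (∫ s in (0 : ℝ)..1, u !₂[s, t] ^ 2) / 2)
    (by fun_prop) (fun t => hasSum_sq_integral_mul_sinMode (continuous_horizontal hu t))
    (fun t => ?_) hB
  linarith

/-- Bessel's inequality. -/
lemma sum_sq_integral_mul_cosMode_le {g : ℝ → ℝ} (hg : Continuous g) (K : ℕ) :
    ∑ k ∈ Finset.range K, (∫ s in (0 : ℝ)..1, g s * cosMode k s) ^ 2 ≤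
      ∫ s in (0 : ℝ)..1, g s ^ 2 := by
  refine (sum_le_hasSum _ (fun k _ => sq_nonneg _) (hasSum_sq_integral_mul_cosMode hg)).trans ?_
  have := sq_intervalIntegral_le hg zero_le_one
  linarith

/-- Bessel's inequality. -/
lemma sum_sq_integral_mul_sinMode_le {g : ℝ → ℝ} (hg : Continuous g) (K : ℕ) :
    ∑ k ∈ Finset.range K, (∫ s in (0 : ℝ)..1, g s * sinMode k s) ^ 2 ≤
      ∫ s in (0 : ℝ)..1, g s ^ 2 := by
  refine (sum_le_hasSum _ (fun k _ => sq_nonneg _) (hasSum_sq_integral_mul_sinMode hg)).trans ?_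
  have : 0 ≤ ∫ s in (0 : ℝ)..1, g s ^ 2 :=
    intervalIntegral.integral_nonneg zero_le_one fun s _ => sq_nonneg _
  linarith

/-- Bessel's inequality on horizontal lines, integrated. -/
lemma sum_integral_mode_sq_le {e : ℕ → ℝ → ℝ} (he : ∀ k, Continuous (e k)) (hu : Continuous u)
    (hbes : ∀ g : ℝ → ℝ, Continuous g → ∀ K, ∑ k ∈ Finset.range K,
      (∫ s in (0 : ℝ)..1, g s * e k s) ^ 2 ≤ ∫ s in (0 : ℝ)..1, g s ^ 2) (K : ℕ) :
    ∑ k ∈ Finset.range K, ∫ t in (0 : ℝ)..1, mode e u k t ^ 2 ≤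
      ∫ x in rect 0 1 0 1, u x ^ 2 := by
  rw [setIntegral_rect_swap zero_le_one zero_le_one (integrableOn_rect_of_continuous (by fun_prop)),
    ← intervalIntegral.integral_finsetSum (f := fun k t => mode e u k t ^ 2) fun k _ =>
      ((continuous_mode he hu k).pow 2).intervalIntegrable 0 1]
  refine intervalIntegral.integral_mono_on zero_le_one
    ((continuous_finsetSum _ fun k _ => (continuous_mode he hu k).pow 2).intervalIntegrable _ _)
    ((continuous_integral_horizontal (hu.pow 2) _ _).intervalIntegrable _ _) fun t _ => ?_
  exact hbes _ (continuous_horizontal hu t) K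

end Slices

/-! ### The ordinary differential equations of the modes -/

/-- `e^{-mt} + σ e^{-m(1-t)}`: for `σ = ±1` an orthogonal basis of the solutions of `s'' = m² s`. -/
noncomputable def boundaryLayer (m σ t : ℝ) : ℝ := Real.exp (-(m * t)) + σ * Real.exp (-(m * (1 - t)))

lemma hasDerivAt_boundaryLayer (m σ t : ℝ) :
    HasDerivAt (boundaryLayer m σ) (-m * boundaryLayer m (-σ) t) t := by
  have h1 : HasDerivAt (fun t : ℝ => Real.exp (-(m * t))) (Real.exp (-(m * t)) * -m) t :=
    HasDerivAt.exp (((hasDerivAt_id' t).const_mul m).fun_neg.congr_deriv (by ring))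
  have h2 : HasDerivAt (fun t : ℝ => Real.exp (-(m * (1 - t)))) (Real.exp (-(m * (1 - t))) * m) t :=
    HasDerivAt.exp ((((hasDerivAt_id' t).const_sub 1).const_mul m).fun_neg.congr_deriv (by ring))
  exact (h1.fun_add (h2.const_mul σ)).congr_deriv (by rw [boundaryLayer]; ring)

@[fun_prop] lemma continuous_boundaryLayer (m σ : ℝ) : Continuous (boundaryLayer m σ) := by
  unfold boundaryLayer; fun_prop

lemma integral_boundaryLayer_mul (m : ℝ) :
    ∫ t in (0 : ℝ)..1, boundaryLayer m 1 t * boundaryLayer m (-1) t = 0 := by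
  have h : ∀ t, boundaryLayer m 1 t * boundaryLayer m (-1) t =
      Real.exp (-(m * t)) ^ 2 - Real.exp (-(m * (1 - t))) ^ 2 := fun t => by
    rw [boundaryLayer, boundaryLayer]; ring
  simp only [h]
  rw [intervalIntegral.integral_sub (Continuous.intervalIntegrable (by fun_prop) _ _)
    (Continuous.intervalIntegrable (by fun_prop) _ _)]
  have := intervalIntegral.integral_comp_sub_left (a := 0) (b := 1)
    (fun t => Real.exp (-(m * t)) ^ 2) 1
  simp only [sub_self, sub_zero] at this
  rw [this, sub_self]

/-- The layer at `0` alone contributes a multiple of its width `1 / m`. -/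
lemma le_integral_boundaryLayer_sq {m σ : ℝ} (hm : 3 ≤ m) (hσ : |σ| = 1) :
    1 / (25 * m) ≤ ∫ t in (0 : ℝ)..1, boundaryLayer m σ t ^ 2 := by
  have hm0 : 0 < m := by linarith
  have hx1 : (0.36 : ℝ) < Real.exp (-1) := lt_trans (by norm_num) Real.exp_neg_one_gt_d9
  have hx2 : Real.exp (-1) < 0.37 := lt_trans Real.exp_neg_one_lt_d9 (by norm_num)
  have hpt : ∀ t ∈ Icc 0 (1 / m), (1 / 25 : ℝ) ≤ boundaryLayer m σ t ^ 2 := fun t ht => by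
    have h1 : m * t ≤ 1 := by
      have := mul_le_mul_of_nonneg_left ht.2 hm0.le
      rwa [mul_one_div_cancel hm0.ne'] at this
    have h2 : Real.exp (-1) ≤ Real.exp (-(m * t)) := Real.exp_le_exp.2 (by linarith)
    have h3 : Real.exp (-(m * (1 - t))) ≤ Real.exp (-1) ^ 2 := by
      rw [← Real.exp_nat_mul]
      exact Real.exp_le_exp.2 (by push_cast; linarith)
    have h4 : -Real.exp (-(m * (1 - t))) ≤ σ * Real.exp (-(m * (1 - t))) := by
      have := neg_abs_le (σ * Real.exp (-(m * (1 - t))))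
      rwa [abs_mul, hσ, one_mul, Real.abs_exp] at this
    have h5 : (1 / 5 : ℝ) ≤ boundaryLayer m σ t := by
      rw [boundaryLayer]; nlinarith
    nlinarith
  have hle : 1 / m ≤ 1 := by rw [div_le_one hm0]; linarith
  calc 1 / (25 * m) = ∫ _ in (0 : ℝ)..(1 / m), (1 / 25 : ℝ) := by
        rw [intervalIntegral.integral_const, smul_eq_mul]; field_simp; ring
    _ ≤ ∫ t in (0 : ℝ)..(1 / m), boundaryLayer m σ t ^ 2 :=
        intervalIntegral.integral_mono_on (by positivity) (continuous_const.intervalIntegrable _ _)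
          (Continuous.intervalIntegrable (by fun_prop) _ _) hpt
    _ ≤ ∫ t in (0 : ℝ)..1, boundaryLayer m σ t ^ 2 :=
        intervalIntegral.integral_mono_interval le_rfl (by positivity) hle
          (Eventually.of_forall fun t => sq_nonneg _)
          (Continuous.intervalIntegrable (by fun_prop) _ _)

lemma sq_integral_mul_le {f g : ℝ → ℝ} (hf : Continuous f) (hg : Continuous g) :
    (∫ t in (0 : ℝ)..1, f t * g t) ^ 2 ≤
      (∫ t in (0 : ℝ)..1, f t ^ 2) * ∫ t in (0 : ℝ)..1, g t ^ 2 := by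
  have h : ∀ x : ℝ, 0 ≤ (∫ t in (0 : ℝ)..1, g t ^ 2) * (x * x) +
      (2 * ∫ t in (0 : ℝ)..1, f t * g t) * x + ∫ t in (0 : ℝ)..1, f t ^ 2 := fun x => by
    have h1 : 0 ≤ ∫ t in (0 : ℝ)..1, (f t + x * g t) ^ 2 :=
      intervalIntegral.integral_nonneg zero_le_one fun t _ => sq_nonneg _
    have h2 : ∀ t, (f t + x * g t) ^ 2 = x * x * g t ^ 2 + 2 * x * (f t * g t) + f t ^ 2 :=
      fun t => by ring
    simp only [h2] at h1
    rw [intervalIntegral.integral_add (Continuous.intervalIntegrable (by fun_prop) _ _)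
      (Continuous.intervalIntegrable (by fun_prop) _ _), intervalIntegral.integral_add
      (Continuous.intervalIntegrable (by fun_prop) _ _)
      (Continuous.intervalIntegrable (by fun_prop) _ _), intervalIntegral.integral_const_mul,
      intervalIntegral.integral_const_mul] at h1
    linarith
  have := discrim_le_zero h
  rw [discrim] at this
  nlinarith

/-- `β` solves `β'' - m² β = s - f` with homogeneous Dirichlet and Neumann conditions at both ends,
where `s` solves `s'' = m² s`; this `s` is the `L²` projection of `f` to the solutions of that
equation. -/
structure IsCorrector (m : ℝ) (f β β₁ s s₁ : ℝ → ℝ) : Prop where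
  deriv_fst : ∀ t, HasDerivAt β (β₁ t) t
  deriv_snd : ∀ t, HasDerivAt β₁ (m ^ 2 * β t + (s t - f t)) t
  zero_fst : β 0 = 0
  one_fst : β 1 = 0
  zero_snd : β₁ 0 = 0
  one_snd : β₁ 1 = 0
  layer_fst : ∀ t, HasDerivAt s (s₁ t) t
  layer_snd : ∀ t, HasDerivAt s₁ (m ^ 2 * s t) t
  integral_le : ∫ t in (0 : ℝ)..1, (s t - f t) ^ 2 ≤ ∫ t in (0 : ℝ)..1, f t ^ 2
  layer_le : s 0 ^ 2 ≤ 400 * m * ∫ t in (0 : ℝ)..1, f t ^ 2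
  layer_deriv_le : s₁ 0 ^ 2 ≤ 400 * m ^ 3 * ∫ t in (0 : ℝ)..1, f t ^ 2

/-- `s` is the projection of `f` to the span of the two boundary layers, and `β` comes from variation of
constants with zero data at `0`. The data at `1` vanish as well, since `s - f` is orthogonal to
`e^{mt}` and `e^{-mt}`. -/
lemma exists_isCorrector {m : ℝ} (hm : 3 ≤ m) {f : ℝ → ℝ} (hf : Continuous f) :
    ∃ β β₁ s s₁, IsCorrector m f β β₁ s s₁ := by
  have hm0 : 0 < m := by linarith
  set F := ∫ t in (0 : ℝ)..1, f t ^ 2 with hF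
  have hF0 : 0 ≤ F := intervalIntegral.integral_nonneg zero_le_one fun t _ => sq_nonneg _
  let n : ℝ → ℝ := fun σ => ∫ t in (0 : ℝ)..1, boundaryLayer m σ t ^ 2
  let c : ℝ → ℝ := fun σ => (∫ t in (0 : ℝ)..1, f t * boundaryLayer m σ t) / n σ
  have hn : ∀ σ, |σ| = 1 → 1 / (25 * m) ≤ n σ := fun σ hσ => le_integral_boundaryLayer_sq hm hσ
  have hn0 : ∀ σ, |σ| = 1 → 0 < n σ := fun σ hσ => lt_of_lt_of_le (by positivity) (hn σ hσ)
  have hc : ∀ σ, |σ| = 1 → c σ ^ 2 ≤ 25 * m * F := fun σ hσ => by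
    have h1 : (∫ t in (0 : ℝ)..1, f t * boundaryLayer m σ t) ^ 2 ≤ F * n σ :=
      sq_integral_mul_le hf (by fun_prop)
    have h2 := hn0 σ hσ
    have h3 : F ≤ 25 * m * F * n σ := by
      have := mul_le_mul_of_nonneg_left (hn σ hσ) (show 0 ≤ 25 * m * F by positivity)
      have e : 25 * m * F * (1 / (25 * m)) = F := by field_simp
      linarith
    simp only [c]
    rw [div_pow, div_le_iff₀ (by positivity)]
    nlinarith
  let s : ℝ → ℝ := fun t => c 1 * boundaryLayer m 1 t + c (-1) * boundaryLayer m (-1) t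
  let s₁ : ℝ → ℝ := fun t => -m * (c 1 * boundaryLayer m (-1) t + c (-1) * boundaryLayer m 1 t)
  have hs : ∀ t, HasDerivAt s (s₁ t) t := fun t =>
    (((hasDerivAt_boundaryLayer m 1 t).const_mul (c 1)).fun_add
      ((hasDerivAt_boundaryLayer m (-1) t).const_mul (c (-1)))).congr_deriv (by
        simp only [s₁, neg_neg]; ring)
  have hs₁ : ∀ t, HasDerivAt s₁ (m ^ 2 * s t) t := fun t =>
    ((((hasDerivAt_boundaryLayer m (-1) t).const_mul (c 1)).fun_add
      ((hasDerivAt_boundaryLayer m 1 t).const_mul (c (-1)))).const_mul (-m)).congr_deriv (by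
        simp only [s, neg_neg]; ring)
  have hsc : Continuous s := by fun_prop
  let q : ℝ → ℝ := fun t => s t - f t
  have hqc : Continuous q := hsc.sub hf
  have ii : ∀ g : ℝ → ℝ, Continuous g → IntervalIntegrable g volume 0 1 := fun g hg =>
    hg.intervalIntegrable _ _
  have hq : ∀ σ, σ = 1 ∨ σ = -1 → ∫ t in (0 : ℝ)..1, q t * boundaryLayer m σ t = 0 := by
    have hcn : ∀ σ, |σ| = 1 → c σ * n σ = ∫ t in (0 : ℝ)..1, f t * boundaryLayer m σ t :=
      fun σ hσ => div_mul_cancel₀ _ (hn0 σ hσ).ne'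
    have hx := integral_boundaryLayer_mul m
    rintro σ (rfl | rfl)
    · have e : ∀ t, q t * boundaryLayer m 1 t = c 1 * boundaryLayer m 1 t ^ 2 +
          c (-1) * (boundaryLayer m 1 t * boundaryLayer m (-1) t) - f t * boundaryLayer m 1 t :=
        fun t => by simp only [q, s]; ring
      simp only [e]
      rw [intervalIntegral.integral_sub (ii _ (by fun_prop)) (ii _ (by fun_prop)),
        intervalIntegral.integral_add (ii _ (by fun_prop)) (ii _ (by fun_prop)),
        intervalIntegral.integral_const_mul, intervalIntegral.integral_const_mul, hx,
        ← hcn 1 (by simp)]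
      simp only [n]
      ring
    · have e : ∀ t, q t * boundaryLayer m (-1) t = c 1 *
          (boundaryLayer m 1 t * boundaryLayer m (-1) t) + c (-1) * boundaryLayer m (-1) t ^ 2 -
            f t * boundaryLayer m (-1) t :=
        fun t => by simp only [q, s]; ring
      simp only [e]
      rw [intervalIntegral.integral_sub (ii _ (by fun_prop)) (ii _ (by fun_prop)),
        intervalIntegral.integral_add (ii _ (by fun_prop)) (ii _ (by fun_prop)),
        intervalIntegral.integral_const_mul, intervalIntegral.integral_const_mul, hx,
        ← hcn (-1) (by simp)]
      simp only [n]
      ring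
  have hqe : ∫ t in (0 : ℝ)..1, q t * Real.exp (-(m * t)) = 0 := by
    have e : ∀ t, q t * Real.exp (-(m * t)) = 1 / 2 * (q t * boundaryLayer m 1 t) +
        1 / 2 * (q t * boundaryLayer m (-1) t) := fun t => by
      rw [boundaryLayer, boundaryLayer]; ring
    simp only [e]
    rw [intervalIntegral.integral_add (ii _ (by fun_prop)) (ii _ (by fun_prop)),
      intervalIntegral.integral_const_mul, intervalIntegral.integral_const_mul, hq 1 (by simp),
      hq (-1) (by simp)]
    simp
  have hqe' : ∫ t in (0 : ℝ)..1, q t * Real.exp (m * t) = 0 := by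
    have e : ∀ t, q t * Real.exp (m * t) = Real.exp m / 2 * (q t * boundaryLayer m 1 t) -
        Real.exp m / 2 * (q t * boundaryLayer m (-1) t) := fun t => by
      have : Real.exp (m * t) = Real.exp m * Real.exp (-(m * (1 - t))) := by
        rw [← Real.exp_add]; congr 1; ring
      rw [boundaryLayer, boundaryLayer, this]; ring
    simp only [e]
    rw [intervalIntegral.integral_sub (ii _ (by fun_prop)) (ii _ (by fun_prop)),
      intervalIntegral.integral_const_mul, intervalIntegral.integral_const_mul, hq 1 (by simp),
      hq (-1) (by simp)]
    simp
  -- variation of constants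
  let P : ℝ → ℝ := fun t => ∫ r in (0 : ℝ)..t, Real.cosh (m * r) * q r
  let R : ℝ → ℝ := fun t => ∫ r in (0 : ℝ)..t, Real.sinh (m * r) * q r
  have hP : ∀ t, HasDerivAt P (Real.cosh (m * t) * q t) t := fun t =>
    ((show Continuous fun r => Real.cosh (m * r) * q r by fun_prop).integral_hasStrictDerivAt
      0 t).hasDerivAt
  have hR : ∀ t, HasDerivAt R (Real.sinh (m * t) * q t) t := fun t =>
    ((show Continuous fun r => Real.sinh (m * r) * q r by fun_prop).integral_hasStrictDerivAt
      0 t).hasDerivAt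
  have hP1 : P 1 = 0 := by
    have e : ∀ t, Real.cosh (m * t) * q t = 1 / 2 * (q t * Real.exp (m * t)) +
        1 / 2 * (q t * Real.exp (-(m * t))) := fun t => by rw [Real.cosh_eq]; ring
    simp only [P, e]
    rw [intervalIntegral.integral_add (ii _ (by fun_prop)) (ii _ (by fun_prop)),
      intervalIntegral.integral_const_mul, intervalIntegral.integral_const_mul, hqe, hqe']
    simp
  have hR1 : R 1 = 0 := by
    have e : ∀ t, Real.sinh (m * t) * q t = 1 / 2 * (q t * Real.exp (m * t)) -
        1 / 2 * (q t * Real.exp (-(m * t))) := fun t => by rw [Real.sinh_eq]; ring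
    simp only [R, e]
    rw [intervalIntegral.integral_sub (ii _ (by fun_prop)) (ii _ (by fun_prop)),
      intervalIntegral.integral_const_mul, intervalIntegral.integral_const_mul, hqe, hqe']
    simp
  have hP0 : P 0 = 0 := intervalIntegral.integral_same
  have hR0 : R 0 = 0 := intervalIntegral.integral_same
  have hsh : ∀ t, HasDerivAt (fun t => Real.sinh (m * t)) (m * Real.cosh (m * t)) t := fun t =>
    ((Real.hasDerivAt_sinh (m * t)).comp t ((hasDerivAt_id' t).const_mul m)).congr_deriv (by ring)
  have hch : ∀ t, HasDerivAt (fun t => Real.cosh (m * t)) (m * Real.sinh (m * t)) t := fun t =>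
    ((Real.hasDerivAt_cosh (m * t)).comp t ((hasDerivAt_id' t).const_mul m)).congr_deriv (by ring)
  let β : ℝ → ℝ := fun t => (Real.sinh (m * t) * P t - Real.cosh (m * t) * R t) / m
  let β₁ : ℝ → ℝ := fun t => Real.cosh (m * t) * P t - Real.sinh (m * t) * R t
  have hs0 : ∀ a b : ℝ, a ^ 2 ≤ 25 * m * F → b ^ 2 ≤ 25 * m * F →
      (a * boundaryLayer m 1 0 + b * boundaryLayer m (-1) 0) ^ 2 ≤ 400 * m * F := fun a b ha hb => by
    have h1 : boundaryLayer m 1 0 ^ 2 ≤ 4 := by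
      have h2 : Real.exp (-m) ≤ 1 := Real.exp_le_one_iff.2 (by linarith)
      have h3 := Real.exp_pos (-m)
      simp only [boundaryLayer, mul_zero, neg_zero, Real.exp_zero, sub_zero, mul_one, one_mul]
      nlinarith
    have h1' : boundaryLayer m (-1) 0 ^ 2 ≤ 4 := by
      have h2 : Real.exp (-m) ≤ 1 := Real.exp_le_one_iff.2 (by linarith)
      have h3 := Real.exp_pos (-m)
      simp only [boundaryLayer, mul_zero, neg_zero, Real.exp_zero, sub_zero, mul_one]
      nlinarith
    have h4 : a ^ 2 * boundaryLayer m 1 0 ^ 2 ≤ 25 * m * F * 4 := by gcongr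
    have h5 : b ^ 2 * boundaryLayer m (-1) 0 ^ 2 ≤ 25 * m * F * 4 := by gcongr
    nlinarith [sq_nonneg (a * boundaryLayer m 1 0 - b * boundaryLayer m (-1) 0)]
  refine ⟨β, β₁, s, s₁, fun t => ?_, fun t => ?_, ?_, ?_, ?_, ?_, hs, hs₁, ?_, ?_, ?_⟩
  · refine ((((hsh t).fun_mul (hP t)).fun_sub ((hch t).fun_mul (hR t))).div_const m).congr_deriv ?_
    simp only [β₁]
    field_simp
    ring
  · refine (((hch t).fun_mul (hP t)).fun_sub ((hsh t).fun_mul (hR t))).congr_deriv ?_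
    have := Real.cosh_sq (m * t)
    simp only [β]
    field_simp
    linear_combination (q t) * this
  · simp [β, hP0, hR0]
  · simp [β, hP1, hR1]
  · simp [β₁, hP0, hR0]
  · simp [β₁, hP1, hR1]
  · have h1 : ∫ t in (0 : ℝ)..1, q t * s t = 0 := by
      have e : ∀ t, q t * s t = c 1 * (q t * boundaryLayer m 1 t) +
          c (-1) * (q t * boundaryLayer m (-1) t) := fun t => by simp only [s]; ring
      simp only [e]
      rw [intervalIntegral.integral_add (ii _ (by fun_prop)) (ii _ (by fun_prop)),
        intervalIntegral.integral_const_mul, intervalIntegral.integral_const_mul, hq 1 (by simp),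
        hq (-1) (by simp)]
      simp
    have e : ∀ t, f t ^ 2 = q t ^ 2 + s t ^ 2 - 2 * (q t * s t) := fun t => by simp only [q]; ring
    have h2 : 0 ≤ ∫ t in (0 : ℝ)..1, s t ^ 2 :=
      intervalIntegral.integral_nonneg zero_le_one fun t _ => sq_nonneg _
    have h3 : F = (∫ t in (0 : ℝ)..1, q t ^ 2) + (∫ t in (0 : ℝ)..1, s t ^ 2) -
        2 * ∫ t in (0 : ℝ)..1, q t * s t := by
      simp only [hF, e]
      rw [intervalIntegral.integral_sub (ii _ (by fun_prop)) (ii _ (by fun_prop)),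
        intervalIntegral.integral_add (ii _ (by fun_prop)) (ii _ (by fun_prop)),
        intervalIntegral.integral_const_mul]
    change ∫ t in (0 : ℝ)..1, q t ^ 2 ≤ F
    linarith
  · exact hs0 _ _ (hc 1 (by simp)) (hc (-1) (by simp))
  · have := mul_le_mul_of_nonneg_left (hs0 _ _ (hc (-1) (by simp)) (hc 1 (by simp)))
      (sq_nonneg m)
    simp only [s₁]
    nlinarith

namespace IsCorrector

variable {m : ℝ} {f β β₁ s s₁ : ℝ → ℝ}

/-- The square of `β'' = m² β + (s - f)` is expanded around `s - f`, and `∫ β β''` is integrated by parts. -/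
lemma energy (h : IsCorrector m f β β₁ s s₁) (hf : Continuous f) :
    (∫ t in (0 : ℝ)..1, (m ^ 2 * β t + (s t - f t)) ^ 2) + 2 * m ^ 2 * (∫ t in (0 : ℝ)..1, β₁ t ^ 2) +
      m ^ 4 * (∫ t in (0 : ℝ)..1, β t ^ 2) ≤ ∫ t in (0 : ℝ)..1, f t ^ 2 := by
  have cβ : Continuous β := continuous_iff_continuousAt.2 fun t => (h.deriv_fst t).continuousAt
  have cβ₁ : Continuous β₁ := continuous_iff_continuousAt.2 fun t => (h.deriv_snd t).continuousAt
  have cs : Continuous s := continuous_iff_continuousAt.2 fun t => (h.layer_fst t).continuousAt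
  have ii : ∀ g : ℝ → ℝ, Continuous g → IntervalIntegrable g volume 0 1 := fun g hg =>
    hg.intervalIntegrable _ _
  have hp := intervalIntegral.integral_mul_deriv_eq_deriv_mul (a := 0) (b := 1)
    (fun t _ => h.deriv_fst t) (fun t _ => h.deriv_snd t) (ii _ cβ₁)
    (ii _ (by fun_prop))
  rw [h.zero_fst, h.one_fst] at hp
  have e : ∀ t, (m ^ 2 * β t + (s t - f t)) ^ 2 = (s t - f t) ^ 2 +
      2 * m ^ 2 * (β t * (m ^ 2 * β t + (s t - f t))) - m ^ 4 * β t ^ 2 := fun t => by ring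
  simp only [e]
  rw [intervalIntegral.integral_sub (ii _ (by fun_prop)) (ii _ (by fun_prop)),
    intervalIntegral.integral_add (ii _ (by fun_prop)) (ii _ (by fun_prop)),
    intervalIntegral.integral_const_mul, intervalIntegral.integral_const_mul, hp]
  simp only [← sq]
  linarith [h.integral_le]

end IsCorrector

/-! ### Testing the equation with single modes -/

section Channel

variable {D : Set Plane} {ε : ℝ}

lemma setIntegral_eq_of_ae_eq_indicator (hD : IsChannel D ε) {F H : Plane → ℝ}
    (h : F =ᵐ[volume.restrict D] (rect 0 1 0 1).indicator H) :
    ∫ x in D, F x = ∫ x in rect 0 1 0 1, H x := by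
  rw [integral_congr_ae h, setIntegral_indicator (measurableSet_rect 0 1 0 1),
    inter_eq_self_of_subset_right hD.unit_subset]

lemma inner_eq_of_ae_eq_tensor (hD : IsChannel D ε) {A T : ℝ → ℝ}
    {u z : Lp ℝ 2 (volume.restrict D)}
    (hu : u =ᵐ[volume.restrict D] (rect 0 1 0 1).indicator fun x => A (x 1) * T (x 0)) :
    inner ℝ z u = ∫ x in rect 0 1 0 1, A (x 1) * T (x 0) * z x := by
  rw [L2_inner_eq_of_ae_eq hu]
  refine setIntegral_eq_of_ae_eq_indicator hD (Eventually.of_forall fun x => ?_)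
  by_cases h : x ∈ rect 0 1 0 1 <;> simp [h, mul_comm]

lemma abs_setIntegral_rect_mul_le (hD : IsChannel D ε) {k G : Plane → ℝ} {M : ℝ} (hM : 0 ≤ M)
    (hk : Continuous k) (hG : Continuous G) (hkM : ∀ x ∈ rect 0 1 0 1, |k x| ≤ M)
    (u : Lp ℝ 2 (volume.restrict D)) :
    |∫ x in rect 0 1 0 1, k x * G x * u x| ≤ M * √(∫ x in rect 0 1 0 1, G x ^ 2) * ‖u‖ := by
  have h1 : MemLp (fun x => k x * G x) 2 (volume.restrict (rect 0 1 0 1)) :=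
    memLp_rect_of_continuous (by fun_prop)
  have h2 : MemLp u 2 (volume.restrict (rect 0 1 0 1)) :=
    (Lp.memLp u).mono_measure (Measure.restrict_mono hD.unit_subset le_rfl)
  refine (abs_integral_mul_le_sqrt h1 h2).trans (mul_le_mul ?_
    (sqrt_setIntegral_sq_le hD.unit_subset u) (Real.sqrt_nonneg _) (by positivity))
  rw [← Real.sqrt_sq hM, ← Real.sqrt_mul (sq_nonneg M), ← integral_const_mul]
  refine Real.sqrt_le_sqrt (setIntegral_mono_on h1.integrable_sq
    ((memLp_rect_of_continuous hG).integrable_sq.const_mul _) (measurableSet_rect 0 1 0 1)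
    fun x hx => ?_)
  rw [mul_pow]
  have := sq_le_sq' (neg_le_of_abs_le (hkM x hx)) (le_of_abs_le (hkM x hx))
  gcongr

lemma sqrt_setIntegral_tensor_sq (hD : IsChannel D ε) {A T : ℝ → ℝ} (hA : Continuous A)
    (hT : Continuous T) {u : Lp ℝ 2 (volume.restrict D)}
    (hu : u =ᵐ[volume.restrict D] (rect 0 1 0 1).indicator fun x => A (x 1) * T (x 0)) :
    √(∫ x in rect 0 1 0 1, (A (x 1) * T (x 0)) ^ 2) = ‖u‖ := by
  rw [setIntegral_tensor_sq hA hT, ← norm_sq_of_ae_eq_tensor hD hA hT hu,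
    Real.sqrt_sq (norm_nonneg _)]

lemma solenoidal_ae_eq {v : VField D} (hv : v ∈ solenoidal D) :
    v 0 1 =ᵐ[volume.restrict D] fun x => -v 1 2 x := by
  have h := (mem_solenoidal.1 hv).2
  rw [divergence_apply] at h
  rw [eq_neg_of_add_eq_zero_left h]
  exact Lp.coeFn_neg _

/-- The terms of the convection that are linear in `v` are controlled by the `L²` norm of the
second component of `v` alone: `v` is divergence free, and the derivatives can be moved to the
profile and to the test field. -/
lemma abs_convection_linear_le (hD : IsChannel D ε) {lam : ℝ} {p v φ : VField D}
    (hp : IsPoiseuille D lam p) (hv : v ∈ solenoidal D) {A A' B B' τ τ' σ σ' : ℝ → ℝ}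
    (hA : ∀ t, HasDerivAt A (A' t) t) (hA' : Continuous A') (hB : Continuous B)
    (hτ : Continuous τ) (hσ : ∀ t, HasDerivAt σ (σ' t) t) (hσ' : Continuous σ')
    (h0 : IsTensor D A A' τ τ' (φ 0)) (h1 : IsTensor D B B' σ σ' (φ 1)) :
    |convection D p v φ + convection D v p φ| ≤ 4 * |lam| * ‖v 1 0‖ * ‖φ‖ := by
  have hAc : Continuous A := continuous_iff_continuousAt.2 fun t => (hA t).continuousAt
  have hσc : Continuous σ := continuous_iff_continuousAt.2 fun t => (hσ t).continuousAt
  let w : ℝ → ℝ := fun t => lam * (t * (t - 1))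
  let w' : ℝ → ℝ := fun t => lam * (2 * t - 1)
  have hw : ∀ t, HasDerivAt w (w' t) t := fun t =>
    (((hasDerivAt_id' t).fun_mul ((hasDerivAt_id' t).sub_const 1)).const_mul lam).congr_deriv
      (by simp only [w']; ring)
  have hwc : Continuous w := by fun_prop
  have hwc' : Continuous w' := by fun_prop
  have hp1 : ∀ k, p 1 k = 0 := fun k => by rw [hp.second]; rfl
  have hz : (0 : Lp ℝ 2 (volume.restrict D)) =ᵐ[volume.restrict D] 0 := Lp.coeFn_zero _ _ _
  have key : ∀ f g h : Plane → ℝ, f =ᵐ[volume.restrict D] 0 ∨ g =ᵐ[volume.restrict D] 0 →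
      ∫ a in D, f a * g a * h a = 0 := fun f g h hfg => by
    rw [← integral_zero Plane ℝ (μ := volume.restrict D)]
    refine integral_congr_ae ?_
    rcases hfg with hf | hf <;> exact hf.mono fun a ha => by simp [ha]
  have e1 : convection D p v φ = (∫ x in rect 0 1 0 1, (w (x 1) * A (x 1)) * τ (x 0) * v 0 1 x) +
      ∫ x in rect 0 1 0 1, (w (x 1) * B (x 1)) * σ (x 0) * v 1 1 x := by
    rw [convection, Fin.sum_univ_two, Fin.sum_univ_two, Fin.sum_univ_two, hp1 0,
      key _ (v 0 _) _ (Or.inl hz), key _ (v 1 _) _ (Or.inl hz), add_zero, add_zero]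
    congr 1
    · refine setIntegral_eq_of_ae_eq_indicator hD ?_
      filter_upwards [hp.first.val, h0.val] with x hx hy
      rw [hx, hy]
      by_cases h : x ∈ rect 0 1 0 1
      · simp only [indicator_of_mem h, w, Fin.succ_zero_eq_one]; ring
      · simp only [indicator_of_notMem h]; ring
    · refine setIntegral_eq_of_ae_eq_indicator hD ?_
      filter_upwards [hp.first.val, h1.val] with x hx hy
      rw [hx, hy]
      by_cases h : x ∈ rect 0 1 0 1
      · simp only [indicator_of_mem h, w, Fin.succ_zero_eq_one]; ring
      · simp only [indicator_of_notMem h]; ring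
  have e2 : convection D v p φ = ∫ x in rect 0 1 0 1, w' (x 1) * (A (x 1) * τ (x 0)) * v 1 0 x := by
    rw [convection, Fin.sum_univ_two, Fin.sum_univ_two, Fin.sum_univ_two, hp1, hp1,
      key (v 0 0) _ (φ 1 0) (Or.inr hz), key (v 1 0) _ (φ 1 0) (Or.inr hz), add_zero, add_zero,
      Fin.succ_zero_eq_one, hp.horizontal_eq_zero, key (v 0 0) _ (φ 0 0) (Or.inr hz), zero_add]
    refine setIntegral_eq_of_ae_eq_indicator hD ?_
    filter_upwards [hp.first.vertical, h0.val] with x hx hy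
    rw [Fin.succ_one_eq_two, hx, hy]
    by_cases h : x ∈ rect 0 1 0 1
    · simp only [indicator_of_mem h, w']; ring
    · simp only [indicator_of_notMem h]; ring
  have hv1 := mem_velocity.1 hv.1 1
  have e3 : ∫ x in rect 0 1 0 1, (w (x 1) * A (x 1)) * τ (x 0) * v 0 1 x =
      (∫ x in rect 0 1 0 1, w' (x 1) * (A (x 1) * τ (x 0)) * v 1 0 x) +
        ∫ x in rect 0 1 0 1, w (x 1) * (A' (x 1) * τ (x 0)) * v 1 0 x := by
    have h2 := H1Zero_vertical hD (walls_subset_noSlip D 1) hv1 (fun t => (hw t).fun_mul (hA t))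
      (by fun_prop) hτ
    have h3 : ∫ x in rect 0 1 0 1, (w (x 1) * A (x 1)) * τ (x 0) * v 0 1 x =
        -∫ x in rect 0 1 0 1, (w (x 1) * A (x 1)) * τ (x 0) * v 1 2 x := by
      rw [← integral_neg]
      refine integral_congr_ae ((ae_restrict_of_subset hD.unit_subset (solenoidal_ae_eq hv)).mono
        fun x hx => ?_)
      simp only [hx]; ring
    have hi : ∀ a b : ℝ → ℝ, Continuous a → Continuous b →
        Integrable (fun x => a (x 1) * (b (x 1) * τ (x 0)) * v 1 0 x)
          (volume.restrict (rect 0 1 0 1)) := fun a b ha hb =>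
      MemLp.integrable_mul (p := 2) (q := 2) (memLp_rect_of_continuous (by fun_prop))
        ((Lp.memLp (v 1 0)).mono_measure (Measure.restrict_mono hD.unit_subset le_rfl))
    have h4 : ∫ x in rect 0 1 0 1, (w' (x 1) * A (x 1) + w (x 1) * A' (x 1)) * τ (x 0) * v 1 0 x =
        (∫ x in rect 0 1 0 1, w' (x 1) * (A (x 1) * τ (x 0)) * v 1 0 x) +
        ∫ x in rect 0 1 0 1, w (x 1) * (A' (x 1) * τ (x 0)) * v 1 0 x := by
      rw [← integral_add (hi w' A hwc' hAc) (hi w A' hwc hA')]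
      refine integral_congr_ae (Eventually.of_forall fun x => ?_)
      simp only
      ring
    rw [h3, ← h4]
    simp only [w, zero_mul, mul_zero, neg_zero] at h2 ⊢
    linarith
  have e4 : ∫ x in rect 0 1 0 1, (w (x 1) * B (x 1)) * σ (x 0) * v 1 1 x =
      -∫ x in rect 0 1 0 1, w (x 1) * (B (x 1) * σ' (x 0)) * v 1 0 x := by
    have h2 := H1Zero_horizontal (g := fun t => w t * B t) hD (walls_subset_noSlip D 1) hv1 hσ hσ'
      (by fun_prop) (Or.inl subset_union_right)
    rw [eq_neg_of_add_eq_zero_left h2]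
    simp only [mul_assoc]
  have bw : ∀ x ∈ rect 0 1 0 1, |w (x 1)| ≤ |lam| := fun x hx => by
    simp only [w, abs_mul]
    have h2 : |x 1| ≤ 1 := abs_le.2 ⟨by linarith [hx.2.1], hx.2.2.le⟩
    have h3 : |x 1 - 1| ≤ 1 := abs_le.2 ⟨by linarith [hx.2.1], by linarith [hx.2.2]⟩
    have : |x 1| * |x 1 - 1| ≤ 1 * 1 := by gcongr
    nlinarith [abs_nonneg lam]
  have bw' : ∀ x ∈ rect 0 1 0 1, |w' (x 1)| ≤ |lam| := fun x hx => by
    simp only [w', abs_mul]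
    have h2 : |2 * x 1 - 1| ≤ 1 := abs_le.2 ⟨by linarith [hx.2.1], by linarith [hx.2.2]⟩
    nlinarith [abs_nonneg lam]
  have b1 := abs_setIntegral_rect_mul_le hD (abs_nonneg lam) (k := fun x => w' (x 1))
    (G := fun x => A (x 1) * τ (x 0)) (by fun_prop) (by fun_prop) bw' (v 1 0)
  have b2 := abs_setIntegral_rect_mul_le hD (abs_nonneg lam) (k := fun x => w (x 1))
    (G := fun x => A' (x 1) * τ (x 0)) (by fun_prop) (by fun_prop) bw (v 1 0)
  have b3 := abs_setIntegral_rect_mul_le hD (abs_nonneg lam) (k := fun x => w (x 1))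
    (G := fun x => B (x 1) * σ' (x 0)) (by fun_prop) (by fun_prop) bw (v 1 0)
  rw [sqrt_setIntegral_tensor_sq hD hAc hτ h0.val] at b1
  rw [sqrt_setIntegral_tensor_sq hD hA' hτ h0.vertical] at b2
  rw [sqrt_setIntegral_tensor_sq hD hB hσ' h1.horizontal] at b3
  have c1 : |lam| * ‖φ 0 0‖ * ‖v 1 0‖ ≤ |lam| * ‖φ‖ * ‖v 1 0‖ := by
    gcongr; exact norm_entry_le φ 0 0
  have c2 : |lam| * ‖φ 0 2‖ * ‖v 1 0‖ ≤ |lam| * ‖φ‖ * ‖v 1 0‖ := by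
    gcongr; exact norm_entry_le φ 0 2
  have c3 : |lam| * ‖φ 1 1‖ * ‖v 1 0‖ ≤ |lam| * ‖φ‖ * ‖v 1 0‖ := by
    gcongr; exact norm_entry_le φ 1 1
  rw [e1, e2, e3, e4]
  have d1 := abs_le.1 b1
  have d2 := abs_le.1 b2
  have d3 := abs_le.1 b3
  refine abs_le.2 ⟨?_, ?_⟩ <;> linarith

/-- For test fields supported above the axis the residual of the Poiseuille flow vanishes, and the
Dirichlet form of `v` is controlled by the convection terms. -/
lemma abs_dirichlet_tensor_le (hD : IsChannel D ε) {lam : ℝ} {p v φ : VField D}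
    (hp : IsPoiseuille D lam p) (hv : v ∈ solenoidal D) (hs : IsSolenoidalSolution hD lam (p + v))
    (hφ : φ ∈ solenoidal D) {A A' B B' τ τ' σ σ' : ℝ → ℝ}
    (hA : ∀ t, HasDerivAt A (A' t) t) (hA' : Continuous A') (hB : Continuous B)
    (hτ : Continuous τ) (hσ : ∀ t, HasDerivAt σ (σ' t) t) (hσ' : Continuous σ')
    (h0 : IsTensor D A A' τ τ' (φ 0)) (h1 : IsTensor D B B' σ σ' (φ 1)) :
    |dirichlet D v φ| ≤ (4 * |lam| * ‖v 1 0‖ + 36 * ‖v‖ ^ 2) * ‖φ‖ := by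
  have hpv := hp.mem_solenoidal hD
  have hr := hp.residual_eq hD hφ.1
  have hlow : ∀ k : ℝ → ℝ → ℝ, ∀ u : Plane → ℝ,
      u =ᵐ[volume.restrict D] (rect 0 1 0 1).indicator (fun x => k (x 1) (x 0)) →
      ∫ x in lowPart D, u x = 0 := fun k u hu => by
    rw [← integral_zero Plane ℝ (μ := volume.restrict (lowPart D))]
    refine integral_congr_ae ?_
    filter_upwards [ae_restrict_of_subset inter_subset_left hu,
      ae_restrict_mem (measurableSet_lowPart hD.isOpen)] with x hx hxl
    rw [hx, indicator_of_notMem fun h : x ∈ rect 0 1 0 1 => (lt_asymm h.2.1 hxl.2)]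
  rw [hlow (fun a b => A a * τ b) _ h0.val, hlow (fun a b => A' a * τ b) _ h0.vertical] at hr
  have he := hs φ hφ
  rw [convection_add_left hD hpv.1 hv.1 hφ.1, convection_add_middle hD hpv.1 hφ.1,
    convection_add_middle hD hv.1 hφ.1, hp.convection_self, map_add, add_apply] at he
  have h2 := abs_convection_linear_le hD hp hv hA hA' hB hτ hσ hσ' h0 h1
  have h3 := convection_le_norm (y := v) hD hv.1 hφ.1
  have h4 : dirichlet D v φ = -((convection D p v φ + convection D v p φ) + convection D v v φ) := by
    linarith
  rw [h4, abs_neg]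
  refine (abs_add_le _ _).trans ((add_le_add h2 h3).trans_eq ?_)
  ring

/-- The curl of a stream function with zero Cauchy data at the top and on the axis, extended by zero
below the axis, is an admissible divergence-free test field. -/
lemma tensor_test_mem_solenoidal (hD : IsChannel D ε) {φ : VField D} {β β₁ β₂ σ τ : ℝ → ℝ} {m : ℝ}
    (hβ : ∀ t, HasDerivAt β (β₁ t) t) (hβ₁ : ∀ t, HasDerivAt β₁ (β₂ t) t) (hβ₂ : Continuous β₂)
    (h0 : β 0 = 0) (h1 : β 1 = 0) (h0' : β₁ 0 = 0) (h1' : β₁ 1 = 0) (hm : m ≠ 0)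
    (hτ : ContDiff ℝ ∞ τ) (hτ' : ∀ t, HasDerivAt τ (-m * σ t) t)
    (hσ : ∀ t, HasDerivAt σ (m * τ t) t) (hσ0 : σ 0 = 0) (hσ1 : σ 1 = 0)
    (hφ0 : IsTensor D (fun t => β₁ t / m) (fun t => β₂ t / m) τ (fun s => -m * σ s) (φ 0))
    (hφ1 : IsTensor D β β₁ σ (fun s => m * τ s) (φ 1)) : φ ∈ solenoidal D := by
  have hβ₁c : Continuous β₁ := continuous_iff_continuousAt.2 fun t => (hβ₁ t).continuousAt
  refine mem_solenoidal.2 ⟨mem_velocity.2 fun i => ?_, ?_⟩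
  · fin_cases i
    · exact tensor_mem_walls hD (fun t => (hβ₁ t).div_const m) (by fun_prop) (by simp [h0'])
        (by simp [h1']) hτ hτ' hφ0
    · exact tensor_mem_wallsAndSides hD hβ hβ₁c h0 h1 hσ (hτ.continuous.const_mul m) hσ0 hσ1 hφ1
  · rw [divergence_apply, Lp.ext_iff]
    filter_upwards [Lp.coeFn_add (φ 0 1) (φ 1 2), Lp.coeFn_zero ℝ 2 (volume.restrict D),
      hφ0.horizontal, hφ1.vertical] with x e1 e2 e3 e4
    rw [e1, e2, Pi.add_apply, e3, e4]
    by_cases h : x ∈ rect 0 1 0 1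
    · simp only [indicator_of_mem h, Pi.zero_apply]
      field_simp
      ring
    · simp [indicator_of_notMem h]

/-- Testing with `(β' cos (m x₁) / m, β sin (m x₁))`, where `β` corrects `f`. Integration by parts
leaves the pairing of `v` with the field made from `f`, and terms in the layer below the axis. -/
lemma dirichlet_corrector (hD : IsChannel D ε) {v φ : VField D} (hv : v ∈ solenoidal D)
    {f f' β β₁ s s₁ σ τ : ℝ → ℝ} {m : ℝ} (hm : m ≠ 0) (hc : IsCorrector m f β β₁ s s₁)
    (hf : ∀ t, HasDerivAt f (f' t) t) (hf' : Continuous f')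
    (hτ : ∀ t, HasDerivAt τ (-m * σ t) t) (hσ : ∀ t, HasDerivAt σ (m * τ t) t)
    (hσ0 : σ 0 = 0) (hσ1 : σ 1 = 0)
    (hφ0 : IsTensor D (fun t => β₁ t / m) (fun t => (m ^ 2 * β t + (s t - f t)) / m) τ
      (fun s => -m * σ s) (φ 0))
    (hφ1 : IsTensor D β β₁ σ (fun s => m * τ s) (φ 1)) :
    dirichlet D v φ = (∫ x in rect 0 1 0 1, f' (x 1) / m * τ (x 0) * v 0 0 x) +
        (∫ x in rect 0 1 0 1, f (x 1) * σ (x 0) * v 1 0 x) -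
        (s 0 - f 0) / m * (∫ x in lowPart D, τ (x 0) * v 0 2 x) +
        s₁ 0 / m ^ 2 * ∫ x in lowPart D, σ (x 0) * v 1 2 x := by
  have cont : ∀ {g g' : ℝ → ℝ}, (∀ t, HasDerivAt g (g' t) t) → Continuous g := fun h =>
    continuous_iff_continuousAt.2 fun t => (h t).continuousAt
  have cf := cont hf
  have cβ := cont hc.deriv_fst
  have cβ₁ := cont hc.deriv_snd
  have cs := cont hc.layer_fst
  have cs₁ := cont hc.layer_snd
  have cτ := cont hτ
  have cσ := cont hσ
  have hv0 := mem_velocity.1 hv.1 0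
  have hv1 := mem_velocity.1 hv.1 1
  have w0 := walls_subset_noSlip D 0
  have w1 := walls_subset_noSlip D 1
  have hsub : inflow ∪ outflow ⊆ noSlip D 1 := subset_union_right
  rw [dirichlet_apply, Fin.sum_univ_two, Fin.sum_univ_two, Fin.sum_univ_two]
  simp only [Fin.succ_zero_eq_one, Fin.succ_one_eq_two]
  rw [inner_eq_of_ae_eq_tensor hD (A := fun t => β₁ t / m) (T := fun s => -m * σ s) hφ0.horizontal,
    inner_eq_of_ae_eq_tensor hD (A := fun t => (m ^ 2 * β t + (s t - f t)) / m) hφ0.vertical,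
    inner_eq_of_ae_eq_tensor hD (T := fun s => m * τ s) hφ1.horizontal,
    inner_eq_of_ae_eq_tensor hD hφ1.vertical]
  let J : (ℝ → ℝ) → (ℝ → ℝ) → Lp ℝ 2 (volume.restrict D) → ℝ := fun a b u =>
    ∫ x in rect 0 1 0 1, a (x 1) * b (x 0) * u x
  have hi : ∀ {a b : ℝ → ℝ} {u : Lp ℝ 2 (volume.restrict D)}, Continuous a → Continuous b →
      Integrable (fun x => a (x 1) * b (x 0) * u x) (volume.restrict (rect 0 1 0 1)) :=
    fun ha hb => MemLp.integrable_mul (p := 2) (q := 2) (memLp_rect_of_continuous (by fun_prop))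
      ((Lp.memLp _).mono_measure (Measure.restrict_mono hD.unit_subset le_rfl))
  have lin : ∀ (c₁ c₂ c₃ : ℝ) {a₁ a₂ a₃ b : ℝ → ℝ} (a b' : ℝ → ℝ)
      (u : Lp ℝ 2 (volume.restrict D)), Continuous a₁ → Continuous a₂ → Continuous a₃ →
      Continuous b → (∀ t r, a t * b' r = (c₁ * a₁ t + c₂ * a₂ t + c₃ * a₃ t) * b r) →
      J a b' u = c₁ * J a₁ b u + c₂ * J a₂ b u + c₃ * J a₃ b u :=
    fun c₁ c₂ c₃ a₁ a₂ a₃ b a b' u h1 h2 h3 hb h => by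
      have i1 := (hi (u := u) h1 hb).const_mul c₁
      have i2 := (hi (u := u) h2 hb).const_mul c₂
      have i3 := (hi (u := u) h3 hb).const_mul c₃
      have i12 : Integrable (fun x => c₁ * (a₁ (x 1) * b (x 0) * u x) +
        c₂ * (a₂ (x 1) * b (x 0) * u x)) (volume.restrict (rect 0 1 0 1)) := i1.add i2
      simp only [J]
      rw [← integral_const_mul, ← integral_const_mul, ← integral_const_mul, ← integral_add i1 i2,
        ← integral_add i12 i3]
      refine integral_congr_ae (Eventually.of_forall fun x => ?_)
      simp only [h]
      ring
  have lin' : ∀ (c : ℝ) {a₁ b : ℝ → ℝ} (a b' : ℝ → ℝ) (u : Lp ℝ 2 (volume.restrict D)),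
      Continuous a₁ → Continuous b → (∀ t r, a t * b' r = c * a₁ t * b r) →
      J a b' u = c * J a₁ b u := fun c a₁ b a b' u h1 hb h => by
    rw [lin c 0 0 a b' u h1 h1 h1 hb fun t r => by rw [h]; ring]; ring
  have A1 := H1Zero_horizontal (g := β₁) hD w0 hv0 hσ (by fun_prop) cβ₁ (Or.inr ⟨hσ0, hσ1⟩)
  have A2 := H1Zero_vertical (g := fun t => (m ^ 2 * β t + (s t - f t)) / m)
    (g' := fun t => (m ^ 2 * β₁ t + (s₁ t - f' t)) / m) hD w0 hv0
    (fun t => (((hc.deriv_fst t).const_mul (m ^ 2)).fun_add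
      ((hc.layer_fst t).fun_sub (hf t))).div_const m) (by fun_prop) cτ
  have A3 := H1Zero_horizontal (g := β) hD w1 hv1 hτ (by fun_prop) cβ (Or.inl hsub)
  have A4 := H1Zero_vertical hD w1 hv1 hc.deriv_snd (by fun_prop) cσ
  have A5 := H1Zero_vertical hD w1 hv1 hc.layer_snd (by fun_prop) cσ
  have A6 := H1Zero_horizontal (g := s₁) hD w0 hv0 hσ (by fun_prop) cs₁ (Or.inr ⟨hσ0, hσ1⟩)
  have A7 : ∫ x in rect 0 1 0 1, s₁ (x 1) * σ (x 0) * v 0 1 x =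
      -∫ x in rect 0 1 0 1, s₁ (x 1) * σ (x 0) * v 1 2 x := by
    rw [← integral_neg]
    refine integral_congr_ae ((ae_restrict_of_subset hD.unit_subset (solenoidal_ae_eq hv)).mono
      fun x hx => ?_)
    simp only [hx]; ring
  have B1 := lin' m β₁ (fun s => m * τ s) (v 0 0) cβ₁ cτ fun t r => by ring
  have B2 := lin m (1 / m) (-(1 / m)) (fun t => (m ^ 2 * β₁ t + (s₁ t - f' t)) / m) τ (v 0 0)
    cβ₁ cs₁ hf' cτ fun t r => by field_simp; ring
  have B3 := lin' (-m) β (fun s => -m * σ s) (v 1 0) cβ cσ fun t r => by ring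
  have B4 := lin (m ^ 2) 1 (-1) (fun t => m ^ 2 * β t + (s t - f t)) σ (v 1 0) cβ cs cf cσ
    fun t r => by ring
  have B5 := lin' (m ^ 2) (fun t => m ^ 2 * s t) σ (v 1 0) cs cσ fun t r => by ring
  have B6 := lin' m s₁ (fun s => m * τ s) (v 0 0) cs₁ cτ fun t r => by ring
  have B7 := lin' (-1) (fun t => β₁ t / m) (fun s => -m * σ s) (v 0 1) cβ₁ cσ
    fun t r => by field_simp
  have B8 := lin' m β (fun s => m * τ s) (v 1 1) cβ cτ fun t r => by ring
  have B9 := lin' (1 / m) (fun t => f' t / m) τ (v 0 0) hf' cτ fun t r => by ring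
  simp only [J] at B1 B2 B3 B4 B5 B6 B7 B8 B9
  rw [B1] at A1
  rw [B2, hc.zero_fst] at A2
  rw [B3] at A3
  rw [B4, hc.zero_snd] at A4
  rw [B5] at A5
  rw [A7, B6] at A6
  rw [B7, B8, B9]
  -- The field made from `s` is a gradient and `v` is divergence free, so their pairing reduces to a
  -- term on the axis, which is an integral over the layer below it.
  have key : -(1 / m * ∫ x in rect 0 1 0 1, s₁ (x 1) * τ (x 0) * v 0 0 x) -
      (∫ x in rect 0 1 0 1, s (x 1) * σ (x 0) * v 1 0 x) =
      s₁ 0 / m ^ 2 * ∫ x in lowPart D, σ (x 0) * v 1 2 x := by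
    field_simp
    linear_combination -A5 - A6
  have e : (m ^ 2 * 0 + (s 0 - f 0)) / m = (s 0 - f 0) / m := by ring
  rw [e] at A2
  linear_combination -A1 + A2 + m * A3 + A4 + key

lemma integral_sq_le_one {g : ℝ → ℝ} (hg : Continuous g) (h : ∀ s, |g s| ≤ 1) :
    ∫ s in (0 : ℝ)..1, g s ^ 2 ≤ 1 := by
  refine (intervalIntegral.integral_mono_on zero_le_one ((hg.pow 2).intervalIntegrable _ _)
    (continuous_const.intervalIntegrable _ _) fun s _ => (sq_le_one_iff_abs_le_one _).2 (h s)).trans ?_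
  simp

lemma integral_sq_nonneg (g : ℝ → ℝ) : 0 ≤ ∫ s in (0 : ℝ)..1, g s ^ 2 :=
  intervalIntegral.integral_nonneg zero_le_one fun _ _ => sq_nonneg _

/-- The test field made from a corrector is small in `H¹` for high frequencies. -/
lemma norm_tensor_test_le (hD : IsChannel D ε) {φ : VField D} {f β β₁ s s₁ σ τ : ℝ → ℝ} {m F : ℝ}
    (hm : 3 ≤ m) (hc : IsCorrector m f β β₁ s s₁) (hf : Continuous f) (hF : 0 ≤ F)
    (hfF : ∫ t in (0 : ℝ)..1, f t ^ 2 ≤ F ^ 2) (hτ : Continuous τ) (hσ : Continuous σ)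
    (hτ1 : ∀ r, |τ r| ≤ 1) (hσ1 : ∀ r, |σ r| ≤ 1)
    (hφ0 : IsTensor D (fun t => β₁ t / m) (fun t => (m ^ 2 * β t + (s t - f t)) / m) τ
      (fun s => -m * σ s) (φ 0))
    (hφ1 : IsTensor D β β₁ σ (fun s => m * τ s) (φ 1)) : ‖φ‖ ≤ 2 * F / m := by
  have cont : ∀ {g g' : ℝ → ℝ}, (∀ t, HasDerivAt g (g' t) t) → Continuous g := fun h =>
    continuous_iff_continuousAt.2 fun t => (h t).continuousAt
  have cβ := cont hc.deriv_fst
  have cβ₁ := cont hc.deriv_snd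
  have cs := cont hc.layer_fst
  have hm0 : 0 < m := by linarith
  have h0 := hφ0.norm_sq hD (by fun_prop) (by fun_prop) hτ (by fun_prop)
  have h1 := hφ1.norm_sq hD cβ cβ₁ hσ (by fun_prop)
  have he := hc.energy hf
  have t1 := integral_sq_le_one hτ hτ1
  have s1 := integral_sq_le_one hσ hσ1
  have t0 := integral_sq_nonneg τ
  have s0 := integral_sq_nonneg σ
  simp only [div_pow, mul_pow, neg_sq, intervalIntegral.integral_div,
    intervalIntegral.integral_const_mul] at h0 h1
  set b0 := ∫ t in (0 : ℝ)..1, β t ^ 2 with hb0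
  set b1 := ∫ t in (0 : ℝ)..1, β₁ t ^ 2 with hb1
  set b2 := ∫ t in (0 : ℝ)..1, (m ^ 2 * β t + (s t - f t)) ^ 2 with hb2
  have n0 : 0 ≤ b0 := integral_sq_nonneg β
  have n1 : 0 ≤ b1 := integral_sq_nonneg β₁
  have n2 : 0 ≤ b2 := integral_sq_nonneg _
  have hm2 : 1 ≤ m ^ 2 := by nlinarith
  have e : ‖φ‖ ^ 2 = ‖φ 0‖ ^ 2 + ‖φ 1‖ ^ 2 := by
    rw [PiLp.norm_sq_eq_of_L2, Fin.sum_univ_two]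
  refine le_of_sq_le_sq ?_ (by positivity)
  rw [div_pow, le_div_iff₀ (by positivity), e, h0, h1]
  set Tt := ∫ t in (0 : ℝ)..1, τ t ^ 2
  set Ss := ∫ t in (0 : ℝ)..1, σ t ^ 2
  have k1 : (b1 / m ^ 2 * Tt + (b1 / m ^ 2 * (m ^ 2 * Ss) + b2 / m ^ 2 * Tt) +
      (b0 * Ss + (b0 * (m ^ 2 * Tt) + b1 * Ss))) * m ^ 2 =
      (b1 + b2 + m ^ 4 * b0) * Tt + (m ^ 2 * b1 * 2 + m ^ 2 * b0) * Ss := by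
    field_simp; ring
  rw [k1]
  have k2 : (b1 + b2 + m ^ 4 * b0) * Tt ≤ b1 + b2 + m ^ 4 * b0 :=
    mul_le_of_le_one_right (by positivity) t1
  have k3 : (m ^ 2 * b1 * 2 + m ^ 2 * b0) * Ss ≤ m ^ 2 * b1 * 2 + m ^ 2 * b0 :=
    mul_le_of_le_one_right (by positivity) s1
  have k4 : b1 ≤ m ^ 2 * b1 := le_mul_of_one_le_left n1 hm2
  have k5 : m ^ 2 * b0 ≤ m ^ 4 * b0 := by
    have : m ^ 2 ≤ m ^ 4 := pow_le_pow_right₀ (by linarith) (by norm_num)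
    gcongr
  nlinarith

/-- The estimate of a single mode: `f` is arbitrary, and the frequency `k` is positive. -/
lemma mode_pairing_le (hD : IsChannel D ε) {lam : ℝ} {p v : VField D}
    (hp : IsPoiseuille D lam p) (hv : v ∈ solenoidal D) (hs : IsSolenoidalSolution hD lam (p + v))
    {k : ℕ} (hk : 1 ≤ k) {f f' : ℝ → ℝ} {F : ℝ} (hf : ∀ t, HasDerivAt f (f' t) t)
    (hf' : Continuous f') (hF : 0 ≤ F) (hfF : ∫ t in (0 : ℝ)..1, f t ^ 2 ≤ F ^ 2) :
    (∫ x in rect 0 1 0 1, f' (x 1) / (k * Real.pi) * cosMode k (x 0) * v 0 0 x) +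
        (∫ x in rect 0 1 0 1, f (x 1) * sinMode k (x 0) * v 1 0 x) ≤
      (4 * |lam| * ‖v 1 0‖ + 36 * ‖v‖ ^ 2) * (2 * F / (k + 1)) +
        (20 * F + |f 0|) * |∫ x in lowPart D, cosMode k (x 0) * v 0 2 x| +
        20 * F * |∫ x in lowPart D, sinMode k (x 0) * v 1 2 x| := by
  have hk1 : (1 : ℝ) ≤ k := by exact_mod_cast hk
  have hπ := Real.pi_gt_three
  set m : ℝ := k * Real.pi with hmdef
  have hm : 3 ≤ m := by nlinarith
  have hmk : (k : ℝ) + 1 ≤ m := by nlinarith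
  have hm0 : 0 < m := by linarith
  have cf : Continuous f := continuous_iff_continuousAt.2 fun t => (hf t).continuousAt
  obtain ⟨β, β₁, s, s₁, hc⟩ := exists_isCorrector hm cf
  have cont : ∀ {g g' : ℝ → ℝ}, (∀ t, HasDerivAt g (g' t) t) → Continuous g := fun h =>
    continuous_iff_continuousAt.2 fun t => (h t).continuousAt
  have cβ := cont hc.deriv_fst
  have cβ₁ := cont hc.deriv_snd
  have cs := cont hc.layer_fst
  have dτ : ∀ t, HasDerivAt (cosMode k) (-m * sinMode k t) t := hasDerivAt_cosMode k
  have dσ : ∀ t, HasDerivAt (sinMode k) (m * cosMode k t) t := hasDerivAt_sinMode k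
  obtain ⟨z0, h0⟩ := exists_isTensor hD (A := fun t => β₁ t / m)
    (A' := fun t => (m ^ 2 * β t + (s t - f t)) / m) (T := cosMode k)
    (T' := fun s => -m * sinMode k s) (by fun_prop) (by fun_prop) (by fun_prop) (by fun_prop)
  obtain ⟨z1, h1⟩ := exists_isTensor hD (A := β) (A' := β₁) (T := sinMode k)
    (T' := fun s => m * cosMode k s) cβ cβ₁ (by fun_prop) (by fun_prop)
  let φ : VField D := WithLp.toLp 2 ![z0, z1]
  have h0' : IsTensor D (fun t => β₁ t / m) (fun t => (m ^ 2 * β t + (s t - f t)) / m) (cosMode k)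
    (fun s => -m * sinMode k s) (φ 0) := h0
  have h1' : IsTensor D β β₁ (sinMode k) (fun s => m * cosMode k s) (φ 1) := h1
  have hφ : φ ∈ solenoidal D := tensor_test_mem_solenoidal hD hc.deriv_fst hc.deriv_snd
    (by fun_prop) hc.zero_fst hc.one_fst hc.zero_snd hc.one_snd hm0.ne' (contDiff_cosMode k) dτ dσ
    (sinMode_zero k) (sinMode_one k) h0' h1'
  have hn := norm_tensor_test_le hD hm hc cf hF hfF (continuous_cosMode k) (continuous_sinMode k)
    (abs_cosMode_le k) (abs_sinMode_le k) h0' h1'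
  have hd := abs_dirichlet_tensor_le hD hp hv hs hφ (fun t => (hc.deriv_snd t).div_const m)
    (by fun_prop) cβ (continuous_cosMode k) dσ (by fun_prop) h0' h1'
  have key := dirichlet_corrector hD hv hm0.ne' hc hf hf' dτ dσ (sinMode_zero k) (sinMode_one k)
    h0' h1'
  set κ := 4 * |lam| * ‖v 1 0‖ + 36 * ‖v‖ ^ 2 with hκ
  have hκ0 : 0 ≤ κ := by positivity
  set a := ∫ x in lowPart D, cosMode k (x 0) * v 0 2 x
  set b := ∫ x in lowPart D, sinMode k (x 0) * v 1 2 x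
  -- both boundary values of the layer lose a power of `m` that the prefactors compensate
  have hs0 : |(s 0 - f 0) / m| ≤ 20 * F + |f 0| := by
    have g1 : |s 0| ≤ 20 * m * F := by
      refine abs_le_of_sq_le_sq ?_ (by positivity)
      refine hc.layer_le.trans ?_
      have : 400 * m * (∫ t in (0 : ℝ)..1, f t ^ 2) ≤ 400 * m * F ^ 2 := by gcongr
      nlinarith [sq_nonneg F, mul_nonneg hm0.le (sq_nonneg F)]
    rw [abs_div, abs_of_pos hm0, div_le_iff₀ hm0]
    refine (abs_sub _ _).trans ?_
    nlinarith [abs_nonneg (f 0)]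
  have hs1 : |s₁ 0 / m ^ 2| ≤ 20 * F := by
    have g1 : |s₁ 0| ≤ 20 * m ^ 2 * F := by
      refine abs_le_of_sq_le_sq ?_ (by positivity)
      refine hc.layer_deriv_le.trans ?_
      have : 400 * m ^ 3 * (∫ t in (0 : ℝ)..1, f t ^ 2) ≤ 400 * m ^ 3 * F ^ 2 := by gcongr
      have h3 : m ^ 3 ≤ m ^ 4 := pow_le_pow_right₀ (by linarith) (by norm_num)
      have h4 : m ^ 3 * F ^ 2 ≤ m ^ 4 * F ^ 2 := by gcongr
      nlinarith
    rw [abs_div, abs_of_pos (show 0 < m ^ 2 by positivity), div_le_iff₀ (by positivity)]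
    linarith
  have hd' : |dirichlet D v φ| ≤ κ * (2 * F / (k + 1)) := by
    refine hd.trans (mul_le_mul_of_nonneg_left (hn.trans ?_) hκ0)
    gcongr
  have u1 : (s 0 - f 0) / m * a ≤ (20 * F + |f 0|) * |a| := by
    refine (le_abs_self _).trans ?_
    rw [abs_mul]
    gcongr
  have u2 : -(s₁ 0 / m ^ 2 * b) ≤ 20 * F * |b| := by
    refine (neg_le_abs _).trans ?_
    rw [abs_mul]
    gcongr
  have u3 := le_of_abs_le hd'
  linarith

/-- The estimate of the mode of frequency zero, which involves only the first component of `v`: the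
test field is `(β, 0)` with `β'' = -f`. -/
lemma mode_zero_pairing_le (hD : IsChannel D ε) {lam : ℝ} {p v : VField D}
    (hp : IsPoiseuille D lam p) (hv : v ∈ solenoidal D) (hs : IsSolenoidalSolution hD lam (p + v))
    {f : ℝ → ℝ} {F : ℝ} (hf : Continuous f) (hF : 0 ≤ F)
    (hfF : ∫ t in (0 : ℝ)..1, f t ^ 2 ≤ F ^ 2) :
    ∫ x in rect 0 1 0 1, f (x 1) * 1 * v 0 0 x ≤
      (4 * |lam| * ‖v 1 0‖ + 36 * ‖v‖ ^ 2) * (3 * F) +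
        2 * F * |∫ x in lowPart D, 1 * v 0 2 x| := by
  let G₁ : ℝ → ℝ := fun t => ∫ u in (0 : ℝ)..t, f u
  have dG₁ : ∀ t, HasDerivAt G₁ (f t) t := fun t => hf.integral_hasStrictDerivAt 0 t |>.hasDerivAt
  have cG₁ : Continuous G₁ := continuous_iff_continuousAt.2 fun t => (dG₁ t).continuousAt
  let G : ℝ → ℝ := fun t => ∫ u in (0 : ℝ)..t, G₁ u
  have dG : ∀ t, HasDerivAt G (G₁ t) t := fun t => cG₁.integral_hasStrictDerivAt 0 t |>.hasDerivAt
  have b1 : ∀ t ∈ Icc (0 : ℝ) 1, |G₁ t| ≤ F := fun t ht => by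
    refine abs_le_of_sq_le_sq ((sq_intervalIntegral_le hf ht.1).trans ?_) hF
    refine le_trans ?_ hfF
    have h1 : ∫ u in (0 : ℝ)..t, f u ^ 2 ≤ ∫ u in (0 : ℝ)..1, f u ^ 2 :=
      intervalIntegral.integral_mono_interval le_rfl ht.1 ht.2
        (Eventually.of_forall fun _ => sq_nonneg _) ((hf.pow 2).intervalIntegrable _ _)
    have h2 : 0 ≤ ∫ u in (0 : ℝ)..t, f u ^ 2 :=
      intervalIntegral.integral_nonneg ht.1 fun _ _ => sq_nonneg _
    nlinarith [ht.1, ht.2]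
  have b2 : ∀ t ∈ Icc (0 : ℝ) 1, |G t| ≤ F := fun t ht => by
    have := intervalIntegral.norm_integral_le_of_norm_le_const (a := 0) (b := t) (f := G₁) (C := F)
      fun u hu => b1 u ⟨((uIoc_of_le ht.1 ▸ hu).1).le, ((uIoc_of_le ht.1 ▸ hu).2).trans ht.2⟩
    rw [sub_zero, abs_of_nonneg ht.1] at this
    exact this.trans (mul_le_of_le_one_right hF ht.2)
  have one : (1 : ℝ) ∈ Icc (0 : ℝ) 1 := ⟨zero_le_one, le_rfl⟩
  let β : ℝ → ℝ := fun t => t * G 1 - G t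
  let β₁ : ℝ → ℝ := fun t => G 1 - G₁ t
  have dβ : ∀ t, HasDerivAt β (β₁ t) t := fun t =>
    (((hasDerivAt_id' t).mul_const (G 1)).fun_sub (dG t)).congr_deriv (by simp only [β₁]; ring)
  have dβ₁ : ∀ t, HasDerivAt β₁ (-f t) t := fun t => ((dG₁ t).const_sub (G 1))
  have cβ : Continuous β := continuous_iff_continuousAt.2 fun t => (dβ t).continuousAt
  have cβ₁ : Continuous β₁ := continuous_iff_continuousAt.2 fun t => (dβ₁ t).continuousAt
  have g0 : β 0 = 0 := by simp [β, G]
  have g1 : β 1 = 0 := by simp [β]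
  have e1 : ∀ t ∈ Icc (0 : ℝ) 1, |β₁ t| ≤ 2 * F := fun t ht => by
    refine (abs_sub _ _).trans ?_
    linarith [b1 t ht, b2 1 one]
  have e0 : ∀ t ∈ Icc (0 : ℝ) 1, |β t| ≤ 2 * F := fun t ht => by
    refine (abs_sub _ _).trans ?_
    rw [abs_mul, abs_of_nonneg ht.1]
    nlinarith [b2 t ht, b2 1 one, ht.1, ht.2, abs_nonneg (G 1)]
  have sq_le : ∀ g : ℝ → ℝ, Continuous g → (∀ t ∈ Icc (0 : ℝ) 1, |g t| ≤ 2 * F) →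
      ∫ t in (0 : ℝ)..1, g t ^ 2 ≤ 4 * F ^ 2 := fun g hg h => by
    refine (intervalIntegral.integral_mono_on zero_le_one ((hg.pow 2).intervalIntegrable _ _)
      (continuous_const.intervalIntegrable _ _) fun t ht => sq_le_sq'
        (neg_le_of_abs_le (h t ht)) (le_of_abs_le (h t ht))).trans_eq ?_
    simp; ring
  have d1 : ∀ t, HasDerivAt (fun _ : ℝ => (1 : ℝ)) ((fun _ => (0 : ℝ)) t) t := fun t =>
    hasDerivAt_const t 1
  have d0 : ∀ t, HasDerivAt (fun _ : ℝ => (0 : ℝ)) ((fun _ => (0 : ℝ)) t) t := fun t =>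
    hasDerivAt_const t 0
  obtain ⟨z0, h0⟩ := exists_isTensor hD cβ cβ₁ (T := fun _ => (1 : ℝ)) (T' := fun _ => (0 : ℝ))
    continuous_const continuous_const
  obtain ⟨z1, h1⟩ := exists_isTensor hD (A := fun _ => (0 : ℝ)) (A' := fun _ => (0 : ℝ))
    (T := fun _ => (0 : ℝ)) (T' := fun _ => (0 : ℝ)) continuous_const continuous_const
    continuous_const continuous_const
  let φ : VField D := WithLp.toLp 2 ![z0, z1]
  have h0' : IsTensor D β β₁ (fun _ => (1 : ℝ)) (fun _ => (0 : ℝ)) (φ 0) := h0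
  have h1' : IsTensor D (fun _ => (0 : ℝ)) (fun _ => (0 : ℝ)) (fun _ => (0 : ℝ))
    (fun _ => (0 : ℝ)) (φ 1) := h1
  have hφ : φ ∈ solenoidal D := by
    refine mem_solenoidal.2 ⟨mem_velocity.2 fun i => ?_, ?_⟩
    · fin_cases i
      · exact tensor_mem_walls hD dβ cβ₁ g0 g1 contDiff_const d1 h0'
      · exact tensor_mem_wallsAndSides hD d0 continuous_const rfl rfl d0 continuous_const rfl rfl h1'
    · rw [divergence_apply, Lp.ext_iff]
      filter_upwards [Lp.coeFn_add (φ 0 1) (φ 1 2), Lp.coeFn_zero ℝ 2 (volume.restrict D),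
        h0'.horizontal, h1'.vertical] with x u1 u2 u3 u4
      rw [u1, u2, Pi.add_apply, u3, u4]
      simp
  have hn : ‖φ‖ ≤ 3 * F := by
    have k0 := h0'.norm_sq hD cβ cβ₁ continuous_const continuous_const
    have k1 := h1'.norm_sq hD continuous_const continuous_const continuous_const continuous_const
    have e : ‖φ‖ ^ 2 = ‖φ 0‖ ^ 2 + ‖φ 1‖ ^ 2 := by
      rw [PiLp.norm_sq_eq_of_L2, Fin.sum_univ_two]
    simp at k0 k1
    refine le_of_sq_le_sq ?_ (by positivity)
    rw [e, k0, k1, norm_zero]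
    nlinarith [sq_le β cβ e0, sq_le β₁ cβ₁ e1, sq_nonneg F]
  have hd := abs_dirichlet_tensor_le hD hp hv hs hφ dβ cβ₁ continuous_const continuous_const d0
    continuous_const h0' h1'
  have hv0 := mem_velocity.1 hv.1 0
  have key : dirichlet D v φ = ∫ x in rect 0 1 0 1, β₁ (x 1) * 1 * v 0 2 x := by
    rw [dirichlet_apply, Fin.sum_univ_two, Fin.sum_univ_two, Fin.sum_univ_two]
    simp only [Fin.succ_zero_eq_one, Fin.succ_one_eq_two]
    rw [inner_eq_of_ae_eq_tensor hD (T := fun _ => (0 : ℝ)) h0'.horizontal,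
      inner_eq_of_ae_eq_tensor hD (T := fun _ => (1 : ℝ)) h0'.vertical,
      inner_eq_of_ae_eq_tensor hD (A := fun _ => (0 : ℝ)) (T := fun _ => (0 : ℝ)) h1'.horizontal,
      inner_eq_of_ae_eq_tensor hD (A := fun _ => (0 : ℝ)) (T := fun _ => (0 : ℝ)) h1'.vertical]
    simp
  have A := H1Zero_vertical (τ := fun _ => (1 : ℝ)) hD (walls_subset_noSlip D 0) hv0 dβ₁ (by fun_prop)
    continuous_const
  have hneg : ∫ x in rect 0 1 0 1, -f (x 1) * 1 * v 0 0 x =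
      -∫ x in rect 0 1 0 1, f (x 1) * 1 * v 0 0 x := by
    rw [← integral_neg]
    refine integral_congr_ae (Eventually.of_forall fun x => ?_)
    simp only; ring
  rw [hneg, ← key] at A
  have hκ0 : 0 ≤ 4 * |lam| * ‖v 1 0‖ + 36 * ‖v‖ ^ 2 := by positivity
  have u1 := (le_of_abs_le hd).trans (mul_le_mul_of_nonneg_left hn hκ0)
  have u2 : β₁ 0 * (∫ x in lowPart D, 1 * v 0 2 x) ≤ 2 * F * |∫ x in lowPart D, 1 * v 0 2 x| := by
    refine (le_abs_self _).trans ?_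
    rw [abs_mul]
    have := e1 0 ⟨le_rfl, zero_le_one⟩
    gcongr
  linarith

end Channel

/-! ### The energy of the modes -/

lemma hasDerivAt_mode {e : ℕ → ℝ → ℝ} (he : ∀ k, Continuous (e k)) {ψ : Plane → ℝ}
    (hψ : ContDiff ℝ ∞ ψ) (hc : HasCompactSupport ψ) (k : ℕ) (t : ℝ) :
    HasDerivAt (mode e ψ k) (mode e (partialDeriv 1 ψ) k t) t := by
  have c1 := (contDiff_partialDeriv hψ 1).continuous
  obtain ⟨C, hC⟩ := (hasCompactSupport_partialDeriv hc 1).exists_bound_of_continuous c1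
  have hek := he k
  have cv : ∀ {g : Plane → ℝ}, Continuous g → ∀ t, Continuous fun s => g !₂[s, t] := fun hg t =>
    continuous_horizontal hg t
  exact (intervalIntegral.hasDerivAt_integral_of_dominated_loc_of_deriv_le
    (F := fun t s => ψ !₂[s, t] * e k s) (F' := fun t s => partialDeriv 1 ψ !₂[s, t] * e k s)
    (bound := fun s => C * |e k s|) (s := univ) univ_mem
    (Eventually.of_forall fun t => ((cv hψ.continuous t).mul hek).aestronglyMeasurable)
    (((cv hψ.continuous t).mul hek).intervalIntegrable _ _)
    ((cv c1 t).mul hek).aestronglyMeasurable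
    (Eventually.of_forall fun s _ t _ => by
      rw [norm_mul]; exact mul_le_mul_of_nonneg_right (hC _) (norm_nonneg _))
    (Continuous.intervalIntegrable (by fun_prop) _ _)
    (Eventually.of_forall fun s _ t _ => (hasDerivAt_vertical
      (hψ.differentiable (by simp)) s t).mul_const _)).2

lemma mode_sinMode_partialDeriv {ψ : Plane → ℝ} (hψ : ContDiff ℝ ∞ ψ) (k : ℕ) (t : ℝ) :
    mode sinMode (partialDeriv 0 ψ) k t = -(k * Real.pi) * mode cosMode ψ k t := by
  have c1 := continuous_horizontal (contDiff_partialDeriv hψ 0).continuous t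
  have c0 := continuous_horizontal hψ.continuous t
  have h : ∫ s in (0 : ℝ)..1, (partialDeriv 0 ψ !₂[s, t] * sinMode k s +
      ψ !₂[s, t] * (k * Real.pi * cosMode k s)) = 0 := by
    rw [intervalIntegral.integral_eq_sub_of_hasDerivAt
      (f := fun s => ψ !₂[s, t] * sinMode k s) (fun s _ => (hasDerivAt_horizontal
        (hψ.differentiable (by simp)) s t).fun_mul (hasDerivAt_sinMode k s))
      (Continuous.intervalIntegrable (by fun_prop) _ _)]
    simp
  rw [intervalIntegral.integral_add (Continuous.intervalIntegrable (by fun_prop) _ _)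
    (Continuous.intervalIntegrable (by fun_prop) _ _)] at h
  rw [mode, mode, eq_neg_of_add_eq_zero_left h, ← intervalIntegral.integral_const_mul,
    ← intervalIntegral.integral_neg]
  refine intervalIntegral.integral_congr fun s _ => ?_
  ring

lemma setIntegral_mul_eq_integral_mode {e : ℕ → ℝ → ℝ} (he : ∀ k, Continuous (e k)) {A : ℝ → ℝ}
    (hA : Continuous A) {u : Plane → ℝ} (hu : Continuous u) (k : ℕ) :
    ∫ x in rect 0 1 0 1, A (x 1) * e k (x 0) * u x = ∫ t in (0 : ℝ)..1, A t * mode e u k t := by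
  have hek := he k
  rw [setIntegral_rect_swap zero_le_one zero_le_one (integrableOn_rect_of_continuous (by fun_prop))]
  refine intervalIntegral.integral_congr fun t _ => ?_
  simp only [mode, Matrix.cons_val_zero, Matrix.cons_val_one]
  rw [← intervalIntegral.integral_const_mul]
  refine intervalIntegral.integral_congr fun s _ => ?_
  ring

lemma setIntegral_rect_sq_vertical {A : ℝ → ℝ} (hA : Continuous A) :
    ∫ x in rect 0 1 0 1, A (x 1) ^ 2 = ∫ t in (0 : ℝ)..1, A t ^ 2 := by
  have := setIntegral_tensor_sq hA (continuous_const (y := (1 : ℝ)))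
  simpa using this

lemma integral_mode_sq_le {e : ℕ → ℝ → ℝ} (he : ∀ k, Continuous (e k)) {u : Plane → ℝ}
    (hu : Continuous u) (hbes : ∀ g : ℝ → ℝ, Continuous g → ∀ K, ∑ k ∈ Finset.range K,
      (∫ s in (0 : ℝ)..1, g s * e k s) ^ 2 ≤ ∫ s in (0 : ℝ)..1, g s ^ 2) (k : ℕ) :
    ∫ t in (0 : ℝ)..1, mode e u k t ^ 2 ≤ ∫ x in rect 0 1 0 1, u x ^ 2 :=
  (Finset.single_le_sum (f := fun k => ∫ t in (0 : ℝ)..1, mode e u k t ^ 2)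
    (fun _ _ => integral_sq_nonneg _) (Finset.self_mem_range_succ k)).trans
    (sum_integral_mode_sq_le he hu hbes (k + 1))

section Channel

variable {D : Set Plane} {ε : ℝ}

/-- `ψ` is a field of test functions adapted to the channel, with triples `t`, that approximates
`v` in `H¹` up to `δ`. -/
structure IsFieldApprox (D : Set Plane) (v t : VField D) (ψ : Fin 2 → Plane → ℝ) (δ : ℝ) :
    Prop where
  isBoxTest : ∀ i, IsBoxTest D (noSlip D i) (ψ i)
  isTripleOf : ∀ i, IsTripleOf D (ψ i) (t i)
  norm_sub_le : ‖v - t‖ ≤ δ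

lemma exists_isFieldApprox (hD : IsChannel D ε) {v : VField D} (hv : v ∈ velocity D) {δ : ℝ}
    (hδ : 0 < δ) : ∃ t ψ, IsFieldApprox D v t ψ δ := by
  choose ψ hψ t ht hδt using fun i => H1Zero_exists_approx hD (walls_subset_noSlip D i)
    (mem_velocity.1 hv i) (half_pos hδ)
  refine ⟨WithLp.toLp 2 t, ψ, hψ, ht, le_of_sq_le_sq ?_ hδ.le⟩
  rw [PiLp.norm_sq_eq_of_L2, Fin.sum_univ_two]
  have h : ∀ i, ‖(v - WithLp.toLp 2 t : VField D) i‖ ^ 2 ≤ (δ / 2) ^ 2 := fun i =>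
    pow_le_pow_left₀ (norm_nonneg _) (hδt i).le 2
  nlinarith [h 0, h 1]

namespace IsFieldApprox

variable {v t : VField D} {ψ : Fin 2 → Plane → ℝ} {δ : ℝ}

lemma norm_sub_entry_le (h : IsFieldApprox D v t ψ δ) (i : Fin 2) (k : Fin 3) :
    ‖(v - t) i k‖ ≤ δ := (norm_entry_le _ i k).trans h.norm_sub_le

lemma norm_entry_le (h : IsFieldApprox D v t ψ δ) (i : Fin 2) (k : Fin 3) : ‖t i k‖ ≤ ‖v‖ + δ :=
  (RoughChannel.norm_entry_le t i k).trans (by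
    have := norm_sub_norm_le t v
    rw [norm_sub_rev] at this
    linarith [h.norm_sub_le])

lemma coeFn_sub (v t : VField D) (i : Fin 2) (k : Fin 3) :
    (v - t) i k =ᵐ[volume.restrict D] fun x => v i k x - t i k x := Lp.coeFn_sub _ _

lemma setIntegral_rect_sq_le (hD : IsChannel D ε) (h : IsFieldApprox D v t ψ δ) (i : Fin 2) :
    ∫ x in rect 0 1 0 1, ψ i x ^ 2 ≤ (‖v‖ + δ) ^ 2 := by
  have h1 : ∫ x in rect 0 1 0 1, ψ i x ^ 2 = ∫ x in rect 0 1 0 1, t i 0 x ^ 2 :=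
    integral_congr_ae ((ae_restrict_of_subset hD.unit_subset (h.isTripleOf i).val).mono
      fun x hx => by simp only [hx])
  rw [h1]
  refine (Real.sqrt_le_left ((norm_nonneg _).trans (h.norm_entry_le i 0))).1 ?_
  exact (sqrt_setIntegral_sq_le hD.unit_subset _).trans (h.norm_entry_le i 0)

lemma setIntegral_rect_partialDeriv_sq_le (hD : IsChannel D ε) (h : IsFieldApprox D v t ψ δ)
    (i j : Fin 2) : ∫ x in rect 0 1 0 1, partialDeriv j (ψ i) x ^ 2 ≤ (‖v‖ + δ) ^ 2 := by
  have h1 : ∫ x in rect 0 1 0 1, partialDeriv j (ψ i) x ^ 2 =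
      ∫ x in rect 0 1 0 1, t i j.succ x ^ 2 :=
    integral_congr_ae ((ae_restrict_of_subset hD.unit_subset ((h.isTripleOf i).grad j)).mono
      fun x hx => by simp only [hx])
  rw [h1]
  refine (Real.sqrt_le_left ((norm_nonneg _).trans (h.norm_entry_le i j.succ))).1 ?_
  exact (sqrt_setIntegral_sq_le hD.unit_subset _).trans (h.norm_entry_le i _)

/-- Pairings of `v` with a single mode are pairings of the mode of `ψ`, up to the error of the
approximation. -/
lemma abs_setIntegral_sub_le (hD : IsChannel D ε) (h : IsFieldApprox D v t ψ δ) (i : Fin 2)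
    {e : ℕ → ℝ → ℝ} (he : ∀ k, Continuous (e k)) (hb : ∀ k s, |e k s| ≤ 1) {A : ℝ → ℝ}
    (hA : Continuous A) (k : ℕ) :
    |(∫ x in rect 0 1 0 1, A (x 1) * e k (x 0) * v i 0 x) -
      ∫ t in (0 : ℝ)..1, A t * mode e (ψ i) k t| ≤ √(∫ t in (0 : ℝ)..1, A t ^ 2) * δ := by
  have hek := he k
  have hi : ∀ u : Lp ℝ 2 (volume.restrict D), Integrable (fun x => A (x 1) * e k (x 0) * u x)
      (volume.restrict (rect 0 1 0 1)) := fun u =>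
    MemLp.integrable_mul (p := 2) (q := 2) (memLp_rect_of_continuous (by fun_prop))
      ((Lp.memLp u).mono_measure (Measure.restrict_mono hD.unit_subset le_rfl))
  rw [← setIntegral_mul_eq_integral_mode he hA (h.isBoxTest i).continuous]
  have e1 : ∫ x in rect 0 1 0 1, A (x 1) * e k (x 0) * ψ i x =
      ∫ x in rect 0 1 0 1, A (x 1) * e k (x 0) * t i 0 x :=
    integral_congr_ae ((ae_restrict_of_subset hD.unit_subset (h.isTripleOf i).val).mono
      fun x hx => by simp only [hx])
  have e2 : (∫ x in rect 0 1 0 1, A (x 1) * e k (x 0) * v i 0 x) -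
      ∫ x in rect 0 1 0 1, A (x 1) * e k (x 0) * t i 0 x =
      ∫ x in rect 0 1 0 1, e k (x 0) * A (x 1) * (v - t) i 0 x := by
    rw [← integral_sub (hi _) (hi _)]
    refine integral_congr_ae ((ae_restrict_of_subset hD.unit_subset (coeFn_sub v t i 0)).mono
      fun x hx => ?_)
    simp only [hx]; ring
  rw [e1, e2]
  have := abs_setIntegral_rect_mul_le hD zero_le_one (k := fun x => e k (x 0))
    (G := fun x => A (x 1)) (by fun_prop) (by fun_prop) (fun x _ => hb k _) ((v - t) i 0)
  rw [setIntegral_rect_sq_vertical hA, one_mul] at this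
  exact this.trans (mul_le_mul_of_nonneg_left (h.norm_sub_entry_le i 0) (Real.sqrt_nonneg _))

lemma setIntegral_low_partialDeriv (hD : IsChannel D ε) (h : IsFieldApprox D v t ψ δ) (i : Fin 2)
    {e : ℝ → ℝ} (he : Continuous e) :
    ∫ x in lowPart D, e (x 0) * t i 2 x = ∫ s in (0 : ℝ)..1, ψ i !₂[s, 0] * e s := by
  have hψ := h.isBoxTest i
  have c1 := hψ.continuous_partialDeriv 1
  have e3 : ∫ x in lowPart D, e (x 0) * t i 2 x =
      ∫ x in lowPart D, e (x 0) * partialDeriv 1 (ψ i) x :=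
    integral_congr_ae ((ae_restrict_of_subset inter_subset_left ((h.isTripleOf i).grad 1)).mono
      fun x hx => by simp only [← hx]; rfl)
  rw [e3, hψ.setIntegral_low hD fun x hx => by simp [partialDeriv_eq_zero hx],
    setIntegral_rect zero_le_one (by norm_num) (integrableOn_rect_of_continuous (by fun_prop))]
  refine intervalIntegral.integral_congr fun s hs => ?_
  rw [uIcc_of_le zero_le_one] at hs
  simp only [Matrix.cons_val_zero]
  rw [intervalIntegral.integral_const_mul, intervalIntegral.integral_eq_sub_of_hasDerivAt
    (fun r _ => hasDerivAt_vertical hψ.differentiable s r)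
    ((continuous_vertical c1 s).intervalIntegrable _ _),
    hψ.apply_bottom hD hs (t := -1) (by linarith [hD.lt_one]), sub_zero, mul_comm]

/-- The pairings over the rough layer are the modes of the trace of `ψ` on the axis, up to the
error of the approximation. -/
lemma abs_setIntegral_low_le (hD : IsChannel D ε) (h : IsFieldApprox D v t ψ δ) (i : Fin 2)
    {e : ℝ → ℝ} (he : Continuous e) (hb : ∀ s, |e s| ≤ 1) :
    |∫ x in lowPart D, e (x 0) * v i 2 x| ≤ |∫ s in (0 : ℝ)..1, ψ i !₂[s, 0] * e s| + δ := by
  have hfin := hD.isFiniteMeasure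
  have hsub : lowPart D ⊆ D := inter_subset_left
  have hi : ∀ u : Lp ℝ 2 (volume.restrict D), Integrable (fun x => e (x 0) * u x)
      (volume.restrict (lowPart D)) := fun u =>
    MemLp.integrable_mul (p := 2) (q := 2)
      ((hD.memLp_of_continuous (by fun_prop)).mono_measure (Measure.restrict_mono hsub le_rfl))
      ((Lp.memLp u).mono_measure (Measure.restrict_mono hsub le_rfl))
  have e2 : (∫ x in lowPart D, e (x 0) * v i 2 x) - ∫ x in lowPart D, e (x 0) * t i 2 x =
      ∫ x in lowPart D, e (x 0) * (v - t) i 2 x := by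
    rw [← integral_sub (hi _) (hi _)]
    refine integral_congr_ae ((ae_restrict_of_subset hsub (coeFn_sub v t i 2)).mono
      fun x hx => ?_)
    simp only [hx]; ring
  have h1 := abs_setIntegral_lowPart_le hD (k := fun x => e (x 0)) (by fun_prop)
    (fun x => hb _) ((v - t) i 2)
  have h2 : √ε ≤ 1 := Real.sqrt_le_one.2 hD.lt_one.le
  have h3 := (sqrt_setIntegral_sq_le hsub ((v - t) i 2)).trans (h.norm_sub_entry_le i 2)
  have h4 : 1 * √ε * √(∫ x in lowPart D, (v - t) i 2 x ^ 2) ≤ 1 * 1 * δ := by gcongr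
  rw [h.setIntegral_low_partialDeriv hD i he] at e2
  rw [← e2] at h1
  have := abs_sub_abs_le_abs_sub (∫ x in lowPart D, e (x 0) * v i 2 x)
    (∫ s in (0 : ℝ)..1, ψ i !₂[s, 0] * e s)
  linarith

/-- The trace of `ψ` on the axis is smaller than its gradient by the factor `√ε`, since it is attained
over a layer of height `ε`. -/
lemma integral_axis_sq_le (hD : IsChannel D ε) (h : IsFieldApprox D v t ψ δ) (i : Fin 2) :
    ∫ s in (0 : ℝ)..1, ψ i !₂[s, 0] ^ 2 ≤ ε * (‖v‖ + δ) ^ 2 := by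
  have hψ := h.isBoxTest i
  have c1 := hψ.continuous_partialDeriv 1
  have hε := hD.pos.le
  have h1 : ∫ s in (0 : ℝ)..1, ψ i !₂[s, 0] ^ 2 ≤
      ∫ s in (0 : ℝ)..1, ε * ∫ r in (-1 : ℝ)..1, partialDeriv 1 (ψ i) !₂[s, r] ^ 2 := by
    refine intervalIntegral.integral_mono_on zero_le_one
      (((continuous_horizontal hψ.continuous 0).pow 2).intervalIntegrable _ _)
      (((continuous_integral_vertical (c1.pow 2) _ _).const_mul ε).intervalIntegrable _ _)
      fun s hs => ?_
    have cs := continuous_vertical c1 s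
    have h2 : ∫ r in (-ε)..0, partialDeriv 1 (ψ i) !₂[s, r] = ψ i !₂[s, 0] := by
      rw [intervalIntegral.integral_eq_sub_of_hasDerivAt
        (fun r _ => hasDerivAt_vertical hψ.differentiable s r) (cs.intervalIntegrable _ _),
        hψ.apply_bottom hD hs le_rfl, sub_zero]
    rw [← h2]
    refine (sq_intervalIntegral_le cs (by linarith)).trans ?_
    rw [zero_sub, neg_neg]
    refine mul_le_mul_of_nonneg_left (intervalIntegral.integral_mono_interval
      (by linarith [hD.lt_one]) (by linarith) zero_le_one
      (Eventually.of_forall fun _ => sq_nonneg _) ((cs.pow 2).intervalIntegrable _ _)) hε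
  refine h1.trans ?_
  rw [intervalIntegral.integral_const_mul, ← hψ.setIntegral_partialDeriv_sq_eq hD 1,
    ← (h.isTripleOf i).norm_sq_grad 1]
  have := h.norm_entry_le i (Fin.succ 1)
  gcongr

end IsFieldApprox

/-- Young's inequality turns the pairing of a mode with itself into a bound of its energy. -/
lemma le_of_mode_pairing {X F κ A B δ : ℝ} (hδ : 0 ≤ δ) (hδ1 : δ ≤ 1)
    (hF2 : F ≤ 2) (hFX : F ^ 2 ≤ X)
    (h : X ≤ κ * (3 * F) + (20 * F + B) * (A + δ) + 20 * F * (B + δ) + 8 * δ) :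
    X ≤ 2000 * (κ ^ 2 + A ^ 2 + B ^ 2 + δ) := by
  have h1 : F * (3 * κ + 20 * A + 20 * B) ≤ (F ^ 2 + (3 * κ + 20 * A + 20 * B) ^ 2) / 2 := by
    nlinarith [sq_nonneg (F - (3 * κ + 20 * A + 20 * B))]
  have h2 : (3 * κ + 20 * A + 20 * B) ^ 2 ≤ 3 * (9 * κ ^ 2 + 400 * A ^ 2 + 400 * B ^ 2) := by
    nlinarith [sq_nonneg (3 * κ - 20 * A), sq_nonneg (3 * κ - 20 * B), sq_nonneg (20 * A - 20 * B)]
  have h3 : B * A ≤ (A ^ 2 + B ^ 2) / 2 := by nlinarith [sq_nonneg (A - B)]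
  have h4 : B * δ ≤ (B ^ 2 + δ) / 2 := by nlinarith [sq_nonneg (B - δ)]
  have h5 : F * δ ≤ 2 * δ := by gcongr
  nlinarith [sq_nonneg κ, sq_nonneg A, sq_nonneg B]

lemma sum_inv_sq_le (K : ℕ) : ∑ k ∈ Finset.range K, (1 / ((k : ℝ) + 1)) ^ 2 ≤ (2 : ℝ) - 1 / K := by
  induction K with
  | zero => simp
  | succ K ih =>
    rw [Finset.sum_range_succ]
    rcases Nat.eq_zero_or_pos K with rfl | hK
    · norm_num
    · have hK' : (0 : ℝ) < K := by exact_mod_cast hK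
      have : (1 / ((K : ℝ) + 1)) ^ 2 ≤ 1 / K - 1 / (K + 1) := by
        rw [div_sub_div _ _ (by positivity) (by positivity), div_pow, div_le_div_iff₀ (by positivity)
          (by positivity)]
        nlinarith
      push_cast
      linarith

namespace IsFieldApprox

variable {v t : VField D} {ψ : Fin 2 → Plane → ℝ} {δ : ℝ}

/-- The energy of the `k`-th mode of a perturbation of the Poiseuille flow is controlled by the
convection and by the `k`-th mode of the trace on the axis. -/
lemma mode_energy_le (hD : IsChannel D ε) {lam : ℝ} {p : VField D} (hp : IsPoiseuille D lam p)
    (hv : v ∈ solenoidal D) (hs : IsSolenoidalSolution hD lam (p + v)) (hv1 : ‖v‖ ≤ 1)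
    (h : IsFieldApprox D v t ψ δ) (hδ : 0 ≤ δ) (hδ1 : δ ≤ 1) (k : ℕ) :
    (∫ r in (0 : ℝ)..1, mode cosMode (ψ 0) k r ^ 2) +
        (∫ r in (0 : ℝ)..1, mode sinMode (ψ 1) k r ^ 2) ≤
      2000 * (((4 * |lam| * ‖v 1 0‖ + 36 * ‖v‖ ^ 2) * (1 / (k + 1))) ^ 2 +
        (∫ s in (0 : ℝ)..1, ψ 0 !₂[s, 0] * cosMode k s) ^ 2 +
        (∫ s in (0 : ℝ)..1, ψ 1 !₂[s, 0] * sinMode k s) ^ 2 + δ) := by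
  set κ := 4 * |lam| * ‖v 1 0‖ + 36 * ‖v‖ ^ 2 with hκdef
  have hκ0 : 0 ≤ κ := by positivity
  set α := ∫ s in (0 : ℝ)..1, ψ 0 !₂[s, 0] * cosMode k s with hα
  set b := ∫ s in (0 : ℝ)..1, ψ 1 !₂[s, 0] * sinMode k s with hb
  have hψ := h.isBoxTest
  have ca : Continuous (mode cosMode (ψ 0) k) :=
    continuous_mode continuous_cosMode (hψ 0).continuous k
  have cb : Continuous (mode sinMode (ψ 1) k) :=
    continuous_mode continuous_sinMode (hψ 1).continuous k
  have hvd : (‖v‖ + δ) ^ 2 ≤ 2 ^ 2 := pow_le_pow_left₀ (by positivity) (by linarith) 2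
  have ha2 : ∫ r in (0 : ℝ)..1, mode cosMode (ψ 0) k r ^ 2 ≤ 2 ^ 2 :=
    ((integral_mode_sq_le continuous_cosMode (hψ 0).continuous
      (fun _ hg K => sum_sq_integral_mul_cosMode_le hg K) k).trans
      (h.setIntegral_rect_sq_le hD 0)).trans hvd
  have hb2 : ∫ r in (0 : ℝ)..1, mode sinMode (ψ 1) k r ^ 2 ≤ 2 ^ 2 :=
    ((integral_mode_sq_le continuous_sinMode (hψ 1).continuous
      (fun _ hg K => sum_sq_integral_mul_sinMode_le hg K) k).trans
      (h.setIntegral_rect_sq_le hD 1)).trans hvd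
  have na := integral_sq_nonneg (mode cosMode (ψ 0) k)
  have nb := integral_sq_nonneg (mode sinMode (ψ 1) k)
  have sa : √(∫ r in (0 : ℝ)..1, mode cosMode (ψ 0) k r ^ 2) ≤ 2 :=
    (Real.sqrt_le_left (by norm_num)).2 ha2
  have sb : √(∫ r in (0 : ℝ)..1, mode sinMode (ψ 1) k r ^ 2) ≤ 2 :=
    (Real.sqrt_le_left (by norm_num)).2 hb2
  rw [← sq_abs α, ← sq_abs b]
  rcases Nat.eq_zero_or_pos k with rfl | hk
  · -- frequency zero: the sine mode is absent
    have hb0 : ∫ r in (0 : ℝ)..1, mode sinMode (ψ 1) 0 r ^ 2 = 0 := by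
      simp [mode, sinMode]
    have hc0 : ∀ s, cosMode 0 s = 1 := fun s => by simp [cosMode]
    have h1 := mode_zero_pairing_le hD hp hv hs ca (Real.sqrt_nonneg _) (Real.sq_sqrt na).ge
    have h2 := h.abs_setIntegral_sub_le hD 0 continuous_cosMode abs_cosMode_le ca 0
    have h3 := h.abs_setIntegral_low_le hD 0 (continuous_cosMode 0) (abs_cosMode_le 0)
    simp only [hc0] at h2 h3
    simp only [hc0] at hα
    rw [← hα] at h3
    set F := √(∫ r in (0 : ℝ)..1, mode cosMode (ψ 0) 0 r ^ 2) with hFdef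
    have hF0 : 0 ≤ F := Real.sqrt_nonneg _
    have h4 := neg_le_of_abs_le h2
    have h5 : ∫ r in (0 : ℝ)..1, mode cosMode (ψ 0) 0 r * mode cosMode (ψ 0) 0 r =
        ∫ r in (0 : ℝ)..1, mode cosMode (ψ 0) 0 r ^ 2 := by simp only [sq]
    rw [h5] at h4
    have h6 : 2 * F * |∫ x in lowPart D, 1 * v 0 2 x| ≤ 2 * F * (|α| + δ) := by gcongr
    have h7 : F * δ ≤ 2 * δ := by gcongr
    refine le_of_mode_pairing hδ hδ1 sa ?_ ?_
    · rw [hb0, add_zero, Real.sq_sqrt na]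
    · rw [hb0, add_zero]
      have p1 : 0 ≤ (18 * F + |b|) * (|α| + δ) := by positivity
      have p2 : 0 ≤ 20 * F * (|b| + δ) := by positivity
      norm_num
      linarith
  · have hk1 : (1 : ℝ) ≤ k := by exact_mod_cast hk
    have hm : 1 ≤ (k : ℝ) * Real.pi := by nlinarith [Real.pi_gt_three]
    set m : ℝ := k * Real.pi with hmdef
    have hm0 : 0 < m := by linarith
    have c1 := (hψ 1).continuous_partialDeriv 1
    have c2 := (hψ 0).continuous_partialDeriv 0
    have cf' : Continuous (mode sinMode (partialDeriv 1 (ψ 1)) k) :=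
      continuous_mode continuous_sinMode c1 k
    have h1 := mode_pairing_le hD hp hv hs hk
      (hasDerivAt_mode continuous_sinMode (hψ 1).contDiff (hψ 1).isTestOff.2.1 k) cf'
      (Real.sqrt_nonneg _) (Real.sq_sqrt nb).ge
    rw [← hmdef] at h1
    set F := √(∫ r in (0 : ℝ)..1, mode sinMode (ψ 1) k r ^ 2) with hFdef
    have hF0 : 0 ≤ F := Real.sqrt_nonneg _
    have hbm : mode sinMode (ψ 1) k 0 = b := rfl
    rw [hbm] at h1
    have h2 := h.abs_setIntegral_sub_le hD 0 continuous_cosMode abs_cosMode_le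
      (A := fun r => mode sinMode (partialDeriv 1 (ψ 1)) k r / m) (by fun_prop) k
    have h3 := h.abs_setIntegral_sub_le hD 1 continuous_sinMode abs_sinMode_le cb k
    have h4 := h.abs_setIntegral_low_le hD 0 (continuous_cosMode k) (abs_cosMode_le k)
    have h5 := h.abs_setIntegral_low_le hD 1 (continuous_sinMode k) (abs_sinMode_le k)
    rw [← hα] at h4
    rw [← hb] at h5
    have sf : √(∫ r in (0 : ℝ)..1, (mode sinMode (partialDeriv 1 (ψ 1)) k r / m) ^ 2) ≤ 2 := by
      refine (Real.sqrt_le_left (by norm_num)).2 ?_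
      simp only [div_pow, intervalIntegral.integral_div]
      refine (div_le_self (integral_sq_nonneg _) (by nlinarith)).trans
        (((integral_mode_sq_le continuous_sinMode c1
          (fun _ hg K => sum_sq_integral_mul_sinMode_le hg K) k).trans
          (h.setIntegral_rect_partialDeriv_sq_le hD 1 1)).trans hvd)
    -- the divergence of `ψ` is small, so that `f' / m` is close to the cosine mode
    have hdiv : |∫ r in (0 : ℝ)..1, mode cosMode (ψ 0) k r *
        (mode sinMode (partialDeriv 1 (ψ 1)) k r - m * mode cosMode (ψ 0) k r)| ≤ 4 * δ := by
      have e1 := setIntegral_mul_eq_integral_mode continuous_sinMode ca c1 k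
      have e2 := setIntegral_mul_eq_integral_mode continuous_sinMode ca c2 k
      have hsk := continuous_sinMode k
      have e3 : ∫ r in (0 : ℝ)..1, mode cosMode (ψ 0) k r *
          (mode sinMode (partialDeriv 1 (ψ 1)) k r - m * mode cosMode (ψ 0) k r) =
          ∫ x in rect 0 1 0 1, sinMode k (x 0) * mode cosMode (ψ 0) k (x 1) *
            (divergence D (t - v)) x := by
        have e4 : ∫ x in rect 0 1 0 1, sinMode k (x 0) * mode cosMode (ψ 0) k (x 1) *
            (divergence D (t - v)) x = ∫ x in rect 0 1 0 1,
              (mode cosMode (ψ 0) k (x 1) * sinMode k (x 0) * partialDeriv 1 (ψ 1) x +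
              mode cosMode (ψ 0) k (x 1) * sinMode k (x 0) * partialDeriv 0 (ψ 0) x) := by
          have hdv : divergence D (t - v) = t 0 1 + t 1 2 := by
            rw [map_sub, (mem_solenoidal.1 hv).2, sub_zero, divergence_apply]
          rw [hdv]
          refine integral_congr_ae ?_
          filter_upwards [ae_restrict_of_subset hD.unit_subset (Lp.coeFn_add (t 0 1) (t 1 2)),
            ae_restrict_of_subset hD.unit_subset ((h.isTripleOf 0).grad 0),
            ae_restrict_of_subset hD.unit_subset ((h.isTripleOf 1).grad 1)] with x u1 u2 u3
          have u2' : t 0 1 x = partialDeriv 0 (ψ 0) x := u2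
          have u3' : t 1 2 x = partialDeriv 1 (ψ 1) x := u3
          rw [u1, Pi.add_apply, u2', u3']
          ring
        have i1 : IntervalIntegrable (fun r => mode cosMode (ψ 0) k r *
            mode sinMode (partialDeriv 1 (ψ 1)) k r) volume 0 1 :=
          (ca.mul cf').intervalIntegrable _ _
        have i2 : IntervalIntegrable (fun r => mode cosMode (ψ 0) k r *
            mode sinMode (partialDeriv 0 (ψ 0)) k r) volume 0 1 :=
          (ca.mul (continuous_mode continuous_sinMode c2 k)).intervalIntegrable _ _
        rw [e4, integral_add (integrableOn_rect_of_continuous (by fun_prop))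
          (integrableOn_rect_of_continuous (by fun_prop)), e1, e2,
          ← intervalIntegral.integral_add i1 i2]
        refine intervalIntegral.integral_congr fun r _ => ?_
        simp only [mode_sinMode_partialDeriv (hψ 0).contDiff k r, ← hmdef]
        ring
      rw [e3]
      have e5 := abs_setIntegral_rect_mul_le hD zero_le_one (k := fun x => sinMode k (x 0))
        (G := fun x => mode cosMode (ψ 0) k (x 1)) (by fun_prop) (by fun_prop)
        (fun x _ => abs_sinMode_le k _) (divergence D (t - v))
      rw [setIntegral_rect_sq_vertical ca, one_mul] at e5
      have e6 : ‖divergence D (t - v)‖ ≤ 2 * δ := by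
        rw [← neg_sub v t, map_neg, norm_neg, divergence_apply]
        refine (norm_add_le _ _).trans ?_
        linarith [h.norm_sub_entry_le 0 1, h.norm_sub_entry_le 1 2]
      refine e5.trans ((mul_le_mul sa e6 (norm_nonneg _) (by norm_num)).trans_eq (by ring))
    have hfa : ∫ r in (0 : ℝ)..1, mode sinMode (partialDeriv 1 (ψ 1)) k r / m *
        mode cosMode (ψ 0) k r = (∫ r in (0 : ℝ)..1, mode cosMode (ψ 0) k r ^ 2) +
        (∫ r in (0 : ℝ)..1, mode cosMode (ψ 0) k r *
        (mode sinMode (partialDeriv 1 (ψ 1)) k r - m * mode cosMode (ψ 0) k r)) / m := by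
      rw [← intervalIntegral.integral_div,
        ← intervalIntegral.integral_add (Continuous.intervalIntegrable (by fun_prop) _ _)
          (Continuous.intervalIntegrable (by fun_prop) _ _)]
      refine intervalIntegral.integral_congr fun r _ => ?_
      field_simp
      ring
    have hdm : -(4 * δ) ≤ (∫ r in (0 : ℝ)..1, mode cosMode (ψ 0) k r *
        (mode sinMode (partialDeriv 1 (ψ 1)) k r - m * mode cosMode (ψ 0) k r)) / m := by
      refine neg_le_of_abs_le ?_
      rw [abs_div, abs_of_pos hm0]
      exact (div_le_self (abs_nonneg _) hm).trans hdiv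
    have h6 := neg_le_of_abs_le h2
    have h7 := neg_le_of_abs_le h3
    rw [hfa] at h6
    have h8 : ∫ r in (0 : ℝ)..1, mode sinMode (ψ 1) k r * mode sinMode (ψ 1) k r =
        ∫ r in (0 : ℝ)..1, mode sinMode (ψ 1) k r ^ 2 := by simp only [sq]
    rw [h8] at h7
    have q1 : √(∫ r in (0 : ℝ)..1, (mode sinMode (partialDeriv 1 (ψ 1)) k r / m) ^ 2) * δ ≤
      2 * δ := by gcongr
    have q2 : F * δ ≤ 2 * δ := by gcongr
    have q3 : (20 * F + |b|) * |∫ x in lowPart D, cosMode k (x 0) * v 0 2 x| ≤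
        (20 * F + |b|) * (|α| + δ) := by gcongr
    have q4 : 20 * F * |∫ x in lowPart D, sinMode k (x 0) * v 1 2 x| ≤
        20 * F * (|b| + δ) := by gcongr
    have q5 : κ * (2 * F / (k + 1)) ≤ κ * (1 / (k + 1)) * (3 * F) := by
      have : κ * (1 / ((k : ℝ) + 1)) * (3 * F) - κ * (2 * F / (k + 1)) =
          κ * (1 / ((k : ℝ) + 1)) * F := by field_simp; ring
      have : 0 ≤ κ * (1 / ((k : ℝ) + 1)) * F := by positivity
      linarith
    refine le_of_mode_pairing hδ hδ1 sb ?_ (by linarith)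
    rw [Real.sq_sqrt nb]
    linarith

/-- Summing over the modes, the factors `1 / (k + 1)` from the convection are square summable, and
Bessel's inequality bounds the modes of the trace by the trace itself. -/
lemma sum_mode_energy_le (hD : IsChannel D ε) {lam : ℝ} {p : VField D} (hp : IsPoiseuille D lam p)
    (hv : v ∈ solenoidal D) (hs : IsSolenoidalSolution hD lam (p + v)) (hv1 : ‖v‖ ≤ 1)
    (h : IsFieldApprox D v t ψ δ) (hδ : 0 ≤ δ) (hδ1 : δ ≤ 1) (K : ℕ) :
    (∑ k ∈ Finset.range K, ∫ r in (0 : ℝ)..1, mode cosMode (ψ 0) k r ^ 2) +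
        (∑ k ∈ Finset.range K, ∫ r in (0 : ℝ)..1, mode sinMode (ψ 1) k r ^ 2) ≤
      2000 * (2 * (4 * |lam| * ‖v 1 0‖ + 36 * ‖v‖ ^ 2) ^ 2 + 2 * (ε * (‖v‖ + δ) ^ 2) + K * δ) := by
  rw [← Finset.sum_add_distrib]
  refine (Finset.sum_le_sum fun k _ => h.mode_energy_le hD hp hv hs hv1 hδ hδ1 k).trans ?_
  rw [← Finset.mul_sum, Finset.sum_add_distrib, Finset.sum_add_distrib, Finset.sum_add_distrib]
  simp only [mul_pow, ← Finset.mul_sum]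
  have h1 := sum_inv_sq_le K
  have h2 : (0 : ℝ) ≤ 1 / K := by positivity
  have h3 := (sum_sq_integral_mul_cosMode_le
    (continuous_horizontal (h.isBoxTest 0).continuous 0) K).trans
    (h.integral_axis_sq_le hD 0)
  have h4 := (sum_sq_integral_mul_sinMode_le
    (continuous_horizontal (h.isBoxTest 1).continuous 0) K).trans
    (h.integral_axis_sq_le hD 1)
  have h5 : (4 * |lam| * ‖v 1 0‖ + 36 * ‖v‖ ^ 2) ^ 2 *
      ∑ k ∈ Finset.range K, (1 / ((k : ℝ) + 1)) ^ 2 ≤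
      (4 * |lam| * ‖v 1 0‖ + 36 * ‖v‖ ^ 2) ^ 2 * 2 := by
    gcongr; linarith
  simp only [Finset.sum_const, Finset.card_range, nsmul_eq_mul]
  linarith

end IsFieldApprox

end Channel

/-! ### The estimate in `L²` -/

section Channel

variable {D : Set Plane} {ε : ℝ}

/-- A bound of the modes that holds for arbitrarily good approximations, at the cost of an error
growing with the number of modes, passes to a fixed approximation `u`: finitely many modes depend
continuously on the function. -/
lemma sum_integral_mode_sq_le_of_approx {e : ℕ → ℝ → ℝ} (he : ∀ k, Continuous (e k))
    (hbes : ∀ g : ℝ → ℝ, Continuous g → ∀ K, ∑ k ∈ Finset.range K,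
      (∫ s in (0 : ℝ)..1, g s * e k s) ^ 2 ≤ ∫ s in (0 : ℝ)..1, g s ^ 2)
    {u w : Plane → ℝ} (hu : Continuous u) (hw : Continuous w) (K : ℕ) :
    ∑ k ∈ Finset.range K, ∫ r in (0 : ℝ)..1, mode e u k r ^ 2 ≤
      2 * (∑ k ∈ Finset.range K, ∫ r in (0 : ℝ)..1, mode e w k r ^ 2) +
        2 * ∫ x in rect 0 1 0 1, (u x - w x) ^ 2 := by
  have h1 := sum_integral_mode_sq_le he (hu.sub hw) hbes K
  have h2 : ∀ k, ∫ r in (0 : ℝ)..1, mode e u k r ^ 2 ≤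
      2 * (∫ r in (0 : ℝ)..1, mode e w k r ^ 2) +
        2 * ∫ r in (0 : ℝ)..1, mode e (u - w) k r ^ 2 := fun k => by
    have cu := continuous_mode he hu k
    have cw := continuous_mode he hw k
    have cd := continuous_mode he (hu.sub hw) k
    have hek := he k
    have i1 : IntervalIntegrable (fun r => 2 * mode e w k r ^ 2) volume 0 1 :=
      ((cw.pow 2).const_mul 2).intervalIntegrable _ _
    have i2 : IntervalIntegrable (fun r => 2 * mode e (u - w) k r ^ 2) volume 0 1 :=
      ((cd.pow 2).const_mul 2).intervalIntegrable _ _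
    rw [← intervalIntegral.integral_const_mul, ← intervalIntegral.integral_const_mul,
      ← intervalIntegral.integral_add i1 i2]
    refine intervalIntegral.integral_mono_on zero_le_one ((cu.pow 2).intervalIntegrable _ _)
      (i1.add i2) fun r _ => ?_
    have h3 : mode e (u - w) k r = mode e u k r - mode e w k r := by
      have j1 : IntervalIntegrable (fun s => u !₂[s, r] * e k s) volume 0 1 :=
        ((continuous_horizontal hu r).mul hek).intervalIntegrable _ _
      have j2 : IntervalIntegrable (fun s => w !₂[s, r] * e k s) volume 0 1 :=
        ((continuous_horizontal hw r).mul hek).intervalIntegrable _ _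
      rw [mode, mode, mode, ← intervalIntegral.integral_sub j1 j2]
      refine intervalIntegral.integral_congr fun s _ => ?_
      simp only [Pi.sub_apply]; ring
    rw [h3]
    nlinarith [sq_nonneg (mode e u k r - 2 * mode e w k r)]
  refine (Finset.sum_le_sum fun k _ => h2 k).trans ?_
  rw [Finset.sum_add_distrib, ← Finset.mul_sum, ← Finset.mul_sum]
  have h4 : ∫ x in rect 0 1 0 1, (u - w) x ^ 2 = ∫ x in rect 0 1 0 1, (u x - w x) ^ 2 := rfl
  linarith

lemma setIntegral_sq_sub_le {v t : VField D} {ψ : Fin 2 → Plane → ℝ} {δ : ℝ}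
    (hD : IsChannel D ε) (h : IsFieldApprox D v t ψ δ) (i : Fin 2) :
    ∫ x in rect 0 1 0 1, (v i 0 x - ψ i x) ^ 2 ≤ δ ^ 2 := by
  have h1 : ∫ x in rect 0 1 0 1, (v i 0 x - ψ i x) ^ 2 =
      ∫ x in rect 0 1 0 1, (v - t) i 0 x ^ 2 := by
    refine integral_congr_ae ?_
    filter_upwards [ae_restrict_of_subset hD.unit_subset (h.isTripleOf i).val,
      ae_restrict_of_subset hD.unit_subset (IsFieldApprox.coeFn_sub v t i 0)] with x h1 h2
    rw [h2, h1]
  rw [h1]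
  refine (Real.sqrt_le_left ((norm_nonneg _).trans h.norm_sub_le)).1 ?_
  exact (sqrt_setIntegral_sq_le hD.unit_subset _).trans (h.norm_sub_entry_le i 0)

lemma integral_sub_sq_le {μ : Measure Plane} {f g h : Plane → ℝ} (hf : MemLp f 2 μ)
    (hg : MemLp g 2 μ) (hh : MemLp h 2 μ) :
    ∫ x, (f x - g x) ^ 2 ∂μ ≤ 2 * (∫ x, (f x - h x) ^ 2 ∂μ) + 2 * ∫ x, (g x - h x) ^ 2 ∂μ := by
  have i1 : Integrable (fun x => 2 * (f x - h x) ^ 2) μ := (hf.sub hh).integrable_sq.const_mul 2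
  have i2 : Integrable (fun x => 2 * (g x - h x) ^ 2) μ := (hg.sub hh).integrable_sq.const_mul 2
  rw [← integral_const_mul, ← integral_const_mul, ← integral_add i1 i2]
  refine integral_mono (hf.sub hg).integrable_sq (i1.add i2) fun x => ?_
  change (f x - g x) ^ 2 ≤ 2 * (f x - h x) ^ 2 + 2 * (g x - h x) ^ 2
  nlinarith [sq_nonneg (f x + g x - 2 * h x)]

/-- A perturbation of the Poiseuille flow of size `√ε` in `H¹` has size `ε` in `L²`. -/
theorem l2_estimate (hD : IsChannel D ε) {lam : ℝ} (hlam : |lam| ≤ 1 / 100000) {p v : VField D}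
    (hp : IsPoiseuille D lam p) (hv : v ∈ solenoidal D) (hs : IsSolenoidalSolution hD lam (p + v))
    (hn : ‖v‖ ≤ 30 * |lam| * √ε) : ∑ i, ‖v i 0‖ ^ 2 ≤ 400000000 * ε ^ 2 := by
  have hε := hD.pos
  have hε1 := hD.lt_one
  have hl := abs_nonneg lam
  have hv2 : ‖v‖ ^ 2 ≤ ε := by
    have : ‖v‖ ^ 2 ≤ (30 * |lam| * √ε) ^ 2 := pow_le_pow_left₀ (norm_nonneg v) hn 2
    rw [mul_pow, Real.sq_sqrt hε.le] at this
    have h2 : (30 * |lam|) ^ 2 ≤ 1 := by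
      rw [sq_le_one_iff₀ (by positivity)]; linarith
    nlinarith
  have hv1 : ‖v‖ ≤ 1 := by nlinarith [norm_nonneg v]
  have hε2 : ε ^ 2 ≤ ε := by nlinarith
  have hδ0 : 0 < ε ^ 2 := by positivity
  obtain ⟨t₀, ψ₀, h₀⟩ := exists_isFieldApprox hD hv.1 hδ0
  set κ := 4 * |lam| * ‖v 1 0‖ + 36 * ‖v‖ ^ 2 with hκ
  set S := 2000 * (2 * κ ^ 2 + 9 * ε ^ 2) with hS
  have hrect : ∀ f : Plane → ℝ, Continuous f → MemLp f 2 (volume.restrict (rect 0 1 0 1)) :=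
    fun f hf => memLp_rect_of_continuous hf
  have hvm : ∀ i, MemLp (v i 0) 2 (volume.restrict (rect 0 1 0 1)) := fun i =>
    (Lp.memLp (v i 0)).mono_measure (Measure.restrict_mono hD.unit_subset le_rfl)
  -- the error of the approximation may depend on the number of modes
  have key : ∀ K : ℕ, ∃ ψ : Fin 2 → Plane → ℝ, (∀ i, Continuous (ψ i)) ∧
      (∀ i, ∫ x in rect 0 1 0 1, (ψ₀ i x - ψ i x) ^ 2 ≤ 4 * ε ^ 2) ∧
      (∑ k ∈ Finset.range K, ∫ r in (0 : ℝ)..1, mode cosMode (ψ 0) k r ^ 2) ≤ S ∧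
      (∑ k ∈ Finset.range K, ∫ r in (0 : ℝ)..1, mode sinMode (ψ 1) k r ^ 2) ≤ S := fun K => by
    have hK : (0 : ℝ) < K + 1 := by positivity
    set δ := ε ^ 2 / (K + 1) with hδ
    have hδpos : 0 < δ := by positivity
    have hδε : δ ≤ ε ^ 2 := div_le_self hδ0.le (by linarith [(Nat.cast_nonneg K : (0 : ℝ) ≤ K)])
    have hKδ : K * δ ≤ ε ^ 2 := by
      rw [hδ, ← mul_div_assoc, div_le_iff₀ hK]; nlinarith
    obtain ⟨t, ψ, h⟩ := exists_isFieldApprox hD hv.1 hδpos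
    have hsum := h.sum_mode_energy_le hD hp hv hs hv1 hδpos.le (by linarith) K
    have hd2 : δ ^ 2 ≤ ε ^ 2 := pow_le_pow_left₀ hδpos.le (hδε.trans hε2) 2
    have n1 : 0 ≤ ∑ k ∈ Finset.range K, ∫ r in (0 : ℝ)..1, mode cosMode (ψ 0) k r ^ 2 :=
      Finset.sum_nonneg fun _ _ => integral_sq_nonneg _
    have n2 : 0 ≤ ∑ k ∈ Finset.range K, ∫ r in (0 : ℝ)..1, mode sinMode (ψ 1) k r ^ 2 :=
      Finset.sum_nonneg fun _ _ => integral_sq_nonneg _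
    have hb : ε * (‖v‖ + δ) ^ 2 ≤ ε * (4 * ε) := by
      refine mul_le_mul_of_nonneg_left ?_ hε.le
      nlinarith [sq_nonneg (‖v‖ - δ)]
    have hle : 2000 * (2 * κ ^ 2 + 2 * (ε * (‖v‖ + δ) ^ 2) + K * δ) ≤ S := by
      rw [hS]; nlinarith
    refine ⟨ψ, fun i => (h.isBoxTest i).continuous, fun i => ?_, by linarith, by linarith⟩
    have a1 := setIntegral_sq_sub_le hD h₀ i
    have a2 := setIntegral_sq_sub_le hD h i
    have a3 := integral_sub_sq_le (hrect _ (h₀.isBoxTest i).continuous)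
      (hrect _ (h.isBoxTest i).continuous) (hvm i)
    simp only [← neg_sub (v i 0 _), neg_sq] at a3
    have a4 : (ε ^ 2) ^ 2 ≤ ε ^ 2 := by nlinarith
    linarith
  have b0 : ∫ x in rect 0 1 0 1, ψ₀ 0 x ^ 2 ≤ 4 * S + 16 * ε ^ 2 := by
    have := setIntegral_sq_le_of_sum_cos_le (h₀.isBoxTest 0).continuous
      (B := 2 * S + 8 * ε ^ 2) fun K => by
        obtain ⟨ψ, c, h1, h2, -⟩ := key K
        have := sum_integral_mode_sq_le_of_approx continuous_cosMode
          (fun _ hg K => sum_sq_integral_mul_cosMode_le hg K) (h₀.isBoxTest 0).continuous (c 0) K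
        linarith [h1 0]
    linarith
  have b1 : ∫ x in rect 0 1 0 1, ψ₀ 1 x ^ 2 ≤ 4 * S + 16 * ε ^ 2 := by
    have := setIntegral_sq_le_of_sum_sin_le (h₀.isBoxTest 1).continuous
      (B := 2 * S + 8 * ε ^ 2) fun K => by
        obtain ⟨ψ, c, h1, -, h2⟩ := key K
        have := sum_integral_mode_sq_le_of_approx continuous_sinMode
          (fun _ hg K => sum_sq_integral_mul_sinMode_le hg K) (h₀.isBoxTest 1).continuous (c 1) K
        linarith [h1 1]
    linarith
  have hall : ∀ i, ‖v i 0‖ ^ 2 ≤ 8 * S + 35 * ε ^ 2 := fun i => by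
    have hb : ∫ x in rect 0 1 0 1, ψ₀ i x ^ 2 ≤ 4 * S + 16 * ε ^ 2 := by
      fin_cases i
      · exact b0
      · exact b1
    have a1 := setIntegral_sq_sub_le hD h₀ i
    have a2 := integral_sub_sq_le (hvm i) (hrect (fun _ => 0) continuous_const)
      (hrect _ (h₀.isBoxTest i).continuous)
    simp only [sub_zero, zero_sub, neg_sq] at a2
    have a3 := H1Zero_poincare_low hD (walls_subset_noSlip D i) (mem_velocity.1 hv.1 i)
    have a4 : ‖v i 2‖ ^ 2 ≤ 1 := pow_le_one₀ (norm_nonneg _) ((norm_entry_le v i 2).trans hv1)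
    have a5 : ε ^ 2 * ‖v i 2‖ ^ 2 ≤ ε ^ 2 := mul_le_of_le_one_right hδ0.le a4
    have a6 : (ε ^ 2) ^ 2 ≤ ε ^ 2 := by nlinarith
    have a7 : ∫ x in lowPart D, v i 0 x ^ 2 ≤ ε ^ 2 * ‖v i 2‖ ^ 2 := a3
    rw [Lp_norm_sq_eq, setIntegral_rect_add_low hD (Lp.memLp (v i 0)).integrable_sq]
    linarith
  -- the part of `κ` that is linear in `v` has the small factor `lam` and is absorbed at the end
  have hκ2 : κ ^ 2 ≤ 32 * lam ^ 2 * ‖v 1 0‖ ^ 2 + 2592 * ε ^ 2 := by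
    have e1 : κ ^ 2 ≤ 2 * (4 * |lam| * ‖v 1 0‖) ^ 2 + 2 * (36 * ‖v‖ ^ 2) ^ 2 := by
      rw [hκ]; nlinarith [sq_nonneg (4 * |lam| * ‖v 1 0‖ - 36 * ‖v‖ ^ 2)]
    have e2 : (‖v‖ ^ 2) ^ 2 ≤ ε ^ 2 := pow_le_pow_left₀ (by positivity) hv2 2
    rw [mul_pow, mul_pow, sq_abs] at e1
    nlinarith
  have hlam2 : lam ^ 2 ≤ (1 / 100000) ^ 2 := by
    rw [← sq_abs]; exact pow_le_pow_left₀ hl hlam 2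
  have hprod : lam ^ 2 * ‖v 1 0‖ ^ 2 ≤ (1 / 100000) ^ 2 * ‖v 1 0‖ ^ 2 := by gcongr
  rw [Fin.sum_univ_two]
  have c0 := hall 0
  have c1 := hall 1
  have c2 := sq_nonneg ‖v 0 0‖
  rw [hS] at c0 c1
  norm_num at hprod
  nlinarith

end Channel

end RoughChannel

open RoughChannel in
theorem theorem2p2 :
    ∃ c₁ ε₀ C r : ℝ, 0 < c₁ ∧ 0 < ε₀ ∧ 0 < C ∧ C * ε₀ ≤ r ∧
      ∀ Ω : Set Plane, IsRoughProfile Ω →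
      ∀ p₀ p₁ : ℝ, |p₁ - p₀| ≤ c₁ →
      ∀ ε : ℝ, 0 < ε → ε ≤ ε₀ → (∃ N : ℕ, ε⁻¹ = N) →
      (∃ x₀ L, IsJohnDomain (roughChannel Ω ε) x₀ L) →
        ∃ (U : Plane → Plane) (P : Plane → ℝ),
          IsWeakSolution (roughChannel Ω ε) p₀ p₁ U P ∧
          gradDistSq (roughChannel Ω ε) U (poiseuille p₀ p₁) ≤ C * ε ∧
          (∫ x in roughChannel Ω ε, ‖U x - poiseuille p₀ p₁ x‖ ^ 2) ≤ C * ε ^ 2 ∧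
          ∀ (U' : Plane → Plane) (P' : Plane → ℝ),
            IsWeakSolution (roughChannel Ω ε) p₀ p₁ U' P' →
            gradDistSq (roughChannel Ω ε) U' (poiseuille p₀ p₁) ≤ r →
              U' =ᵐ[volume.restrict (roughChannel Ω ε)] U ∧
              P' =ᵐ[volume.restrict (roughChannel Ω ε)] P := by
  refine ⟨1 / 100000, 1 / 12000000 / 400000000, 400000000, 1 / 12000000, by norm_num, by norm_num,
    by norm_num, by norm_num, fun Ω hΩ p₀ p₁ hp₀₁ ε hε hε₀ _ ⟨x₀, L, hJ⟩ => ?_⟩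
  have hD : IsChannel (roughChannel Ω ε) ε :=
    isChannel_roughChannel hΩ hε (hε₀.trans_lt (by norm_num))
  set D := roughChannel Ω ε
  set lam := (p₁ - p₀) / 2 with hlamdef
  have hlam : |lam| ≤ 1 / 100000 := by
    rw [hlamdef, abs_div, abs_two]
    linarith [abs_nonneg (p₁ - p₀)]
  obtain ⟨p, hp⟩ := exists_isPoiseuille hD lam
  obtain ⟨v, hv, hs, hn, huniq⟩ := exists_isSolenoidalSolution hD hlam hp
  have hz : p + v ∈ solenoidal D := add_mem (hp.mem_solenoidal hD) hv
  obtain ⟨q, hq⟩ := hs.exists_isVelocityPressure hJ hz.1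
  obtain ⟨U, P, hUP, hU, hdU, hqP⟩ := hq.exists_isWeakSolution hz
  have hsub : p + v - p = v := add_sub_cancel_left p v
  refine ⟨U, P, hUP, ?_, ?_, fun U' P' h' hr => ?_⟩
  · rw [gradDistSq_eq_dirichlet hD hp hdU, hsub]
    refine (dirichlet_self_le v).trans ((pow_le_pow_left₀ (norm_nonneg v) hn 2).trans ?_)
    rw [mul_pow, Real.sq_sqrt hε.le]
    have : (30 * |lam|) ^ 2 ≤ 1 := by
      rw [sq_le_one_iff₀ (by positivity)]; linarith
    nlinarith
  · rw [setIntegral_norm_sub_sq_eq hD hp hU, hsub]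
    exact l2_estimate hD hlam hp hv hs hn
  · obtain ⟨z', hz', q', hq', hU', hdU', hqP'⟩ := h'.exists_isVelocityPressure hD
    rw [gradDistSq_eq_dirichlet hD hp hdU'] at hr
    have hw : z' - p ∈ solenoidal D := sub_mem hz' (hp.mem_solenoidal hD)
    have hpz : p + (z' - p) = z' := add_sub_cancel p z'
    -- `5 / 12000000 ≤ (1 / 1500)²`
    have hnw : ‖z' - p‖ ≤ 1 / 1500 := by
      refine le_of_sq_le_sq ((norm_sq_le_dirichlet hD hw.1).trans ?_) (by norm_num)
      exact (mul_le_mul_of_nonneg_left hr (by norm_num)).trans (by norm_num)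
    have hwv : z' - p = v := huniq _ hw (by rw [hpz]; exact hq'.isSolenoidalSolution) hnw
    have hzz : z' = p + v := by rw [← hwv, hpz]
    subst hzz
    have hqq : q' = q := hq'.pressure_unique hJ hq
    subst hqq
    constructor
    · filter_upwards [hU 0, hU 1, hU' 0, hU' 1] with x h0 h1 h0' h1'
      ext i
      fin_cases i
      · exact h0'.symm.trans h0
      · exact h1'.symm.trans h1
    · filter_upwards [hqP, hqP'] with x h0 h1
      linarith
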